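/- Identify $\mathbb R^3$ with the imaginary quaternions and put $\widehat{\mathbb R}^3=\mathbb R^3\cup\{\infty\}$. M-circles are circles and lines, M-spheres are spheres and planes. A *Dupin cyclidic (DC) system* is a rational map $F=UW^{-1}:(\mathbb RP^1)^3\to\widehat{\mathbb R}^3$, with $U,W\in\mathbb H[s,t,u]$ linear in each variable, such that $\partial_sF,\partial_tF,\partial_uF$ are mutually orthogonal and the Jacobian is not identically zero. ($F$ is regarded as undefined at common zeros of $U$ and $W$; near the value $\infty$ one differentiates the composition with the unit inversion.) $\mathrm{Sing}(F)$ is the image of the points where the Jacobian vanishes. Two systems $F,F'$ are Möbius equivalent if $F'=\mu\circ F\circ\rho$, with $\mu$ a Möbius transformation and $\rho$ composed of projective transformations of the three parameter lines and a permutation of them. $F$ is *spherical* if in at least one of its three families of coordinate surfaces every surface lies on an M-sphere. A two-dimensional DC system $P=UW^{-1}$ on an M-sphere is defined likewise, with two variables; its *poles* are the points of $\mathrm{Sing}(P)$. It is *1-polar* if it is Möbius equivalent to Cartesian coordinates of a plane (one pole), and *2-polar* if it is Möbius equivalent to polar coordinates (two poles). The *offset construction* based on $P$ is $P(s,t)-u\,d\,WnW^{-1}$,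 where $d\ne0$ is real and $n$ is a unit imaginary quaternion for which $WnW^{-1}$ is the normal to the M-sphere. The *axial construction* rotates a system $P$ on a plane about a line $\mathbb R a$ of the plane: $(U,W)\mapsto ((1-u+ua)U,(1-u+ua)W)$, where $a$ is a unit imaginary quaternion. **Theorem.** Every spherical DC system is Möbius equivalent to one obtained by an offset construction from a two-dimensional DC system on a sphere (S1) or on a plane (S2), or by an axial construction from a 2-polar (S3) or a 1-polar (S4) system on a plane. Conversely, all these constructions give spherical DC systems. Below, a singular curve swept out by poles is called simple (double) if exactly one (exactly two) of the coordinate surfaces degenerate to it. The axis of an axial construction is called a double line because it lies on every plane of the rotating family, and each of these planes is attained at exactly two parameters. All lines contain $\infty$. * **(S1)** Offsets based on a sphere. The base is either 2-polar, with its poles seen from the centre at an angle $\theta\in(0,\pi]$, or 1-polar. All these cases occur. Two systems of class (S1) are Möbius equivalent if and only if both bases are 2-polar with the same $\theta$ or both are 1-polar. For $0<\theta<\pi$ (a one-parameter family of Möbius classes) the singular locus consists of two intersecting simple lines. In the two limit cases, $\theta=\pi$ and 1-polar base, it is a double line. * **(S2)** Offsets based on a plane. There are four cases, each of which is a single Möbius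 class, and the four classes are different. The singular locus is: two parallel simple lines (2-polar base with two finite poles); a double line (1-polar base with a finite pole); a simple line (2-polar base with one pole at $\infty$); the point $\infty$ (1-polar base with pole $\infty$). * **(S3)** Axial constructions from a 2-polar system with poles $p,q$. Let $q'$ be the mirror image of $q$ in the axis. Exactly the following cases occur. * $p,q$ are off the axis and $p\ne q'$. These form a one-parameter family of Möbius classes, with parameter $\kappa=|p-q|/|p-q'|$, which takes all values in $(0,1)\cup(1,\infty)$. The singular locus consists of the double axis and two different simple circles around it. * $p,q$ are off the axis and $p=q'$. The singular locus is the double axis and a double circle around it. * Exactly one of $p,q$ is on the axis. The singular locus is the double axis and one simple circle around it. * $p,q$ are both on the axis. The singular locus is the double axis. Two systems of class (S3) are Möbius equivalent if and only if they belong to the same case and, in the first case, have the same $\kappa$. * **(S4)** Axial constructions from a 1-polar system. Two cases occur. If the pole is not on the axis, the singular locus is the double axis and a double circle around it, and all these systems are Möbius equivalent. If the pole is on the axis, the singular locus is the double axis. -/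

import Mathlib

open scoped Quaternion OnePoint LinearAlgebra.Projectivization

namespace DupinCyclidic

/-! The Euclidean space is the space `{q | q.re = 0}` of imaginary quaternions; its points and the
point `∞` are regarded as elements of `OnePoint ℍ[ℝ]`. -/

/-- The inversion `p ↦ q - r² (p - q)⁻¹` in the sphere with centre `q` and radius `r`; for imaginary
`q` it maps the extended imaginary quaternions to themselves. -/
noncomputable def inversion (q : ℍ[ℝ]) (r : ℝ) : OnePoint ℍ[ℝ] → OnePoint ℍ[ℝ]
  | ∞ => (q : OnePoint ℍ[ℝ])
  | (p : ℍ[ℝ]) => open Classical in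
      if p = q then ∞ else ((q - (r ^ 2) • (p - q)⁻¹ : ℍ[ℝ]) : OnePoint ℍ[ℝ])

/-- Möbius transformations: finite compositions of inversions in spheres of the Euclidean space.
(Inversions are involutions, so these form the group that they generate.) -/
inductive IsMobius : (OnePoint ℍ[ℝ] → OnePoint ℍ[ℝ]) → Prop
  | id : IsMobius id
  | comp (q : ℍ[ℝ]) (r : ℝ) (f : OnePoint ℍ[ℝ] → OnePoint ℍ[ℝ]) :
      q.re = 0 → 0 < r → IsMobius f → IsMobius (inversion q r ∘ f)

/-- The sphere with centre `c` and radius `r`. -/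
def sphere (c : ℍ[ℝ]) (r : ℝ) : Set (OnePoint ℍ[ℝ]) :=
  (fun p : ℍ[ℝ] => (p : OnePoint ℍ[ℝ])) '' {p | p.re = 0 ∧ ‖p - c‖ = r}

/-- The plane `⟨ν, p⟩ = d`, together with `∞`. -/
def plane (ν : ℍ[ℝ]) (d : ℝ) : Set (OnePoint ℍ[ℝ]) :=
  {∞} ∪ (fun p : ℍ[ℝ] => (p : OnePoint ℍ[ℝ])) '' {p | p.re = 0 ∧ inner ℝ ν p = d}

/-- M-spheres: spheres and planes. -/
def IsMSphere (S : Set (OnePoint ℍ[ℝ])) : Prop :=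
  (∃ (c : ℍ[ℝ]) (r : ℝ), c.re = 0 ∧ 0 < r ∧ S = sphere c r) ∨
  (∃ (ν : ℍ[ℝ]) (d : ℝ), ν.re = 0 ∧ ν ≠ 0 ∧ S = plane ν d)

/-- The straight line through `c` with direction `v`, together with `∞`. -/
def line (c v : ℍ[ℝ]) : Set (OnePoint ℍ[ℝ]) :=
  {∞} ∪ Set.range (fun l : ℝ => ((c + l • v : ℍ[ℝ]) : OnePoint ℍ[ℝ]))

/-- The circle with centre `c` and radius `r` in the plane through `c` orthogonal to `v`. -/
def circle (c v : ℍ[ℝ]) (r : ℝ) : Set (OnePoint ℍ[ℝ]) :=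
  (fun p : ℍ[ℝ] => (p : OnePoint ℍ[ℝ])) '' {p | p.re = 0 ∧ inner ℝ v (p - c) = 0 ∧ ‖p - c‖ = r}

/-- A pair `(U, W)` of quaternionic polynomials that are linear in each of `n` real projective
variables. The `i`-th variable `x i = (x i 0, x i 1)` is a vector of homogeneous coordinates of a
point of the real projective line; the affine parameter `s` corresponds to `(1, s)` and the
parameter `∞` to `(0, 1)`. -/
abbrev QMap (n : ℕ) : Type := MultilinearMap ℝ (fun _ : Fin n => Fin 2 → ℝ) (ℍ[ℝ] × ℍ[ℝ])

/-- The real projective line. -/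
abbrev RP1 : Type := ℙ ℝ (Fin 2 → ℝ)

variable {n : ℕ}

/-- `x` represents a point of `(ℝP¹)ⁿ` at which the rational map `U W⁻¹` is defined, i.e. which
is not a common zero of `U` and `W`. -/
def Defined (D : QMap n) (x : Fin n → Fin 2 → ℝ) : Prop := (∀ i, x i ≠ 0) ∧ D x ≠ 0

/-- The value `U W⁻¹`, which is `∞` where `W = 0`. -/
noncomputable def val (D : QMap n) (x : Fin n → Fin 2 → ℝ) : OnePoint ℍ[ℝ] :=
  open Classical in
  if (D x).2 = 0 then ∞ else (((D x).1 * (D x).2⁻¹ : ℍ[ℝ]) : OnePoint ℍ[ℝ])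

/-- The map `F = U W⁻¹` in a chart of the target around the value at `x`: `F` itself if the value
at `x` is finite, and its composition `- F⁻¹ = - W U⁻¹` with the unit inversion otherwise. -/
noncomputable def chartVal (D : QMap n) (x y : Fin n → Fin 2 → ℝ) : ℍ[ℝ] :=
  open Classical in
  if (D x).2 = 0 then -((D y).2 * (D y).1⁻¹) else (D y).1 * (D y).2⁻¹

/-- The `i`-th partial derivative at `x`. The `i`-th variable moves along the curve
`τ ↦ x i + τ (- x i 1, x i 0)`, which is a regular curve in the projective line. -/
noncomputable def partialDeriv (D : QMap n) (x : Fin n → Fin 2 → ℝ) (i : Fin n) : ℍ[ℝ] :=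
  deriv (fun τ : ℝ => chartVal D x (Function.update x i (x i + τ • ![-x i 1, x i 0]))) 0

/-- Dupin cyclidic systems (`n = 3`; also used for `n = 2`): the values are imaginary quaternions
or `∞`, the partial derivatives are mutually orthogonal, and they are linearly independent (the
Jacobian is non-zero) at one point at least. -/
structure IsDC (D : QMap n) : Prop where
  imaginary : ∀ x, Defined D x → (D x).2 ≠ 0 → ((D x).1 * (D x).2⁻¹).re = 0
  orthogonal : ∀ x, Defined D x → ∀ i j, i ≠ j →
    inner ℝ (partialDeriv D x i) (partialDeriv D x j) = 0
  nondegenerate : ∃ x, Defined D x ∧ LinearIndependent ℝ (partialDeriv D x)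

/-- The singular locus: the image of all points where the Jacobian vanishes. -/
def sing (D : QMap n) : Set (OnePoint ℍ[ℝ]) :=
  val D '' {x | Defined D x ∧ ¬ LinearIndependent ℝ (partialDeriv D x)}

/-- The coordinate hypersurface obtained by fixing the `i`-th parameter to be `c`. -/
def surface (D : QMap n) (i : Fin n) (c : RP1) : Set (OnePoint ℍ[ℝ]) :=
  val D '' {x | Defined D x ∧ ∃ h : x i ≠ 0, Projectivization.mk ℝ (x i) h = c}

/-- A system is spherical if at least one of its families of surfaces consists of M-spheres
(some members of the family may degenerate to subsets of M-spheres). -/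
def IsSpherical (D : QMap 3) : Prop :=
  ∃ i, ∀ c, ∃ S, IsMSphere S ∧ surface D i c ⊆ S

/-- Möbius equivalence `D' = μ ∘ D ∘ ρ` as rational maps, where `μ` is a Möbius transformation and
`ρ` is composed of projective transformations of the parameter lines and a permutation of them. -/
def MobiusEquiv (D D' : QMap n) : Prop :=
  ∃ μ, IsMobius μ ∧ ∃ (σ : Equiv.Perm (Fin n)) (g : Fin n → GL (Fin 2) ℝ),
    ∀ x : Fin n → Fin 2 → ℝ, (∀ i, x i ≠ 0) →
      (Defined D' x ↔ Defined D (fun i => (g i).1.mulVec (x (σ i)))) ∧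
      (Defined D' x → val D' x = μ (val D (fun i => (g i).1.mulVec (x (σ i)))))

/-- The number of coordinate surfaces that coincide with the set `Γ`. For a curve `Γ` these are
the surfaces that degenerate to `Γ`. -/
noncomputable def multiplicity (D : QMap n) (Γ : Set (OnePoint ℍ[ℝ])) : ℕ :=
  {k : Fin n × RP1 | surface D k.1 k.2 = Γ}.ncard

/-! ### Two-dimensional systems -/

/-- The quaternion `a + b i + c j + d k`. -/
def quat (a b c d : ℝ) : ℍ[ℝ] := ⟨a, b, c, d⟩

@[simp] lemma quat_re (a b c d : ℝ) : (quat a b c d).re = a := rfl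

@[simp] lemma quat_imI (a b c d : ℝ) : (quat a b c d).imI = b := rfl

@[simp] lemma quat_imJ (a b c d : ℝ) : (quat a b c d).imJ = c := rfl

@[simp] lemma quat_imK (a b c d : ℝ) : (quat a b c d).imK = d := rfl

/-- The Cartesian coordinates `s i + t j` on the plane spanned by `i` and `j`. -/
def cartesian : QMap 2 where
  toFun x := (quat 0 (x 0 1 * x 1 0) (x 0 0 * x 1 1) 0, quat (x 0 0 * x 1 0) 0 0 0)
  map_update_add' := by
    intro _ m i x y
    fin_cases i <;> ext <;> simp [Function.update] <;> ring_nf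
  map_update_smul' := by
    intro _ m i c x
    fin_cases i <;> ext <;> simp [Function.update] <;> ring_nf

/-- The polar coordinates `(1 + t k) (s i) (1 + t k)⁻¹` on the plane spanned by `i` and `j`:
`s` is the (signed) distance from the origin, and `t` is the tangent of half of the angle. -/
def polar : QMap 2 where
  toFun x := (quat 0 (x 0 1 * x 1 0) (x 0 1 * x 1 1) 0, quat (x 0 0 * x 1 0) 0 0 (x 0 0 * x 1 1))
  map_update_add' := by
    intro _ m i x y
    fin_cases i <;> ext <;> simp [Function.update] <;> ring_nf
  map_update_smul' := by
    intro _ m i c x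
    fin_cases i <;> ext <;> simp [Function.update] <;> ring_nf

/-- 1-polar systems on an M-sphere; the pole is the unique element of `sing P`. -/
def OnePolar (P : QMap 2) : Prop := IsDC P ∧ MobiusEquiv cartesian P

/-- 2-polar systems on an M-sphere; the poles are the two elements of `sing P`. -/
def TwoPolar (P : QMap 2) : Prop := IsDC P ∧ MobiusEquiv polar P

/-- All values of `P` lie in the set `S`. -/
def LiesOn (P : QMap 2) (S : Set (OnePoint ℍ[ℝ])) : Prop := ∀ x, Defined P x → val P x ∈ S

/-! ### Offset and axial constructions -/

/-- `G` is obtained from `P = U W⁻¹` by taking offsets along the unit normals `W n₀ W⁻¹`, i.e.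
`G(s, t, u) = P(s, t) - u d W n₀ W⁻¹`: the control points are moved by the distance `d` along the
normals, and the weights are kept. -/
def IsOffset (P : QMap 2) (G : QMap 3) : Prop :=
  ∃ (n₀ : ℍ[ℝ]) (d : ℝ), n₀.re = 0 ∧ ‖n₀‖ = 1 ∧ d ≠ 0 ∧
    (∀ x, Defined P x → (P x).2 ≠ 0 →
      ∀ i, inner ℝ ((P x).2 * n₀ * (P x).2⁻¹) (partialDeriv P x i) = 0) ∧
    ∀ x, G x = (x 2 0 • (P ![x 0, x 1]).1 - (x 2 1 * d) • ((P ![x 0, x 1]).2 * n₀),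
      x 2 0 • (P ![x 0, x 1]).2)

/-- `G` is the offset construction based on the two-dimensional system `P` on the sphere with
centre `c` and radius `r`. -/
def SphereOffset (P : QMap 2) (c : ℍ[ℝ]) (r : ℝ) (G : QMap 3) : Prop :=
  IsDC P ∧ c.re = 0 ∧ 0 < r ∧ LiesOn P (sphere c r) ∧ IsOffset P G

/-- `G` is the offset construction based on the two-dimensional system `P` on a plane. -/
def PlaneOffset (P : QMap 2) (G : QMap 3) : Prop :=
  IsDC P ∧ (∃ (ν : ℍ[ℝ]) (d : ℝ), ν.re = 0 ∧ ν ≠ 0 ∧ LiesOn P (plane ν d)) ∧ IsOffset P G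

/-- `G` is the axial construction: the two-dimensional system `P` on a plane is rotated about the
line `ℝ a` in this plane, by left multiplication of `(U, W)` by `(1 - u) + u a`. -/
def Axial (P : QMap 2) (a : ℍ[ℝ]) (G : QMap 3) : Prop :=
  IsDC P ∧ a.re = 0 ∧ ‖a‖ = 1 ∧
    (∃ ν : ℍ[ℝ], ν.re = 0 ∧ ν ≠ 0 ∧ inner ℝ ν a = 0 ∧ LiesOn P (plane ν 0)) ∧
    ∀ x, G x = ((((x 2 0 - x 2 1 : ℝ) : ℍ[ℝ]) + x 2 1 • a) * (P ![x 0, x 1]).1,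
      (((x 2 0 - x 2 1 : ℝ) : ℍ[ℝ]) + x 2 1 • a) * (P ![x 0, x 1]).2)

/-- The axis of an axial construction is counted as a double line: it lies on all coordinate
planes of the rotating family, and each of these is attained at exactly two parameters. -/
def IsDoubleAxis (a : ℍ[ℝ]) (G : QMap 3) : Prop :=
  ∀ c, line 0 a ⊆ surface G 2 c ∧ {c' | surface G 2 c' = surface G 2 c}.ncard = 2

/-! ### The four classes -/

/-- Offset construction based on a sphere. -/
def ClassS1 (G : QMap 3) : Prop := ∃ P c r, SphereOffset P c r G

/-- Offset construction based on a plane. -/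
def ClassS2 (G : QMap 3) : Prop := ∃ P, PlaneOffset P G

/-- Axial construction from a 2-polar system. -/
def ClassS3 (G : QMap 3) : Prop := ∃ P a, TwoPolar P ∧ Axial P a G

/-- Axial construction from a 1-polar system. -/
def ClassS4 (G : QMap 3) : Prop := ∃ P a, OnePolar P ∧ Axial P a G

/-- Kinds of offset constructions based on a sphere: from a 2-polar system, `θ` being the angle
at which the two poles are seen from the centre, or from a 1-polar system. -/
inductive KindS1
  | twoPolar (θ : ℝ)
  | onePolar

/-- `G` is an offset construction based on a sphere, of the given kind. -/
def HasKindS1 : KindS1 → QMap 3 → Prop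
  | .twoPolar θ, G => ∃ (P : QMap 2) (c : ℍ[ℝ]) (r : ℝ) (p q : ℍ[ℝ]),
      SphereOffset P c r G ∧ TwoPolar P ∧ p ≠ q ∧ sing P = {(p : OnePoint ℍ[ℝ]), ↑q} ∧
      InnerProductGeometry.angle (p - c) (q - c) = θ
  | .onePolar, G => ∃ P c r, SphereOffset P c r G ∧ OnePolar P

/-- Kinds of offset constructions based on a plane. -/
inductive KindS2
  | twoFinitePoles
  | twoPolesOneInfinite
  | oneFinitePole
  | oneInfinitePole

/-- `G` is an offset construction based on a plane, of the given kind. -/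
def HasKindS2 : KindS2 → QMap 3 → Prop
  | .twoFinitePoles, G => ∃ P, PlaneOffset P G ∧ TwoPolar P ∧ ∞ ∉ sing P
  | .twoPolesOneInfinite, G => ∃ P, PlaneOffset P G ∧ TwoPolar P ∧ ∞ ∈ sing P
  | .oneFinitePole, G => ∃ P, PlaneOffset P G ∧ OnePolar P ∧ ∞ ∉ sing P
  | .oneInfinitePole, G => ∃ P, PlaneOffset P G ∧ OnePolar P ∧ ∞ ∈ sing P

/-- Kinds of axial constructions from a 2-polar system with poles `p`, `q`: both poles off the axis
and not symmetric in the axis, with `κ = |p - q| / |p - q'|` where `q'` is symmetric to `q`; poles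
off the axis and symmetric in it; exactly one pole on the axis; both poles on the axis. -/
inductive KindS3
  | generic (κ : ℝ)
  | symmetricPoles
  | onePoleOnAxis
  | bothPolesOnAxis

/-- `G` is an axial construction from a 2-polar system, with axis `ℝ a` and of the given kind.
Conjugation by `a` is the half-turn about the axis, which acts on planes through the axis as the
reflection in the axis. -/
def HasKindS3 (a : ℍ[ℝ]) : KindS3 → QMap 3 → Prop
  | .generic κ, G => ∃ (P : QMap 2) (p q : ℍ[ℝ]), TwoPolar P ∧ Axial P a G ∧
      p ≠ q ∧ sing P = {(p : OnePoint ℍ[ℝ]), ↑q} ∧ ↑p ∉ line 0 a ∧ ↑q ∉ line 0 a ∧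
      q ≠ a * p * a⁻¹ ∧ ‖p - q‖ / ‖p - a * q * a⁻¹‖ = κ
  | .symmetricPoles, G => ∃ (P : QMap 2) (p : ℍ[ℝ]), TwoPolar P ∧ Axial P a G ∧
      sing P = {(p : OnePoint ℍ[ℝ]), ↑(a * p * a⁻¹)} ∧ ↑p ∉ line 0 a
  | .onePoleOnAxis, G => ∃ (P : QMap 2) (p q : OnePoint ℍ[ℝ]), TwoPolar P ∧ Axial P a G ∧
      sing P = {p, q} ∧ p ∉ line 0 a ∧ q ∈ line 0 a
  | .bothPolesOnAxis, G => ∃ P : QMap 2, TwoPolar P ∧ Axial P a G ∧ sing P ⊆ line 0 a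

/-- Kinds of axial constructions from a 1-polar system. -/
inductive KindS4
  | poleOffAxis
  | poleOnAxis

/-- `G` is an axial construction from a 1-polar system, with axis `ℝ a` and of the given kind. -/
def HasKindS4 (a : ℍ[ℝ]) : KindS4 → QMap 3 → Prop
  | .poleOffAxis, G => ∃ P : QMap 2, OnePolar P ∧ Axial P a G ∧ ¬ sing P ⊆ line 0 a
  | .poleOnAxis, G => ∃ P : QMap 2, OnePolar P ∧ Axial P a G ∧ sing P ⊆ line 0 a

/-! ### Shapes of singular loci -/

/-- Two different lines that intersect in a point of the Euclidean space, both simple. -/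
def TwoIntersectingLines (G : QMap 3) : Prop :=
  ∃ c v w : ℍ[ℝ], c.re = 0 ∧ v.re = 0 ∧ w.re = 0 ∧ LinearIndependent ℝ ![v, w] ∧
    sing G = line c v ∪ line c w ∧ multiplicity G (line c v) = 1 ∧ multiplicity G (line c w) = 1

/-- Two different parallel lines, both simple. -/
def TwoParallelLines (G : QMap 3) : Prop :=
  ∃ c c' v : ℍ[ℝ], c.re = 0 ∧ c'.re = 0 ∧ v.re = 0 ∧ v ≠ 0 ∧ line c v ≠ line c' v ∧
    sing G = line c v ∪ line c' v ∧ multiplicity G (line c v) = 1 ∧ multiplicity G (line c' v) = 1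

/-- One line, of multiplicity `m`. -/
def OneLine (m : ℕ) (G : QMap 3) : Prop :=
  ∃ c v : ℍ[ℝ], c.re = 0 ∧ v.re = 0 ∧ v ≠ 0 ∧ sing G = line c v ∧ multiplicity G (line c v) = m

/-- The double axis and two different simple circles around it. -/
def AxisAndTwoCircles (a : ℍ[ℝ]) (G : QMap 3) : Prop :=
  IsDoubleAxis a G ∧ ∃ l l' r r' : ℝ, 0 < r ∧ 0 < r' ∧ (l, r) ≠ (l', r') ∧
    sing G = line 0 a ∪ circle (l • a) a r ∪ circle (l' • a) a r' ∧
    multiplicity G (circle (l • a) a r) = 1 ∧ multiplicity G (circle (l' • a) a r') = 1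

/-- The double axis and one circle of multiplicity `m` around it. -/
def AxisAndCircle (m : ℕ) (a : ℍ[ℝ]) (G : QMap 3) : Prop :=
  IsDoubleAxis a G ∧ ∃ l r : ℝ, 0 < r ∧ sing G = line 0 a ∪ circle (l • a) a r ∧
    multiplicity G (circle (l • a) a r) = m

/-- The double axis alone. -/
def AxisOnly (a : ℍ[ℝ]) (G : QMap 3) : Prop := IsDoubleAxis a G ∧ sing G = line 0 a

end DupinCyclidic

open DupinCyclidic

namespace DupinCyclidic

open Function
open Complex (normSq I normSq_apply normSq_pos normSq_nonneg normSq_eq_zero normSq_eq_conj_mul_self normSq_ofReal conj_conj I_sq I_ne_zero ofReal_one)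
open Quaternion (inner_def coe_mul_eq_smul mul_coe_eq_smul coe_injective)
open Matrix (cons_val_zero cons_val_one cons_val)
open Real (sqrt sqrt_pos sq_sqrt)
open Set (mem_ofPred_eq singleton_subset_iff mem_singleton_iff Ioc Ioi)
open Projectivization (ind mk_eq_mk_iff')
open scoped ComplexConjugate

local notation "ℍ²" => ℍ[ℝ] × ℍ[ℝ]

/-! ### The Hermitian form on pairs of quaternions and derivatives of rational maps -/

/-- The Hermitian form on `ℍ²` whose isotropic vectors `(U, W)` represent imaginary quotients
`U W⁻¹`. -/
noncomputable def form (X Y : ℍ²) : ℍ[ℝ] := star X.1 * Y.2 + star X.2 * Y.1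

/-- The right multiplication of a pair by a quaternion. -/
noncomputable def rmul (X : ℍ²) (h : ℍ[ℝ]) : ℍ² := (X.1 * h, X.2 * h)

/-- The point of the extended space that is represented by a pair. -/
noncomputable def toPoint (X : ℍ²) : OnePoint ℍ[ℝ] :=
  open Classical in if X.2 = 0 then ∞ else ((X.1 * X.2⁻¹ : ℍ[ℝ]) : OnePoint ℍ[ℝ])

lemma val_eq_toPoint {n : ℕ} (D : QMap n) (x) : val D x = toPoint (D x) := rfl

lemma form_add_left (X Y Z) : form (X + Y) Z = form X Z + form Y Z := by
  simp [form, add_mul]; abel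

lemma form_add_right (X Y Z) : form X (Y + Z) = form X Y + form X Z := by
  simp [form, mul_add]; abel

lemma form_smul_left (c : ℝ) (X Y) : form (c • X) Y = c • form X Y := by
  simp [form]

lemma form_smul_right (c : ℝ) (X Y) : form X (c • Y) = c • form X Y := by
  simp [form]

@[simp] lemma form_zero_left (X) : form 0 X = 0 := by simp [form]

@[simp] lemma form_zero_right (X) : form X 0 = 0 := by simp [form]

lemma star_form (X Y) : star (form X Y) = form Y X := by
  simp [form]; abel

lemma form_rmul (X Y) (h k : ℍ[ℝ]) : form (rmul X h) (rmul Y k) = star h * form X Y * k := by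
  simp [form, rmul, mul_add, add_mul, mul_assoc]

lemma rmul_one (X) : rmul X 1 = X := by simp [rmul]

lemma rmul_rmul (X h k) : rmul (rmul X h) k = rmul X (h * k) := by simp [rmul, mul_assoc]

lemma rmul_add_left (X Y h) : rmul (X + Y) h = rmul X h + rmul Y h := by simp [rmul, add_mul]

lemma rmul_sub_left (X Y h) : rmul (X - Y) h = rmul X h - rmul Y h := by simp [rmul, sub_mul]

lemma rmul_add_right (X h k) : rmul X (h + k) = rmul X h + rmul X k := by simp [rmul, mul_add]

lemma rmul_sub_right (X h k) : rmul X (h - k) = rmul X h - rmul X k := by simp [rmul, mul_sub]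

lemma rmul_smul_left (c : ℝ) (X h) : rmul (c • X) h = c • rmul X h := by simp [rmul]

@[simp] lemma rmul_zero_left (h) : rmul 0 h = 0 := by simp [rmul]

@[simp] lemma rmul_zero_right (X) : rmul X 0 = 0 := by simp [rmul]

lemma rmul_eq_zero {X h} (hh : h ≠ 0) : rmul X h = 0 ↔ X = 0 := by
  simp [rmul, Prod.ext_iff, hh]

lemma toPoint_rmul (X) {h : ℍ[ℝ]} (hh : h ≠ 0) : toPoint (rmul X h) = toPoint X := by
  by_cases h1 : X.2 = 0 <;> simp [toPoint, rmul, h1, hh, mul_assoc]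

lemma toPoint_smul (X) {c : ℝ} (hc : c ≠ 0) : toPoint (c • X) = toPoint X := by
  have : c • X = rmul X (c : ℍ[ℝ]) := by
    ext1 <;> simp [rmul, mul_coe_eq_smul]
  rw [this, toPoint_rmul]
  exact fun h => hc (coe_injective h)

lemma toPoint_eq_iff {X Y : ℍ²} (hX : X ≠ 0) (hY : Y ≠ 0) :
    toPoint X = toPoint Y ↔ ∃ h, h ≠ 0 ∧ Y = rmul X h := by
  constructor
  · intro h
    unfold toPoint at h
    by_cases h1 : X.2 = 0 <;> by_cases h2 : Y.2 = 0 <;> simp [h1, h2] at h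
    · have hX1 : X.1 ≠ 0 := fun h' => hX (Prod.ext h' h1)
      have hY1 : Y.1 ≠ 0 := fun h' => hY (Prod.ext h' h2)
      exact ⟨X.1⁻¹ * Y.1, by simp [hX1, hY1], by ext1 <;> simp [rmul, h1, h2, hX1]⟩
    · refine ⟨X.2⁻¹ * Y.2, by simp [h1, h2], ?_⟩
      ext1
      · rw [rmul, ← mul_assoc, h, mul_assoc, inv_mul_cancel₀ h2, mul_one]
      · simp [rmul, h1]
  · rintro ⟨h, hh, rfl⟩
    rw [toPoint_rmul _ hh]

lemma form_self_eq_zero_iff (X : ℍ²) (h : X.2 ≠ 0) :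
    form X X = 0 ↔ (X.1 * X.2⁻¹).re = 0 := by
  have h1 : form X X = star X.2 * ((X.1 * X.2⁻¹) + star (X.1 * X.2⁻¹)) * X.2 := by
    simp only [form, star_mul, mul_add, add_mul]
    rw [mul_assoc (star X.2), mul_assoc X.1, inv_mul_cancel₀ h, mul_one, ← mul_assoc (star X.2),
      ← star_mul, inv_mul_cancel₀ h, star_one, one_mul, add_comm]
  rw [h1, mul_eq_zero, mul_eq_zero, star_eq_zero, or_iff_left h, or_iff_right h,
    Quaternion.self_add_star]
  constructor
  · intro h
    have h2 : ((2 * (X.1 * X.2⁻¹).re : ℝ) : ℍ[ℝ]) = ((0 : ℝ) : ℍ[ℝ]) := by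
      push_cast; exact h
    linarith [coe_injective h2]
  · intro h; rw [h]; simp

lemma isotropic_quotient {X : ℍ²} (hX : form X X = 0) (h : X.2 ≠ 0) :
    star X.2⁻¹ * star X.1 = - (X.1 * X.2⁻¹) := by
  rw [← star_mul]
  have := (form_self_eq_zero_iff X h).1 hX
  exact Quaternion.star_eq_neg.2 this

lemma hasDerivAt_quotient {X Y : ℍ²} (hX : form X X = 0) (h : X.2 ≠ 0) :
    HasDerivAt (fun τ : ℝ => (X + τ • Y).1 * (X + τ • Y).2⁻¹)
      (star X.2⁻¹ * form X Y * X.2⁻¹) 0 := by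
  have h1 : ∀ a b : ℍ[ℝ], HasDerivAt (fun τ : ℝ => a + τ • b) b 0 := fun a b => by
    simpa using ((hasDerivAt_id (0 : ℝ)).smul_const b).const_add a
  have h2 : HasDerivAt (fun τ : ℝ => (X.2 + τ • Y.2)⁻¹) (-(X.2⁻¹ * Y.2 * X.2⁻¹)) 0 := by
    have h3 : HasFDerivAt (Inv.inv : ℍ[ℝ] → ℍ[ℝ]) _ (X.2 + (0 : ℝ) • Y.2) :=
      hasFDerivAt_inv' (𝕜 := ℝ) (by simpa using h)
    have := h3.comp_hasDerivAt (0 : ℝ) (h1 X.2 Y.2)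
    simp only [zero_smul, add_zero, neg_apply,
      ContinuousLinearMap.mulLeftRight_apply] at this
    exact this
  have h4 := (h1 X.1 Y.1).mul h2
  refine h4.congr_deriv ?_
  simp only [form, zero_smul, add_zero, mul_add, add_mul]
  rw [← mul_assoc, ← mul_assoc, isotropic_quotient hX h, ← star_mul, mul_inv_cancel₀ h]
  simp only [star_one, one_mul, mul_assoc]
  noncomm_ring

lemma inner_conj (v p q : ℍ[ℝ]) :
    inner ℝ (star v * p * v) (star v * q * v) = ‖v‖ ^ 4 * inner ℝ p q := by
  rw [real_inner_eq_norm_add_mul_self_sub_norm_mul_self_sub_norm_mul_self_div_two,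
    real_inner_eq_norm_add_mul_self_sub_norm_mul_self_sub_norm_mul_self_div_two p q,
    ← add_mul, ← mul_add]
  simp only [norm_mul, Quaternion.norm_star]
  ring

variable {n : ℕ}

/-- The tangent vector of the `i`-th coordinate line, in the frame of the pair. It does not depend
on the `i`-th variable. -/
noncomputable def omega (F : (Fin n → Fin 2 → ℝ) → ℍ²) (x : Fin n → Fin 2 → ℝ)
    (i : Fin n) : ℍ[ℝ] :=
  form (F (update x i ![1, 0])) (F (update x i ![0, 1]))

lemma vec_eq (v : Fin 2 → ℝ) : v = v 0 • ![1, 0] + v 1 • ![0, 1] := by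
  ext i; fin_cases i <;> simp

lemma map_update_vec (D : QMap n) (x i) (v : Fin 2 → ℝ) :
    D (update x i v) = v 0 • D (update x i ![1, 0]) + v 1 • D (update x i ![0, 1]) := by
  conv_lhs => rw [vec_eq v, D.map_update_add, D.map_update_smul, D.map_update_smul]

/-- All values of the pair are isotropic. -/
def Isotropic (D : QMap n) : Prop := ∀ x, form (D x) (D x) = 0

lemma Isotropic.form_update {D : QMap n} (hD : Isotropic D) (x i) (v w : Fin 2 → ℝ) :
    form (D (update x i v)) (D (update x i w)) = (v 0 * w 1 - v 1 * w 0) • omega D x i := by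
  have h0 := hD (update x i ![1, 0])
  have h1 := hD (update x i ![0, 1])
  have h2 := hD (update x i ![1, 1])
  rw [map_update_vec D x i ![1, 1]] at h2
  simp only [cons_val_zero, cons_val_one, one_smul, form_add_left, form_add_right,
    h0, h1, zero_add, add_zero] at h2
  rw [map_update_vec D x i v, map_update_vec D x i w]
  simp only [form_add_left, form_add_right, form_smul_left, form_smul_right, h0, h1]
  rw [eq_neg_of_add_eq_zero_left h2]
  simp only [omega, smul_zero, zero_add, add_zero, smul_smul, smul_neg, sub_smul]
  rw [mul_comm (w 1), mul_comm (w 0)]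
  abel

lemma Isotropic.form_tangent {D : QMap n} (hD : Isotropic D) (x i) :
    form (D x) (D (update x i ![-x i 1, x i 0])) = (x i 0 ^ 2 + x i 1 ^ 2) • omega D x i := by
  have := hD.form_update x i (x i) ![-x i 1, x i 0]
  rw [update_eq_self] at this
  rw [this]; congr 1; simp; ring

lemma sq_add_sq_pos {v : Fin 2 → ℝ} (hv : v ≠ 0) : 0 < v 0 ^ 2 + v 1 ^ 2 := by
  have : v 0 ≠ 0 ∨ v 1 ≠ 0 := by
    by_contra! h
    exact hv (by ext i; fin_cases i <;> simp [h])
  rcases this with h | h <;> positivity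

lemma Isotropic.partialDeriv_eq {D : QMap n} (hD : Isotropic D) {x} (hx : D x ≠ 0) :
    ∃ (v : ℍ[ℝ]) (e : ℝ), v ≠ 0 ∧ e ≠ 0 ∧ ∀ i,
      partialDeriv D x i = (e * (x i 0 ^ 2 + x i 1 ^ 2)) • (star v * omega D x i * v) := by
  have key : ∀ i (τ : ℝ), D (update x i (x i + τ • ![-x i 1, x i 0])) =
      D x + τ • D (update x i ![-x i 1, x i 0]) := fun i τ => by
    rw [D.map_update_add, D.map_update_smul, update_eq_self]
  by_cases h : (D x).2 = 0
  · have h1 : (D x).1 ≠ 0 := fun h' => hx (Prod.ext h' h)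
    refine ⟨(D x).1⁻¹, -1, inv_ne_zero h1, by simp, fun i => ?_⟩
    unfold partialDeriv chartVal
    simp only [h, if_true, key]
    have h2 := hasDerivAt_quotient (X := (D x).swap) (Y := (D (update x i ![-x i 1, x i 0])).swap)
      (by have := hD x; rw [form] at this ⊢; simpa [add_comm] using this) (by simpa using h1)
    have h3 := h2.neg.deriv
    rw [neg_one_mul, neg_smul, ← smul_mul_assoc, ← mul_smul_comm, ← hD.form_tangent]
    refine Eq.trans h3 ?_
    simp only [form, Prod.fst_swap, Prod.snd_swap]
    rw [add_comm (star (D x).1 * _)]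
  · refine ⟨(D x).2⁻¹, 1, inv_ne_zero h, by simp, fun i => ?_⟩
    unfold partialDeriv chartVal
    simp only [h, if_false, key]
    rw [(hasDerivAt_quotient (hD x) h).deriv, hD.form_tangent]
    simp

lemma IsDC.isotropic {D : QMap n} (hD : IsDC D) : Isotropic D := by
  intro x
  by_cases hx : Defined D x
  · by_cases h : (D x).2 = 0
    · simp [form, h]
    · exact (form_self_eq_zero_iff _ h).2 (hD.imaginary x hx h)
  · have : D x = 0 := by
      by_cases h : ∀ i, x i ≠ 0
      · by_contra h'; exact hx ⟨h, h'⟩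
      · push Not at h
        obtain ⟨i, hi⟩ := h
        exact D.map_coord_zero i hi
    rw [this]; simp

lemma Isotropic.omega_eq_zero_of_eq_zero {D : QMap n} (hD : Isotropic D) {x i} (hi : x i ≠ 0)
    (hx : D x = 0) : omega D x i = 0 := by
  have := hD.form_tangent x i
  rw [hx, form_zero_left] at this
  exact (smul_eq_zero.1 this.symm).resolve_left (sq_add_sq_pos hi).ne'

lemma omega_eq_zero_of_coord {D : QMap n} {x : Fin n → Fin 2 → ℝ} {i k} (hik : i ≠ k)
    (hk : x k = 0) : omega D x i = 0 := by
  have : D (update x i ![1, 0]) = 0 := D.map_coord_zero k (by rw [update_of_ne hik.symm, hk])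
  simp [omega, this]

lemma Isotropic.partialDeriv_eq_zero_iff {D : QMap n} (hD : Isotropic D) {x} (hx : Defined D x)
    (i) : partialDeriv D x i = 0 ↔ omega D x i = 0 := by
  obtain ⟨v, e, hv, he, h⟩ := hD.partialDeriv_eq hx.2
  rw [h, smul_eq_zero]
  have := (sq_add_sq_pos (hx.1 i)).ne'
  simp [he, hv, this]

lemma Isotropic.inner_partialDeriv_eq_zero_iff {D : QMap n} (hD : Isotropic D) {x}
    (hx : Defined D x) (i j) : inner ℝ (partialDeriv D x i) (partialDeriv D x j) = 0 ↔
      inner ℝ (omega D x i) (omega D x j) = 0 := by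
  obtain ⟨v, e, hv, he, h⟩ := hD.partialDeriv_eq hx.2
  rw [h, h, inner_smul_left, inner_smul_right, inner_conj]
  have h1 := (sq_add_sq_pos (hx.1 i)).ne'
  have h2 := (sq_add_sq_pos (hx.1 j)).ne'
  simp [he, hv, h1, h2]

/-- The algebraic form of the definition of Dupin cyclidic systems. -/
structure AlgDC (D : QMap n) : Prop where
  isotropic : Isotropic D
  orthogonal : ∀ x i j, i ≠ j → inner ℝ (omega D x i) (omega D x j) = 0
  nondegenerate : ∃ x, Defined D x ∧ ∀ i, omega D x i ≠ 0

lemma linearIndependent_iff_of_orthogonal {v : Fin n → ℍ[ℝ]}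
    (h : ∀ i j, i ≠ j → inner ℝ (v i) (v j) = 0) :
    LinearIndependent ℝ v ↔ ∀ i, v i ≠ 0 :=
  ⟨fun h i => h.ne_zero i, fun h' => linearIndependent_of_ne_zero_of_inner_eq_zero h' h⟩

lemma isDC_iff {D : QMap n} : IsDC D ↔ AlgDC D := by
  constructor
  · intro hD
    refine ⟨hD.isotropic, fun x i j hij => ?_, ?_⟩
    · by_cases hx : Defined D x
      · exact (hD.isotropic.inner_partialDeriv_eq_zero_iff hx i j).1 (hD.orthogonal x hx i j hij)
      · by_cases h : ∀ i, x i ≠ 0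
        · have h' : D x = 0 := by
            by_contra h'; exact hx ⟨h, h'⟩
          rw [hD.isotropic.omega_eq_zero_of_eq_zero (h i) h', inner_zero_left]
        · push Not at h
          obtain ⟨k, hk⟩ := h
          by_cases hik : i = k
          · rw [omega_eq_zero_of_coord (i := j) (hik ▸ hij.symm) hk, inner_zero_right]
          · rw [omega_eq_zero_of_coord hik hk, inner_zero_left]
    · obtain ⟨x, hx, h⟩ := hD.nondegenerate
      exact ⟨x, hx, fun i hi => h.ne_zero i ((hD.isotropic.partialDeriv_eq_zero_iff hx i).2 hi)⟩
  · intro hD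
    refine ⟨fun x hx h => (form_self_eq_zero_iff _ h).1 (hD.isotropic x), fun x hx i j hij =>
      (hD.isotropic.inner_partialDeriv_eq_zero_iff hx i j).2 (hD.orthogonal x i j hij), ?_⟩
    obtain ⟨x, hx, h⟩ := hD.nondegenerate
    refine ⟨x, hx, (linearIndependent_iff_of_orthogonal fun i j hij =>
      (hD.isotropic.inner_partialDeriv_eq_zero_iff hx i j).2 (hD.orthogonal x i j hij)).2 fun i hi =>
      h i ((hD.isotropic.partialDeriv_eq_zero_iff hx i).1 hi)⟩

lemma AlgDC.sing_eq {D : QMap n} (hD : AlgDC D) :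
    sing D = val D '' {x | Defined D x ∧ ∃ i, omega D x i = 0} := by
  unfold sing
  congr 1
  ext x
  simp only [mem_ofPred_eq, and_congr_right_iff]
  intro hx
  rw [linearIndependent_iff_of_orthogonal fun i j hij =>
    (hD.isotropic.inner_partialDeriv_eq_zero_iff hx i j).2 (hD.orthogonal x i j hij)]
  push Not
  simp only [hD.isotropic.partialDeriv_eq_zero_iff hx]

/-! ### Möbius transformations as matrices -/

/-- Similitudes of the Hermitian form (up to sign): these are the matrices that represent Möbius
transformations. -/
structure IsSim (M : ℍ² →ₗ[ℝ] ℍ²) : Prop where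
  map_rmul : ∀ X h, M (rmul X h) = rmul (M X) h
  map_form : ∃ r : ℝ, r ≠ 0 ∧ ∀ X Y, form (M X) (M Y) = r • form X Y

/-- The left multiplication by a matrix with quaternionic entries. -/
noncomputable def qmat (a b c d : ℍ[ℝ]) : ℍ² →ₗ[ℝ] ℍ² where
  toFun X := (a * X.1 + b * X.2, c * X.1 + d * X.2)
  map_add' X Y := by ext1 <;> simp [mul_add] <;> abel
  map_smul' r X := by ext1 <;> simp

lemma qmat_apply (a b c d : ℍ[ℝ]) (X) :
    qmat a b c d X = (a * X.1 + b * X.2, c * X.1 + d * X.2) := rfl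

lemma isSim_qmat {a b c d : ℍ[ℝ]} (h1 : star a * c + star c * a = 0)
    (h2 : star b * d + star d * b = 0) (r : ℝ) (hr : r ≠ 0)
    (h3 : star a * d + star c * b = (r : ℍ[ℝ])) : IsSim (qmat a b c d) := by
  refine ⟨fun X h => by simp [qmat_apply, rmul, add_mul, mul_assoc], r, hr, fun X Y => ?_⟩
  have h4 : star d * a + star b * c = (r : ℍ[ℝ]) := by
    have := congrArg star h3
    simpa using this
  have : form (qmat a b c d X) (qmat a b c d Y) =
      star X.1 * (star a * c + star c * a) * Y.1 + star X.2 * (star b * d + star d * b) * Y.2 +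
      star X.1 * (star a * d + star c * b) * Y.2 + star X.2 * (star d * a + star b * c) * Y.1 := by
    simp only [form, qmat_apply, star_add, star_mul]
    noncomm_ring
  rw [this, h1, h2, h3, h4, form, smul_add, mul_coe_eq_smul, mul_coe_eq_smul]
  simp

lemma IsSim.eq_qmat {M} (hM : IsSim M) :
    M = qmat (M (1, 0)).1 (M (0, 1)).1 (M (1, 0)).2 (M (0, 1)).2 := by
  refine LinearMap.ext fun X => ?_
  have : X = rmul (1, 0) X.1 + rmul (0, 1) X.2 := by ext1 <;> simp [rmul]
  conv_lhs => rw [this, map_add, hM.map_rmul, hM.map_rmul]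
  rfl

lemma form_eq_zero_of_forall {X} (h : ∀ Y, form X Y = 0) : X = 0 := by
  have h1 := h (1, 0)
  have h2 := h (0, 1)
  simp [form] at h1 h2
  exact Prod.ext h2 h1

lemma IsSim.injective {M} (hM : IsSim M) : Injective M := by
  rw [injective_iff_map_eq_zero]
  intro X hX
  obtain ⟨r, hr, h⟩ := hM.map_form
  refine form_eq_zero_of_forall fun Y => ?_
  have := h X Y
  rw [hX, form_zero_left] at this
  exact (smul_eq_zero.1 this.symm).resolve_left hr

lemma IsSim.map_eq_zero {M} (hM : IsSim M) {X} : M X = 0 ↔ X = 0 :=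
  map_eq_zero_iff _ hM.injective

lemma IsSim.isotropic_iff {M} (hM : IsSim M) (X) : form (M X) (M X) = 0 ↔ form X X = 0 := by
  obtain ⟨r, hr, h⟩ := hM.map_form
  rw [h]; simp [hr]

lemma isSim_id : IsSim LinearMap.id := ⟨fun _ _ => rfl, 1, one_ne_zero, by simp⟩

lemma IsSim.comp {M N} (hM : IsSim M) (hN : IsSim N) : IsSim (M ∘ₗ N) := by
  obtain ⟨r, hr, h⟩ := hM.map_form
  obtain ⟨s, hs, h'⟩ := hN.map_form
  exact ⟨fun X k => by simp [hM.map_rmul, hN.map_rmul], r * s, mul_ne_zero hr hs, fun X Y => by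
    simp [h, h', mul_smul]⟩

lemma IsSim.exists_inverse {M} (hM : IsSim M) : ∃ N, IsSim N ∧ (∀ X, N (M X) = X) ∧
    ∀ X, M (N X) = X := by
  let e := LinearEquiv.ofInjectiveEndo M hM.injective
  have h1 : ∀ X, M (e.symm X) = X := fun X => e.apply_symm_apply X
  have h2 : ∀ X, e.symm (M X) = X := fun X => e.symm_apply_apply X
  refine ⟨e.symm.toLinearMap, ⟨fun X h => hM.injective ?_, ?_⟩, h2, h1⟩
  · simp only [LinearEquiv.coe_coe, hM.map_rmul, h1]
  · obtain ⟨r, hr, h⟩ := hM.map_form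
    refine ⟨r⁻¹, inv_ne_zero hr, fun X Y => ?_⟩
    have := h (e.symm X) (e.symm Y)
    rw [h1, h1] at this
    simp only [LinearEquiv.coe_coe]
    rw [this, smul_smul, inv_mul_cancel₀ hr, one_smul]

/-- The map `μ` of the extended space is given by the matrix `M`. -/
def Realizes (μ : OnePoint ℍ[ℝ] → OnePoint ℍ[ℝ])
    (M : ℍ² →ₗ[ℝ] ℍ²) : Prop :=
  ∀ X, X ≠ 0 → form X X = 0 → μ (toPoint X) = toPoint (M X)

/-- The matrix of an inversion. -/
noncomputable def invMat (q : ℍ[ℝ]) (r : ℝ) : ℍ² →ₗ[ℝ] ℍ² :=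
  qmat q (-(q * q) - ((r ^ 2 : ℝ) : ℍ[ℝ])) 1 (-q)

lemma star_eq_neg_of_re {q : ℍ[ℝ]} (hq : q.re = 0) : star q = -q := Quaternion.star_eq_neg.2 hq

lemma mul_self_of_re {q : ℍ[ℝ]} (hq : q.re = 0) : q * q = ((-‖q‖ ^ 2 : ℝ) : ℍ[ℝ]) := by
  have h := Quaternion.self_mul_star q
  rw [star_eq_neg_of_re hq, mul_neg, Quaternion.normSq_eq_norm_mul_self] at h
  rw [← neg_neg (q * q), h, ← Quaternion.coe_neg]
  congr 1; ring

lemma isSim_invMat {q : ℍ[ℝ]} (hq : q.re = 0) {r : ℝ} (hr : 0 < r) : IsSim (invMat q r) := by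
  have hs := star_eq_neg_of_re hq
  refine isSim_qmat ?_ ?_ (-r ^ 2) (by simp [hr.ne']) ?_
  · simp [hs]
  · rw [mul_self_of_re hq, ← Quaternion.coe_neg, ← Quaternion.coe_sub, Quaternion.star_coe,
      star_neg, hs, neg_neg, Quaternion.coe_commutes]
    simp
  · simp [hs]
    abel

lemma realizes_invMat (q : ℍ[ℝ]) (r : ℝ) :
    Realizes (inversion q r) (invMat q r) := by
  intro X hX _
  unfold toPoint invMat
  rw [qmat_apply]
  by_cases h : X.2 = 0
  · have h1 : X.1 ≠ 0 := fun h' => hX (Prod.ext h' h)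
    simp [h, h1, inversion]
  · have h2 : 1 * X.1 + -q * X.2 = (X.1 * X.2⁻¹ - q) * X.2 := by
      rw [sub_mul, mul_assoc, inv_mul_cancel₀ h]; noncomm_ring
    simp only [h, if_false]
    rw [h2]
    by_cases h3 : X.1 * X.2⁻¹ = q
    · simp [h3, inversion]
    · have h4 : X.1 * X.2⁻¹ - q ≠ 0 := sub_ne_zero.2 h3
      have h5 : q * X.1 + (-(q * q) - ((r ^ 2 : ℝ) : ℍ[ℝ])) * X.2 =
          (q * (X.1 * X.2⁻¹ - q) - ((r ^ 2 : ℝ) : ℍ[ℝ])) * X.2 := by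
        have h6 : X.1 * X.2⁻¹ * X.2 = X.1 := by rw [mul_assoc, inv_mul_cancel₀ h, mul_one]
        rw [sub_mul, sub_mul, mul_assoc, sub_mul, h6]; noncomm_ring
      have h6 : (X.1 * X.2⁻¹ - q) * X.2 ≠ 0 := mul_ne_zero h4 h
      simp only [h6, if_false, h5, inversion, h3]
      congr 1
      rw [mul_inv_rev, ← mul_assoc, mul_assoc _ X.2, mul_inv_cancel₀ h, mul_one, sub_mul, mul_assoc,
        mul_inv_cancel₀ h4, mul_one, coe_mul_eq_smul]

lemma Realizes.comp {μ ν M N} (h : Realizes μ M) (h' : Realizes ν N) (hN : IsSim N) :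
    Realizes (μ ∘ ν) (M ∘ₗ N) := by
  intro X hX hX'
  simp only [comp_apply, LinearMap.comp_apply]
  rw [h' X hX hX', h _ (by rwa [Ne, hN.map_eq_zero]) ((hN.isotropic_iff X).2 hX')]

lemma IsMobius.exists_sim {μ} (h : IsMobius μ) : ∃ M, IsSim M ∧ Realizes μ M := by
  induction h with
  | id => exact ⟨LinearMap.id, isSim_id, fun _ _ _ => rfl⟩
  | comp q r f hq hr _ ih =>
    obtain ⟨M, hM, h⟩ := ih
    exact ⟨_, (isSim_invMat hq hr).comp hM, (realizes_invMat q r).comp h hM⟩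

lemma IsMobius.comp' {μ ν} (h : IsMobius μ) (h' : IsMobius ν) : IsMobius (μ ∘ ν) := by
  induction h with
  | id => exact h'
  | comp q r f hq hr _ ih => exact IsMobius.comp q r _ hq hr ih

/-- The matrix represents a Möbius transformation. -/
def Realizable (M : ℍ² →ₗ[ℝ] ℍ²) : Prop := ∃ μ, IsMobius μ ∧ Realizes μ M

lemma Realizable.comp {M N} (h : Realizable M) (h' : Realizable N) (hN : IsSim N) :
    Realizable (M ∘ₗ N) := by
  obtain ⟨μ, hμ, h⟩ := h
  obtain ⟨ν, hν, h'⟩ := h'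
  exact ⟨_, hμ.comp' hν, h.comp h' hN⟩

lemma Realizable.of_smul {M N} (h : Realizable M) (t : ℝ) (ht : t ≠ 0) (hN : ∀ X, M X = t • N X) :
    Realizable N := by
  obtain ⟨μ, hμ, h⟩ := h
  refine ⟨μ, hμ, fun X hX hX' => ?_⟩
  rw [h X hX hX', hN, toPoint_smul _ ht]

lemma realizable_invMat {q : ℍ[ℝ]} (hq : q.re = 0) {r : ℝ} (hr : 0 < r) :
    Realizable (invMat q r) :=
  ⟨_, IsMobius.comp q r _ hq hr IsMobius.id, realizes_invMat q r⟩

lemma isSim_diag {q : ℍ[ℝ]} (hq : q ≠ 0) {t : ℝ} (ht : t ≠ 0) : IsSim (qmat q 0 0 (t • q)) := by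
  refine isSim_qmat (by simp) (by simp) (t * ‖q‖ ^ 2) (by positivity) ?_
  rw [mul_smul_comm, Quaternion.star_mul_self, Quaternion.normSq_eq_norm_mul_self]
  simp [pow_two, coe_mul_eq_smul, smul_comm t]

lemma inv_re {q : ℍ[ℝ]} (hq : q.re = 0) : (q⁻¹).re = 0 := by
  rw [Quaternion.inv_def]; simp [hq]

lemma realizable_affineReflection {q : ℍ[ℝ]} (hq : q.re = 0) (h0 : q ≠ 0) :
    Realizable (qmat q 1 0 (-q)) := by
  have h1 := realizable_invMat (q := 0) (by simp) (r := 1) one_pos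
  have h2 := realizable_invMat hq (r := ‖q‖) (norm_pos_iff.2 h0)
  have s1 := isSim_invMat (q := 0) (by simp) (r := 1) one_pos
  have s2 := isSim_invMat hq (r := ‖q‖) (norm_pos_iff.2 h0)
  refine (h1.comp (h2.comp h1 s1) (s2.comp s1)).of_smul 1 one_ne_zero fun X => ?_
  simp only [LinearMap.comp_apply, invMat, qmat_apply, mul_self_of_re hq, one_smul]
  ext1 <;> simp

lemma realizable_translation {v : ℍ[ℝ]} (hv : v.re = 0) : Realizable (qmat 1 v 0 1) := by
  by_cases h0 : v = 0
  · refine ⟨id, IsMobius.id, fun X _ _ => ?_⟩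
    simp [h0, qmat_apply]
  have h1 := realizable_affineReflection (q := v⁻¹) (inv_re hv) (inv_ne_zero h0)
  have h2 := realizable_affineReflection (q := (1 / 2 : ℝ) • v⁻¹) (by simp [inv_re hv])
    (by simp [h0])
  have hs : IsSim (qmat ((1 / 2 : ℝ) • v⁻¹) 1 0 (-((1 / 2 : ℝ) • v⁻¹))) := by
    refine isSim_qmat (by simp) (by simp [star_eq_neg_of_re (inv_re hv)])
      (-(1 / 4 * ‖v⁻¹‖ ^ 2)) ?_ ?_
    · have : 0 < ‖v⁻¹‖ := norm_pos_iff.2 (inv_ne_zero h0)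
      exact neg_ne_zero.2 (by positivity)
    · have := mul_self_of_re (inv_re hv)
      have e : star ((1 / 2 : ℝ) • v⁻¹) = -((1 / 2 : ℝ) • v⁻¹) :=
        star_eq_neg_of_re (by simp [inv_re hv])
      rw [e, neg_mul_neg, smul_mul_smul_comm, this, star_zero, zero_mul, add_zero,
        ← Quaternion.coe_smul]
      congr 1
      rw [smul_eq_mul]; ring
  refine (h1.comp h2 hs).of_smul (-(1 / 2 * ‖v⁻¹‖ ^ 2)) ?_ fun X => ?_
  · have : 0 < ‖v⁻¹‖ := norm_pos_iff.2 (inv_ne_zero h0)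
    exact neg_ne_zero.2 (by positivity)
  · have h3 := mul_self_of_re (inv_re hv)
    have h4 : ∀ Y : ℍ[ℝ], v⁻¹ * (v⁻¹ * Y) = (-‖v⁻¹‖ ^ 2) • Y := fun Y => by
      rw [← mul_assoc, h3, coe_mul_eq_smul]
    have h5 : (-‖v⁻¹‖ ^ 2) • v = v⁻¹ := by
      rw [← h4 v, inv_mul_cancel₀ h0, mul_one]
    simp only [LinearMap.comp_apply, qmat_apply]
    ext1
    · simp only [one_mul, zero_mul, zero_add, Prod.smul_fst, smul_add, mul_add, smul_mul_assoc,
        mul_smul_comm, h4, neg_mul]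
      conv_rhs => rw [← smul_mul_assoc, show (-(1 / 2 * ‖v⁻¹‖ ^ 2)) • v = (1 / 2 : ℝ) • v⁻¹ by
        conv_rhs => rw [← h5]
        rw [smul_smul]; congr 1; ring]
      rw [smul_smul, smul_mul_assoc, show (1 / 2 * -‖v⁻¹‖ ^ 2) = (-(1 / 2 * ‖v⁻¹‖ ^ 2)) by ring,
        add_assoc]
      congr 1
      module
    · simp only [one_mul, zero_mul, zero_add, Prod.smul_snd, smul_mul_assoc,
        mul_smul_comm, h4, neg_mul, mul_neg]
      module

lemma realizable_reflection {q : ℍ[ℝ]} (hq : q.re = 0) (h0 : q ≠ 0) :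
    Realizable (qmat q 0 0 (-q)) := by
  have h1 := realizable_affineReflection hq h0
  have hs : IsSim (qmat q 1 0 (-q)) := by
    refine isSim_qmat (by simp) (by simp [star_eq_neg_of_re hq]) (-‖q‖ ^ 2) (by
      have := norm_pos_iff.2 h0
      simp [h0]) ?_
    rw [star_eq_neg_of_re hq, neg_mul_neg, mul_self_of_re hq]; simp
  refine ((realizable_translation (v := q⁻¹) (inv_re hq)).comp h1 hs).of_smul 1 one_ne_zero
    fun X => ?_
  simp [LinearMap.comp_apply, qmat_apply, h0]

lemma isSim_reflection {q : ℍ[ℝ]} (h0 : q ≠ 0) : IsSim (qmat q 0 0 (-q)) := by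
  have := isSim_diag h0 (t := -1) (by norm_num)
  simpa using this

lemma exists_orthogonal_factor (a : ℍ[ℝ]) :
    ∃ q : ℍ[ℝ], q.re = 0 ∧ q ≠ 0 ∧ (q * a).re = 0 := by
  by_cases h : a.imI = 0 ∧ a.imJ = 0
  · exact ⟨quat 0 1 0 0, rfl, fun h' => by simpa using congrArg (fun q : ℍ[ℝ] => q.imI) h',
      by simp [h.1]⟩
  · refine ⟨quat 0 a.imJ (-a.imI) 0, rfl, fun h' => h ⟨?_, ?_⟩, by simp; ring⟩
    · simpa using congrArg (fun q : ℍ[ℝ] => q.imJ) h'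
    · simpa using congrArg (fun q : ℍ[ℝ] => q.imI) h'

lemma realizable_rotation {a : ℍ[ℝ]} (ha : a ≠ 0) : Realizable (qmat a 0 0 a) := by
  obtain ⟨q, hq, h0, hqa⟩ := exists_orthogonal_factor a
  have h1 := realizable_reflection hq h0
  have h2 := realizable_reflection hqa (mul_ne_zero h0 ha)
  refine (h1.comp h2 (isSim_reflection (mul_ne_zero h0 ha))).of_smul (-‖q‖ ^ 2) (by simp [h0])
    fun X => ?_
  have h3 : ∀ Y : ℍ[ℝ], q * (q * Y) = (-‖q‖ ^ 2) • Y := fun Y => by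
    rw [← mul_assoc, mul_self_of_re hq, coe_mul_eq_smul]
  simp only [LinearMap.comp_apply, qmat_apply]
  ext1 <;> simp [mul_assoc, h3]

lemma realizable_neg : Realizable (qmat 1 0 0 (-1)) := by
  have hi : (quat 0 1 0 0) ≠ 0 := fun h => by simpa using congrArg (fun q : ℍ[ℝ] => q.imI) h
  have h1 := realizable_reflection (q := quat 0 1 0 0) rfl hi
  have h2 := realizable_rotation hi
  refine (h1.comp h2 (by simpa using isSim_diag hi one_ne_zero)).of_smul (-1) (by norm_num)
    fun X => ?_
  have h3 : ∀ Y : ℍ[ℝ], quat 0 1 0 0 * (quat 0 1 0 0 * Y) = - Y := fun Y => by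
    rw [← mul_assoc]
    have : quat 0 1 0 0 * quat 0 1 0 0 = -1 := by ext <;> simp
    rw [this]; simp
  simp only [LinearMap.comp_apply, qmat_apply]
  ext1 <;> simp [h3]

lemma realizable_diag {a : ℍ[ℝ]} (ha : a ≠ 0) {t : ℝ} (ht : t ≠ 0) :
    Realizable (qmat a 0 0 (t • a)) := by
  have h1 := realizable_invMat (q := 0) (by simp) (r := 1) one_pos
  have s1 := isSim_invMat (q := 0) (by simp) (r := 1) one_pos
  have hpos : ∀ t : ℝ, 0 < t → Realizable (qmat a 0 0 (t • a)) := by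
    intro t ht
    have hr : 0 < 1 / √t := by positivity
    have h2 := realizable_invMat (q := 0) (by simp) hr
    have s2 := isSim_invMat (q := 0) (by simp) hr
    refine ((realizable_rotation ha).comp (h2.comp h1 s1) (s2.comp s1)).of_smul (-1 / t)
      (by positivity) fun X => ?_
    simp only [LinearMap.comp_apply, invMat, qmat_apply]
    ext1
    · simp [sq_sqrt ht.le, neg_div]
      rw [← Quaternion.coe_inv, coe_mul_eq_smul, mul_smul_comm]
    · simp [smul_smul, neg_div, ht.ne']
  rcases lt_or_gt_of_ne ht with h | h
  · have h2 := hpos (-t) (by linarith)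
    refine (h2.comp realizable_neg (by simpa using isSim_reflection one_ne_zero)).of_smul 1
      one_ne_zero fun X => ?_
    simp only [LinearMap.comp_apply, qmat_apply]
    ext1 <;> simp
  · exact hpos t h

lemma realizable_of_lower_eq_zero {a b d : ℍ[ℝ]} (h : IsSim (qmat a b 0 d)) :
    Realizable (qmat a b 0 d) := by
  obtain ⟨r, hr, hf⟩ := h.map_form
  have h1 := hf (1, 0) (0, 1)
  have h2 := hf (0, 1) (0, 1)
  simp only [form, qmat_apply, mul_one, mul_zero, add_zero, zero_add, star_zero, zero_mul, star_one,
    smul_zero] at h1 h2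
  have ha : a ≠ 0 := by
    rintro rfl
    apply hr
    have := congrArg (fun q : ℍ[ℝ] => q.re) h1
    simpa using this.symm
  have hn : ‖a‖ ≠ 0 := norm_ne_zero_iff.2 ha
  have hd : d = (r / ‖a‖ ^ 2) • a := by
    have h3 : a * (star a * d) = ((‖a‖ ^ 2 : ℝ) : ℍ[ℝ]) * d := by
      rw [← mul_assoc, Quaternion.self_mul_star, Quaternion.normSq_eq_norm_mul_self, pow_two]
    rw [h1, mul_smul_comm, mul_one, coe_mul_eq_smul] at h3
    rw [div_eq_inv_mul, mul_smul, h3, smul_smul, inv_mul_cancel₀ (by positivity), one_smul]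
  have hd0 : d ≠ 0 := by
    rw [hd]; simp [hr, ha]
  have hv : (b * d⁻¹).re = 0 := (form_self_eq_zero_iff (b, d) hd0).1 h2
  have ht : r / ‖a‖ ^ 2 ≠ 0 := by positivity
  refine ((realizable_translation hv).comp (realizable_diag ha ht) (isSim_diag ha ht)).of_smul 1
    one_ne_zero fun X => ?_
  simp only [LinearMap.comp_apply, qmat_apply]
  rw [← hd]
  ext1
  · simp [mul_assoc, hd0]
  · simp

lemma IsSim.realizable {M} (hM : IsSim M) : Realizable M := by
  obtain ⟨a, b, c, d, rfl⟩ : ∃ a b c d, M = qmat a b c d := ⟨_, _, _, _, hM.eq_qmat⟩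
  by_cases hc : c = 0
  · subst hc; exact realizable_of_lower_eq_zero hM
  · have hq : (a * c⁻¹).re = 0 := by
      refine (form_self_eq_zero_iff (a, c) hc).1 ?_
      have h1 : form (1, 0) (1, 0) = 0 := by simp [form]
      have h2 := (hM.isotropic_iff (1, 0)).2 h1
      simpa [qmat_apply] using h2
    set q := a * c⁻¹ with hqd
    have hqc : q * c = a := by rw [hqd, mul_assoc, inv_mul_cancel₀ hc, mul_one]
    have s1 := isSim_invMat hq (r := 1) one_pos
    have s2 := s1.comp hM
    have h3 : invMat q 1 ∘ₗ qmat a b c d = qmat (-c) (q * b + (-(q * q) - 1) * d) 0 (b - q * d) := by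
      refine LinearMap.ext fun X => ?_
      simp only [LinearMap.comp_apply, invMat, qmat_apply, ← hqc]
      ext1 <;> (simp; noncomm_ring)
    have h4 := realizable_of_lower_eq_zero (h3 ▸ s2)
    rw [← h3] at h4
    refine ((realizable_invMat hq one_pos).comp h4 s2).of_smul (-1) (by norm_num) fun X => ?_
    simp only [LinearMap.comp_apply, invMat, qmat_apply]
    ext1 <;> (simp; noncomm_ring)

/-! ### Equivalence of systems in algebraic form -/

variable {n : ℕ}

/-- The right multiplication by a quaternion as a linear map. -/
noncomputable def rmulL (h : ℍ[ℝ]) : ℍ² →ₗ[ℝ] ℍ² where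
  toFun X := rmul X h
  map_add' X Y := rmul_add_left X Y h
  map_smul' c X := rmul_smul_left c X h

/-- The substitution of parameters: a permutation and projective transformations. -/
noncomputable def subst (σ : Equiv.Perm (Fin n)) (g : Fin n → GL (Fin 2) ℝ)
    (x : Fin n → Fin 2 → ℝ) : Fin n → Fin 2 → ℝ := fun i => (g i).1.mulVec (x (σ i))

/-- The system obtained from `D` by a linear map on the left, substitution of parameters,
and right multiplication by a quaternion. -/
noncomputable def act (M : ℍ² →ₗ[ℝ] ℍ²) (σ : Equiv.Perm (Fin n))
    (g : Fin n → GL (Fin 2) ℝ) (h : ℍ[ℝ]) (D : QMap n) : QMap n :=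
  (rmulL h ∘ₗ M).compMultilinearMap
    ((D.compLinearMap fun i => Matrix.mulVecLin (g i).1).domDomCongr σ)

lemma act_apply (M σ g h) (D : QMap n) (x) :
    act M σ g h D x = rmul (M (D (subst σ g x))) h := rfl

/-- Algebraic equivalence of systems. -/
def Rel (D D' : QMap n) : Prop :=
  ∃ M, IsSim M ∧ ∃ (σ : Equiv.Perm (Fin n)) (g : Fin n → GL (Fin 2) ℝ) (h : ℍ[ℝ]), h ≠ 0 ∧
    D' = act M σ g h D

lemma rel_act {M} (hM : IsSim M) (σ) (g) {h} (hh : h ≠ 0) (D : QMap n) : Rel D (act M σ g h D) :=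
  ⟨M, hM, σ, g, h, hh, rfl⟩

lemma mulVec_inv_mulVec (g : GL (Fin 2) ℝ) (v : Fin 2 → ℝ) :
    (g⁻¹).1.mulVec (g.1.mulVec v) = v := by
  rw [Matrix.mulVec_mulVec, ← Units.val_mul, inv_mul_cancel]; simp

lemma mulVec_mulVec_inv (g : GL (Fin 2) ℝ) (v : Fin 2 → ℝ) :
    g.1.mulVec ((g⁻¹).1.mulVec v) = v := by
  rw [Matrix.mulVec_mulVec, ← Units.val_mul, mul_inv_cancel]; simp

lemma mulVec_ne_zero_iff (g : GL (Fin 2) ℝ) (v : Fin 2 → ℝ) : g.1.mulVec v ≠ 0 ↔ v ≠ 0 := by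
  refine not_congr ⟨fun h => ?_, fun h => by rw [h, Matrix.mulVec_zero]⟩
  rw [← mulVec_inv_mulVec g v, h, Matrix.mulVec_zero]

lemma subst_subst (σ τ : Equiv.Perm (Fin n)) (g k : Fin n → GL (Fin 2) ℝ) (x) :
    subst σ g (subst τ k x) = subst (σ.trans τ) (fun i => g i * k (σ i)) x := by
  funext i
  simp only [subst, Matrix.mulVec_mulVec, Units.val_mul, Equiv.trans_apply]

lemma subst_one (x : Fin n → Fin 2 → ℝ) : subst 1 1 x = x := by
  funext i; simp [subst]

lemma exists_subst_inverse (σ : Equiv.Perm (Fin n)) (g : Fin n → GL (Fin 2) ℝ) :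
    ∃ τ k, (∀ x, subst σ g (subst τ k x) = x) ∧ ∀ x, subst τ k (subst σ g x) = x := by
  refine ⟨σ.symm, fun i => (g (σ.symm i))⁻¹, fun x => ?_, fun x => ?_⟩
  · funext i
    simp only [subst, Equiv.symm_apply_apply]
    exact mulVec_mulVec_inv _ _
  · funext i
    simp only [subst, Equiv.apply_symm_apply]
    exact mulVec_inv_mulVec _ _

lemma subst_ne_zero_iff (σ : Equiv.Perm (Fin n)) (g : Fin n → GL (Fin 2) ℝ) (x) :
    (∀ i, subst σ g x i ≠ 0) ↔ ∀ i, x i ≠ 0 := by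
  simp only [subst, mulVec_ne_zero_iff]
  exact ⟨fun h i => by simpa using h (σ.symm i), fun h i => h _⟩

lemma Rel.refl (D : QMap n) : Rel D D :=
  ⟨LinearMap.id, isSim_id, 1, 1, 1, one_ne_zero, by
    refine MultilinearMap.ext fun x => ?_
    simp only [act_apply, rmul_one, subst_one, LinearMap.id_coe, id_eq]⟩

lemma Rel.symm {D D' : QMap n} (h : Rel D D') : Rel D' D := by
  obtain ⟨M, hM, σ, g, h, hh, rfl⟩ := h
  obtain ⟨N, hN, h1, h2⟩ := hM.exists_inverse
  obtain ⟨τ, k, h3, h4⟩ := exists_subst_inverse σ g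
  refine ⟨N, hN, τ, k, h⁻¹, inv_ne_zero hh, MultilinearMap.ext fun x => ?_⟩
  rw [act_apply, act_apply, h3, hN.map_rmul, h1, rmul_rmul, mul_inv_cancel₀ hh, rmul_one]

lemma Rel.trans {D D' D'' : QMap n} (h : Rel D D') (h' : Rel D' D'') : Rel D D'' := by
  obtain ⟨M, hM, σ, g, h, hh, rfl⟩ := h
  obtain ⟨N, hN, τ, k, h', hh', rfl⟩ := h'
  refine ⟨N ∘ₗ M, hN.comp hM, σ.trans τ, fun i => g i * k (σ i), h * h', mul_ne_zero hh hh',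
    MultilinearMap.ext fun x => ?_⟩
  rw [act_apply, act_apply, act_apply, subst_subst, hN.map_rmul, rmul_rmul]; rfl

lemma defined_act {M} (hM : IsSim M) (σ g) {h} (hh : h ≠ 0) (D : QMap n) (x) :
    Defined (act M σ g h D) x ↔ Defined D (subst σ g x) := by
  unfold Defined
  rw [subst_ne_zero_iff, act_apply, Ne, rmul_eq_zero hh, hM.map_eq_zero]

lemma val_act {M μ} (hM : IsSim M) (hμ : Realizes μ M) (σ g) {h} (hh : h ≠ 0) {D : QMap n}
    (hD : Isotropic D) {x} (hx : Defined (act M σ g h D) x) :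
    val (act M σ g h D) x = μ (val D (subst σ g x)) := by
  rw [val_eq_toPoint, val_eq_toPoint, act_apply, toPoint_rmul _ hh,
    hμ _ ((defined_act hM σ g hh D x).1 hx).2 (hD _)]

lemma Rel.mobiusEquiv {D D' : QMap n} (hD : Isotropic D) (h : Rel D D') : MobiusEquiv D D' := by
  obtain ⟨M, hM, σ, g, h, hh, rfl⟩ := h
  obtain ⟨μ, hμ, hr⟩ := hM.realizable
  exact ⟨μ, hμ, σ, g, fun x _ => ⟨defined_act hM σ g hh D x, val_act hM hr σ g hh hD⟩⟩

lemma subst_update (σ : Equiv.Perm (Fin n)) (g : Fin n → GL (Fin 2) ℝ) (x i v) :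
    subst σ g (update x i v) = update (subst σ g x) (σ.symm i) ((g (σ.symm i)).1.mulVec v) := by
  funext j
  by_cases hj : j = σ.symm i
  · subst hj; simp [subst]
  · have : σ j ≠ i := fun h => hj (by rw [← h, Equiv.symm_apply_apply])
    simp [subst, hj, this]

lemma isotropic_act {M} (hM : IsSim M) (σ g h) {D : QMap n} (hD : Isotropic D) :
    Isotropic (act M σ g h D) := by
  intro x
  rw [act_apply, form_rmul, (hM.isotropic_iff _).2 (hD _)]; simp

lemma omega_act {M} (hM : IsSim M) (σ : Equiv.Perm (Fin n)) (g h) {D : QMap n}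
    (hD : Isotropic D) :
    ∃ r : ℝ, r ≠ 0 ∧ ∀ x i, omega (act M σ g h D) x i =
      (r * (g (σ.symm i)).1.det) • (star h * omega D (subst σ g x) (σ.symm i) * h) := by
  obtain ⟨r, hr, hf⟩ := hM.map_form
  refine ⟨r, hr, fun x i => ?_⟩
  rw [omega, act_apply, act_apply, form_rmul, hf, subst_update, subst_update, hD.form_update,
    smul_smul, mul_smul_comm, smul_mul_assoc]
  congr 1
  simp [Matrix.det_fin_two, Matrix.mulVec, Matrix.vecHead, Matrix.vecTail]
  ring_nf
  simp

lemma GL_det_ne_zero (g : GL (Fin 2) ℝ) : g.1.det ≠ 0 :=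
  ((Matrix.isUnit_iff_isUnit_det _).1 g.isUnit).ne_zero

lemma omega_act_eq_zero_iff {M} (hM : IsSim M) (σ : Equiv.Perm (Fin n)) (g) {h} (hh : h ≠ 0)
    {D : QMap n} (hD : Isotropic D) (x i) :
    omega (act M σ g h D) x i = 0 ↔ omega D (subst σ g x) (σ.symm i) = 0 := by
  obtain ⟨r, hr, h1⟩ := omega_act hM σ g h hD
  rw [h1]
  simp [hr, GL_det_ne_zero, hh]

lemma algDC_act {M} (hM : IsSim M) (σ : Equiv.Perm (Fin n)) (g) {h} (hh : h ≠ 0)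
    {D : QMap n} (hD : AlgDC D) : AlgDC (act M σ g h D) := by
  refine ⟨isotropic_act hM σ g h hD.isotropic, fun x i j hij => ?_, ?_⟩
  · obtain ⟨r, hr, h1⟩ := omega_act hM σ g h hD.isotropic
    rw [h1, h1, inner_smul_left, inner_smul_right, inner_conj,
      hD.orthogonal _ _ _ (σ.symm.injective.ne hij)]
    simp
  · obtain ⟨y, hy, h1⟩ := hD.nondegenerate
    obtain ⟨τ, k, h3, h4⟩ := exists_subst_inverse σ g
    refine ⟨subst τ k y, (defined_act hM σ g hh D _).2 (by rwa [h3]), fun i => ?_⟩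
    rw [Ne, omega_act_eq_zero_iff hM σ g hh hD.isotropic, h3]
    exact h1 _

lemma Rel.algDC {D D' : QMap n} (h : Rel D D') (hD : AlgDC D) : AlgDC D' := by
  obtain ⟨M, hM, σ, g, h, hh, rfl⟩ := h
  exact algDC_act hM σ g hh hD

lemma sing_act {M μ} (hM : IsSim M) (hμ : Realizes μ M) (σ : Equiv.Perm (Fin n)) (g) {h}
    (hh : h ≠ 0) {D : QMap n} (hD : AlgDC D) : sing (act M σ g h D) = μ '' sing D := by
  rw [hD.sing_eq, (algDC_act hM σ g hh hD).sing_eq]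
  obtain ⟨τ, k, h3, h4⟩ := exists_subst_inverse σ g
  ext p
  constructor
  · rintro ⟨x, ⟨hx, i, hi⟩, rfl⟩
    refine ⟨_, ⟨subst σ g x, ⟨(defined_act hM σ g hh D x).1 hx, _,
      (omega_act_eq_zero_iff hM σ g hh hD.isotropic x i).1 hi⟩, rfl⟩, ?_⟩
    rw [val_act hM hμ σ g hh hD.isotropic hx]
  · rintro ⟨_, ⟨y, ⟨hy, i, hi⟩, rfl⟩, rfl⟩
    have hx : Defined (act M σ g h D) (subst τ k y) := (defined_act hM σ g hh D _).2 (by rwa [h3])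
    refine ⟨subst τ k y, ⟨hx, σ i, ?_⟩, ?_⟩
    · rw [omega_act_eq_zero_iff hM σ g hh hD.isotropic, h3]; simpa using hi
    · rw [val_act hM hμ σ g hh hD.isotropic hx, h3]

/-! ### Rigidity: Möbius equivalence implies algebraic equivalence -/

lemma continuous_comp_add_smul (D : QMap n) (x y : Fin n → Fin 2 → ℝ) :
    Continuous fun δ : ℝ => D (x + fun i => δ • y i) := by
  simp_rw [D.map_add_univ]
  refine continuous_finsetSum _ fun s _ => ?_
  have : ∀ δ : ℝ, (s.piecewise x fun i => δ • y i) =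
      fun i => (if i ∈ s then 1 else δ) • (s.piecewise x y) i := fun δ => by
    funext i; by_cases hi : i ∈ s <;> simp [hi]
  simp_rw [this, D.map_smul_univ]
  refine Continuous.smul (f := fun δ : ℝ => ∏ i, if i ∈ s then 1 else δ)
    (continuous_finsetProd _ fun i _ => ?_) continuous_const
  have : Continuous fun δ : ℝ => if i ∈ s then (1 : ℝ) else δ := by
    split_ifs <;> fun_prop
  exact this

lemma continuous_form {f g : ℝ → ℍ²} (hf : Continuous f) (hg : Continuous g) :
    Continuous fun t => form (f t) (g t) := by
  unfold form
  fun_prop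

lemma continuous_omega_add_smul (D : QMap n) (x c : Fin n → Fin 2 → ℝ) (i) :
    Continuous fun δ : ℝ => omega D (x + fun j => δ • c j) i := by
  have h1 : ∀ (e : Fin 2 → ℝ) (δ : ℝ), update (x + fun j => δ • c j) i e =
      update x i e + fun j => δ • update c i 0 j := by
    intro e δ
    funext j
    by_cases hj : j = i
    · subst hj; simp
    · simp [hj]
  have h2 : (fun δ : ℝ => omega D (x + fun j => δ • c j) i) = fun δ =>
      form (D (update x i ![1, 0] + fun j => δ • update c i 0 j))
        (D (update x i ![0, 1] + fun j => δ • update c i 0 j)) := by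
    funext δ; rw [omega, h1, h1]
  rw [h2]
  have c1 := continuous_comp_add_smul D (update x i ![1, 0]) (update c i 0)
  have c2 := continuous_comp_add_smul D (update x i ![0, 1]) (update c i 0)
  exact continuous_form c1 c2

/-- There is a grid of parameters at whose vertices the system is regular. -/
lemma AlgDC.exists_grid {D : QMap n} (hD : AlgDC D) :
    ∃ p : Fin n → Bool → Fin 2 → ℝ,
      (∀ i, p i false 0 * p i true 1 - p i false 1 * p i true 0 ≠ 0) ∧
      ∀ (s : Fin n → Bool) i, omega D (fun j => p j (s j)) i ≠ 0 := by
  obtain ⟨x, hx, h⟩ := hD.nondegenerate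
  have key : ∀ (s : Fin n → Bool) (i : Fin n), ∀ᶠ δ : ℝ in nhds 0,
      omega D (x + fun j => δ • (if s j then ![-x j 1, x j 0] else 0)) i ≠ 0 := by
    intro s i
    refine (continuous_omega_add_smul D x _ i).continuousAt.eventually_ne ?_
    have : (x + fun j => (0 : ℝ) • (if s j then ![-x j 1, x j 0] else 0)) = x := by
      funext j; simp
    rw [this]
    exact h i
  have h2 : ∀ᶠ δ : ℝ in nhdsWithin 0 {0}ᶜ, ∀ (s : Fin n → Bool) (i : Fin n),
      omega D (x + fun j => δ • (if s j then ![-x j 1, x j 0] else 0)) i ≠ 0 :=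
    Filter.eventually_all.2 fun s => Filter.eventually_all.2 fun i =>
      (key s i).filter_mono nhdsWithin_le_nhds
  obtain ⟨δ, h3, h4⟩ := (h2.and self_mem_nhdsWithin).exists
  refine ⟨fun i b => x i + δ • (if b then ![-x i 1, x i 0] else 0), fun i => ?_, fun s i => h3 s i⟩
  have := (sq_add_sq_pos (hx.1 i)).ne'
  have h5 : δ ≠ 0 := h4
  simp
  intro h6
  apply mul_ne_zero h5 this
  linarith

lemma bool_fun_induction {Q : (Fin n → Bool) → Prop} (s₀ : Fin n → Bool) (h₀ : Q s₀)
    (h : ∀ s i b, Q s → Q (update s i b)) (s) : Q s := by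
  have : ∀ A : Finset (Fin n), Q (A.piecewise s s₀) := by
    intro A
    induction A using Finset.induction with
    | empty => simpa using h₀
    | insert j A _ ih => rw [Finset.piecewise_insert]; exact h _ _ _ ih
  simpa using this Finset.univ

lemma ext_on_grid {N : Type*} [AddCommGroup N] [Module ℝ N]
    {f g : MultilinearMap ℝ (fun _ : Fin n => Fin 2 → ℝ) N} (p : Fin n → Bool → Fin 2 → ℝ)
    (hp : ∀ i, p i false 0 * p i true 1 - p i false 1 * p i true 0 ≠ 0)
    (h : ∀ s : Fin n → Bool, f (fun j => p j (s j)) = g (fun j => p j (s j))) : f = g := by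
  have hli : ∀ i, LinearIndependent ℝ (p i) := by
    intro i
    have h1 : LinearIndependent ℝ ![p i false, p i true] := by
      rw [LinearIndependent.pair_iff]
      intro a b hab
      have h0 := congrFun hab 0
      have h1 := congrFun hab 1
      simp at h0 h1
      constructor
      · refine (mul_eq_zero.1 ?_).resolve_right (hp i)
        linear_combination (p i true 1) * h0 - (p i true 0) * h1
      · refine (mul_eq_zero.1 ?_).resolve_right (hp i)
        linear_combination (p i false 0) * h1 - (p i false 1) * h0
    have h2 := h1.comp (fun b : Bool => if b then (1 : Fin 2) else 0) (by
      intro a b; cases a <;> cases b <;> simp)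
    convert h2 using 1
    funext b; cases b <;> rfl
  have hb : ∀ i, ∃ b : Module.Basis Bool ℝ (Fin 2 → ℝ), ∀ j, b j = p i j := fun i =>
    ⟨basisOfLinearIndependentOfCardEqFinrank (hli i)
      (by rw [Module.finrank_fin_fun, Fintype.card_bool]),
      fun j => by rw [coe_basisOfLinearIndependentOfCardEqFinrank]⟩
  choose b hb using hb
  refine Module.Basis.ext_multilinear b fun v => ?_
  simp only [hb]
  exact h v

/-- If a line in `ℍ²` is reparametrised by right multiplications at three points, then the factors
agree. -/
lemma rmul_eq_of_three_points {X Y : ℍ²} (hX : form X X = 0) (hY : form Y Y = 0)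
    (hXY : form X Y ≠ 0) {a b c : ℍ[ℝ]} (h : rmul X a + rmul Y b = rmul (X + Y) c) :
    a = c ∧ b = c := by
  have h1 : rmul X (a - c) + rmul Y (b - c) = 0 := by
    rw [rmul_sub_right, rmul_sub_right, sub_add_sub_comm, h, rmul_add_left, sub_self]
  have h2 : form X (rmul X (a - c) + rmul Y (b - c)) = form X Y * (b - c) := by
    have e1 := form_rmul X X 1 (a - c)
    have e2 := form_rmul X Y 1 (b - c)
    rw [rmul_one] at e1 e2
    rw [form_add_right, e1, e2, hX]; simp
  have h3 : form Y (rmul X (a - c) + rmul Y (b - c)) = form Y X * (a - c) := by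
    have e1 := form_rmul Y X 1 (a - c)
    have e2 := form_rmul Y Y 1 (b - c)
    rw [rmul_one] at e1 e2
    rw [form_add_right, e1, e2, hY]; simp
  rw [h1, form_zero_right] at h2 h3
  have hYX : form Y X ≠ 0 := by
    rw [← star_form, Ne, star_eq_zero]; exact hXY
  exact ⟨sub_eq_zero.1 ((mul_eq_zero.1 h3.symm).resolve_left hYX),
    sub_eq_zero.1 ((mul_eq_zero.1 h2.symm).resolve_left hXY)⟩

lemma grid_update (p : Fin n → Bool → Fin 2 → ℝ) (s : Fin n → Bool) (i b) :
    (fun j => p j (update s i b j)) = update (fun j => p j (s j)) i (p i b) := by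
  funext j
  by_cases hj : j = i
  · subst hj; simp
  · simp [hj]

lemma grid_ne_zero {p : Fin n → Bool → Fin 2 → ℝ}
    (hp : ∀ i, p i false 0 * p i true 1 - p i false 1 * p i true 0 ≠ 0) (i b) : p i b ≠ 0 := by
  intro h
  apply hp i
  cases b <;> simp [h]

lemma grid_add_ne_zero {p : Fin n → Bool → Fin 2 → ℝ}
    (hp : ∀ i, p i false 0 * p i true 1 - p i false 1 * p i true 0 ≠ 0) (i) :
    p i false + p i true ≠ 0 := by
  intro h
  apply hp i
  rw [eq_neg_of_add_eq_zero_left h]; simp; ring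

lemma AlgDC.exists_rmul_const {D D' : QMap n} (hD : AlgDC D)
    (h : ∀ x, (∀ i, x i ≠ 0) → ∃ k, k ≠ 0 ∧ D' x = rmul (D x) k) :
    ∃ k, k ≠ 0 ∧ ∀ x, D' x = rmul (D x) k := by
  obtain ⟨p, hp, hom⟩ := hD.exists_grid
  have h1 : ∀ s : Fin n → Bool, ∃ k, k ≠ 0 ∧
      D' (fun j => p j (s j)) = rmul (D fun j => p j (s j)) k :=
    fun s => h _ fun i => grid_ne_zero hp i _
  choose k hk0 hk using h1
  have hedge : ∀ s i, k (update s i false) = k (update s i true) := by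
    intro s i
    obtain ⟨c, _, hc⟩ := h (update (fun j => p j (s j)) i (p i false + p i true)) (by
      intro j
      by_cases hj : j = i
      · subst hj; simpa using grid_add_ne_zero hp j
      · simpa [hj] using grid_ne_zero hp j _)
    have hf := hk (update s i false)
    have ht := hk (update s i true)
    rw [grid_update] at hf ht
    rw [D'.map_update_add, D.map_update_add, hf, ht] at hc
    have hne : form (D (update (fun j => p j (s j)) i (p i false)))
        (D (update (fun j => p j (s j)) i (p i true))) ≠ 0 := by
      rw [hD.isotropic.form_update]
      exact smul_ne_zero (hp i) (hom s i)
    obtain ⟨e1, e2⟩ := rmul_eq_of_three_points (hD.isotropic _) (hD.isotropic _) hne hc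
    rw [e1, e2]
  have hconst : ∀ s, k s = k fun _ => false := by
    refine bool_fun_induction (fun _ => false) rfl fun s i b ih => ?_
    rw [← ih]
    have : k s = k (update s i (s i)) := by rw [update_eq_self]
    rw [this]
    cases b <;> cases s i <;> simp [hedge]
  refine ⟨k fun _ => false, hk0 _, fun x => ?_⟩
  have : D' = (rmulL (k fun _ => false)).compMultilinearMap D := by
    refine ext_on_grid p hp fun s => ?_
    rw [hk, hconst]; rfl
  rw [this]; rfl

lemma MobiusEquiv.rel {D D' : QMap n} (hD : AlgDC D)
    (h : MobiusEquiv D D') : Rel D D' := by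
  obtain ⟨μ, hμ, σ, g, h⟩ := h
  obtain ⟨M, hM, hr⟩ := hμ.exists_sim
  have hE := algDC_act hM σ g one_ne_zero hD
  have : ∀ x, (∀ i, x i ≠ 0) → ∃ k, k ≠ 0 ∧ D' x = rmul (act M σ g 1 D x) k := by
    intro x hx
    obtain ⟨h1, h2⟩ := h x hx
    by_cases hd : Defined D' x
    · have hd' : Defined (act M σ g 1 D) x := (defined_act hM σ g one_ne_zero D x).2 (h1.1 hd)
      have h3 : toPoint (act M σ g 1 D x) = toPoint (D' x) := by
        rw [← val_eq_toPoint, val_act hM hr σ g one_ne_zero hD.isotropic hd', ← val_eq_toPoint,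
          h2 hd]
        rfl
      exact (toPoint_eq_iff hd'.2 hd.2).1 h3
    · refine ⟨1, one_ne_zero, ?_⟩
      have hd' : ¬ Defined (act M σ g 1 D) x := fun h' =>
        hd (h1.2 ((defined_act hM σ g one_ne_zero D x).1 h'))
      have e1 : D' x = 0 := by
        by_contra h'; exact hd ⟨hx, h'⟩
      have e2 : act M σ g 1 D x = 0 := by
        by_contra h'; exact hd' ⟨hx, h'⟩
      rw [e1, e2, rmul_zero_left]
  obtain ⟨k, hk, h3⟩ := hE.exists_rmul_const this
  refine ⟨M, hM, σ, g, k, hk, MultilinearMap.ext fun x => ?_⟩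
  rw [h3, act_apply, act_apply, rmul_rmul, one_mul]

lemma mobiusEquiv_iff_rel {D D' : QMap n} (hD : AlgDC D) :
    MobiusEquiv D D' ↔ Rel D D' :=
  ⟨fun h => h.rel hD, fun h => h.mobiusEquiv hD.isotropic⟩

/-! ### Systems on a plane in complex form -/

variable {n : ℕ}

/-- The embedding of the complex numbers into the quaternions with image `ℝ + ℝ k`. -/
noncomputable def cx (z : ℂ) : ℍ[ℝ] := quat z.re 0 0 z.im

/-- The quaternion `i z`, where `z` is regarded as an element of `ℝ + ℝ k`. -/
noncomputable def icx (z : ℂ) : ℍ[ℝ] := quat 0 z.re (-z.im) 0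

/-- The pair `(i a, b)`, which represents the point `i a b⁻¹` of the plane spanned by `i` and
`j`. -/
noncomputable def emb : ℂ × ℂ →ₗ[ℝ] ℍ² where
  toFun p := (icx p.1, cx p.2)
  map_add' p q := by ext <;> simp [icx, cx]; ring
  map_smul' r p := by ext <;> simp [icx, cx]

/-- The complement of the image of `emb`. -/
noncomputable def emb' : ℂ × ℂ →ₗ[ℝ] ℍ² where
  toFun p := (cx p.2, icx p.1)
  map_add' p q := by ext <;> simp [icx, cx]; ring
  map_smul' r p := by ext <;> simp [icx, cx]

/-- The projection to the image of `emb`. -/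
noncomputable def proj : ℍ² →ₗ[ℝ] ℂ × ℂ where
  toFun X := (⟨X.1.imI, -X.1.imJ⟩, ⟨X.2.re, X.2.imK⟩)
  map_add' p q := by
    refine Prod.ext (Complex.ext ?_ ?_) (Complex.ext ?_ ?_) <;> simp; ring
  map_smul' r p := by
    refine Prod.ext (Complex.ext ?_ ?_) (Complex.ext ?_ ?_) <;> simp

/-- The projection to the image of `emb'`. -/
noncomputable def proj' : ℍ² →ₗ[ℝ] ℂ × ℂ where
  toFun X := (⟨X.2.imI, -X.2.imJ⟩, ⟨X.1.re, X.1.imK⟩)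
  map_add' p q := by
    refine Prod.ext (Complex.ext ?_ ?_) (Complex.ext ?_ ?_) <;> simp; ring
  map_smul' r p := by
    refine Prod.ext (Complex.ext ?_ ?_) (Complex.ext ?_ ?_) <;> simp

lemma emb_apply (p : ℂ × ℂ) : emb p = (icx p.1, cx p.2) := rfl

lemma emb'_apply (p : ℂ × ℂ) : emb' p = (cx p.2, icx p.1) := rfl

lemma proj_emb (p : ℂ × ℂ) : proj (emb p) = p := by
  ext <;> simp [proj, emb, icx, cx]

lemma emb_proj_add (X : ℍ²) : emb (proj X) + emb' (proj' X) = X := by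
  ext <;> simp [proj, proj', emb, emb', icx, cx]

/-- The determinant of two vectors in `ℂ²`. -/
def cdet (p q : ℂ × ℂ) : ℂ := p.1 * q.2 - p.2 * q.1

@[simp] lemma cx_zero : cx 0 = 0 := by ext <;> simp [cx]

@[simp] lemma icx_zero : icx 0 = 0 := by ext <;> simp [icx]

lemma cx_eq_zero {z : ℂ} : cx z = 0 ↔ z = 0 := by
  simp [Quaternion.ext_iff, cx, Complex.ext_iff]

lemma icx_eq_zero {z : ℂ} : icx z = 0 ↔ z = 0 := by
  simp [Quaternion.ext_iff, icx, Complex.ext_iff]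

lemma cx_mul (z w : ℂ) : cx (z * w) = cx z * cx w := by ext <;> simp [cx]

lemma cx_inv {z : ℂ} : cx z⁻¹ = (cx z)⁻¹ := by
  by_cases hz : z = 0
  · simp [hz]
  · refine eq_inv_of_mul_eq_one_left ?_
    rw [← cx_mul, inv_mul_cancel₀ hz]
    ext <;> simp [cx]

lemma emb_smul (z : ℂ) (p : ℂ × ℂ) : emb (z • p) = rmul (emb p) (cx z) := by
  ext <;> simp [emb, rmul, icx, cx] <;> ring

lemma emb'_smul (z : ℂ) (p : ℂ × ℂ) : emb' (z • p) = rmul (emb' p) (cx z) := by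
  ext <;> simp [emb', rmul, icx, cx] <;> ring

lemma emb_eq_zero {p : ℂ × ℂ} : emb p = 0 ↔ p = 0 :=
  ⟨fun h => by rw [← proj_emb p, h, map_zero], fun h => by rw [h, map_zero]⟩

lemma form_emb_emb (p q : ℂ × ℂ) : form (emb p) (emb q) = icx (-cdet p q) := by
  ext <;> simp [form, emb, icx, cx, cdet] <;> ring

lemma form_emb_emb' (p q : ℂ × ℂ) : form (emb p) (emb' q) =
    cx (conj p.1 * q.1 + conj p.2 * q.2) := by
  ext <;> simp [form, emb, emb', icx, cx]; ring

lemma form_emb'_emb' (p q : ℂ × ℂ) : form (emb' p) (emb' q) = icx (-cdet p q) := by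
  ext <;> simp [form, emb', icx, cx, cdet] <;> ring

lemma isotropic_emb (p : ℂ × ℂ) : form (emb p) (emb p) = 0 := by
  rw [form_emb_emb]; simp [cdet, mul_comm]

lemma inner_icx (z w : ℂ) : inner ℝ (icx z) (icx w) = (conj z * w).re := by
  rw [inner_def]; simp [icx]

/-- The plane spanned by `i` and `j`. -/
noncomputable def basePlane : Set (OnePoint ℍ[ℝ]) := plane (quat 0 0 0 1) 0

lemma coe_mem_plane {ν : ℍ[ℝ]} {d : ℝ} {p : ℍ[ℝ]} :
    (p : OnePoint ℍ[ℝ]) ∈ plane ν d ↔ p.re = 0 ∧ inner ℝ ν p = d := by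
  simp [plane]

lemma infty_mem_plane {ν : ℍ[ℝ]} {d : ℝ} : ∞ ∈ plane ν d := by simp [plane]

lemma coe_mem_basePlane {p : ℍ[ℝ]} : (p : OnePoint ℍ[ℝ]) ∈ basePlane ↔ p.re = 0 ∧ p.imK = 0 := by
  rw [basePlane, coe_mem_plane, inner_def]; simp

lemma exists_emb_of_mem_basePlane {X : ℍ²} (hX : X ≠ 0) (h : toPoint X ∈ basePlane) :
    ∃ p k, k ≠ 0 ∧ X = rmul (emb p) k := by
  by_cases h2 : X.2 = 0
  · have h1 : X.1 ≠ 0 := fun h' => hX (Prod.ext h' h2)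
    have hi : icx 1 ≠ 0 := by rw [Ne, icx_eq_zero]; simp
    refine ⟨(1, 0), (icx 1)⁻¹ * X.1, mul_ne_zero (inv_ne_zero hi) h1, ?_⟩
    ext1
    · simp [rmul, emb_apply, hi]
    · simp [rmul, emb_apply, h2]
  · simp only [toPoint, h2, if_false, coe_mem_basePlane] at h
    refine ⟨(⟨(X.1 * X.2⁻¹).imI, -(X.1 * X.2⁻¹).imJ⟩, 1), X.2, h2, ?_⟩
    have h3 : icx ⟨(X.1 * X.2⁻¹).imI, -(X.1 * X.2⁻¹).imJ⟩ = X.1 * X.2⁻¹ := by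
      obtain ⟨h4, h5⟩ := h
      ext
      · rw [h4]; simp [icx]
      · simp only [icx, quat_imI]
      · simp only [icx, quat_imJ, neg_neg]
      · rw [h5]; simp [icx]
    have h4 : cx 1 = 1 := by ext <;> simp [cx]
    ext1
    · simp only [rmul, emb_apply, h3]
      rw [mul_assoc, inv_mul_cancel₀ h2, mul_one]
    · simp only [rmul, emb_apply, h4, one_mul]

lemma toPoint_emb_mem (p : ℂ × ℂ) : toPoint (emb p) ∈ basePlane := by
  unfold toPoint
  split_ifs with h
  · exact infty_mem_plane
  · rw [coe_mem_basePlane]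
    simp only [emb_apply] at h ⊢
    rw [← cx_inv]
    constructor <;> simp [icx, cx]

lemma rmul_add_rmul_eq_zero {X Y : ℍ²} (hX : form X X = 0) (hY : form Y Y = 0)
    (hXY : form X Y ≠ 0) {a b : ℍ[ℝ]} (h : rmul X a + rmul Y b = 0) : a = 0 ∧ b = 0 := by
  have := rmul_eq_of_three_points hX hY hXY (a := a) (b := b) (c := 0) (by rw [h, rmul_zero_right])
  exact this

lemma exists_coords {p q : ℂ × ℂ} (h : cdet p q ≠ 0) (r : ℂ × ℂ) :
    ∃ z w : ℂ, r = z • p + w • q := by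
  refine ⟨cdet r q / cdet p q, cdet p r / cdet p q, ?_⟩
  ext1 <;> (simp; field_simp; simp [cdet]; ring)

/-- Bilinear maps to `ℂ²`. -/
abbrev TMap (n : ℕ) : Type := MultilinearMap ℝ (fun _ : Fin n => Fin 2 → ℝ) (ℂ × ℂ)

/-- A regular system on the plane has the form `(i a, b) k` with complex `a`, `b`. -/
lemma AlgDC.exists_complex {P : QMap n} (hP : AlgDC P)
    (h : ∀ x, Defined P x → val P x ∈ basePlane) :
    ∃ (T : TMap n) (k : ℍ[ℝ]), k ≠ 0 ∧ ∀ x, P x = rmul (emb (T x)) k := by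
  obtain ⟨p, hp, hom⟩ := hP.exists_grid
  have h1 : ∀ x, (∀ i, x i ≠ 0) → ∃ a k, k ≠ 0 ∧ P x = rmul (emb a) k := by
    intro x hx
    by_cases h0 : P x = 0
    · exact ⟨0, 1, one_ne_zero, by simp [h0]⟩
    · exact exists_emb_of_mem_basePlane h0 (h x ⟨hx, h0⟩)
  choose a k hk0 hk using fun s : Fin n → Bool =>
    h1 (fun j => p j (s j)) fun i => grid_ne_zero hp i _
  have hedge : ∀ s i, ∃ z, k (update s i false) = cx z * k (update s i true) := by
    intro s i
    obtain ⟨c, l, hl, hc⟩ := h1 (update (fun j => p j (s j)) i (p i false + p i true)) (by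
      intro j
      by_cases hj : j = i
      · subst hj; simpa using grid_add_ne_zero hp j
      · simpa [hj] using grid_ne_zero hp j _)
    have hne : form (P (update (fun j => p j (s j)) i (p i false)))
        (P (update (fun j => p j (s j)) i (p i true))) ≠ 0 := by
      rw [hP.isotropic.form_update]
      exact smul_ne_zero (hp i) (hom s i)
    have hf := hk (update s i false)
    have ht := hk (update s i true)
    rw [grid_update] at hf ht
    rw [hf, ht, form_rmul] at hne
    have hne' : form (emb (a (update s i false))) (emb (a (update s i true))) ≠ 0 := by
      intro h'; rw [h'] at hne; simp at hne
    have hd : cdet (a (update s i false)) (a (update s i true)) ≠ 0 := by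
      intro h'; apply hne'; rw [form_emb_emb, h']; simp
    obtain ⟨z, w, hzw⟩ := exists_coords hd c
    rw [P.map_update_add, hf, ht, hzw, map_add, emb_smul, emb_smul, rmul_add_left, rmul_rmul,
      rmul_rmul, ← sub_eq_zero, add_sub_add_comm, ← rmul_sub_right, ← rmul_sub_right] at hc
    obtain ⟨e1, e2⟩ := rmul_add_rmul_eq_zero (isotropic_emb _) (isotropic_emb _) hne' hc
    rw [sub_eq_zero] at e1 e2
    have hw : w ≠ 0 := by
      rintro rfl
      rw [cx_zero, zero_mul] at e2
      exact hk0 _ e2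
    refine ⟨z * w⁻¹, ?_⟩
    have hw' : cx w ≠ 0 := by rwa [Ne, cx_eq_zero]
    rw [e1, e2, cx_mul, cx_inv, mul_assoc, ← mul_assoc _ (cx w), inv_mul_cancel₀ hw', one_mul]
  have hedge' : ∀ s i, ∃ z, k (update s i true) = cx z * k (update s i false) := by
    intro s i
    obtain ⟨z, hz⟩ := hedge s i
    have hz0 : cx z ≠ 0 := by
      intro h'; rw [h', zero_mul] at hz; exact hk0 _ hz
    exact ⟨z⁻¹, by rw [hz, cx_inv, ← mul_assoc, inv_mul_cancel₀ hz0, one_mul]⟩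
  have hone : cx 1 = 1 := by ext <;> simp [cx]
  set k₀ := k fun _ => false with hk₀
  have hconst : ∀ s, ∃ z, k s = cx z * k₀ := by
    refine bool_fun_induction (fun _ => false) ⟨1, by rw [hone, one_mul]⟩ fun s i b ih => ?_
    obtain ⟨z, hz⟩ := ih
    have h2 : k s = k (update s i (s i)) := by rw [update_eq_self]
    have h3 : ∃ w, k (update s i b) = cx w * k s := by
      rw [h2]
      cases b <;> cases s i
      · exact ⟨1, by rw [hone, one_mul]⟩
      · exact hedge s i
      · exact hedge' s i
      · exact ⟨1, by rw [hone, one_mul]⟩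
    obtain ⟨w, hw⟩ := h3
    exact ⟨w * z, by rw [hw, hz, cx_mul, mul_assoc]⟩
  choose z hz using hconst
  have hk₀0 : k₀ ≠ 0 := hk0 _
  have h4 : (rmulL k₀⁻¹).compMultilinearMap P =
      (emb ∘ₗ proj ∘ₗ rmulL k₀⁻¹).compMultilinearMap P := by
    refine ext_on_grid p hp fun s => ?_
    have : rmulL k₀⁻¹ (P fun j => p j (s j)) = emb (z s • a s) := by
      change rmul _ _ = _
      rw [hk, rmul_rmul, hz, mul_assoc, mul_inv_cancel₀ hk₀0, mul_one, emb_smul]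
    simp only [LinearMap.compMultilinearMap_apply, LinearMap.comp_apply, this, proj_emb]
  refine ⟨(proj ∘ₗ rmulL k₀⁻¹).compMultilinearMap P, k₀, hk₀0, fun x => ?_⟩
  have h5 := congrArg (fun F => rmul (F x) k₀) h4
  simp only [LinearMap.compMultilinearMap_apply, LinearMap.comp_apply] at h5 ⊢
  rw [← h5]
  change _ = rmul (rmul _ _) _
  rw [rmul_rmul, inv_mul_cancel₀ hk₀0, rmul_one]

/-! ### Classification of orthogonal bilinear maps to `ℂ²` -/

/-- The multiplication by a complex matrix. -/
noncomputable def cmat (a b c d : ℂ) : ℂ × ℂ →ₗ[ℝ] ℂ × ℂ where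
  toFun p := (a * p.1 + b * p.2, c * p.1 + d * p.2)
  map_add' p q := by ext1 <;> simp <;> ring
  map_smul' r p := by ext1 <;> simp <;> ring

lemma cmat_apply (a b c d : ℂ) (p) : cmat a b c d p = (a * p.1 + b * p.2, c * p.1 + d * p.2) := rfl

/-- The polar coordinates in complex form. -/
noncomputable def polarT : TMap 2 := proj.compMultilinearMap polar

/-- The Cartesian coordinates in complex form. -/
noncomputable def cartT : TMap 2 := proj.compMultilinearMap cartesian

lemma polarT_apply (x) : polarT x =
    (x 0 1 * (x 1 0 - I * x 1 1), x 0 0 * (x 1 0 + I * x 1 1)) := by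
  refine Prod.ext (Complex.ext ?_ ?_) (Complex.ext ?_ ?_) <;> simp [polarT, proj, polar]

lemma cartT_apply (x) : cartT x =
    ((x 0 1 : ℂ) * x 1 0 - I * (x 0 0 * x 1 1), (x 0 0 : ℂ) * x 1 0) := by
  refine Prod.ext (Complex.ext ?_ ?_) (Complex.ext ?_ ?_) <;> simp [cartT, proj, cartesian]

lemma emb_polarT (x) : emb (polarT x) = polar x := by
  ext <;> simp [polarT, emb, proj, polar, icx, cx]

lemma emb_cartT (x) : emb (cartT x) = cartesian x := by
  ext <;> simp [cartT, emb, proj, cartesian, icx, cx]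

/-- The map `T` is obtained from `T₀` by a complex matrix and substitution of parameters. -/
def TEquiv (T₀ T : TMap 2) : Prop :=
  ∃ (σ : Equiv.Perm (Fin 2)) (g : Fin 2 → GL (Fin 2) ℝ) (a b c d : ℂ), a * d - b * c ≠ 0 ∧
    ∀ x, T x = cmat a b c d (T₀ (subst σ g x))

lemma TEquiv.of_subst {T₀ T T' : TMap 2} (σ g) (h : TEquiv T₀ T')
    (hT : ∀ x, T (subst σ g x) = T' x) : TEquiv T₀ T := by
  obtain ⟨τ, k, a, b, c, d, hd, h⟩ := h
  obtain ⟨σ', g', h1, h2⟩ := exists_subst_inverse σ g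
  refine ⟨τ.trans σ', fun i => k i * g' (τ i), a, b, c, d, hd, fun x => ?_⟩
  rw [← subst_subst, ← h, ← hT, h1]

section bilinear

variable {N : Type*} [AddCommGroup N] [Module ℝ N]
  (T : MultilinearMap ℝ (fun _ : Fin 2 => Fin 2 → ℝ) N)

lemma update_pair_zero {α : Type*} (a b c : α) : update ![a, b] 0 c = ![c, b] := by
  funext i; fin_cases i <;> rfl

lemma update_pair_one {α : Type*} (a b c : α) : update ![a, b] 1 c = ![a, c] := by
  funext i; fin_cases i <;> rfl

lemma map2_add_left (a a' b : Fin 2 → ℝ) : T ![a + a', b] = T ![a, b] + T ![a', b] := by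
  simpa only [update_pair_zero] using T.map_update_add ![a, b] 0 a a'

lemma map2_add_right (a b b' : Fin 2 → ℝ) : T ![a, b + b'] = T ![a, b] + T ![a, b'] := by
  simpa only [update_pair_one] using T.map_update_add ![a, b] 1 b b'

lemma map2_smul_left (r : ℝ) (a b : Fin 2 → ℝ) : T ![r • a, b] = r • T ![a, b] := by
  simpa only [update_pair_zero] using T.map_update_smul ![a, b] 0 r a

lemma map2_smul_right (r : ℝ) (a b : Fin 2 → ℝ) : T ![a, r • b] = r • T ![a, b] := by
  simpa only [update_pair_one] using T.map_update_smul ![a, b] 1 r b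

end bilinear

lemma vec2_eta {α : Type*} (x : Fin 2 → α) : x = ![x 0, x 1] := by
  ext i; fin_cases i <;> rfl

/-- The cross product of two vectors in the plane. -/
def wedge (v w : Fin 2 → ℝ) : ℝ := v 0 * w 1 - v 1 * w 0

/-- The determinants of the pencils of a bilinear map are real multiples of `c` and `c i`. -/
structure RealDet (T : TMap 2) (c : ℂ) (q r : (Fin 2 → ℝ) → ℝ) : Prop where
  ne_zero : c ≠ 0
  first : ∀ s s' t, cdet (T ![s, t]) (T ![s', t]) = wedge s s' * (c * q t)
  second : ∀ s t t', cdet (T ![s, t]) (T ![s, t']) = wedge t t' * (c * (I * r s))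
  first_ne : ∃ t, q t ≠ 0
  second_ne : ∃ s, r s ≠ 0

/-- The matrix with two given columns. -/
noncomputable def colGL (v w : Fin 2 → ℝ) (h : wedge v w ≠ 0) : GL (Fin 2) ℝ :=
  Matrix.GeneralLinearGroup.mkOfDetNeZero !![v 0, w 0; v 1, w 1] (by
    rw [Matrix.det_fin_two_of]; unfold wedge at h; intro h'; apply h; linarith)

lemma colGL_mulVec (v w : Fin 2 → ℝ) (h : wedge v w ≠ 0) (x : Fin 2 → ℝ) :
    (colGL v w h).1.mulVec x = x 0 • v + x 1 • w := by
  ext i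
  fin_cases i <;> simp [colGL, Matrix.GeneralLinearGroup.mkOfDetNeZero, Matrix.mulVec,
    Matrix.vecHead, Matrix.vecTail] <;> ring

lemma four_vectors_polar {T00 T01 T10 T11 : ℂ × ℂ} {c : ℂ} (hc : c ≠ 0) {q0 q1 r1 : ℝ}
    (hr : r1 ≠ 0) (h0 : cdet T00 T01 = 0) (h1 : cdet T10 T11 = 0)
    (h2 : cdet T00 T10 = c * q0) (h3 : cdet T00 T11 + cdet T01 T10 = c * q1)
    (h4 : cdet T00 T11 + cdet T10 T01 = c * (I * r1)) :
    ∃ x y : ℝ, y ≠ 0 ∧ cdet T10 T00 ≠ 0 ∧ T01 = (x + I * y : ℂ) • T00 ∧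
      T11 = (x - I * y : ℂ) • T10 := by
  have e1 : 2 * cdet T00 T11 = c * (q1 + I * r1) := by
    have : cdet T01 T10 = - cdet T10 T01 := by simp [cdet]; ring
    linear_combination h3 + h4 - this
  have e2 : 2 * cdet T01 T10 = c * (q1 - I * r1) := by
    have : cdet T01 T10 = - cdet T10 T01 := by simp [cdet]; ring
    linear_combination h3 - h4 + this
  have n1 : (q1 + I * r1 : ℂ) ≠ 0 := fun h => hr (by simpa using congrArg Complex.im h)
  have n2 : (q1 - I * r1 : ℂ) ≠ 0 := fun h => hr (by simpa using congrArg Complex.im h)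
  have dep : ∀ p q : ℂ × ℂ, p ≠ 0 → cdet p q = 0 → ∃ z : ℂ, q = z • p := by
    intro p q hp h
    simp only [cdet] at h
    by_cases h1 : p.1 = 0
    · have h2 : p.2 ≠ 0 := fun h' => hp (Prod.ext h1 h')
      refine ⟨q.2 / p.2, Prod.ext ?_ ?_⟩
      · rw [h1, zero_mul, zero_sub, neg_eq_zero] at h
        simpa [h1] using (mul_eq_zero.1 h).resolve_left h2
      · simp; field_simp
    · refine ⟨q.1 / p.1, Prod.ext ?_ ?_⟩
      · simp; field_simp
      · simp; field_simp; linear_combination h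
  have p0 : T00 ≠ 0 := by
    rintro rfl
    have : cdet 0 T11 = 0 := by simp [cdet]
    rw [this, mul_zero] at e1
    exact mul_ne_zero hc n1 e1.symm
  have p1 : T10 ≠ 0 := by
    rintro rfl
    have : cdet T01 0 = 0 := by simp [cdet]
    rw [this, mul_zero] at e2
    exact mul_ne_zero hc n2 e2.symm
  obtain ⟨z, rfl⟩ := dep _ _ p0 h0
  obtain ⟨w, rfl⟩ := dep _ _ p1 h1
  have f1 : cdet T00 (w • T10) = w * cdet T00 T10 := by simp [cdet]; ring
  have f2 : cdet (z • T00) T10 = z * cdet T00 T10 := by simp [cdet]; ring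
  rw [f1, h2] at e1
  rw [f2, h2] at e2
  have hq : q0 ≠ 0 := by
    rintro rfl
    simp at e1
    rcases e1 with h | h
    · exact hc h
    · exact n1 h
  have hq' : (q0 : ℂ) ≠ 0 := by exact_mod_cast hq
  refine ⟨q1 / (2 * q0), -r1 / (2 * q0), by simp [hr, hq], ?_, ?_, ?_⟩
  · have : cdet T10 T00 = - cdet T00 T10 := by simp [cdet]; ring
    rw [this, h2]
    exact neg_ne_zero.2 (mul_ne_zero hc hq')
  · congr 1
    have e3 : 2 * (z * q0) = q1 - I * r1 :=
      mul_left_cancel₀ hc (by linear_combination e2)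
    push_cast
    field_simp
    linear_combination e3
  · congr 1
    have e3 : 2 * (w * q0) = q1 + I * r1 :=
      mul_left_cancel₀ hc (by linear_combination e1)
    push_cast
    field_simp
    linear_combination e3

lemma four_vectors_cart {T00 T01 T10 T11 : ℂ × ℂ} {c : ℂ} (hc : c ≠ 0) {q0 r0 : ℝ}
    (hq : q0 ≠ 0)
    (h1 : cdet T00 T10 = c * q0) (h2 : cdet T00 T11 + cdet T01 T10 = 0)
    (h4 : cdet T00 T01 = c * (I * r0)) (h5 : cdet T00 T11 + cdet T10 T01 = 0)
    (h6 : cdet T10 T11 = 0) :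
    T11 = 0 ∧ T01 = (I * (r0 / q0 : ℝ) : ℂ) • T10 := by
  have hq' : (q0 : ℂ) ≠ 0 := by exact_mod_cast hq
  have hd : cdet T00 T10 ≠ 0 := by rw [h1]; exact mul_ne_zero hc hq'
  have anti : cdet T01 T10 = - cdet T10 T01 := by simp [cdet]; ring
  have e1 : cdet T00 T11 = 0 := by linear_combination (h2 + h5 - anti) / 2
  have e2 : cdet T10 T01 = 0 := by linear_combination (h5 - h2 + anti) / 2
  have expand : ∀ p : ℂ × ℂ, cdet T00 T10 • p = cdet T00 p • T10 - cdet T10 p • T00 := by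
    intro p
    ext1 <;> simp [cdet] <;> ring
  constructor
  · have := expand T11
    rw [e1, h6, zero_smul, zero_smul, sub_zero] at this
    exact (smul_eq_zero.1 this).resolve_left hd
  · have := expand T01
    rw [h4, e2, zero_smul, sub_zero] at this
    rw [← inv_smul_smul₀ hd T01, this, h1, smul_smul]
    congr 1
    push_cast
    field_simp

lemma RealDet.map_vec {T : TMap 2} (x : Fin 2 → Fin 2 → ℝ) (e0 e1 f0 f1 : Fin 2 → ℝ) :
    T ![x 0 0 • e0 + x 0 1 • e1, x 1 0 • f0 + x 1 1 • f1] =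
      (x 0 0 * x 1 0) • T ![e0, f0] + (x 0 0 * x 1 1) • T ![e0, f1] +
      (x 0 1 * x 1 0) • T ![e1, f0] + (x 0 1 * x 1 1) • T ![e1, f1] := by
  simp only [map2_add_left, map2_add_right, map2_smul_left, map2_smul_right, smul_add, smul_smul]
  module

lemma subst_colGL (e0 e1 f0 f1 : Fin 2 → ℝ) (he : wedge e0 e1 ≠ 0) (hf : wedge f0 f1 ≠ 0) (x) :
    subst 1 ![colGL e0 e1 he, colGL f0 f1 hf] x =
      ![x 0 0 • e0 + x 0 1 • e1, x 1 0 • f0 + x 1 1 • f1] := by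
  funext i
  fin_cases i
  · exact colGL_mulVec _ _ he _
  · exact colGL_mulVec _ _ hf _

lemma TEquiv.of_basis {T₀ T : TMap 2} {e0 e1 f0 f1 : Fin 2 → ℝ} (he : wedge e0 e1 ≠ 0)
    (hf : wedge f0 f1 ≠ 0) {a b c d : ℂ} (hd : a * d - b * c ≠ 0)
    (h : ∀ x : Fin 2 → Fin 2 → ℝ, T ![x 0 0 • e0 + x 0 1 • e1, x 1 0 • f0 + x 1 1 • f1] =
      cmat a b c d (T₀ x)) : TEquiv T₀ T := by
  refine TEquiv.of_subst (T' := (cmat a b c d).compMultilinearMap T₀) 1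
    ![colGL e0 e1 he, colGL f0 f1 hf] ⟨1, 1, a, b, c, d, hd, fun x => by rw [subst_one]; rfl⟩
    fun x => ?_
  rw [subst_colGL, h]; rfl

lemma RealDet.polar_of_roots {T : TMap 2} {c q r} (h : RealDet T c q r) {e0 e1 : Fin 2 → ℝ}
    (he : wedge e0 e1 ≠ 0) (h0 : r e0 = 0) (h1 : r e1 = 0) (h2 : r (e0 + e1) ≠ 0) :
    TEquiv polarT T := by
  have wf : wedge ![1, 0] ![0, 1] = 1 := by simp [wedge]
  have k1 := h.second e0 ![1, 0] ![0, 1]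
  have k2 := h.second e1 ![1, 0] ![0, 1]
  have k3 := h.second (e0 + e1) ![1, 0] ![0, 1]
  have k4 := h.first e0 e1 ![1, 0]
  have k5 := h.first e0 e1 ![0, 1]
  have k6 := h.first e0 e1 (![1, 0] + ![0, 1])
  simp only [wf, h0, h1, map2_add_left, map2_add_right, ofReal_one, Complex.ofReal_zero]
    at k1 k2 k3 k4 k5 k6
  have cadd : ∀ a b c d : ℂ × ℂ, cdet (a + b) (c + d) = cdet a c + cdet a d + cdet b c + cdet b d :=
    fun a b c d => by simp [cdet]; ring
  rw [cadd] at k3 k6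
  have we : (wedge e0 e1 : ℂ) ≠ 0 := by exact_mod_cast he
  obtain ⟨x, y, hy, hd, e1', e2'⟩ := four_vectors_polar (T00 := T ![e0, ![1, 0]])
    (T01 := T ![e0, ![0, 1]]) (T10 := T ![e1, ![1, 0]]) (T11 := T ![e1, ![0, 1]]) (c := c)
    (q0 := wedge e0 e1 * q ![1, 0]) (r1 := r (e0 + e1))
    (q1 := wedge e0 e1 * (q (![1, 0] + ![0, 1]) - q ![1, 0] - q ![0, 1])) h.ne_zero h2
    (by rw [k1]; simp) (by rw [k2]; simp) (by rw [k4]; push_cast; ring)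
    (by push_cast; linear_combination k6 - k4 - k5)
    (by linear_combination k3 - k1 - k2)
  refine TEquiv.of_basis (e0 := e0) (e1 := e1) (f0 := ![1, 0]) (f1 := ![-x / y, 1 / y]) he
    (by simp [wedge, hy]) (a := (T ![e1, ![1, 0]]).1) (b := (T ![e0, ![1, 0]]).1)
    (c := (T ![e1, ![1, 0]]).2) (d := (T ![e0, ![1, 0]]).2)
    (by intro h'; apply hd; rw [cdet]; linear_combination h') fun z => ?_
  have hf : (![-x / y, 1 / y] : Fin 2 → ℝ) = (-x / y) • ![1, 0] + (1 / y) • ![0, 1] := by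
    ext i; fin_cases i <;> simp
  rw [RealDet.map_vec, hf]
  simp only [map2_add_right, map2_smul_right, e1', e2']
  rw [polarT_apply, cmat_apply]
  have hy' : (y : ℂ) ≠ 0 := by exact_mod_cast hy
  ext1 <;> (simp; field_simp; ring)

lemma RealDet.cart_of_double_roots {T : TMap 2} {c q r} (h : RealDet T c q r)
    {e0 e1 f0 f1 : Fin 2 → ℝ} (he : wedge e0 e1 ≠ 0) (hf : wedge f0 f1 ≠ 0) {q0 r0 : ℝ}
    (hq0 : q0 ≠ 0) (hr0 : r0 ≠ 0) (hq : ∀ a b : ℝ, q (a • f0 + b • f1) = q0 * a ^ 2)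
    (hr : ∀ a b : ℝ, r (a • e0 + b • e1) = r0 * a ^ 2) : TEquiv cartT T := by
  have q00 := hq 1 0
  have q01 := hq 0 1
  have q11 := hq 1 1
  have r00 := hr 1 0
  have r01 := hr 0 1
  have r11 := hr 1 1
  simp only [one_smul, zero_smul, add_zero, zero_add] at q00 q01 q11 r00 r01 r11
  have k1 := h.second e0 f0 f1
  have k2 := h.second e1 f0 f1
  have k3 := h.second (e0 + e1) f0 f1
  have k4 := h.first e0 e1 f0
  have k5 := h.first e0 e1 f1
  have k6 := h.first e0 e1 (f0 + f1)
  simp only [q00, q01, q11, r00, r01, r11, map2_add_left, map2_add_right] at k1 k2 k3 k4 k5 k6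
  have cadd : ∀ a b c d : ℂ × ℂ, cdet (a + b) (c + d) = cdet a c + cdet a d + cdet b c + cdet b d :=
    fun a b c d => by simp [cdet]; ring
  rw [cadd] at k3 k6
  obtain ⟨z1, z2⟩ := four_vectors_cart (T00 := T ![e0, f0]) (T01 := T ![e0, f1])
    (T10 := T ![e1, f0]) (T11 := T ![e1, f1]) (c := c) (q0 := wedge e0 e1 * q0)
    (r0 := wedge f0 f1 * r0) h.ne_zero (mul_ne_zero he hq0)
    (by rw [k4]; push_cast; ring) (by push_cast at *; linear_combination k6 - k4 - k5)
    (by rw [k1]; push_cast; ring)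
    (by push_cast at *; linear_combination k3 - k1 - k2)
    (by rw [k2]; simp)
  set t : ℝ := -(wedge f0 f1 * r0 / (wedge e0 e1 * q0)) with ht
  have ht0 : t ≠ 0 := neg_ne_zero.2 (by positivity)
  refine TEquiv.of_basis (e0 := e0) (e1 := e1) (f0 := f0) (f1 := t⁻¹ • f1) he
    (by
      have : wedge f0 (t⁻¹ • f1) = t⁻¹ * wedge f0 f1 := by simp [wedge]; ring
      rw [this]; exact mul_ne_zero (inv_ne_zero ht0) hf)
    (a := (T ![e1, f0]).1) (b := (T ![e0, f0]).1)
    (c := (T ![e1, f0]).2) (d := (T ![e0, f0]).2) ?_ fun z => ?_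
  · have : (T ![e1, f0]).1 * (T ![e0, f0]).2 - (T ![e0, f0]).1 * (T ![e1, f0]).2 =
      -cdet (T ![e0, f0]) (T ![e1, f0]) := by simp [cdet]; ring
    rw [this, k4]
    refine neg_ne_zero.2 (mul_ne_zero (by exact_mod_cast he) (mul_ne_zero h.ne_zero ?_))
    simpa using hq0
  · rw [RealDet.map_vec]
    simp only [map2_smul_right, z1, z2]
    rw [show wedge f0 f1 * r0 / (wedge e0 e1 * q0) = -t by rw [ht]; ring]
    have ht' : (t : ℂ) ≠ 0 := by exact_mod_cast ht0
    rw [cartT_apply, cmat_apply]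
    ext1 <;> (simp; field_simp; ring)

/-- A binary quadratic form with positive discriminant has two independent roots. -/
lemma exists_roots {f : (Fin 2 → ℝ) → ℝ} {a b c : ℝ}
    (hf : ∀ v, f v = a * v 0 ^ 2 + b * (v 0 * v 1) + c * v 1 ^ 2) (hd : 0 < b ^ 2 - 4 * a * c) :
    ∃ e0 e1, wedge e0 e1 ≠ 0 ∧ f e0 = 0 ∧ f e1 = 0 ∧ f (e0 + e1) ≠ 0 := by
  by_cases ha : a = 0
  · subst ha
    have hb : b ≠ 0 := by rintro rfl; simp at hd
    refine ⟨![1, 0], ![c, -b], by simp [wedge, hb], by rw [hf]; simp, by rw [hf]; simp; ring, ?_⟩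
    rw [hf]; simp
    intro h
    apply pow_ne_zero 2 hb
    linarith
  · set δ := √(b ^ 2 - 4 * a * c) with hδ
    have h1 : δ ^ 2 = b ^ 2 - 4 * a * c := sq_sqrt hd.le
    have h2 : 0 < δ := sqrt_pos.2 hd
    refine ⟨![-b + δ, 2 * a], ![-b - δ, 2 * a], ?_, ?_, ?_, ?_⟩
    · have : wedge ![-b + δ, 2 * a] ![-b - δ, 2 * a] = 4 * a * δ := by simp [wedge]; ring
      rw [this]; positivity
    · rw [hf]; simp; linear_combination a * h1
    · rw [hf]; simp; linear_combination a * h1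
    · have : f (![-b + δ, 2 * a] + ![-b - δ, 2 * a]) = -4 * a * δ ^ 2 := by
        rw [hf, h1]; simp; ring
      rw [this]
      have := h2.ne'
      simp [ha, this]

/-- A non-zero binary quadratic form with zero discriminant has a double root. -/
lemma exists_double_root {f : (Fin 2 → ℝ) → ℝ} {a b c : ℝ}
    (hf : ∀ v, f v = a * v 0 ^ 2 + b * (v 0 * v 1) + c * v 1 ^ 2) (hd : b ^ 2 - 4 * a * c = 0)
    (h0 : ∃ v, f v ≠ 0) :
    ∃ e0 e1 : Fin 2 → ℝ, ∃ r : ℝ, wedge e0 e1 ≠ 0 ∧ r ≠ 0 ∧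
      ∀ s t : ℝ, f (s • e0 + t • e1) = r * s ^ 2 := by
  by_cases ha : a = 0
  · subst ha
    have hb : b = 0 := by simpa using hd
    subst hb
    have hc : c ≠ 0 := by
      rintro rfl
      obtain ⟨v, hv⟩ := h0
      apply hv; rw [hf]; ring
    exact ⟨![0, 1], ![1, 0], c, by simp [wedge], hc, fun s t => by rw [hf]; simp⟩
  · refine ⟨![1, 0], ![-b, 2 * a], a, by simp [wedge, ha], ha, fun s t => ?_⟩
    rw [hf]; simp; linear_combination (-a * t ^ 2) * hd

lemma real_quadratic {f : (Fin 2 → ℝ) → ℝ} {c A B C : ℂ} (hc : c ≠ 0)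
    (h : ∀ v, A * (v 0 ^ 2 : ℝ) + B * (v 0 * v 1 : ℝ) + C * (v 1 ^ 2 : ℝ) = c * f v) :
    ∃ a b d : ℝ, A = c * a ∧ B = c * b ∧ C = c * d ∧
      ∀ v, f v = a * v 0 ^ 2 + b * (v 0 * v 1) + d * v 1 ^ 2 := by
  have h1 := h ![1, 0]
  have h2 := h ![0, 1]
  have h3 := h ![1, 1]
  simp at h1 h2 h3
  have hB : B = c * (f ![1, 1] - f ![1, 0] - f ![0, 1] : ℝ) := by
    push_cast; linear_combination h3 - h1 - h2
  refine ⟨f ![1, 0], f ![1, 1] - f ![1, 0] - f ![0, 1], f ![0, 1], h1, hB, h2, fun v => ?_⟩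
  have h4 := h v
  rw [h1, hB, h2] at h4
  have h5 : c * (f v : ℂ) = c * ((f ![1, 0] * v 0 ^ 2 +
      (f ![1, 1] - f ![1, 0] - f ![0, 1]) * (v 0 * v 1) + f ![0, 1] * v 1 ^ 2 : ℝ) : ℂ) := by
    rw [← h4]; push_cast; ring
  exact_mod_cast mul_left_cancel₀ hc h5

lemma RealDet.swap {T : TMap 2} {c q r} (h : RealDet T c q r) :
    RealDet (T.domDomCongr (Equiv.swap 0 1)) (c * I) r (fun t => - q t) := by
  have hs : ∀ s t, (T.domDomCongr (Equiv.swap 0 1)) ![s, t] = T ![t, s] := by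
    intro s t
    rw [MultilinearMap.domDomCongr_apply]
    congr 1
    funext i; fin_cases i <;> simp
  refine ⟨mul_ne_zero h.ne_zero I_ne_zero, fun s s' t => ?_, fun s t t' => ?_,
    h.second_ne, ?_⟩
  · rw [hs, hs, h.second]; ring
  · rw [hs, hs, h.first]; push_cast; linear_combination (wedge t t' * c * q s) * I_sq
  · obtain ⟨t, ht⟩ := h.first_ne
    exact ⟨t, neg_ne_zero.2 ht⟩

lemma RealDet.classification {T : TMap 2} {c q r} (h : RealDet T c q r) :
    TEquiv polarT T ∨ TEquiv cartT T := by
  have wf : wedge ![1, 0] ![0, 1] = 1 := by simp [wedge]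
  set E0 : Fin 2 → ℝ := ![1, 0]
  set E1 : Fin 2 → ℝ := ![0, 1]
  obtain ⟨q0, q1, q2, hq0, hq1, hq2, hq⟩ := real_quadratic (f := q) h.ne_zero
    (A := cdet (T ![E0, E0]) (T ![E1, E0]))
    (B := cdet (T ![E0, E0]) (T ![E1, E1]) + cdet (T ![E0, E1]) (T ![E1, E0]))
    (C := cdet (T ![E0, E1]) (T ![E1, E1])) (fun v => by
      have := h.first E0 E1 v
      rw [wf, ofReal_one, one_mul] at this
      rw [← this, vec_eq v]
      simp only [map2_add_right, map2_smul_right]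
      simp [cdet, E0, E1]; ring)
  obtain ⟨r0, r1, r2, hr0, hr1, hr2, hr⟩ := real_quadratic (f := r) (c := c * I)
    (mul_ne_zero h.ne_zero I_ne_zero)
    (A := cdet (T ![E0, E0]) (T ![E0, E1]))
    (B := cdet (T ![E0, E0]) (T ![E1, E1]) + cdet (T ![E1, E0]) (T ![E0, E1]))
    (C := cdet (T ![E1, E0]) (T ![E1, E1])) (fun v => by
      have := h.second v E0 E1
      rw [wf, ofReal_one, one_mul, ← mul_assoc] at this
      rw [← this, vec_eq v]
      simp only [map2_add_left, map2_smul_left]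
      simp [cdet, E0, E1]; ring)
  have hdisc : q1 ^ 2 - 4 * q0 * q2 = -(r1 ^ 2 - 4 * r0 * r2) := by
    have e1 : (c * q1) ^ 2 - 4 * (c * q0) * (c * q2) = (c * I * r1) ^ 2 -
        4 * (c * I * r0) * (c * I * r2) := by
      rw [← hq0, ← hq1, ← hq2, ← hr0, ← hr1, ← hr2]
      simp only [cdet]; ring
    have e2 : c ^ 2 * ((q1 ^ 2 - 4 * q0 * q2 : ℝ) : ℂ) =
        c ^ 2 * ((-(r1 ^ 2 - 4 * r0 * r2) : ℝ) : ℂ) := by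
      push_cast
      linear_combination e1 + c ^ 2 * (r1 ^ 2 - 4 * r0 * r2) * I_sq
    exact_mod_cast mul_left_cancel₀ (pow_ne_zero 2 h.ne_zero) e2
  rcases lt_trichotomy (r1 ^ 2 - 4 * r0 * r2) 0 with hlt | heq | hgt
  · obtain ⟨e0, e1, he, h0, h1, h2⟩ := exists_roots hq (by rw [hdisc]; linarith)
    left
    refine TEquiv.of_subst (T' := T.domDomCongr (Equiv.swap 0 1)) (Equiv.swap 0 1) 1
      (h.swap.polar_of_roots he (by simp [h0]) (by simp [h1]) (by simpa using h2)) fun x => ?_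
    rw [MultilinearMap.domDomCongr_apply]
    congr 1
    funext i; simp [subst]
  · obtain ⟨e0, e1, ρ, he, hρ, h1⟩ := exists_double_root hr heq h.second_ne
    obtain ⟨f0, f1, κ, hf, hκ, h2⟩ := exists_double_root hq (by rw [hdisc, heq, neg_zero])
      h.first_ne
    exact Or.inr (h.cart_of_double_roots he hf hκ hρ h2 h1)
  · obtain ⟨e0, e1, he, h0, h1, h2⟩ := exists_roots hr hgt
    exact Or.inl (h.polar_of_roots he h0 h1 h2)

/-! ### Pencil forms -/

/-- The two-dimensional system `(i a, b)` defined by a complex bilinear map. -/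
noncomputable def embQ (T : TMap 2) : QMap 2 := emb.compMultilinearMap T

lemma embQ_apply (T : TMap 2) (x) : embQ T x = emb (T x) := rfl

lemma rel_of_apply {n : ℕ} {D D' : QMap n} {k : ℍ[ℝ]} (hk : k ≠ 0)
    (h : ∀ x, D' x = rmul (D x) k) : Rel D D' :=
  ⟨LinearMap.id, isSim_id, 1, 1, k, hk, MultilinearMap.ext fun x => by
    rw [act_apply, subst_one, h]; rfl⟩

lemma omega_embQ (T : TMap 2) (x i) : omega (embQ T) x i =
    icx (-cdet (T (update x i ![1, 0])) (T (update x i ![0, 1]))) := form_emb_emb _ _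

lemma cdet_pencil {p q : ℂ × ℂ} (v w : Fin 2 → ℝ) :
    cdet (v 0 • p + v 1 • q) (w 0 • p + w 1 • q) = wedge v w * cdet p q := by
  simp [cdet, wedge]; ring

lemma exists_real_of_orthogonal {z w : ℂ} (hw : w ≠ 0) (h : (conj z * w).re = 0) :
    ∃ r : ℝ, z = w * (I * r) := by
  have h1 : (z / w).re = 0 := by
    rw [Complex.div_re]
    simp at h
    rw [← add_div, mul_comm z.re, mul_comm z.im]
    rw [mul_comm z.re, mul_comm z.im] at h
    rw [h, zero_div]
  refine ⟨(z / w).im, ?_⟩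
  have h2 : z / w = I * (z / w).im := by
    apply Complex.ext
    · simp [h1]
    · simp
  rw [← h2]; field_simp

lemma AlgDC.realDet {T : TMap 2} (h : AlgDC (embQ T)) : ∃ c q r, RealDet T c q r := by
  obtain ⟨x, -, hx⟩ := h.nondegenerate
  set Q : (Fin 2 → ℝ) → ℂ := fun t => cdet (T ![![1, 0], t]) (T ![![0, 1], t]) with hQ
  set R : (Fin 2 → ℝ) → ℂ := fun s => cdet (T ![s, ![1, 0]]) (T ![s, ![0, 1]]) with hR
  have om0 : ∀ s t, omega (embQ T) ![s, t] 0 = icx (-Q t) := fun s t => by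
    rw [omega_embQ, update_pair_zero, update_pair_zero]
  have om1 : ∀ s t, omega (embQ T) ![s, t] 1 = icx (-R s) := fun s t => by
    rw [omega_embQ, update_pair_one, update_pair_one]
  have horth : ∀ s t, (conj (Q t) * R s).re = 0 := fun s t => by
    have := h.orthogonal ![s, t] 0 1 (by simp)
    rw [om0, om1, inner_icx] at this
    simpa using this
  have hQ0 : Q (x 1) ≠ 0 := fun h0 => hx 0 (by rw [vec2_eta x, om0, h0]; simp)
  have hR0 : R (x 0) ≠ 0 := fun h0 => hx 1 (by rw [vec2_eta x, om1, h0]; simp)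
  have h1 : ∀ t, ∃ q : ℝ, Q t = R (x 0) * (I * q) := fun t =>
    exists_real_of_orthogonal hR0 (horth _ _)
  choose q hq using h1
  have hq1 : q (x 1) ≠ 0 := by
    intro h0; apply hQ0; rw [hq, h0]; simp
  have h2 : ∀ s, ∃ r : ℝ, R s = R (x 0) * r := fun s => by
    obtain ⟨r, hr⟩ := exists_real_of_orthogonal (z := R s) hQ0 (by
      have := horth s (x 1)
      simp at this ⊢; linarith)
    refine ⟨-(q (x 1) * r), ?_⟩
    rw [hr, hq]; push_cast; linear_combination (R (x 0) * q (x 1) * r) * I_sq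
  choose r hr using h2
  refine ⟨R (x 0) * I, q, fun s => -r s,
    mul_ne_zero hR0 I_ne_zero, fun s s' t => ?_, fun s t t' => ?_, ⟨x 1, hq1⟩,
    ⟨x 0, ?_⟩⟩
  · have := hq t
    rw [mul_assoc, ← this]
    conv_lhs => rw [vec_eq s, vec_eq s']
    simp only [map2_add_left, map2_smul_left]
    rw [cdet_pencil]
  · have := hr s
    rw [show R (x 0) * I * (I * ((-r s : ℝ) : ℂ)) = R s by
      rw [this]; push_cast; linear_combination (-R (x 0) * r s) * I_sq]
    conv_lhs => rw [vec_eq t, vec_eq t']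
    simp only [map2_add_right, map2_smul_right]
    rw [cdet_pencil]
  · intro h0
    apply hR0; rw [hr, neg_eq_zero.1 h0]; simp

lemma AlgDC.tEquiv {T : TMap 2} (h : AlgDC (embQ T)) : TEquiv polarT T ∨ TEquiv cartT T := by
  obtain ⟨c, q, r, h⟩ := h.realDet
  exact h.classification

/-- The pencil `u₀ A + u₁ B` of two-dimensional systems. -/
noncomputable def pencil (A B : QMap 2) : QMap 3 where
  toFun x := x 2 0 • A ![x 0, x 1] + x 2 1 • B ![x 0, x 1]
  map_update_add' := by
    intro inst m i x y
    obtain rfl : inst = instDecidableEqFin 3 := Subsingleton.elim _ _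
    fin_cases i
    · simp [map2_add_left]; abel
    · simp [map2_add_right]; abel
    · simp [add_smul]; abel
  map_update_smul' := by
    intro inst m i c x
    obtain rfl : inst = instDecidableEqFin 3 := Subsingleton.elim _ _
    fin_cases i
    · simp [map2_smul_left, smul_comm c]
    · simp [map2_smul_right, smul_comm c]
    · simp [mul_smul]

lemma pencil_apply (A B : QMap 2) (x) :
    pencil A B x = x 2 0 • A ![x 0, x 1] + x 2 1 • B ![x 0, x 1] := rfl

/-- Hermitian forms `α |a|² + 2 Re (β ā b) + γ |b|²` on `ℂ²`. -/
structure Herm where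
  α : ℝ
  β : ℂ
  γ : ℝ

namespace Herm

/-- The value of a Hermitian form. -/
noncomputable def eval (H : Herm) (p : ℂ × ℂ) : ℝ :=
  H.α * normSq p.1 + 2 * (H.β * conj p.1 * p.2).re + H.γ * normSq p.2

/-- The skew-Hermitian matrix defined by a Hermitian form. -/
noncomputable def skew (H : Herm) : ℂ × ℂ →ₗ[ℝ] ℂ × ℂ :=
  cmat (I * H.α) (I * H.β) (I * conj H.β) (I * H.γ)

/-- The determinant of a Hermitian form. -/
noncomputable def det (H : Herm) : ℝ := H.α * H.γ - normSq H.β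

/-- The pull-back of a Hermitian form by a complex matrix. -/
noncomputable def pull (H : Herm) (a b c d : ℂ) : Herm where
  α := H.eval (a, c)
  β := H.α * conj a * b + H.β * conj a * d +
    conj (H.β) * conj c * b + H.γ * conj c * d
  γ := H.eval (b, d)

/-- The multiple of a Hermitian form. -/
def scale (H : Herm) (c : ℝ) : Herm := ⟨c * H.α, c * H.β, c * H.γ⟩

lemma ext' {H K : Herm} (h1 : H.α = K.α) (h2 : H.β = K.β) (h3 : H.γ = K.γ) : H = K := by
  cases H; cases K; simp_all

lemma det_pull (H : Herm) (a b c d : ℂ) :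
    (H.pull a b c d).det = normSq (a * d - b * c) * H.det := by
  simp [det, eval, pull, normSq_apply]; ring

lemma eval_smul (H : Herm) (z : ℂ) (p) : H.eval (z • p) = normSq z * H.eval p := by
  simp [eval, normSq_apply]; ring

lemma pull_pull (H : Herm) (a b c d a' b' c' d' : ℂ) :
    (H.pull a b c d).pull a' b' c' d' =
      H.pull (a * a' + b * c') (a * b' + b * d') (c * a' + d * c') (c * b' + d * d') := by
  refine ext' ?_ ?_ ?_
  · simp [eval, pull, normSq_apply]; ring
  · apply Complex.ext <;> simp [eval, pull, normSq_apply] <;> ring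
  · simp [eval, pull, normSq_apply]; ring

lemma pull_one (H : Herm) : H.pull 1 0 0 1 = H := by
  refine ext' ?_ ?_ ?_ <;> simp [eval, pull]

/-- A Hermitian form is non-zero. -/
def NonZero (H : Herm) : Prop := H.α ≠ 0 ∨ H.β ≠ 0 ∨ H.γ ≠ 0

lemma NonZero.pull {H : Herm} (h : H.NonZero) {a b c d : ℂ} (hd : a * d - b * c ≠ 0) :
    (H.pull a b c d).NonZero := by
  by_contra h'
  have hz : H.pull a b c d = ⟨0, 0, 0⟩ := by
    unfold NonZero at h'; push Not at h'
    exact ext' h'.1 h'.2.1 h'.2.2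
  have h1 := pull_pull H a b c d (d / (a * d - b * c)) (-b / (a * d - b * c))
    (-c / (a * d - b * c)) (a / (a * d - b * c))
  have e1 : a * (d / (a * d - b * c)) + b * (-c / (a * d - b * c)) = 1 := by field_simp; ring
  have e2 : a * (-b / (a * d - b * c)) + b * (a / (a * d - b * c)) = 0 := by field_simp; ring
  have e3 : c * (d / (a * d - b * c)) + d * (-c / (a * d - b * c)) = 0 := by field_simp; ring
  have e4 : c * (-b / (a * d - b * c)) + d * (a / (a * d - b * c)) = 1 := by
    rw [← div_self hd]; ring
  rw [e1, e2, e3, e4, pull_one, hz] at h1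
  rw [← h1] at h
  simp [NonZero, Herm.pull, eval] at h

end Herm

/-- The three-dimensional system that is defined by a complex bilinear map and a Hermitian form. -/
noncomputable def pencilForm (T : TMap 2) (H : Herm) : QMap 3 :=
  pencil (embQ T) ((emb' ∘ₗ H.skew).compMultilinearMap T)

lemma pencilForm_apply (T : TMap 2) (H : Herm) (x) : pencilForm T H x =
    x 2 0 • emb (T ![x 0, x 1]) + x 2 1 • emb' (H.skew (T ![x 0, x 1])) := rfl

lemma form_emb_skew (H : Herm) (p : ℂ × ℂ) :
    form (emb p) (emb' (H.skew p)) = cx (I * H.eval p) := by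
  rw [form_emb_emb']
  congr 1
  apply Complex.ext <;> simp [Herm.skew, cmat_apply, Herm.eval, normSq_apply] <;> ring

lemma form_pencil (H : Herm) (p q : ℂ × ℂ) (u v : ℝ) :
    form (u • emb p + v • emb' (H.skew p)) (u • emb q + v • emb' (H.skew q)) =
      icx (-((u ^ 2 - H.det * v ^ 2 : ℝ) * cdet p q)) := by
  have h1 : form (emb p) (emb' (H.skew q)) + form (emb' (H.skew p)) (emb q) = 0 := by
    rw [← star_form (emb q), form_emb_emb', form_emb_emb']
    ext <;> simp [cx, Herm.skew, cmat_apply] <;> ring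
  have h2 : cdet (H.skew p) (H.skew q) = - H.det * cdet p q := by
    apply Complex.ext <;> simp [cdet, Herm.skew, cmat_apply, Herm.det, normSq_apply] <;> ring
  simp only [form_add_left, form_add_right, form_smul_left, form_smul_right]
  rw [form_emb_emb, form_emb'_emb', h2]
  have h3 : u • u • icx (-cdet p q) + u • v • form (emb' (H.skew p)) (emb q) +
      (v • u • form (emb p) (emb' (H.skew q)) + v • v • icx (-(-H.det * cdet p q))) =
      u • u • icx (-cdet p q) + v • v • icx (-(-H.det * cdet p q)) +
      (u * v) • (form (emb p) (emb' (H.skew q)) + form (emb' (H.skew p)) (emb q)) := by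
    module
  have h4 : u • u • icx (-cdet p q) + v • v • icx (-(-H.det * cdet p q)) =
      icx (-((u ^ 2 - H.det * v ^ 2 : ℝ) * cdet p q)) := by
    ext <;> simp [icx, pow_two] <;> ring
  rw [← h4]
  refine Eq.trans ?_ (add_zero _)
  rw [← smul_zero (u * v), ← h1]
  module

lemma update_triple_zero {α : Type*} (x : Fin 3 → α) (c : α) :
    ![update x 0 c 0, update x 0 c 1] = update ![x 0, x 1] 0 c := by
  funext i; fin_cases i <;> rfl

lemma update_triple_one {α : Type*} (x : Fin 3 → α) (c : α) :
    ![update x 1 c 0, update x 1 c 1] = update ![x 0, x 1] 1 c := by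
  funext i; fin_cases i <;> rfl

lemma omega_pencilForm_zero (T H) (x : Fin 3 → Fin 2 → ℝ) : omega (pencilForm T H) x 0 =
    (x 2 0 ^ 2 - H.det * x 2 1 ^ 2) • omega (embQ T) ![x 0, x 1] 0 := by
  rw [omega, pencilForm_apply, pencilForm_apply, update_triple_zero, update_triple_zero]
  simp only [ne_eq, Fin.reduceEq, not_false_eq_true, update_of_ne]
  rw [form_pencil, omega_embQ]
  ext <;> simp [icx, pow_two]

lemma omega_pencilForm_one (T H) (x : Fin 3 → Fin 2 → ℝ) : omega (pencilForm T H) x 1 =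
    (x 2 0 ^ 2 - H.det * x 2 1 ^ 2) • omega (embQ T) ![x 0, x 1] 1 := by
  rw [omega, pencilForm_apply, pencilForm_apply, update_triple_one, update_triple_one]
  simp only [ne_eq, Fin.reduceEq, not_false_eq_true, update_of_ne]
  rw [form_pencil, omega_embQ]
  ext <;> simp [icx, pow_two]

lemma omega_pencilForm_two (T H) (x : Fin 3 → Fin 2 → ℝ) : omega (pencilForm T H) x 2 =
    cx (I * H.eval (T ![x 0, x 1])) := by
  rw [omega, pencilForm_apply, pencilForm_apply, ← form_emb_skew]
  simp

lemma isotropic_pencilForm (T H) : Isotropic (pencilForm T H) := by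
  intro x
  rw [pencilForm_apply, form_pencil]
  simp [cdet, mul_comm]

lemma inner_icx_cx (z w : ℂ) : inner ℝ (icx z) (cx w) = 0 := by
  rw [inner_def]; simp [icx, cx]

lemma algDC_pencilForm {T : TMap 2} {H : Herm} (hT : AlgDC (embQ T))
    (h : ∃ x, (∀ i, omega (embQ T) x i ≠ 0) ∧ H.eval (T x) ≠ 0) : AlgDC (pencilForm T H) := by
  refine ⟨isotropic_pencilForm T H, fun x i j hij => ?_, ?_⟩
  · have h01 : inner ℝ (omega (pencilForm T H) x 0) (omega (pencilForm T H) x 1) = 0 := by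
      rw [omega_pencilForm_zero, omega_pencilForm_one, inner_smul_left, inner_smul_right,
        hT.orthogonal _ 0 1 (by simp)]; simp
    have h02 : inner ℝ (omega (pencilForm T H) x 0) (omega (pencilForm T H) x 2) = 0 := by
      rw [omega_pencilForm_zero, omega_pencilForm_two, inner_smul_left, omega_embQ, inner_icx_cx]
      simp
    have h12 : inner ℝ (omega (pencilForm T H) x 1) (omega (pencilForm T H) x 2) = 0 := by
      rw [omega_pencilForm_one, omega_pencilForm_two, inner_smul_left, omega_embQ, inner_icx_cx]
      simp
    fin_cases i <;> fin_cases j <;> first | exact absurd rfl hij | assumption |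
      (rw [real_inner_comm]; assumption)
  · obtain ⟨x, h1, h2⟩ := h
    have h3 : T x ≠ 0 := by
      intro h3; apply h2; rw [h3]; simp [Herm.eval]
    have hx : ∀ i, x i ≠ 0 := by
      intro i hi; exact h3 (T.map_coord_zero i hi)
    have e : ![(![x 0, x 1, ![1, 0]] : Fin 3 → Fin 2 → ℝ) 0,
      (![x 0, x 1, ![1, 0]] : Fin 3 → Fin 2 → ℝ) 1] = x := (vec2_eta x).symm
    refine ⟨![x 0, x 1, ![1, 0]], ⟨?_, ?_⟩, ?_⟩
    · intro i
      fin_cases i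
      · exact hx 0
      · exact hx 1
      · simp
    · rw [pencilForm_apply, e]
      simpa [emb_eq_zero] using h3
    · intro i
      fin_cases i
      · change omega _ _ 0 ≠ 0
        rw [omega_pencilForm_zero, e]; simpa using h1 0
      · change omega _ _ 1 ≠ 0
        rw [omega_pencilForm_one, e]; simpa using h1 1
      · change omega _ _ 2 ≠ 0
        rw [omega_pencilForm_two, e, Ne, cx_eq_zero]
        simpa using h2

/-! ### Equivalences of pencil forms -/

/-- The quaternionic matrix of a complex matrix. -/
noncomputable def cxMat (a b c d : ℂ) : ℍ² →ₗ[ℝ] ℍ² :=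
  qmat (cx (conj a)) (icx b) (-icx (conj c)) (cx d)

lemma cxMat_emb (a b c d : ℂ) (p) : cxMat a b c d (emb p) = emb (cmat a b c d p) := by
  ext <;> simp [cxMat, qmat_apply, emb_apply, cmat_apply, cx, icx] <;> ring

lemma cxMat_emb' (a b c d : ℂ) (p) : cxMat a b c d (emb' p) =
    emb' (cmat (conj d) (-conj c) (-conj b) (conj a) p)
    := by
  ext <;> simp [cxMat, qmat_apply, emb'_apply, cmat_apply, cx, icx] <;> ring

lemma isSim_cxMat {a b c d : ℂ} (h : a * d - b * c = 1) : IsSim (cxMat a b c d) := by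
  have h1 := congrArg Complex.re h
  have h2 := congrArg Complex.im h
  simp at h1 h2
  refine isSim_qmat ?_ ?_ 1 one_ne_zero ?_
  · ext <;> simp [cx, icx] <;> ring
  · ext <;> simp [cx, icx] <;> ring
  · ext <;> simp [cx, icx]
    · linarith
    · linarith

/-- The matrix with two given diagonal entries. -/
noncomputable def diagGL (a b : ℝ) (h : a ≠ 0 ∧ b ≠ 0) : GL (Fin 2) ℝ :=
  colGL ![a, 0] ![0, b] (by simpa [wedge] using h)

lemma diagGL_mulVec (a b : ℝ) (h) (v : Fin 2 → ℝ) :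
    (diagGL a b h).1.mulVec v = ![a * v 0, b * v 1] := by
  rw [diagGL, colGL_mulVec]
  ext i; fin_cases i <;> simp [mul_comm]

lemma subst_one_two (k : GL (Fin 2) ℝ) (x : Fin 3 → Fin 2 → ℝ) :
    subst 1 ![1, 1, k] x = ![x 0, x 1, k.1.mulVec (x 2)] := by
  funext i; fin_cases i <;> simp [subst]

lemma rel_pencilForm_scale (T H) {c : ℝ} (hc : c ≠ 0) :
    Rel (pencilForm T H) (pencilForm T (H.scale c)) := by
  refine ⟨LinearMap.id, isSim_id, 1, ![1, 1, diagGL 1 c ⟨one_ne_zero, hc⟩], 1, one_ne_zero,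
    MultilinearMap.ext fun x => ?_⟩
  rw [act_apply, rmul_one, LinearMap.id_apply, pencilForm_apply, pencilForm_apply, subst_one_two,
    diagGL_mulVec]
  have h0 : ∀ p, (H.scale c).skew p = c • H.skew p := fun p => by
    ext1 <;> simp [Herm.scale, Herm.skew, cmat_apply] <;> ring
  simp [h0, smul_smul, mul_comm]

lemma exists_lift (σ : Equiv.Perm (Fin 2)) (g : Fin 2 → GL (Fin 2) ℝ) :
    ∃ (τ : Equiv.Perm (Fin 3)) (k : Fin 3 → GL (Fin 2) ℝ), ∀ x,
      ![subst τ k x 0, subst τ k x 1] = subst σ g ![x 0, x 1] ∧ subst τ k x 2 = x 2 := by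
  have h : σ = 1 ∨ σ = Equiv.swap 0 1 := by
    revert σ; decide
  rcases h with rfl | rfl
  · refine ⟨1, ![g 0, g 1, 1], fun x => ⟨?_, by simp [subst]⟩⟩
    funext i; fin_cases i <;> rfl
  · refine ⟨Equiv.swap 0 1, ![g 0, g 1, 1], fun x => ⟨?_, ?_⟩⟩
    · funext i; fin_cases i <;> simp [subst]
    · have : (Equiv.swap (0 : Fin 3) 1) 2 = 2 := by decide
      simp [subst, this]

lemma rel_pencilForm_subst {T T' : TMap 2} (H) (σ g) (h : ∀ x, T' x = T (subst σ g x)) :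
    Rel (pencilForm T H) (pencilForm T' H) := by
  obtain ⟨τ, k, hk⟩ := exists_lift σ g
  refine ⟨LinearMap.id, isSim_id, τ, k, 1, one_ne_zero, MultilinearMap.ext fun x => ?_⟩
  rw [act_apply, rmul_one, LinearMap.id_apply, pencilForm_apply, pencilForm_apply, (hk x).1,
    (hk x).2, h]

lemma cmat_smul (a b c d z : ℂ) (p) : cmat a b c d (z • p) = z • cmat a b c d p := by
  ext1 <;> simp [cmat_apply] <;> ring

lemma rel_pencilForm_smul {T T' : TMap 2} (H) {z : ℂ} (hz : z ≠ 0) (h : ∀ x, T' x = z • T x) :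
    Rel (pencilForm T H) (pencilForm T' H) := by
  refine rel_of_apply (k := cx z) (by rwa [Ne, cx_eq_zero]) fun x => ?_
  rw [pencilForm_apply, pencilForm_apply, h, Herm.skew, cmat_smul, emb_smul, emb'_smul,
    rmul_add_left, rmul_smul_left, rmul_smul_left]

lemma rel_pencilForm_cmat {T T' : TMap 2} (H : Herm) {a b c d : ℂ} (hd : a * d - b * c ≠ 0)
    (h : ∀ x, T' x = cmat a b c d (T x)) :
    Rel (pencilForm T (H.pull a b c d)) (pencilForm T' H) := by
  obtain ⟨z, hz⟩ := IsAlgClosed.exists_pow_nat_eq (a * d - b * c) (n := 2) (by norm_num)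
  have hz0 : z ≠ 0 := by rintro rfl; apply hd; rw [← hz]; simp
  have hn : normSq z ≠ 0 := by simpa using hz0
  have h1 : (a / z) * (d / z) - (b / z) * (c / z) = 1 := by
    field_simp; rw [hz]
  refine ⟨_, isSim_cxMat h1, 1, ![1, 1, diagGL 1 (normSq z)⁻¹
    ⟨one_ne_zero, inv_ne_zero hn⟩], cx z, by rwa [Ne, cx_eq_zero],
    MultilinearMap.ext fun x => ?_⟩
  rw [act_apply, pencilForm_apply, pencilForm_apply, subst_one_two, diagGL_mulVec]
  simp only [cons_val_zero, cons_val_one, cons_val, one_mul, map_add,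
    map_smul, cxMat_emb, cxMat_emb', rmul_add_left, rmul_smul_left, ← emb_smul, ← emb'_smul]
  refine congrArg₂ (· + ·) ?_ ?_
  · rw [h]
    congr 2
    ext1 <;> simp [cmat_apply] <;> field_simp
  · rw [h]
    have hzc : conj z ≠ 0 := by simpa using hz0
    have hns : ((normSq z : ℝ) : ℂ) = conj z * z := normSq_eq_conj_mul_self
    have hzz : conj z ^ 2 = conj a * conj d -
        conj b * conj c := by
      rw [← map_pow, hz]; simp
    have hH : ∀ p, cmat (conj d) (-conj c) (-conj b)
        (conj a) ((H.pull a b c d).skew p) =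
        (conj z ^ 2) • H.skew (cmat a b c d p) := by
      intro p
      rw [hzz]
      have hr : ∀ w : ℂ, (w.re : ℂ) = (w + conj w) / 2 := fun w => by
        rw [Complex.re_eq_add_conj]
      ext1 <;> simp only [cmat_apply, Herm.skew, Herm.pull, Herm.eval, Complex.ofReal_add,
        Complex.ofReal_mul, normSq_eq_conj_mul_self, hr, map_add, map_mul,
        conj_conj, Prod.smul_fst, Prod.smul_snd, smul_eq_mul, Complex.ofReal_ofNat,
        Complex.conj_ofReal] <;> ring
    have hc : ∀ p, cmat (conj (d / z)) (-conj (c / z))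
        (-conj (b / z)) (conj (a / z)) p = (conj z)⁻¹ •
        cmat (conj d) (-conj c) (-conj b) (conj a) p := by
      intro p
      ext1 <;> simp [cmat_apply] <;> field_simp
    rw [hc, hH, smul_smul, smul_smul, mul_comm _ (x 2 1),
      mul_smul (x 2 1), ← map_smul emb' (normSq z)⁻¹]
    congr 2
    have hs : ∀ (r : ℝ) (p : ℂ × ℂ), r • p = (r : ℂ) • p := fun r p => rfl
    rw [hs, smul_smul, Complex.ofReal_inv, hns]
    rw [show (conj z * z)⁻¹ * (z * (conj z)⁻¹ * conj z ^ 2) = 1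
      by field_simp, one_smul]

lemma TEquiv.rel_pencilForm {T₀ T : TMap 2} (h : TEquiv T₀ T) (H : Herm) :
    ∃ a b c d : ℂ, a * d - b * c ≠ 0 ∧ Rel (pencilForm T₀ (H.pull a b c d)) (pencilForm T H) := by
  obtain ⟨σ, g, a, b, c, d, hd, h⟩ := h
  refine ⟨a, b, c, d, hd, ?_⟩
  refine (rel_pencilForm_cmat (T' := (cmat a b c d).compMultilinearMap T₀) H hd
    fun x => rfl).trans ?_
  exact rel_pencilForm_subst H σ g h

/-! ### Polar and Cartesian coordinates -/

lemma isotropic_embQ (T : TMap 2) : Isotropic (embQ T) := fun x => isotropic_emb (T x)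

lemma embQ_polarT : embQ polarT = polar := MultilinearMap.ext emb_polarT

lemma embQ_cartT : embQ cartT = cartesian := MultilinearMap.ext emb_cartT

lemma omega_polarT_zero (x) : omega (embQ polarT) x 0 = icx ((x 1 0 ^ 2 + x 1 1 ^ 2 : ℝ) : ℂ) := by
  rw [omega_embQ, polarT_apply, polarT_apply]
  congr 1
  simp [cdet]
  linear_combination (-(x 1 1 : ℂ) ^ 2) * I_sq

lemma omega_polarT_one (x) :
    omega (embQ polarT) x 1 = icx (I * ((-(2 * (x 0 0 * x 0 1)) : ℝ) : ℂ)) := by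
  rw [omega_embQ, polarT_apply, polarT_apply]
  congr 1
  simp [cdet]
  ring

lemma omega_cartT_zero (x) : omega (embQ cartT) x 0 = icx ((x 1 0 ^ 2 : ℝ) : ℂ) := by
  rw [omega_embQ, cartT_apply, cartT_apply]
  congr 1
  simp [cdet]
  ring

lemma omega_cartT_one (x) :
    omega (embQ cartT) x 1 = icx (I * ((-(x 0 0 ^ 2) : ℝ) : ℂ)) := by
  rw [omega_embQ, cartT_apply, cartT_apply]
  congr 1
  simp [cdet]
  ring

lemma algDC_embQ {T : TMap 2} {q r : (Fin 2 → Fin 2 → ℝ) → ℝ}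
    (h0 : ∀ x, omega (embQ T) x 0 = icx (q x))
    (h1 : ∀ x, omega (embQ T) x 1 = icx (I * r x))
    (h : ∃ x, (∀ i, x i ≠ 0) ∧ q x ≠ 0 ∧ r x ≠ 0) : AlgDC (embQ T) := by
  have h01 : ∀ x, inner ℝ (omega (embQ T) x 0) (omega (embQ T) x 1) = 0 := fun x => by
    rw [h0, h1, inner_icx]; simp
  obtain ⟨x, hx, hq, hr⟩ := h
  have e0 : omega (embQ T) x 0 ≠ 0 := by rw [h0, Ne, icx_eq_zero]; simpa using hq
  have e1 : omega (embQ T) x 1 ≠ 0 := by rw [h1, Ne, icx_eq_zero]; simpa using hr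
  refine ⟨isotropic_embQ T, fun x i j hij => ?_, x, ⟨hx, fun h => e0 ?_⟩, fun i => ?_⟩
  · fin_cases i <;> fin_cases j <;> first | exact absurd rfl hij | exact h01 x |
      (rw [real_inner_comm]; exact h01 x)
  · exact (isotropic_embQ T).omega_eq_zero_of_eq_zero (hx 0) h
  · fin_cases i <;> assumption

lemma algDC_polarT : AlgDC (embQ polarT) :=
  algDC_embQ omega_polarT_zero omega_polarT_one ⟨![![1, 1], ![1, 0]], by
    intro i; fin_cases i <;> simp, by simp, by simp⟩

lemma algDC_cartT : AlgDC (embQ cartT) :=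
  algDC_embQ omega_cartT_zero omega_cartT_one ⟨![![1, 0], ![1, 0]], by
    intro i; fin_cases i <;> simp, by simp, by simp⟩

lemma eval_polarT (H : Herm) (x) : H.eval (polarT x) =
    (x 1 0 ^ 2 + x 1 1 ^ 2) * (H.α * x 0 1 ^ 2 + H.γ * x 0 0 ^ 2) +
      2 * (x 0 0 * x 0 1) * (H.β * (x 1 0 + I * x 1 1) ^ 2).re := by
  rw [polarT_apply]
  simp [Herm.eval, normSq_apply, pow_two]
  ring

lemma eval_cartT (H : Herm) (x) : H.eval (cartT x) =
    H.α * (x 0 1 ^ 2 * x 1 0 ^ 2 + x 0 0 ^ 2 * x 1 1 ^ 2) +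
      2 * (x 0 0 * x 1 0) * (H.β.re * (x 0 1 * x 1 0) - H.β.im * (x 0 0 * x 1 1)) +
      H.γ * (x 0 0 ^ 2 * x 1 0 ^ 2) := by
  rw [cartT_apply]
  simp [Herm.eval, normSq_apply, pow_two]
  ring

lemma exists_eval_polarT_ne_zero {H : Herm} (hH : H.NonZero) :
    ∃ x, (∀ i, omega (embQ polarT) x i ≠ 0) ∧ H.eval (polarT x) ≠ 0 := by
  by_contra hc
  push Not at hc
  have h : ∀ s a b : ℝ, s ≠ 0 → a ^ 2 + b ^ 2 ≠ 0 → (a ^ 2 + b ^ 2) * (H.α * s ^ 2 + H.γ) +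
      2 * s * (H.β * (a + I * b) ^ 2).re = 0 := by
    intro s a b hs hab
    have := hc ![![1, s], ![a, b]] (by
      intro i
      fin_cases i
      · change omega _ _ 0 ≠ 0
        rw [omega_polarT_zero, Ne, icx_eq_zero]; exact_mod_cast hab
      · change omega _ _ 1 ≠ 0
        rw [omega_polarT_one, Ne, icx_eq_zero]; simpa using hs)
    rw [eval_polarT] at this
    simpa using this
  have h1 := h 1 1 0 (by simp) (by simp)
  have h2 := h (-1) 1 0 (by simp) (by simp)
  have h3 := h 1 1 1 (by simp) (by norm_num)
  have h4 := h (-1) 1 1 (by simp) (by norm_num)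
  have h5 := h 2 1 0 (by simp) (by simp)
  simp [pow_two] at h1 h2 h3 h4 h5
  have a1 : H.α = 0 := by linarith
  have a2 : H.γ = 0 := by linarith
  have a3 : H.β = 0 := Complex.ext (by simp; linarith) (by simp; linarith)
  simp [Herm.NonZero, a1, a2, a3] at hH

lemma exists_eval_cartT_ne_zero {H : Herm} (hH : H.NonZero) :
    ∃ x, (∀ i, omega (embQ cartT) x i ≠ 0) ∧ H.eval (cartT x) ≠ 0 := by
  by_contra hc
  push Not at hc
  have h : ∀ s t : ℝ, H.α * (s ^ 2 + t ^ 2) + 2 * (H.β.re * s - H.β.im * t) + H.γ = 0 := by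
    intro s t
    have := hc ![![1, s], ![1, t]] (by
      intro i
      fin_cases i
      · change omega _ _ 0 ≠ 0
        rw [omega_cartT_zero, Ne, icx_eq_zero]; simp
      · change omega _ _ 1 ≠ 0
        rw [omega_cartT_one, Ne, icx_eq_zero]; simp)
    rw [eval_cartT] at this
    simpa using this
  have h1 := h 0 0
  have h2 := h 1 0
  have h3 := h (-1) 0
  have h4 := h 0 1
  have a2 : H.γ = 0 := by linarith
  have a1 : H.α = 0 := by linarith
  have a3 : H.β = 0 := Complex.ext (by simp; linarith) (by simp; linarith)
  simp [Herm.NonZero, a1, a2, a3] at hH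

/-- The complex bilinear map defines a two-dimensional system in the base plane. -/
def IsBase (T : TMap 2) : Prop := TEquiv polarT T ∨ TEquiv cartT T

lemma TEquiv.eq_act {T₀ T : TMap 2} {σ g} {a b c d : ℂ} (hd : a * d - b * c ≠ 0)
    (h : ∀ x, T x = cmat a b c d (T₀ (subst σ g x))) :
    ∃ M k, IsSim M ∧ k ≠ 0 ∧ (∀ p, rmul (M (emb p)) k = emb (cmat a b c d p)) ∧
      embQ T = act M σ g k (embQ T₀) := by
  obtain ⟨z, hz⟩ := IsAlgClosed.exists_pow_nat_eq (a * d - b * c) (n := 2) (by norm_num)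
  have hz0 : z ≠ 0 := by rintro rfl; apply hd; rw [← hz]; simp
  have h1 : (a / z) * (d / z) - (b / z) * (c / z) = 1 := by
    field_simp; rw [hz]
  have h2 : ∀ p, rmul (cxMat (a / z) (b / z) (c / z) (d / z) (emb p)) (cx z) =
      emb (cmat a b c d p) := fun p => by
    rw [cxMat_emb, ← emb_smul]
    congr 1
    ext1 <;> simp [cmat_apply] <;> field_simp
  refine ⟨_, cx z, isSim_cxMat h1, by rwa [Ne, cx_eq_zero], h2, MultilinearMap.ext fun x => ?_⟩
  rw [act_apply, embQ_apply, embQ_apply, h2, h]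

lemma TEquiv.rel_embQ {T₀ T : TMap 2} (h : TEquiv T₀ T) : Rel (embQ T₀) (embQ T) := by
  obtain ⟨σ, g, a, b, c, d, hd, h⟩ := h
  obtain ⟨M, k, hM, hk, -, h⟩ := TEquiv.eq_act hd h
  exact ⟨M, hM, σ, g, k, hk, h⟩

lemma IsBase.algDC {T : TMap 2} (h : IsBase T) : AlgDC (embQ T) :=
  h.elim (fun h => h.rel_embQ.algDC algDC_polarT) fun h => h.rel_embQ.algDC algDC_cartT

lemma isBase_iff {T : TMap 2} : IsBase T ↔ AlgDC (embQ T) := ⟨IsBase.algDC, AlgDC.tEquiv⟩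

lemma IsBase.algDC_pencilForm {T : TMap 2} (h : IsBase T) {H : Herm} (hH : H.NonZero) :
    AlgDC (pencilForm T H) := by
  rcases h with h | h <;> obtain ⟨a, b, c, d, hd, hr⟩ := h.rel_pencilForm H
  · exact hr.algDC (DupinCyclidic.algDC_pencilForm algDC_polarT
      (exists_eval_polarT_ne_zero (hH.pull hd)))
  · exact hr.algDC (DupinCyclidic.algDC_pencilForm algDC_cartT
      (exists_eval_cartT_ne_zero (hH.pull hd)))

/-! ### Normal forms -/

lemma rel_pencilForm_symm {T : TMap 2} (H : Herm) {σ g} {a b c d z : ℂ}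
    (hd : a * d - b * c ≠ 0) (hz : z ≠ 0) (h : ∀ x, cmat a b c d (T x) = z • T (subst σ g x)) :
    Rel (pencilForm T (H.pull a b c d)) (pencilForm T H) := by
  refine (rel_pencilForm_cmat (T' := (cmat a b c d).compMultilinearMap T) H hd
    fun x => rfl).trans ?_
  refine (rel_pencilForm_smul (T' := (cmat z⁻¹ 0 0 z⁻¹ ∘ₗ cmat a b c d).compMultilinearMap T) H
    (inv_ne_zero hz) fun x => ?_).trans (rel_pencilForm_subst (σ := σ) (g := g) H fun x => ?_).symm
  · change cmat z⁻¹ 0 0 z⁻¹ (cmat a b c d (T x)) = z⁻¹ • cmat a b c d (T x)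
    rw [cmat_apply z⁻¹]
    ext1 <;> simp
  · change cmat z⁻¹ 0 0 z⁻¹ (cmat a b c d (T x)) = _
    rw [h, cmat_apply]
    ext1 <;> simp [hz]

lemma subst2 (g h : GL (Fin 2) ℝ) (x : Fin 2 → Fin 2 → ℝ) :
    subst 1 ![g, h] x = ![g.1.mulVec (x 0), h.1.mulVec (x 1)] := by
  funext i; fin_cases i <;> rfl

lemma rel_polarT_scale (H : Herm) {l : ℝ} (hl : l ≠ 0) :
    Rel (pencilForm polarT H) (pencilForm polarT ⟨l ^ 2 * H.α, l * H.β, H.γ⟩) := by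
  have := (rel_pencilForm_symm (T := polarT) H (σ := 1)
    (g := ![diagGL 1 l ⟨one_ne_zero, hl⟩, diagGL 1 1 ⟨one_ne_zero, one_ne_zero⟩])
    (a := l) (b := 0) (c := 0) (d := 1) (z := 1) (by simpa using hl) one_ne_zero fun x => by
      rw [subst2, diagGL_mulVec, diagGL_mulVec, polarT_apply, polarT_apply]
      simp [cmat_apply, mul_assoc]).symm
  convert this using 2
  refine Herm.ext' ?_ ?_ ?_
  · simp [Herm.pull, Herm.eval, normSq_apply]; ring
  · simp [Herm.pull]; ring
  · simp [Herm.pull, Herm.eval]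

lemma rel_polarT_rotate (H : Herm) {z : ℂ} (hz : normSq z = 1) :
    Rel (pencilForm polarT H) (pencilForm polarT ⟨H.α, z * H.β, H.γ⟩) := by
  obtain ⟨w, rfl⟩ := IsAlgClosed.exists_pow_nat_eq z (n := 2) (by norm_num)
  have hw : w.re * w.re + w.im * w.im = 1 := by
    rw [map_pow, pow_eq_one_iff_of_nonneg (normSq_nonneg w) (by norm_num)] at hz
    rw [← normSq_apply, hz]
  have hwc : conj w * w = 1 := by
    rw [← normSq_eq_conj_mul_self, normSq_apply, hw]; simp
  have := (rel_pencilForm_symm (T := polarT) H (σ := 1)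
    (g := ![diagGL 1 1 ⟨one_ne_zero, one_ne_zero⟩, colGL ![w.re, w.im] ![-w.im, w.re]
      (by simp [wedge, hw])])
    (a := conj w) (b := 0) (c := 0) (d := w) (z := 1)
    (by rw [hwc]; simp) one_ne_zero fun x => by
      rw [subst2, diagGL_mulVec, colGL_mulVec, polarT_apply, polarT_apply]
      refine Prod.ext (Complex.ext ?_ ?_) (Complex.ext ?_ ?_) <;> simp [cmat_apply] <;> ring).symm
  convert this using 2
  refine Herm.ext' ?_ ?_ ?_
  · simp [Herm.pull, Herm.eval, normSq_apply, hw]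
  · simp [Herm.pull]; ring
  · simp [Herm.pull, Herm.eval, normSq_apply, hw]

lemma rel_polarT_swap (H : Herm) :
    Rel (pencilForm polarT H) (pencilForm polarT ⟨H.γ, conj H.β, H.α⟩) := by
  have := (rel_pencilForm_symm (T := polarT) H (σ := 1)
    (g := ![colGL ![0, 1] ![1, 0] (by simp [wedge]), diagGL 1 (-1) (by simp)])
    (a := 0) (b := 1) (c := 1) (d := 0) (z := 1) (by simp) one_ne_zero fun x => by
      rw [subst2, diagGL_mulVec, colGL_mulVec, polarT_apply, polarT_apply]
      simp [cmat_apply, sub_eq_add_neg]).symm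
  convert this using 2
  refine Herm.ext' ?_ ?_ ?_ <;> simp [Herm.pull, Herm.eval]

lemma rel_polarT {H K : Herm} {c l : ℝ} (hc : c ≠ 0) (hl : l ≠ 0) (hα : K.α = c * l ^ 2 * H.α)
    (hβ : normSq K.β = c ^ 2 * l ^ 2 * normSq H.β) (hγ : K.γ = c * H.γ) :
    Rel (pencilForm polarT H) (pencilForm polarT K) := by
  have h1 := (rel_polarT_scale H hl).trans (rel_pencilForm_scale polarT _ hc)
  by_cases h0 : H.β = 0
  · have hK : K.β = 0 := by simpa [h0] using hβ
    convert h1 using 2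
    refine Herm.ext' ?_ ?_ ?_ <;> simp [Herm.scale, h0, hK, hα, hγ]; ring
  · have hz : normSq (K.β / (c * l * H.β)) = 1 := by
      have : normSq H.β ≠ 0 := by simpa using h0
      simp only [map_div₀, map_mul, normSq_ofReal, hβ]
      field_simp
    refine h1.trans ?_
    convert rel_polarT_rotate _ hz using 2
    have hc' : (c : ℂ) ≠ 0 := by exact_mod_cast hc
    have hl' : (l : ℂ) ≠ 0 := by exact_mod_cast hl
    refine Herm.ext' ?_ ?_ ?_
    · simp [Herm.scale, hα]; ring
    · simp [Herm.scale]; field_simp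
    · simp [Herm.scale, hγ]

lemma rel_polarT_of_mul_pos {H K : Herm} (h : 0 < H.α * H.γ * (K.α * K.γ))
    (hβ : normSq H.β * (K.α * K.γ) = normSq K.β * (H.α * H.γ)) :
    Rel (pencilForm polarT H) (pencilForm polarT K) := by
  have hHα : H.α ≠ 0 := by rintro h0; simp [h0] at h
  have hHγ : H.γ ≠ 0 := by rintro h0; simp [h0] at h
  have hKα : K.α ≠ 0 := by rintro h0; simp [h0] at h
  have hKγ : K.γ ≠ 0 := by rintro h0; simp [h0] at h
  have hpos : 0 < K.α * H.γ / (H.α * K.γ) := by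
    have : K.α * H.γ / (H.α * K.γ) = H.α * H.γ * (K.α * K.γ) / (H.α * K.γ) ^ 2 := by
      field_simp
    rw [this]; positivity
  have hs := sq_sqrt hpos.le
  refine rel_polarT (c := K.γ / H.γ) (l := sqrt (K.α * H.γ / (H.α * K.γ)))
    (div_ne_zero hKγ hHγ) (sqrt_pos.2 hpos).ne' ?_ ?_ ?_
  · rw [hs]; field_simp
  · rw [hs]; field_simp; linear_combination (-1 : ℝ) * hβ
  · field_simp

lemma rel_polarT_of_gamma_eq_zero {H K : Herm} (hH : H.α ≠ 0) (hK : K.α ≠ 0) (hH0 : H.γ = 0)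
    (hK0 : K.γ = 0) (hβ : H.β = 0 ↔ K.β = 0) :
    Rel (pencilForm polarT H) (pencilForm polarT K) := by
  by_cases h0 : H.β = 0
  · have := hβ.1 h0
    refine rel_polarT (c := K.α / H.α) (l := 1) (div_ne_zero hK hH) one_ne_zero ?_ ?_ ?_
    · field_simp
    · simp [h0, this]
    · simp [hH0, hK0]
  · have h1 : K.β ≠ 0 := fun h => h0 (hβ.2 h)
    have h2 : normSq H.β ≠ 0 := by simpa using h0
    have h3 : normSq K.β ≠ 0 := by simpa using h1
    have h4 : 0 < normSq K.β / normSq H.β :=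
      div_pos (normSq_pos.2 h1) (normSq_pos.2 h0)
    set e := sqrt (normSq K.β / normSq H.β) with he
    have he0 : e ≠ 0 := (sqrt_pos.2 h4).ne'
    have he2 : e ^ 2 = normSq K.β / normSq H.β := sq_sqrt h4.le
    refine rel_polarT (c := e ^ 2 * H.α / K.α) (l := K.α / (e * H.α))
      (by positivity) (by positivity) ?_ ?_ ?_
    · field_simp
    · have : (e ^ 2 * H.α / K.α) ^ 2 * (K.α / (e * H.α)) ^ 2 = e ^ 2 := by field_simp
      rw [this, he2]; field_simp
    · simp [hH0, hK0]

lemma rel_polarT_of_alpha_gamma_eq_zero {H K : Herm} (hH : H.α = 0) (hK : K.α = 0) (hH0 : H.γ = 0)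
    (hK0 : K.γ = 0) (hβ : H.β ≠ 0) (hβ' : K.β ≠ 0) :
    Rel (pencilForm polarT H) (pencilForm polarT K) := by
  have h2 : normSq H.β ≠ 0 := by simpa using hβ
  have h4 : 0 < normSq K.β / normSq H.β :=
    div_pos (normSq_pos.2 hβ') (normSq_pos.2 hβ)
  refine rel_polarT (c := sqrt (normSq K.β / normSq H.β)) (l := 1)
    (sqrt_pos.2 h4).ne' one_ne_zero (by simp [hH, hK]) ?_ (by simp [hH0, hK0])
  rw [sq_sqrt h4.le]; field_simp

/-- One of the diagonal coefficients of a Hermitian form vanishes, and the other does not. -/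
def Herm.OneZero (H : Herm) : Prop := (H.α ≠ 0 ∧ H.γ = 0) ∨ (H.α = 0 ∧ H.γ ≠ 0)

lemma Herm.OneZero.exists_rel {H : Herm} (h : H.OneZero) :
    ∃ K : Herm, K.α ≠ 0 ∧ K.γ = 0 ∧ (H.β = 0 ↔ K.β = 0) ∧
      Rel (pencilForm polarT H) (pencilForm polarT K) := by
  rcases h with h | h
  · exact ⟨H, h.1, h.2, Iff.rfl, .refl _⟩
  · exact ⟨_, h.2, h.1, by simp, rel_polarT_swap H⟩

lemma rel_polarT_of_oneZero {H K : Herm} (hH : H.OneZero) (hK : K.OneZero)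
    (hβ : H.β = 0 ↔ K.β = 0) : Rel (pencilForm polarT H) (pencilForm polarT K) := by
  obtain ⟨H', h1, h2, h3, h4⟩ := hH.exists_rel
  obtain ⟨K', k1, k2, k3, k4⟩ := hK.exists_rel
  exact (h4.trans (rel_polarT_of_gamma_eq_zero h1 k1 h2 k2 (by tauto))).trans k4.symm

lemma rel_cartT_translate (H : Herm) (z : ℂ) :
    Rel (pencilForm cartT (H.pull 1 z 0 1)) (pencilForm cartT H) := by
  refine rel_pencilForm_symm (T := cartT) H (σ := 1)
    (g := ![colGL ![1, z.re] ![0, 1] (by simp [wedge]), colGL ![1, -z.im] ![0, 1]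
      (by simp [wedge])]) (z := 1) (by simp) one_ne_zero fun x => ?_
  rw [subst2, colGL_mulVec, colGL_mulVec, cartT_apply, cartT_apply]
  refine Prod.ext (Complex.ext ?_ ?_) (Complex.ext ?_ ?_) <;> simp [cmat_apply] <;> ring

lemma rel_cartT_scale (H : Herm) {l : ℝ} (hl : l ≠ 0) :
    Rel (pencilForm cartT (H.pull l 0 0 1)) (pencilForm cartT H) := by
  refine rel_pencilForm_symm (T := cartT) H (σ := 1)
    (g := ![diagGL 1 l ⟨one_ne_zero, hl⟩, diagGL 1 l ⟨one_ne_zero, hl⟩])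
    (z := 1) (by simpa using hl) one_ne_zero fun x => ?_
  rw [subst2, diagGL_mulVec, diagGL_mulVec, cartT_apply, cartT_apply]
  refine Prod.ext (Complex.ext ?_ ?_) (Complex.ext ?_ ?_) <;> simp [cmat_apply] <;> ring

lemma rel_cartT_normal {H : Herm} (hα : H.α ≠ 0) :
    Rel (pencilForm cartT H) (pencilForm cartT ⟨1, 0, SignType.sign H.det⟩) := by
  have hα' : (H.α : ℂ) ≠ 0 := by exact_mod_cast hα
  have h1 := rel_cartT_translate H (-H.β / H.α)
  have e1 : H.pull 1 (-H.β / H.α) 0 1 = ⟨H.α, 0, H.det / H.α⟩ := by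
    refine Herm.ext' ?_ ?_ ?_
    · simp [Herm.pull, Herm.eval]
    · simp [Herm.pull]; field_simp; simp
    · simp [Herm.pull, Herm.eval, Herm.det, normSq_apply]
      field_simp; ring
  rw [e1] at h1
  have h2 : Rel (pencilForm cartT ⟨H.α, 0, H.det / H.α⟩)
      (pencilForm cartT ⟨1, 0, H.det / H.α ^ 2⟩) := by
    convert rel_pencilForm_scale cartT _ (inv_ne_zero hα) using 2
    refine Herm.ext' ?_ ?_ ?_
    · simp [Herm.scale, hα]
    · simp [Herm.scale]
    · simp [Herm.scale]; field_simp
  refine h1.symm.trans (h2.trans ?_)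
  by_cases hd : H.det = 0
  · simpa [hd] using Rel.refl _
  · have hs : sqrt |H.det| / H.α ≠ 0 := div_ne_zero (by positivity) hα
    have h3 := (rel_cartT_scale ⟨1, 0, H.det / H.α ^ 2⟩ hs).symm
    refine h3.trans ?_
    convert rel_pencilForm_scale cartT _ (c := H.α ^ 2 / |H.det|) (by positivity) using 2
    have h5 : sqrt |H.det| ^ 2 = |H.det| := sq_sqrt (abs_nonneg _)
    refine Herm.ext' ?_ ?_ ?_
    · simp only [Herm.scale, Herm.pull, Herm.eval, normSq_ofReal]
      simp only [map_zero, mul_zero, add_zero, ← pow_two, div_pow, h5, zero_mul]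
      field_simp
      simp
    · simp [Herm.scale, Herm.pull]
    · simp [Herm.scale, Herm.pull, Herm.eval]
      rw [eq_comm, div_mul_div_comm, mul_comm, mul_div_mul_right _ _ (by positivity)]
      rcases lt_or_gt_of_ne hd with h | h
      · rw [abs_of_neg h, sign_neg h]; field_simp; simp
      · rw [abs_of_pos h, sign_pos h]; field_simp; simp

lemma rel_cartT {H K : Herm} (hH : H.α ≠ 0) (hK : K.α ≠ 0)
    (h : SignType.sign H.det = SignType.sign K.det) :
    Rel (pencilForm cartT H) (pencilForm cartT K) := by
  have := rel_cartT_normal hH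
  rw [h] at this
  exact this.trans (rel_cartT_normal hK).symm

lemma rel_cartT_of_alpha_beta_eq_zero {H K : Herm} (hH : H.α = 0) (hK : K.α = 0) (hH0 : H.β = 0)
    (hK0 : K.β = 0) (hγ : H.γ ≠ 0) (hγ' : K.γ ≠ 0) :
    Rel (pencilForm cartT H) (pencilForm cartT K) := by
  convert rel_pencilForm_scale cartT H (div_ne_zero hγ' hγ) using 2
  refine Herm.ext' ?_ ?_ ?_ <;> simp [Herm.scale, hH, hK, hH0, hK0]
  field_simp

/-! ### Charts of M-spheres -/

/-- The similarity `M` maps the base plane to `S`. -/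
def IsChart (M : ℍ² →ₗ[ℝ] ℍ²) (S : Set (OnePoint ℍ[ℝ])) : Prop :=
  IsSim M ∧ ∀ X, X ≠ 0 → form X X = 0 → (toPoint (M X) ∈ S ↔ toPoint X ∈ basePlane)

/-- The unit quaternion `k`, which is the normal of the base plane. -/
noncomputable def qk : ℍ[ℝ] := quat 0 0 0 1

lemma qk_mul_qk : qk * qk = -1 := by ext <;> simp [qk]

lemma qk_ne_zero : qk ≠ 0 := fun h => by simpa [qk] using congrArg QuaternionAlgebra.imK h

lemma star_qk : star qk = -qk := star_eq_neg_of_re rfl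

lemma inner_mul_right_mul (p q h : ℍ[ℝ]) :
    inner ℝ (p * h) (q * h) = ‖h‖ ^ 2 * inner ℝ p q := by
  rw [← real_inner_self_eq_norm_sq]
  simp only [inner_def, Quaternion.re_mul, Quaternion.imI_mul, Quaternion.imJ_mul,
    Quaternion.imK_mul, Quaternion.re_star, Quaternion.imI_star, Quaternion.imJ_star,
    Quaternion.imK_star]
  ring

lemma inner_mul_left_mul (p q h : ℍ[ℝ]) :
    inner ℝ (h * p) (h * q) = ‖h‖ ^ 2 * inner ℝ p q := by
  rw [← real_inner_self_eq_norm_sq]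
  simp only [inner_def, Quaternion.re_mul, Quaternion.imI_mul, Quaternion.imJ_mul,
    Quaternion.imK_mul, Quaternion.re_star, Quaternion.imI_star, Quaternion.imJ_star,
    Quaternion.imK_star]
  ring

lemma div_re_of_isotropic {X : ℍ²} (hX : form X X = 0) (h : X.2 ≠ 0) :
    (X.1 * X.2⁻¹).re = 0 := (form_self_eq_zero_iff X h).1 hX

lemma toPoint_of_ne_zero {X : ℍ²} (h : X.2 ≠ 0) :
    toPoint X = ((X.1 * X.2⁻¹ : ℍ[ℝ]) : OnePoint ℍ[ℝ]) := by simp [toPoint, h]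

lemma toPoint_of_eq_zero {X : ℍ²} (h : X.2 = 0) : toPoint X = ∞ := by simp [toPoint, h]

lemma toPoint_mem_plane {X : ℍ²} (hX : form X X = 0) (ν : ℍ[ℝ]) (d : ℝ) :
    toPoint X ∈ plane ν d ↔ inner ℝ X.1 (ν * X.2) = d * ‖X.2‖ ^ 2 := by
  by_cases h : X.2 = 0
  · rw [toPoint_of_eq_zero h]; simp [infty_mem_plane, h]
  · rw [toPoint_of_ne_zero h, coe_mem_plane]
    have h1 : X.1 = X.1 * X.2⁻¹ * X.2 := by rw [mul_assoc, inv_mul_cancel₀ h, mul_one]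
    conv_rhs => rw [h1, inner_mul_right_mul, mul_comm d]
    have h2 : ‖X.2‖ ^ 2 ≠ 0 := by simpa using h
    rw [mul_right_inj' h2, real_inner_comm]
    simp [div_re_of_isotropic hX h]

lemma coe_mem_sphere {c p : ℍ[ℝ]} {r : ℝ} :
    (p : OnePoint ℍ[ℝ]) ∈ sphere c r ↔ p.re = 0 ∧ ‖p - c‖ = r := by
  simp [sphere, mem_ofPred_eq]

lemma infty_notMem_sphere {c : ℍ[ℝ]} {r : ℝ} : ∞ ∉ sphere c r := by simp [sphere]

lemma toPoint_mem_sphere {X : ℍ²} (hX : form X X = 0) (c : ℍ[ℝ]) (r : ℝ) :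
    toPoint X ∈ sphere c r ↔ X.2 ≠ 0 ∧ ‖X.1 - c * X.2‖ = r * ‖X.2‖ := by
  by_cases h : X.2 = 0
  · rw [toPoint_of_eq_zero h]; simp [infty_notMem_sphere, h]
  · rw [toPoint_of_ne_zero h, coe_mem_sphere]
    have h1 : X.1 - c * X.2 = (X.1 * X.2⁻¹ - c) * X.2 := by
      rw [sub_mul, mul_assoc, inv_mul_cancel₀ h, mul_one]
    rw [h1, norm_mul, mul_left_inj' (by simpa using h)]
    simp [div_re_of_isotropic hX h, h]

/-- The rotation by `q`, followed by the translation by the image of `d k`. -/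
noncomputable def planeMat (q : ℍ[ℝ]) (d : ℝ) : ℍ² →ₗ[ℝ] ℍ² :=
  qmat q (d • (q * qk)) 0 q

lemma planeMat_apply (q : ℍ[ℝ]) (d : ℝ) (X) :
    planeMat q d X = (q * X.1 + (d • (q * qk)) * X.2, q * X.2) := by
  simp [planeMat, qmat_apply]

lemma coe_norm_sq (q : ℍ[ℝ]) : star q * q = ((‖q‖ ^ 2 : ℝ) : ℍ[ℝ]) := by
  rw [Quaternion.star_mul_self, Quaternion.normSq_eq_norm_mul_self, pow_two]

lemma isSim_planeMat {q : ℍ[ℝ]} (hq : q ≠ 0) (d : ℝ) : IsSim (planeMat q d) := by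
  refine isSim_qmat (by simp) ?_ (‖q‖ ^ 2) (by simpa using hq) (by simpa using coe_norm_sq q)
  simp only [Quaternion.star_smul, star_mul, star_qk, smul_mul_assoc, mul_smul_comm]
  rw [mul_assoc, ← mul_assoc (star q) q qk, coe_norm_sq, Quaternion.coe_commutes, ← smul_add]
  noncomm_ring
  simp

lemma isChart_planeMat {q ν : ℍ[ℝ]} (hq : q ≠ 0) (d : ℝ) (hν : ν * q = q * qk)
    (h1 : ‖ν‖ = 1) : IsChart (planeMat q d) (plane ν d) := by
  refine ⟨isSim_planeMat hq d, fun X hX h0 => ?_⟩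
  rw [toPoint_mem_plane (((isSim_planeMat hq d).isotropic_iff X).2 h0), basePlane,
    toPoint_mem_plane h0, planeMat_apply]
  simp only
  have e : q * X.1 + (d • (q * qk)) * X.2 = q * (X.1 + d • (qk * X.2)) := by
    rw [mul_add, mul_smul_comm, smul_mul_assoc, mul_assoc]
  rw [← mul_assoc, hν, e, mul_assoc, inner_mul_left_mul, norm_mul, inner_add_left,
    inner_smul_left, real_inner_self_eq_norm_sq, norm_mul]
  have hk : ‖qk‖ = 1 := by
    have := congrArg norm hν
    rw [norm_mul, norm_mul, h1, one_mul] at this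
    have h3 : ‖q‖ ≠ 0 := by simpa using hq
    nlinarith [mul_left_cancel₀ h3 (this.symm.trans (mul_one ‖q‖).symm)]
  rw [hk, mul_pow]
  have h2 : ‖q‖ ^ 2 ≠ 0 := by simpa using hq
  simp only [conj_trivial, zero_mul]
  constructor
  · intro h
    have : ‖q‖ ^ 2 * inner ℝ X.1 (qk * X.2) = 0 := by linarith
    exact (mul_eq_zero.1 this).resolve_left h2
  · intro h
    change inner ℝ X.1 (qk * X.2) = 0 at h
    rw [h]; ring

/-- The Cayley transformation that maps the base plane to the sphere with centre `c` and
radius `r`. -/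
noncomputable def sphereMat (c : ℍ[ℝ]) (r : ℝ) : ℍ² →ₗ[ℝ] ℍ² :=
  qmat (r - c * qk) (c - r * qk) (-qk) 1

lemma sphereMat_apply (c : ℍ[ℝ]) (r : ℝ) (X) : sphereMat c r X =
    (r • (X.1 - qk * X.2) + c * (X.2 - qk * X.1), X.2 - qk * X.1) := by
  simp only [sphereMat, qmat_apply, ← coe_mul_eq_smul]
  ext1 <;> (simp only; noncomm_ring)

lemma isSim_sphereMat {c : ℍ[ℝ]} (hc : c.re = 0) {r : ℝ} (hr : r ≠ 0) : IsSim (sphereMat c r) := by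
  have h1 := star_eq_neg_of_re hc
  have h2 : (r : ℍ[ℝ]) * qk = qk * r := Quaternion.coe_commutes _ _
  refine isSim_qmat ?_ ?_ (2 * r) (by simpa using hr) ?_
  · simp only [star_sub, star_mul, star_neg, star_qk, h1, Quaternion.star_coe]
    rw [sub_mul, mul_neg, h2]; noncomm_ring
  · simp only [star_sub, star_mul, star_qk, h1, Quaternion.star_coe, star_one]
    rw [mul_one, one_mul, neg_mul, ← h2]; abel
  · simp only [star_sub, star_mul, star_neg, star_qk, h1, Quaternion.star_coe]
    have h3 : qk * (r * qk) = - (r : ℍ[ℝ]) := by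
      rw [← mul_assoc, ← h2, mul_assoc, qk_mul_qk, mul_neg, mul_one]
    push_cast
    have : (r : ℍ[ℝ]) - -qk * -c + - -qk * (c - r * qk) = r - qk * (r * qk) := by noncomm_ring
    rw [mul_one, this, h3, ← Quaternion.coe_mul, two_mul, Quaternion.coe_add]; abel

lemma isChart_sphereMat {c : ℍ[ℝ]} (hc : c.re = 0) {r : ℝ} (hr : 0 < r) :
    IsChart (sphereMat c r) (sphere c r) := by
  refine ⟨isSim_sphereMat hc hr.ne', fun X hX h0 => ?_⟩
  rw [toPoint_mem_sphere (((isSim_sphereMat hc hr.ne').isotropic_iff X).2 h0), basePlane,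
    toPoint_mem_plane h0, sphereMat_apply]
  simp only [add_sub_cancel_right]
  have hk : ∀ p : ℍ[ℝ], ‖qk * p‖ ^ 2 = ‖p‖ ^ 2 := fun p => by
    rw [← real_inner_self_eq_norm_sq, ← real_inner_self_eq_norm_sq, inner_def,
      inner_def]
    simp [qk]; ring
  have e0 : inner ℝ X.2 (qk * X.1) = - inner ℝ X.1 (qk * X.2) := by
    simp [inner_def, qk]; ring
  have e : ‖X.1 - qk * X.2‖ ^ 2 - ‖X.2 - qk * X.1‖ ^ 2 = -4 * inner ℝ X.1 (qk * X.2) := by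
    rw [norm_sub_sq_real, norm_sub_sq_real, hk, hk, e0]; ring
  rw [norm_smul, Real.norm_of_nonneg hr.le, mul_right_inj' hr.ne']
  rw [zero_mul]
  change _ ↔ inner ℝ X.1 (qk * X.2) = 0
  constructor
  · rintro ⟨-, h⟩
    rw [h] at e; linarith
  · intro h
    rw [h] at e
    have h1 : ‖X.1 - qk * X.2‖ = ‖X.2 - qk * X.1‖ := by
      rw [← sq_eq_sq₀ (norm_nonneg _) (norm_nonneg _)]; linarith
    refine ⟨fun h2 => hX ?_, h1⟩
    rw [h2, norm_zero, norm_eq_zero] at h1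
    have h3 : X.2 = qk * X.1 := sub_eq_zero.1 h2
    have h4 : X.1 = qk * X.2 := sub_eq_zero.1 h1
    have h5 : X.1 = 0 := by
      have : X.1 = -X.1 := by
        conv_lhs => rw [h4, h3, ← mul_assoc, qk_mul_qk, neg_one_mul]
      have h6 : (2 : ℝ) • X.1 = 0 := by rw [two_smul]; nth_rewrite 1 [this]; simp
      exact (smul_eq_zero.1 h6).resolve_left two_ne_zero
    exact Prod.ext h5 (by rw [h3, h5]; simp)

lemma exists_rotation {ν : ℍ[ℝ]} (h0 : ν.re = 0) (h1 : ‖ν‖ = 1) :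
    ∃ q, q ≠ 0 ∧ ν * q = q * qk := by
  have h2 := mul_self_of_re h0
  rw [h1] at h2
  by_cases h : 1 - ν * qk = 0
  · refine ⟨quat 0 1 0 0, fun h => by simpa using congrArg QuaternionAlgebra.imI h, ?_⟩
    have h3 : ν = -qk := by
      have : ν * qk * qk = qk := by rw [← sub_eq_zero.1 h, one_mul]
      rw [mul_assoc, qk_mul_qk, mul_neg, mul_one] at this
      rw [← this, neg_neg]
    rw [h3]; ext <;> simp [qk]
  · refine ⟨1 - ν * qk, h, ?_⟩
    rw [mul_sub, ← mul_assoc, h2, sub_mul, mul_assoc, qk_mul_qk]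
    push_cast
    noncomm_ring

lemma IsMSphere.exists_chart {S} (hS : IsMSphere S) : ∃ M, IsChart M S := by
  rcases hS with ⟨c, r, hc, hr, rfl⟩ | ⟨ν, d, h0, h1, rfl⟩
  · exact ⟨_, isChart_sphereMat hc hr⟩
  · have hn : ‖ν‖ ≠ 0 := by simpa using h1
    have e : plane ν d = plane (‖ν‖⁻¹ • ν) (‖ν‖⁻¹ * d) := by
      unfold plane
      congr 2
      ext p
      simp only [mem_ofPred_eq, inner_smul_left, conj_trivial, mul_right_inj' (inv_ne_zero hn)]
    have h2 : ‖‖ν‖⁻¹ • ν‖ = 1 := by rw [norm_smul, norm_inv, norm_norm, inv_mul_cancel₀ hn]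
    obtain ⟨q, hq, h⟩ := exists_rotation (ν := ‖ν‖⁻¹ • ν) (by simp [h0]) h2
    exact ⟨_, e ▸ isChart_planeMat hq _ h h2⟩

lemma IsChart.exists_base {M S} (hM : IsChart M S) {P : QMap 2} (hP : AlgDC P)
    (h : LiesOn P S) : ∃ T k, IsBase T ∧ k ≠ 0 ∧ ∀ x, P x = rmul (M (emb (T x))) k := by
  obtain ⟨N, hN, h1, h2⟩ := hM.1.exists_inverse
  have e : ∀ x, act N 1 1 1 P x = N (P x) := fun x => by rw [act_apply, subst_one, rmul_one]
  have hA : AlgDC (act N 1 1 1 P) := algDC_act hN 1 1 one_ne_zero hP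
  obtain ⟨T, k, hk, hT⟩ := hA.exists_complex (fun x hx => by
    rw [val_eq_toPoint, e, ← hM.2 _ (hN.map_eq_zero.not.2 ?_) ((hN.isotropic_iff _).2
      (hP.isotropic x)), h2]
    · refine h x ?_
      rw [defined_act hN 1 1 one_ne_zero, subst_one] at hx; exact hx
    · rw [defined_act hN 1 1 one_ne_zero, subst_one] at hx; exact hx.2)
  refine ⟨T, k, ?_, hk, fun x => ?_⟩
  · rw [isBase_iff]
    refine Rel.algDC ⟨LinearMap.id, isSim_id, 1, 1, k⁻¹, inv_ne_zero hk,
      MultilinearMap.ext fun x => ?_⟩ hA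
    rw [act_apply, subst_one, LinearMap.id_apply, hT, rmul_rmul, mul_inv_cancel₀ hk, rmul_one]
    rfl
  · rw [← hM.1.map_rmul, ← hT, e, h2]

lemma IsChart.liesOn {M S} (hM : IsChart M S) {P : QMap 2} {T : TMap 2} {k : ℍ[ℝ]} (hk : k ≠ 0)
    (h : ∀ x, P x = rmul (M (emb (T x))) k) : LiesOn P S := by
  intro x hx
  rw [val_eq_toPoint, h, toPoint_rmul _ hk]
  refine (hM.2 _ ?_ (isotropic_emb _)).2 (toPoint_emb_mem _)
  intro h0
  apply hx.2
  rw [h, h0]; simp [rmul]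

/-! ### Normals -/

lemma Isotropic.partialDeriv_of_ne_zero {D : QMap n} (hD : Isotropic D) {x} (h : (D x).2 ≠ 0) (i) :
    partialDeriv D x i = (x i 0 ^ 2 + x i 1 ^ 2) • (star (D x).2⁻¹ * omega D x i * (D x).2⁻¹) := by
  have key : ∀ τ : ℝ, D (update x i (x i + τ • ![-x i 1, x i 0])) =
      D x + τ • D (update x i ![-x i 1, x i 0]) := fun τ => by
    rw [D.map_update_add, D.map_update_smul, update_eq_self]
  unfold partialDeriv chartVal
  simp only [h, if_false, key]
  rw [(hasDerivAt_quotient (hD x) h).deriv, hD.form_tangent]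
  simp

lemma conj_eq_star (W n : ℍ[ℝ]) : W * n * W⁻¹ = ‖W‖ ^ 2 • (star W⁻¹ * n * W⁻¹) := by
  by_cases h : W = 0
  · simp [h]
  · have : W = ‖W‖ ^ 2 • star W⁻¹ := by
      have h1 : star W⁻¹ * star W = 1 := by rw [← star_mul, mul_inv_cancel₀ h, star_one]
      rw [← mul_coe_eq_smul, ← coe_norm_sq, ← mul_assoc, h1, one_mul]
    nth_rewrite 1 [this]
    simp

lemma Isotropic.inner_normal_eq_zero_iff {D : QMap n} (hD : Isotropic D) {x} (hx : Defined D x)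
    (h : (D x).2 ≠ 0) (n₀ : ℍ[ℝ]) (i) :
    inner ℝ ((D x).2 * n₀ * (D x).2⁻¹) (partialDeriv D x i) = 0 ↔ inner ℝ n₀ (omega D x i) = 0 := by
  rw [hD.partialDeriv_of_ne_zero h, conj_eq_star, inner_smul_left, inner_smul_right, inner_conj]
  have h1 := (sq_add_sq_pos (hx.1 i)).ne'
  simp [h, h1]

lemma AlgDC.exists_finite {P : QMap 2} (hP : AlgDC P) :
    ∃ x, Defined P x ∧ (P x).2 ≠ 0 ∧ ∀ i, omega P x i ≠ 0 := by
  obtain ⟨p, hp, hom⟩ := hP.exists_grid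
  have hdef : ∀ s : Fin 2 → Bool, Defined P (fun j => p j (s j)) := fun s =>
    ⟨fun j => grid_ne_zero hp j _, fun h => hom s 0
      (hP.isotropic.omega_eq_zero_of_eq_zero (grid_ne_zero hp 0 _) h)⟩
  by_contra hc
  have h0 : ∀ s : Fin 2 → Bool, (P (fun j => p j (s j))).2 = 0 := fun s => by
    by_contra h; exact hc ⟨_, hdef s, h, hom s⟩
  have h1 := hP.isotropic.form_update (fun j => p j false) 0 (p 0 false) (p 0 true)
  have h2 := h0 (update (fun _ => false) 0 false)
  have h3 := h0 (update (fun _ => false) 0 true)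
  rw [grid_update] at h2 h3
  rw [form, h2, h3] at h1
  simp only [star_zero, mul_zero, zero_mul, add_zero] at h1
  exact smul_ne_zero (hp 0) (hom (fun _ => false) 0) h1.symm

lemma omega_of_eq {M} (hM : IsSim M) {P : QMap 2} {T : TMap 2} {k : ℍ[ℝ]}
    (h : ∀ x, P x = rmul (M (emb (T x))) k) : ∃ r : ℝ, r ≠ 0 ∧ ∀ x i,
      omega P x i = r • (star k * omega (embQ T) x i * k) := by
  obtain ⟨r, hr, hM⟩ := hM.map_form
  refine ⟨r, hr, fun x i => ?_⟩
  simp only [omega, h, form_rmul, hM, embQ_apply]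
  simp

lemma inner_conj_qk (k : ℍ[ℝ]) (z : ℂ) : inner ℝ (k⁻¹ * qk * k) (star k * icx z * k) = 0 := by
  by_cases hk : k = 0
  · simp [hk]
  · have h1 := conj_eq_star k⁻¹ qk
    rw [inv_inv] at h1
    rw [h1, inner_smul_left, inner_conj]
    simp [inner_def, qk, icx]

lemma eq_qk_of_orthogonal {m : ℍ[ℝ]} (h0 : m.re = 0) (h1 : ‖m‖ = 1) {z w : ℂ} (hz : z ≠ 0)
    (hw : w ≠ 0) (hzw : inner ℝ (icx z) (icx w) = 0) (hmz : inner ℝ m (icx z) = 0)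
    (hmw : inner ℝ m (icx w) = 0) : ∃ e : ℝ, (e = 1 ∨ e = -1) ∧ m = e • qk := by
  rw [inner_icx] at hzw
  simp [inner_def, icx] at hzw hmz hmw
  have hz' : z.re ^ 2 + z.im ^ 2 ≠ 0 := fun h => hz (Complex.ext
    (by simp; nlinarith [sq_nonneg z.re, sq_nonneg z.im])
    (by simp; nlinarith [sq_nonneg z.re, sq_nonneg z.im]))
  have hw' : w.re ^ 2 + w.im ^ 2 ≠ 0 := fun h => hw (Complex.ext
    (by simp; nlinarith [sq_nonneg w.re, sq_nonneg w.im])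
    (by simp; nlinarith [sq_nonneg w.re, sq_nonneg w.im]))
  have hd : z.re * w.im - z.im * w.re ≠ 0 := by
    intro h
    apply mul_ne_zero hz' hw'
    linear_combination (z.re * w.re + z.im * w.im) * hzw + (z.re * w.im - z.im * w.re) * h
  have hI : m.imI = 0 := by
    have : m.imI * (z.re * w.im - z.im * w.re) = 0 := by
      linear_combination w.im * hmz - z.im * hmw
    exact (mul_eq_zero.1 this).resolve_right hd
  have hJ : m.imJ = 0 := by
    have : m.imJ * (z.re * w.im - z.im * w.re) = 0 := by
      linear_combination w.re * hmz - z.re * hmw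
    exact (mul_eq_zero.1 this).resolve_right hd
  refine ⟨m.imK, ?_, ?_⟩
  · have : ‖m‖ ^ 2 = 1 := by rw [h1]; norm_num
    rw [← real_inner_self_eq_norm_sq, inner_def] at this
    simp [h0, hI, hJ] at this
    rcases mul_self_eq_one_iff.1 this with h | h <;> simp [h]
  · ext <;> simp [h0, hI, hJ, qk]

lemma conj_re {m : ℍ[ℝ]} (h0 : m.re = 0) (k : ℍ[ℝ]) : (k * m * k⁻¹).re = 0 := by
  rw [conj_eq_star, Quaternion.re_smul, smul_eq_mul]
  have : star (star k⁻¹ * m * k⁻¹) = -(star k⁻¹ * m * k⁻¹) := by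
    rw [star_mul, star_mul, star_star, star_eq_neg_of_re h0]; noncomm_ring
  rw [Quaternion.star_eq_neg.1 this, mul_zero]

/-- The unit normals of a two-dimensional system. -/
lemma normal_eq {M} (hM : IsSim M) {P : QMap 2} {T : TMap 2} (hT : IsBase T) {k : ℍ[ℝ]}
    (hk : k ≠ 0) (h : ∀ x, P x = rmul (M (emb (T x))) k) {n₀ : ℍ[ℝ]} (h0 : n₀.re = 0)
    (h1 : ‖n₀‖ = 1) (hn : ∀ x, Defined P x → (P x).2 ≠ 0 →
      ∀ i, inner ℝ ((P x).2 * n₀ * (P x).2⁻¹) (partialDeriv P x i) = 0) :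
    ∃ e : ℝ, (e = 1 ∨ e = -1) ∧ k * n₀ = e • (qk * k) := by
  have hP : AlgDC P := by
    refine Rel.algDC ⟨M, hM, 1, 1, k, hk, MultilinearMap.ext fun x => ?_⟩ hT.algDC
    rw [act_apply, subst_one, h]; rfl
  obtain ⟨x, hx, hW, hom⟩ := hP.exists_finite
  obtain ⟨r, hr, ho⟩ := omega_of_eq hM h
  have h2 : ∀ i, inner ℝ (k * n₀ * k⁻¹) (omega (embQ T) x i) = 0 := by
    intro i
    have h3 := (hP.isotropic.inner_normal_eq_zero_iff hx hW n₀ i).1 (hn x hx hW i)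
    have h4 : n₀ = ‖k⁻¹‖ ^ 2 • (star k * (k * n₀ * k⁻¹) * k) := by
      have := conj_eq_star k⁻¹ (k * n₀ * k⁻¹)
      rw [inv_inv] at this
      rw [← this]
      simp only [mul_assoc, inv_mul_cancel₀ hk, mul_one]
      rw [← mul_assoc, inv_mul_cancel₀ hk, one_mul]
    rw [ho, h4, inner_smul_left, inner_smul_right, inner_conj] at h3
    simpa [hk, hr] using h3
  have hne : ∀ i, omega (embQ T) x i ≠ 0 := by
    intro i h; apply hom i; rw [ho, h]; simp
  have h5 := hT.algDC.orthogonal x 0 1 (by simp)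
  have h20 := h2 0
  have h21 := h2 1
  have hne0 := hne 0
  have hne1 := hne 1
  rw [omega_embQ] at hne0 hne1 h20 h21 h5
  rw [omega_embQ] at h5
  rw [Ne, icx_eq_zero] at hne0 hne1
  obtain ⟨e, he, h6⟩ := eq_qk_of_orthogonal (conj_re h0 k) (by
    rw [norm_mul, norm_mul, norm_inv, h1, mul_one, mul_inv_cancel₀ (by simpa using hk)])
    hne0 hne1 h5 h20 h21
  refine ⟨e, he, ?_⟩
  rw [← smul_mul_assoc, ← h6]
  simp [mul_assoc, hk]

lemma normal_of_eq {M} (hM : IsSim M) {P : QMap 2} {T : TMap 2} (hT : IsBase T)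
    (h : ∀ x, P x = M (emb (T x))) (x) (hx : Defined P x) (hW : (P x).2 ≠ 0) (i) :
    inner ℝ ((P x).2 * qk * (P x).2⁻¹) (partialDeriv P x i) = 0 := by
  have h' : ∀ x, P x = rmul (M (emb (T x))) 1 := fun x => by rw [h, rmul_one]
  have hP : AlgDC P := by
    refine Rel.algDC ⟨M, hM, 1, 1, 1, one_ne_zero, MultilinearMap.ext fun x => ?_⟩ hT.algDC
    rw [act_apply, subst_one, h']; rfl
  rw [hP.isotropic.inner_normal_eq_zero_iff hx hW]
  obtain ⟨r, -, ho⟩ := omega_of_eq hM h'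
  rw [ho, inner_smul_right, omega_embQ]
  have := inner_conj_qk 1 (-cdet (T (update x i ![1, 0])) (T (update x i ![0, 1])))
  simp only [inv_one, one_mul, mul_one, star_one] at this ⊢
  rw [this, mul_zero]

/-! ### Offset and axial constructions as pencil forms -/

/-- The Hermitian form of the offsets based on a sphere. -/
noncomputable def hSphere : Herm := ⟨1, 0, 1⟩

/-- The Hermitian form of the offsets based on a plane. -/
noncomputable def hPlane : Herm := ⟨0, 0, 1⟩

/-- The Hermitian form of the axial constructions. -/
noncomputable def hAxial : Herm := ⟨0, -I, 0⟩

/-- The unit quaternion `i`. -/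
noncomputable def qi : ℍ[ℝ] := quat 0 1 0 0

/-- The base system `P` and the three-dimensional system `G` in terms of the complex bilinear map
`T` and the Hermitian form `H`. -/
structure Presents (H : Herm) (M : ℍ² →ₗ[ℝ] ℍ²) (T : TMap 2) (k : ℍ[ℝ])
    (g : GL (Fin 2) ℝ) (P : QMap 2) (G : QMap 3) : Prop where
  isSim : IsSim M
  isBase : IsBase T
  ne_zero : k ≠ 0
  base : ∀ x, P x = rmul (M (emb (T x))) k
  eq_act : G = act M 1 ![1, 1, g] k (pencilForm T H)

lemma Presents.rel_base {H M T k g P G} (h : Presents H M T k g P G) : Rel (embQ T) P :=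
  ⟨M, h.isSim, 1, 1, k, h.ne_zero, MultilinearMap.ext fun x => by
    rw [act_apply, subst_one, h.base]; rfl⟩

lemma Presents.rel {H M T k g P G} (h : Presents H M T k g P G) : Rel (pencilForm T H) G :=
  ⟨M, h.isSim, _, _, k, h.ne_zero, h.eq_act⟩

lemma Presents.algDC {H M T k g P G} (h : Presents H M T k g P G) (hH : H.NonZero) : AlgDC G :=
  h.rel.algDC (h.isBase.algDC_pencilForm hH)

lemma Presents.algDC_base {H M T k g P G} (h : Presents H M T k g P G) : AlgDC P :=
  h.rel_base.algDC h.isBase.algDC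

lemma Presents.apply {H M T k g P G} (h : Presents H M T k g P G) (x) : G x =
    rmul (M (g.1.mulVec (x 2) 0 • emb (T ![x 0, x 1]) +
      g.1.mulVec (x 2) 1 • emb' (H.skew (T ![x 0, x 1])))) k := by
  rw [h.eq_act, act_apply, subst_one_two, pencilForm_apply]; rfl

lemma exists_presents {M} (hM : IsSim M) {T : TMap 2} (hT : IsBase T) (H : Herm) (g) :
    Presents H M T 1 g ((M ∘ₗ emb).compMultilinearMap T) (act M 1 ![1, 1, g] 1 (pencilForm T H)) :=
  ⟨hM, hT, one_ne_zero, fun x => by rw [rmul_one]; rfl, rfl⟩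

lemma nonZero_hSphere : hSphere.NonZero := by simp [hSphere, Herm.NonZero]

lemma nonZero_hPlane : hPlane.NonZero := by simp [hPlane, Herm.NonZero]

lemma nonZero_hAxial : hAxial.NonZero := by simp [hAxial, Herm.NonZero]

lemma cx_mul_qk (z : ℂ) : cx z * qk = qk * cx z := by ext <;> simp [cx, qk]

lemma icx_mul_qk (z : ℂ) : icx z * qk = -(qk * icx z) := by ext <;> simp [icx, qk]

lemma emb'_skew_hSphere (p : ℂ × ℂ) :
    emb' (hSphere.skew p) = (qk * (emb p).2, -(qk * (emb p).1)) := by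
  ext <;> simp [hSphere, Herm.skew, cmat_apply, emb'_apply, emb_apply, cx, icx, qk]

lemma emb'_skew_hPlane (p : ℂ × ℂ) : emb' (hPlane.skew p) = (qk * (emb p).2, 0) := by
  ext <;> simp [hPlane, Herm.skew, cmat_apply, emb'_apply, emb_apply, cx, icx, qk]

lemma emb'_skew_hAxial (p : ℂ × ℂ) :
    emb' (hAxial.skew p) = (qi * (emb p).1, qi * (emb p).2) := by
  ext <;> simp [hAxial, Herm.skew, cmat_apply, emb'_apply, emb_apply, cx, icx, qi]

lemma sphereMat_pencil (c : ℍ[ℝ]) (r : ℝ) (p : ℂ × ℂ) (u v : ℝ) :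
    sphereMat c r (u • emb p + v • emb' (hSphere.skew p)) =
      ((r * (u - v)) • ((emb p).1 - qk * (emb p).2) + (u + v) • (c * ((emb p).2 - qk * (emb p).1)),
        (u + v) • ((emb p).2 - qk * (emb p).1)) := by
  have h : ∀ q : ℍ[ℝ], qk * (qk * q) = -q := fun q => by
    rw [← mul_assoc, qk_mul_qk, neg_one_mul]
  rw [map_add, map_smul, map_smul, sphereMat_apply, sphereMat_apply, emb'_skew_hSphere]
  ext1
  · simp only [mul_neg, h, Prod.fst_add, Prod.smul_fst, neg_neg, sub_neg_eq_add]
    rw [show qk * (emb p).2 - (emb p).1 = -((emb p).1 - qk * (emb p).2) by abel,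
      show -(qk * (emb p).1) + (emb p).2 = (emb p).2 - qk * (emb p).1 by abel]
    module
  · simp only [h, Prod.snd_add, Prod.smul_snd, sub_neg_eq_add]
    module

lemma sphere_formula {c : ℍ[ℝ]} {r : ℝ} (hr : r ≠ 0) {T : TMap 2} {k n₀ : ℍ[ℝ]} {e d : ℝ}
    (hn : k * n₀ = e • (qk * k)) (hd : d * e ≠ 0) {P : QMap 2}
    (hP : ∀ x, P x = rmul (sphereMat c r (emb (T x))) k) (x) :
    act (sphereMat c r) 1 ![1, 1, colGL ![1, 0] ![d * e / (2 * r), -(d * e / (2 * r))]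
      (by simp [wedge]; exact ⟨by simpa using hd, hr⟩)] k (pencilForm T hSphere) x =
      (x 2 0 • (P ![x 0, x 1]).1 - (x 2 1 * d) • ((P ![x 0, x 1]).2 * n₀),
        x 2 0 • (P ![x 0, x 1]).2) := by
  rw [act_apply, subst_one_two, pencilForm_apply, colGL_mulVec, hP]
  simp only [cons_val_zero, cons_val_one, cons_val]
  rw [sphereMat_pencil]
  set p := T ![x 0, x 1]
  have h1 : ((emb p).2 - qk * (emb p).1) * qk = -((emb p).1 - qk * (emb p).2) := by
    simp only [emb_apply, sub_mul, cx_mul_qk, mul_assoc, icx_mul_qk, mul_neg]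
    rw [← mul_assoc, qk_mul_qk]
    noncomm_ring
  have h2 : (rmul (sphereMat c r (emb p)) k).2 * n₀ =
      -(e • (((emb p).1 - qk * (emb p).2) * k)) := by
    simp only [rmul, sphereMat_apply]
    rw [mul_assoc, hn, mul_smul_comm, ← mul_assoc, h1, neg_mul, smul_neg]
  rw [h2]
  simp only [rmul, sphereMat_apply, Pi.add_apply, Pi.smul_apply, smul_eq_mul, add_mul,
    cons_val_zero, cons_val_one, mul_one, mul_zero, zero_add, smul_mul_assoc]
  ext1
  · simp only
    match_scalars <;> field_simp <;> ring
  · simp only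
    match_scalars; ring

lemma SphereOffset.presents {P c r G} (h : SphereOffset P c r G) :
    ∃ T k g, Presents hSphere (sphereMat c r) T k g P G := by
  obtain ⟨hP, hc, hr, hS, n₀, d, hn0, hn1, hd, hn, hG⟩ := h
  have hch := isChart_sphereMat hc hr
  obtain ⟨T, k, hT, hk, hPT⟩ := hch.exists_base (isDC_iff.1 hP) hS
  obtain ⟨e, he, hke⟩ := normal_eq hch.1 hT hk hPT hn0 hn1 hn
  have he0 : d * e ≠ 0 := by rcases he with rfl | rfl <;> simpa using hd
  exact ⟨T, k, _, hch.1, hT, hk, hPT, MultilinearMap.ext fun x => by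
    rw [hG, sphere_formula hr.ne' hke he0 hPT]⟩

lemma plane_formula {q : ℍ[ℝ]} {d' : ℝ} {T : TMap 2} {k n₀ : ℍ[ℝ]} {e d : ℝ}
    (hn : k * n₀ = e • (qk * k)) (hd : d * e ≠ 0) {P : QMap 2}
    (hP : ∀ x, P x = rmul (planeMat q d' (emb (T x))) k) (x) :
    act (planeMat q d') 1 ![1, 1, diagGL 1 (-(d * e)) (by simpa using hd)] k
      (pencilForm T hPlane) x =
      (x 2 0 • (P ![x 0, x 1]).1 - (x 2 1 * d) • ((P ![x 0, x 1]).2 * n₀),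
        x 2 0 • (P ![x 0, x 1]).2) := by
  rw [act_apply, subst_one_two, pencilForm_apply, diagGL_mulVec, hP]
  simp only [cons_val_zero, cons_val_one, cons_val]
  set p := T ![x 0, x 1]
  have h2 : (rmul (planeMat q d' (emb p)) k).2 * n₀ = e • (q * (qk * ((emb p).2 * k))) := by
    simp only [rmul, planeMat_apply, emb_apply]
    rw [mul_assoc, hn, mul_smul_comm, mul_assoc, ← mul_assoc _ qk, cx_mul_qk, mul_assoc]
  rw [h2, emb'_skew_hPlane, map_add, map_smul, map_smul, planeMat_apply, planeMat_apply]
  simp only [rmul]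
  ext1
  · simp only [Prod.fst_add, Prod.smul_fst, add_mul, smul_mul_assoc, mul_zero, add_zero, mul_assoc]
    match_scalars <;> ring
  · simp only [Prod.snd_add, Prod.smul_snd, mul_zero, smul_zero, add_zero, smul_mul_assoc, one_mul]

lemma plane_normalize {ν : ℍ[ℝ]} (h0 : ν.re = 0) (h1 : ν ≠ 0) (d : ℝ) : ∃ ν' d',
    ν'.re = 0 ∧ ‖ν'‖ = 1 ∧ plane ν d = plane ν' d' ∧ (d = 0 → d' = 0) ∧ ∃ c : ℝ, ν' = c • ν := by
  have hn : ‖ν‖ ≠ 0 := by simpa using h1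
  refine ⟨‖ν‖⁻¹ • ν, ‖ν‖⁻¹ * d, by simp [h0], by
    rw [norm_smul, norm_inv, norm_norm, inv_mul_cancel₀ hn], ?_, by rintro rfl; simp, _, rfl⟩
  unfold plane
  congr 2
  ext p
  simp only [mem_ofPred_eq, inner_smul_left, conj_trivial, mul_right_inj' (inv_ne_zero hn)]

lemma PlaneOffset.presents {P G} (h : PlaneOffset P G) :
    ∃ ν q d T k g, ν.re = 0 ∧ ‖ν‖ = 1 ∧ q ≠ 0 ∧ ν * q = q * qk ∧
      Presents hPlane (planeMat q d) T k g P G := by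
  obtain ⟨hP, ⟨ν, d', h0, h1, hS⟩, n₀, d, hn0, hn1, hd, hn, hG⟩ := h
  obtain ⟨ν, d', h0, h1, e, -⟩ := plane_normalize h0 h1 d'
  rw [e] at hS
  obtain ⟨q, hq, hqν⟩ := exists_rotation h0 h1
  have hch := isChart_planeMat hq d' hqν h1
  obtain ⟨T, k, hT, hk, hPT⟩ := hch.exists_base (isDC_iff.1 hP) hS
  obtain ⟨e, he, hke⟩ := normal_eq hch.1 hT hk hPT hn0 hn1 hn
  have he0 : d * e ≠ 0 := by rcases he with rfl | rfl <;> simpa using hd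
  exact ⟨ν, q, d', T, k, _, h0, h1, hq, hqν, hch.1, hT, hk, hPT, MultilinearMap.ext fun x => by
    rw [hG, plane_formula hke he0 hPT]⟩

lemma axial_formula {q a : ℍ[ℝ]} (ha : a * q = q * qi) {T : TMap 2} {k : ℍ[ℝ]} {P : QMap 2}
    (hP : ∀ x, P x = rmul (planeMat q 0 (emb (T x))) k) (x) :
    act (planeMat q 0) 1 ![1, 1, colGL ![1, 0] ![-1, 1] (by simp [wedge])] k
      (pencilForm T hAxial) x =
      ((((x 2 0 - x 2 1 : ℝ) : ℍ[ℝ]) + x 2 1 • a) * (P ![x 0, x 1]).1,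
      (((x 2 0 - x 2 1 : ℝ) : ℍ[ℝ]) + x 2 1 • a) * (P ![x 0, x 1]).2) := by
  rw [act_apply, subst_one_two, pencilForm_apply, colGL_mulVec, hP]
  simp only [cons_val_zero, cons_val_one, cons_val]
  set p := T ![x 0, x 1]
  rw [emb'_skew_hAxial, map_add, map_smul, map_smul, planeMat_apply, planeMat_apply]
  simp only [rmul, zero_smul, zero_mul, add_zero, add_mul, smul_mul_assoc,
    coe_mul_eq_smul, ← mul_assoc, ha, Prod.fst_add, Prod.snd_add, Prod.smul_fst,
    Prod.smul_snd]
  ext1 <;> simp [sub_eq_add_neg]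

lemma exists_frame {a ν : ℍ[ℝ]} (ha0 : a.re = 0) (ha1 : ‖a‖ = 1) (h0 : ν.re = 0) (h1 : ‖ν‖ = 1)
    (h : inner ℝ ν a = 0) : ∃ q, q ≠ 0 ∧ ν * q = q * qk ∧ a * q = q * qi := by
  obtain ⟨q, hq, hν⟩ := exists_rotation h0 h1
  obtain ⟨m, hm⟩ : ∃ m, m = q⁻¹ * a * q := ⟨_, rfl⟩
  have hqm : q * m = a * q := by simp [hm, ← mul_assoc, hq]
  have m0 : m.re = 0 := by
    have := conj_re ha0 q⁻¹
    rwa [inv_inv, ← hm] at this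
  have m1 : ‖m‖ = 1 := by
    have hq' : ‖q‖ ≠ 0 := by simpa using hq
    rw [hm, norm_mul, norm_mul, ha1, norm_inv, mul_one, inv_mul_cancel₀ hq']
  have mk : m.imK = 0 := by
    have e1 : inner ℝ (q * qk) (q * m) = 0 := by
      rw [← hν, hqm, inner_mul_right_mul, h, mul_zero]
    rw [inner_mul_left_mul] at e1
    have e2 := (mul_eq_zero.1 e1).resolve_left (by simpa using hq)
    simpa [inner_def, qk] using e2
  have hz : m = icx ⟨m.imI, -m.imJ⟩ := by ext <;> simp [icx, m0, mk]
  have hzn : m.imI ^ 2 + m.imJ ^ 2 = 1 := by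
    have : ‖m‖ ^ 2 = 1 := by rw [m1]; norm_num
    rw [← real_inner_self_eq_norm_sq, inner_def] at this
    simp [m0, mk] at this
    linarith
  obtain ⟨w, hw⟩ := IsAlgClosed.exists_pow_nat_eq (⟨m.imI, m.imJ⟩ : ℂ) (n := 2) (by norm_num)
  have hwn : w.re * w.re + w.im * w.im = 1 := by
    have h2 := congrArg normSq hw
    rw [map_pow, normSq_apply (⟨m.imI, m.imJ⟩ : ℂ)] at h2
    have h3 : normSq w ^ 2 = 1 := by rw [h2]; simp only; linarith
    rw [pow_eq_one_iff_of_nonneg (normSq_nonneg w) (by norm_num)] at h3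
    rw [← normSq_apply, h3]
  have hw0 : w ≠ 0 := by rintro rfl; simp at hwn
  have hr := congrArg Complex.re hw
  have hi := congrArg Complex.im hw
  simp [pow_two] at hr hi
  refine ⟨q * cx w, mul_ne_zero hq (by rwa [Ne, cx_eq_zero]), ?_, ?_⟩
  · rw [← mul_assoc, hν, mul_assoc, mul_assoc, cx_mul_qk]
  · rw [← mul_assoc, ← hqm, mul_assoc, mul_assoc, hz, ← hr, ← hi]
    congr 1
    ext <;> simp [icx, cx, qi]
    · linear_combination w.re * hwn
    · linear_combination w.im * hwn

lemma Axial.presents {P a G} (h : Axial P a G) :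
    ∃ ν q T k, ν.re = 0 ∧ ‖ν‖ = 1 ∧ q ≠ 0 ∧ ν * q = q * qk ∧ a * q = q * qi ∧
      Presents hAxial (planeMat q 0) T k (colGL ![1, 0] ![-1, 1] (by simp [wedge])) P G := by
  obtain ⟨hP, ha0, ha1, ⟨ν, h0, h1, hνa, hS⟩, hG⟩ := h
  obtain ⟨ν', d', h0', h1', e, hd, c, hc⟩ := plane_normalize h0 h1 0
  rw [e, hd rfl] at hS
  obtain ⟨q, hq, hqν, hqa⟩ := exists_frame ha0 ha1 h0' h1' (by rw [hc, inner_smul_left, hνa, mul_zero])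
  have hch := isChart_planeMat hq 0 hqν h1'
  obtain ⟨T, k, hT, hk, hPT⟩ := hch.exists_base (isDC_iff.1 hP) hS
  exact ⟨ν', q, T, k, h0', h1', hq, hqν, hqa, hch.1, hT, hk, hPT, MultilinearMap.ext fun x => by
    rw [hG, axial_formula hqa hPT]⟩

lemma norm_qk : ‖qk‖ = 1 := by
  have : ‖qk‖ ^ 2 = 1 := by
    rw [← real_inner_self_eq_norm_sq, inner_def]; simp [qk]
  rwa [pow_eq_one_iff_of_nonneg (norm_nonneg _) (by norm_num)] at this

lemma norm_qi : ‖qi‖ = 1 := by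
  have : ‖qi‖ ^ 2 = 1 := by
    rw [← real_inner_self_eq_norm_sq, inner_def]; simp [qi]
  rwa [pow_eq_one_iff_of_nonneg (norm_nonneg _) (by norm_num)] at this

lemma exists_sphereOffset {T : TMap 2} (hT : IsBase T) :
    ∃ P G g, SphereOffset P 0 1 G ∧ Presents hSphere (sphereMat 0 1) T 1 g P G := by
  have hch := isChart_sphereMat (c := 0) rfl one_pos
  set P : QMap 2 := (sphereMat 0 1 ∘ₗ emb).compMultilinearMap T
  have hP : ∀ x, P x = rmul (sphereMat 0 1 (emb (T x))) 1 := fun x => by rw [rmul_one]; rfl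
  have hpr := exists_presents hch.1 hT hSphere
  refine ⟨P, _, _, ⟨isDC_iff.2 (hpr 1).algDC_base, rfl, one_pos, hch.liesOn one_ne_zero hP,
    qk, 1, rfl, norm_qk, one_ne_zero, fun x hx hW i => normal_of_eq hch.1 hT (fun x => rfl) x hx hW i,
    fun x => ?_⟩, hpr (colGL ![1, 0] ![1 * 1 / (2 * 1), -(1 * 1 / (2 * 1))] (by simp [wedge]))⟩
  exact sphere_formula (e := 1) (d := 1) one_ne_zero (by simp) (by simp) hP x

lemma exists_planeOffset {T : TMap 2} (hT : IsBase T) :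
    ∃ P G g, PlaneOffset P G ∧ Presents hPlane (planeMat 1 0) T 1 g P G := by
  have hch := isChart_planeMat (q := 1) (ν := qk) one_ne_zero 0 (by simp) norm_qk
  set P : QMap 2 := (planeMat 1 0 ∘ₗ emb).compMultilinearMap T
  have hP : ∀ x, P x = rmul (planeMat 1 0 (emb (T x))) 1 := fun x => by rw [rmul_one]; rfl
  have hpr := exists_presents hch.1 hT hPlane
  refine ⟨P, _, _, ⟨isDC_iff.2 (hpr 1).algDC_base, ⟨qk, 0, rfl, qk_ne_zero,
    hch.liesOn one_ne_zero hP⟩,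
    qk, 1, rfl, norm_qk, one_ne_zero, fun x hx hW i => normal_of_eq hch.1 hT (fun x => rfl) x hx hW i,
    fun x => ?_⟩, hpr (diagGL 1 (-(1 * 1)) (by simp))⟩
  exact plane_formula (e := 1) (d := 1) (by simp) (by simp) hP x

lemma exists_axial {T : TMap 2} (hT : IsBase T) :
    ∃ P G g, Axial P qi G ∧ Presents hAxial (planeMat 1 0) T 1 g P G := by
  have hch := isChart_planeMat (q := 1) (ν := qk) one_ne_zero 0 (by simp) norm_qk
  set P : QMap 2 := (planeMat 1 0 ∘ₗ emb).compMultilinearMap T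
  have hP : ∀ x, P x = rmul (planeMat 1 0 (emb (T x))) 1 := fun x => by rw [rmul_one]; rfl
  have hpr := exists_presents hch.1 hT hAxial
  refine ⟨P, _, _, ⟨isDC_iff.2 (hpr 1).algDC_base, rfl, norm_qi, ⟨qk, rfl, qk_ne_zero, by
    simp [inner_def, qi, qk], hch.liesOn one_ne_zero hP⟩,
    fun x => ?_⟩, hpr (colGL ![1, 0] ![-1, 1] (by simp [wedge]))⟩
  exact axial_formula (by simp) hP x

/-! ### Poles -/

lemma polar_ne_zero {x : Fin 2 → Fin 2 → ℝ} (hx : ∀ i, x i ≠ 0) : embQ polarT x ≠ 0 := by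
  intro h
  have h0 := algDC_polarT.isotropic.omega_eq_zero_of_eq_zero (hx 0) h
  rw [omega_polarT_zero, icx_eq_zero] at h0
  exact (sq_add_sq_pos (hx 1)).ne' (by exact_mod_cast h0)

lemma cart_eq_zero : embQ cartT ![![0, 1], ![0, 1]] = 0 := by
  rw [embQ_apply, cartT_apply, emb_eq_zero]; simp

lemma not_rel_polar_cart : ¬ Rel (embQ polarT) (embQ cartT) := by
  rintro ⟨M, hM, σ, g, h, hh, he⟩
  have h1 := cart_eq_zero
  rw [he, act_apply, rmul_eq_zero hh, hM.map_eq_zero] at h1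
  refine polar_ne_zero ?_ h1
  rw [subst_ne_zero_iff]
  intro i; fin_cases i <;> simp

lemma toPoint_emb_smul {z : ℂ} (hz : z ≠ 0) (p : ℂ × ℂ) : toPoint (emb (z • p)) = toPoint (emb p) := by
  rw [emb_smul, toPoint_rmul _ (by rwa [Ne, cx_eq_zero])]

lemma polar_coord_ne_zero {v : Fin 2 → ℝ} (hv : v ≠ 0) :
    (v 0 - I * v 1 : ℂ) ≠ 0 ∧ (v 0 + I * v 1 : ℂ) ≠ 0 := by
  constructor <;> intro h <;> apply hv <;> have h1 := congrArg Complex.re h <;>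
    have h2 := congrArg Complex.im h <;> simp at h1 h2 <;> ext i <;> fin_cases i <;> simp [h1, h2]

lemma sing_polarT : sing (embQ polarT) = {toPoint (emb (1, 0)), toPoint (emb (0, 1))} := by
  rw [algDC_polarT.sing_eq]
  ext p
  simp only [Set.mem_image, mem_ofPred_eq, Set.mem_insert_iff, mem_singleton_iff]
  constructor
  · rintro ⟨x, ⟨hx, i, hi⟩, rfl⟩
    obtain ⟨t1, t2⟩ := polar_coord_ne_zero (hx.1 1)
    have h1 : x 0 0 = 0 ∨ x 0 1 = 0 := by
      fin_cases i
      · change omega _ _ 0 = 0 at hi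
        rw [omega_polarT_zero, icx_eq_zero] at hi
        exact absurd (by exact_mod_cast hi) (sq_add_sq_pos (hx.1 1)).ne'
      · change omega _ _ 1 = 0 at hi
        rw [omega_polarT_one, icx_eq_zero] at hi
        simpa using hi
    rw [val_eq_toPoint, embQ_apply, polarT_apply]
    rcases h1 with h1 | h1
    · left
      have h2 : x 0 1 ≠ 0 := fun h => hx.1 0 (by ext i; fin_cases i <;> simpa)
      rw [← toPoint_emb_smul (z := x 0 1 * (x 1 0 - I * x 1 1))
        (mul_ne_zero (by exact_mod_cast h2) t1) (1, 0)]
      simp [h1]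
    · right
      have h2 : x 0 0 ≠ 0 := fun h => hx.1 0 (by ext i; fin_cases i <;> simpa)
      rw [← toPoint_emb_smul (z := x 0 0 * (x 1 0 + I * x 1 1))
        (mul_ne_zero (by exact_mod_cast h2) t2) (0, 1)]
      simp [h1]
  · rintro (rfl | rfl)
    · refine ⟨![![0, 1], ![1, 0]], ⟨⟨fun i => by fin_cases i <;> simp, ?_⟩, 1, ?_⟩, ?_⟩
      · rw [embQ_apply, polarT_apply, Ne, emb_eq_zero]; simp
      · rw [omega_polarT_one, icx_eq_zero]; simp
      · rw [val_eq_toPoint, embQ_apply, polarT_apply]; simp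
    · refine ⟨![![1, 0], ![1, 0]], ⟨⟨fun i => by fin_cases i <;> simp, ?_⟩, 1, ?_⟩, ?_⟩
      · rw [embQ_apply, polarT_apply, Ne, emb_eq_zero]; simp
      · rw [omega_polarT_one, icx_eq_zero]; simp
      · rw [val_eq_toPoint, embQ_apply, polarT_apply]; simp

lemma sing_cartT : sing (embQ cartT) = {toPoint (emb (1, 0))} := by
  rw [algDC_cartT.sing_eq]
  ext p
  simp only [Set.mem_image, mem_ofPred_eq, mem_singleton_iff]
  constructor
  · rintro ⟨x, ⟨hx, i, hi⟩, rfl⟩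
    have h1 : (cartT x).2 = 0 := by
      rw [cartT_apply]
      fin_cases i
      · change omega _ _ 0 = 0 at hi
        rw [omega_cartT_zero, icx_eq_zero] at hi
        simp only [Complex.ofReal_eq_zero, ne_eq, OfNat.ofNat_ne_zero, not_false_eq_true,
          pow_eq_zero_iff] at hi
        simp [hi]
      · change omega _ _ 1 = 0 at hi
        rw [omega_cartT_one, icx_eq_zero] at hi
        simp at hi
        simp [hi]
    have h2 : (cartT x).1 ≠ 0 := by
      intro h; apply hx.2
      rw [embQ_apply, emb_eq_zero]; exact Prod.ext h h1
    rw [val_eq_toPoint, embQ_apply, ← toPoint_emb_smul h2 (1, 0)]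
    congr 2
    ext1 <;> simp [h1]
  · rintro rfl
    refine ⟨![![0, 1], ![1, 0]], ⟨⟨fun i => by fin_cases i <;> simp, ?_⟩, 1, ?_⟩, ?_⟩
    · rw [embQ_apply, cartT_apply, Ne, emb_eq_zero]; simp
    · rw [omega_cartT_one, icx_eq_zero]; simp
    · rw [val_eq_toPoint, embQ_apply, cartT_apply]; simp

/-- The base system is obtained from polar or Cartesian coordinates by the complex matrix with
columns `v` and `w`. -/
def TColumns (T₀ T : TMap 2) (v w : ℂ × ℂ) : Prop :=
  v.1 * w.2 - w.1 * v.2 ≠ 0 ∧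
    ∃ σ g, ∀ x, T x = cmat v.1 w.1 v.2 w.2 (T₀ (subst σ g x))

lemma TEquiv.exists_columns {T₀ T : TMap 2} (h : TEquiv T₀ T) : ∃ v w, TColumns T₀ T v w := by
  obtain ⟨σ, g, a, b, c, d, hd, h⟩ := h
  exact ⟨(a, c), (b, d), hd, σ, g, h⟩

lemma TColumns.tEquiv {T₀ T : TMap 2} {v w} (h : TColumns T₀ T v w) : TEquiv T₀ T := by
  obtain ⟨hd, σ, g, h⟩ := h
  exact ⟨σ, g, _, _, _, _, hd, h⟩

lemma exists_tColumns (T₀ : TMap 2) {v w : ℂ × ℂ} (h : v.1 * w.2 - w.1 * v.2 ≠ 0) :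
    ∃ T, TColumns T₀ T v w :=
  ⟨(cmat v.1 w.1 v.2 w.2).compMultilinearMap T₀, h, 1, 1, fun x => by rw [subst_one]; rfl⟩

lemma TColumns.ne_zero {T₀ T : TMap 2} {v w} (h : TColumns T₀ T v w) : v ≠ 0 ∧ w ≠ 0 := by
  constructor <;> rintro rfl <;> exact h.1 (by simp)

lemma TColumns.rel_pencilForm {T₀ T : TMap 2} {v w} (h : TColumns T₀ T v w) (H : Herm) :
    Rel (pencilForm T₀ (H.pull v.1 w.1 v.2 w.2)) (pencilForm T H) := by
  obtain ⟨hd, σ, g, h⟩ := h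
  exact (rel_pencilForm_cmat (T' := (cmat v.1 w.1 v.2 w.2).compMultilinearMap T₀) H hd
    fun x => rfl).trans (rel_pencilForm_subst H σ g h)

lemma Presents.sing_base {H M T k g P G} (h : Presents H M T k g P G) {T₀ : TMap 2}
    (hT₀ : AlgDC (embQ T₀)) {v w} (hT : TColumns T₀ T v w) :
    ∃ μ, sing P = μ '' sing (embQ T₀) ∧ (∀ p, p ≠ 0 → μ (toPoint (emb p)) =
      toPoint (M (emb (cmat v.1 w.1 v.2 w.2 p)))) := by
  obtain ⟨hd, σ, g, hT⟩ := hT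
  obtain ⟨N, l, hN, hl, h1, h2⟩ := TEquiv.eq_act hd hT
  have hMN := h.isSim.comp hN
  obtain ⟨μ, -, hμ⟩ := hMN.realizable
  have e : P = act (M ∘ₗ N) σ g (l * k) (embQ T₀) := by
    refine MultilinearMap.ext fun x => ?_
    rw [h.base, act_apply, hT, embQ_apply, ← h1, h.isSim.map_rmul, rmul_rmul]; rfl
  refine ⟨μ, ?_, fun p hp => ?_⟩
  · rw [e, sing_act hMN hμ σ g (mul_ne_zero hl h.ne_zero) hT₀]
  · rw [hμ _ (by rwa [Ne, emb_eq_zero]) (isotropic_emb p), ← h1, h.isSim.map_rmul,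
      toPoint_rmul _ hl]; rfl

lemma Presents.sing_polar {H M T k g P G} (h : Presents H M T k g P G) {v w}
    (hT : TColumns polarT T v w) : sing P = {toPoint (M (emb v)), toPoint (M (emb w))} := by
  obtain ⟨μ, h1, h2⟩ := h.sing_base algDC_polarT hT
  rw [h1, sing_polarT, Set.image_pair, h2 _ (by simp), h2 _ (by simp)]
  simp [cmat_apply]

lemma Presents.sing_cart {H M T k g P G} (h : Presents H M T k g P G) {v w}
    (hT : TColumns cartT T v w) : sing P = {toPoint (M (emb v))} := by
  obtain ⟨μ, h1, h2⟩ := h.sing_base algDC_cartT hT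
  rw [h1, sing_cartT, Set.image_singleton, h2 _ (by simp)]
  simp [cmat_apply]

lemma Presents.twoPolar_iff {H M T k g P G} (h : Presents H M T k g P G) :
    TwoPolar P ↔ TEquiv polarT T := by
  constructor
  · rintro ⟨-, h1⟩
    rcases h.isBase with h2 | h2
    · exact h2
    · rw [← embQ_polarT, mobiusEquiv_iff_rel algDC_polarT] at h1
      exact absurd (h1.trans (h2.rel_embQ.trans h.rel_base).symm) not_rel_polar_cart
  · intro h1
    refine ⟨isDC_iff.2 h.algDC_base, ?_⟩
    rw [← embQ_polarT]
    exact (h1.rel_embQ.trans h.rel_base).mobiusEquiv algDC_polarT.isotropic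

lemma Presents.onePolar_iff {H M T k g P G} (h : Presents H M T k g P G) :
    OnePolar P ↔ TEquiv cartT T := by
  constructor
  · rintro ⟨-, h1⟩
    rcases h.isBase with h2 | h2
    · rw [← embQ_cartT, mobiusEquiv_iff_rel algDC_cartT] at h1
      exact absurd ((h2.rel_embQ.trans h.rel_base).trans h1.symm) not_rel_polar_cart
    · exact h2
  · intro h1
    refine ⟨isDC_iff.2 h.algDC_base, ?_⟩
    rw [← embQ_cartT]
    exact (h1.rel_embQ.trans h.rel_base).mobiusEquiv algDC_cartT.isotropic

lemma toPoint_sim_injective {M} (hM : IsSim M) {p q : ℂ × ℂ} (hp : p ≠ 0) (hq : q ≠ 0)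
    (h : toPoint (M (emb p)) = toPoint (M (emb q))) : cdet p q = 0 := by
  obtain ⟨l, hl, e⟩ := (toPoint_eq_iff (by rwa [Ne, hM.map_eq_zero, emb_eq_zero])
    (by rwa [Ne, hM.map_eq_zero, emb_eq_zero])).1 h
  rw [← hM.map_rmul] at e
  have e' := hM.injective e
  have h1 : form (emb p) (emb q) = 0 := by
    rw [e', ← rmul_one (emb p), rmul_rmul, form_rmul, isotropic_emb]; simp
  rw [form_emb_emb, icx_eq_zero] at h1
  simpa using h1

/-! ### Equations of M-spheres -/

/-- The quadratic form whose zeros on the isotropic cone are the points of an M-sphere. -/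
noncomputable def quadric (A : ℝ) (Y : ℍ[ℝ]) (C : ℝ) (X : ℍ²) : ℝ :=
  A * ‖X.1‖ ^ 2 + inner ℝ X.1 (Y * X.2) + C * ‖X.2‖ ^ 2

lemma quadric_rmul (A Y C X h) : quadric A Y C (rmul X h) = ‖h‖ ^ 2 * quadric A Y C X := by
  simp only [quadric, rmul, norm_mul, ← mul_assoc, inner_mul_right_mul]
  ring

lemma quadric_zero (A Y C) : quadric A Y C 0 = 0 := by simp [quadric]

/-- The coordinate surfaces of the `i`-th family satisfy equations of M-spheres. -/
def SphericalAt (D : QMap n) (i : Fin n) : Prop :=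
  ∀ c : Fin 2 → ℝ, c ≠ 0 → ∃ (A : ℝ) (Y : ℍ[ℝ]) (C : ℝ), Y.re = 0 ∧ (A ≠ 0 ∨ Y ≠ 0 ∨ C ≠ 0) ∧
    ∀ x, x i = c → quadric A Y C (D x) = 0

lemma IsMSphere.exists_quadric {S} (hS : IsMSphere S) : ∃ (A : ℝ) (Y : ℍ[ℝ]) (C : ℝ),
    Y.re = 0 ∧ (A ≠ 0 ∨ Y ≠ 0 ∨ C ≠ 0) ∧
      ∀ X, form X X = 0 → toPoint X ∈ S → quadric A Y C X = 0 := by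
  rcases hS with ⟨c, r, hc, hr, rfl⟩ | ⟨ν, d, h0, h1, rfl⟩
  · refine ⟨1, (-2 : ℝ) • c, ‖c‖ ^ 2 - r ^ 2, by simp [hc], by simp, fun X hX h => ?_⟩
    have h2 := ((toPoint_mem_sphere hX c r).1 h).2
    have h3 := congrArg (· ^ 2) h2
    simp only [norm_sub_sq_real, norm_mul, mul_pow] at h3
    simp only [quadric, smul_mul_assoc, inner_smul_right]
    linarith
  · refine ⟨0, ν, -d, h0, by simp [h1], fun X hX h => ?_⟩
    have h2 := (toPoint_mem_plane hX ν d).1 h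
    simp only [quadric, h2]; ring

lemma IsSpherical.sphericalAt {D : QMap 3} (hD : Isotropic D) {i} (h : ∀ c, ∃ S, IsMSphere S ∧
    surface D i c ⊆ S) : SphericalAt D i := by
  intro c hc
  obtain ⟨S, hS, hsub⟩ := h (Projectivization.mk ℝ c hc)
  obtain ⟨A, Y, C, h0, h1, h2⟩ := hS.exists_quadric
  refine ⟨A, Y, C, h0, h1, fun x hx => ?_⟩
  by_cases hd : D x = 0
  · rw [hd, quadric_zero]
  · have hxd : Defined D x := ⟨fun j hj => hd (D.map_coord_zero j hj), hd⟩
    exact h2 _ (hD x) (hsub ⟨x, ⟨hxd, by rw [hx]; exact hc, by simp only [hx]⟩, rfl⟩)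

lemma quadric_qmat (A Y C a b c d) : ∃ A' Y' C', ∀ X,
    quadric A Y C (qmat a b c d X) = quadric A' Y' C' X := by
  refine ⟨A * ‖a‖ ^ 2 + inner ℝ a (Y * c) + C * ‖c‖ ^ 2,
    (2 * A) • (star a * b) + star a * Y * d + star c * star Y * b + (2 * C) • (star c * d),
    A * ‖b‖ ^ 2 + inner ℝ b (Y * d) + C * ‖d‖ ^ 2, fun X => ?_⟩
  have e : ∀ p q u w : ℍ[ℝ], inner ℝ (p * u) (q * w) = inner ℝ u (star p * q * w) := by
    intro p q u w
    simp only [inner_def, Quaternion.re_mul, Quaternion.imI_mul, Quaternion.imJ_mul,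
      Quaternion.imK_mul, Quaternion.re_star, Quaternion.imI_star, Quaternion.imJ_star,
      Quaternion.imK_star]
    ring
  have e' : ∀ p q u w : ℍ[ℝ], inner ℝ (p * w) (q * u) = inner ℝ u (star q * p * w) := by
    intro p q u w
    rw [real_inner_comm, e]
  have h1 : ∀ u v : ℍ[ℝ], ‖u + v‖ ^ 2 = ‖u‖ ^ 2 + 2 * inner ℝ u v + ‖v‖ ^ 2 := fun u v =>
    norm_add_sq_real u v
  simp only [quadric, qmat_apply, h1, norm_mul, mul_pow, mul_add, inner_add_left, inner_add_right,
    add_mul, smul_mul_assoc, inner_smul_right]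
  have f1 : inner ℝ (a * X.1) (Y * (c * X.1)) = ‖X.1‖ ^ 2 * inner ℝ a (Y * c) := by
    rw [← mul_assoc, inner_mul_right_mul]
  have f2 : inner ℝ (b * X.2) (Y * (d * X.2)) = ‖X.2‖ ^ 2 * inner ℝ b (Y * d) := by
    rw [← mul_assoc, inner_mul_right_mul]
  have f3 : inner ℝ (a * X.1) (Y * (d * X.2)) = inner ℝ X.1 (star a * Y * d * X.2) := by
    rw [← mul_assoc, e, ← mul_assoc]
  have f4 : inner ℝ (b * X.2) (Y * (c * X.1)) = inner ℝ X.1 (star c * star Y * b * X.2) := by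
    rw [← mul_assoc, e', star_mul]
  rw [e a b, f1, f2, f3, f4, e c d]
  ring

lemma quadric_re (A Y C) {X : ℍ²} (hX : form X X = 0) :
    quadric A Y C X = quadric A (Y - Y.re) C X := by
  have h1 : inner ℝ X.1 X.2 = 0 := by
    have := congrArg QuaternionAlgebra.re hX
    simp [form] at this
    simp [inner_def]; linarith
  simp only [quadric, sub_mul, inner_sub_right, coe_mul_eq_smul, inner_smul_right, h1]
  ring

lemma quadric_sim {M} (hM : IsSim M) {A Y C} (hY : Y.re = 0) (h : A ≠ 0 ∨ Y ≠ 0 ∨ C ≠ 0) :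
    ∃ A' Y' C', Y'.re = 0 ∧ (A' ≠ 0 ∨ Y' ≠ 0 ∨ C' ≠ 0) ∧ ∀ X, form X X = 0 →
      quadric A Y C (M X) = quadric A' Y' C' X := by
  obtain ⟨A', Y', C', h1⟩ := quadric_qmat A Y C (M (1, 0)).1 (M (0, 1)).1 (M (1, 0)).2 (M (0, 1)).2
  rw [← hM.eq_qmat] at h1
  refine ⟨A', Y' - Y'.re, C', by simp, ?_, fun X hX => by rw [h1, quadric_re _ _ _ hX]⟩
  by_contra hc
  push Not at hc
  obtain ⟨c1, c2, c3⟩ := hc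
  obtain ⟨N, hN, -, h4⟩ := hM.exists_inverse
  have h0 : ∀ X, form X X = 0 → quadric A Y C X = 0 := fun X hX => by
    rw [← h4 X, h1, quadric_re _ _ _ ((hN.isotropic_iff X).2 hX), c1, c2, c3]
    simp [quadric]
  have a1 := h0 (1, 0) (by simp [form])
  have a2 := h0 (0, 1) (by simp [form])
  have a3 := h0 (Y, 1) (by simp [form, star_eq_neg_of_re hY])
  simp [quadric] at a1 a2 a3
  rw [a1, a2] at a3
  simp at a3
  rw [a1, a2, a3] at h
  simp at h

lemma SphericalAt.act {D : QMap n} (hD : Isotropic D) {i j} (h : SphericalAt D i) {M}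
    (hM : IsSim M) (σ : Equiv.Perm (Fin n)) (g : Fin n → GL (Fin 2) ℝ) (k : ℍ[ℝ]) (hj : σ i = j) :
    SphericalAt (act M σ g k D) j := by
  intro c hc
  obtain ⟨A, Y, C, h0, h1, h2⟩ := h ((g i).1.mulVec c) ((mulVec_ne_zero_iff _ _).2 hc)
  obtain ⟨N, hN, h3, -⟩ := hM.exists_inverse
  obtain ⟨A', Y', C', h0', h1', h4⟩ := quadric_sim hN h0 h1
  refine ⟨A', Y', C', h0', h1', fun x hx => ?_⟩
  rw [act_apply, quadric_rmul, ← h4 _ ((hM.isotropic_iff _).2 (hD _)), h3, h2, mul_zero]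
  simp only [subst, hj, hx]

/-! ### Two bilinear facts -/

lemma map2_expand {V : Type*} [AddCommGroup V] [Module ℝ V]
    (T : MultilinearMap ℝ (fun _ : Fin 2 => Fin 2 → ℝ) V) (x) : T x =
    (x 0 0 * x 1 0) • T ![![1, 0], ![1, 0]] + (x 0 0 * x 1 1) • T ![![1, 0], ![0, 1]] +
      (x 0 1 * x 1 0) • T ![![0, 1], ![1, 0]] + (x 0 1 * x 1 1) • T ![![0, 1], ![0, 1]] := by
  have h1 : ∀ y v, T (update y 0 v) = v 0 • T (update y 0 ![1, 0]) + v 1 • T (update y 0 ![0, 1]) :=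
    fun y v => by
      conv_lhs => rw [vec_eq v]
      rw [T.map_update_add, T.map_update_smul, T.map_update_smul]
  have h2 : ∀ y v, T (update y 1 v) = v 0 • T (update y 1 ![1, 0]) + v 1 • T (update y 1 ![0, 1]) :=
    fun y v => by
      conv_lhs => rw [vec_eq v]
      rw [T.map_update_add, T.map_update_smul, T.map_update_smul]
  have h3 := fun a b c => h1 ![a, b] c
  have h4 := fun a b c => h2 ![a, b] c
  simp only [update_pair_zero, update_pair_one] at h3 h4
  rw [vec2_eta x, h3 (x 0) (x 1) (x 0), h4 ![1, 0] (x 1) (x 1), h4 ![0, 1] (x 1) (x 1)]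
  simp only [cons_val_zero, cons_val_one]
  module

/-- A bilinear map that is pointwise proportional to `T` is a constant multiple of `T`. -/
def Coprime (T : TMap 2) : Prop :=
  ∀ B : TMap 2, (∀ x, cdet (T x) (B x) = 0) → ∃ m : ℂ, ∀ x, B x = m • T x

lemma coprime_polarT : Coprime polarT := by
  intro B h
  have e := map2_expand B
  set b00 := B ![![1, 0], ![1, 0]]
  set b01 := B ![![1, 0], ![0, 1]]
  set b10 := B ![![0, 1], ![1, 0]]
  set b11 := B ![![0, 1], ![0, 1]]
  have h1 := h ![![1, 0], ![1, 0]]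
  have h2 := h ![![1, 0], ![0, 1]]
  have h3 := h ![![0, 1], ![1, 0]]
  have h4 := h ![![0, 1], ![0, 1]]
  have h5 := h ![![1, 1], ![1, 0]]
  have h6 := h ![![1, 1], ![0, 1]]
  have h7 := h ![![1, 1], ![1, 1]]
  rw [e, polarT_apply] at h1 h2 h3 h4 h5 h6 h7
  simp [cdet] at h1 h2 h3 h4 h5 h6 h7
  rw [h1, h3] at h5
  rw [h2, h4] at h6
  rw [h1, h2, h3, h4] at h7
  simp only [add_zero, zero_add] at h5 h6 h7
  have e1 : b00.2 = b10.1 := by linear_combination h5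
  have e2 : b11.1 = -b01.2 := by
    linear_combination I * h6 + (b01.2 + b11.1) * I_sq
  have e3 : b01.2 = I * b10.1 := by
    rw [e1, e2] at h7
    linear_combination (1 / 2) * h7
  refine ⟨b10.1, fun x => ?_⟩
  rw [e, polarT_apply]
  ext1
  · simp [h1, h2, e2, e3]; ring
  · simp [h3, h4, e1, e3]; ring

lemma coprime_cartT : Coprime cartT := by
  intro B h
  have e := map2_expand B
  set b00 := B ![![1, 0], ![1, 0]]
  set b01 := B ![![1, 0], ![0, 1]]
  set b10 := B ![![0, 1], ![1, 0]]
  set b11 := B ![![0, 1], ![0, 1]]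
  have h1 := h ![![1, 0], ![1, 0]]
  have h2 := h ![![1, 0], ![0, 1]]
  have h3 := h ![![0, 1], ![1, 0]]
  have h5 := h ![![1, 1], ![1, 0]]
  have h6 := h ![![1, 0], ![1, 1]]
  have h7 := h ![![0, 1], ![1, 1]]
  have h8 := h ![![1, 1], ![1, 1]]
  rw [e, cartT_apply] at h1 h2 h3 h5 h6 h7 h8
  simp [cdet] at h1 h2 h3 h5 h6 h7 h8
  rw [h1, h3] at h5
  rw [h1, h2] at h6
  rw [h3] at h7
  rw [h1, h2, h3] at h8
  simp only [add_zero, zero_add] at h5 h6 h7 h8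
  have e1 : b00.2 = b10.1 := by linear_combination h5
  have e2 : b01.1 = -(I * b10.1) := by rw [e1] at h6; linear_combination -h6
  have e3 : b11.1 = 0 := by
    rw [e1, e2, h7] at h8
    linear_combination -h8
  refine ⟨b10.1, fun x => ?_⟩
  rw [e, cartT_apply]
  ext1
  · simp [h1, e2, e3]; ring
  · simp [h2, h3, h7, e1]; ring

lemma eq_zero_of_coord_ne_zero {V : Type*} [TopologicalSpace V] [T2Space V] [Zero V]
    {f : (Fin 2 → Fin 2 → ℝ) → V} (hf : Continuous f)
    (h : ∀ x, (∀ i j, x i j ≠ 0) → f x = 0) (x) : f x = 0 := by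
  set y : ℝ → Fin 2 → Fin 2 → ℝ := fun δ i j => x i j + δ * (if 0 ≤ x i j then 1 else -1)
  have hy : Continuous y := by fun_prop
  have h1 : Filter.Tendsto (fun δ => f (y δ)) (nhdsWithin 0 (Ioi 0)) (nhds (f x)) := by
    have : y 0 = x := by funext i j; simp [y]
    have h2 : Filter.Tendsto (fun δ => f (y δ)) (nhdsWithin 0 (Ioi 0)) (nhds (f (y 0))) :=
      ((hf.comp hy).tendsto 0).mono_left nhdsWithin_le_nhds
    rwa [this] at h2
  have h3 : Filter.Tendsto (fun δ => f (y δ)) (nhdsWithin 0 (Ioi 0)) (nhds 0) := by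
    refine tendsto_const_nhds.congr' ?_
    filter_upwards [self_mem_nhdsWithin] with δ hδ
    refine (h _ fun i j => ?_).symm
    have hδ' : 0 < δ := hδ
    simp only [y]
    split_ifs with h4
    · exact (by linarith : 0 < x i j + δ * 1).ne'
    · push Not at h4
      exact (by linarith : x i j + δ * -1 < 0).ne
  exact tendsto_nhds_unique h1 h3

lemma continuous_map2 {V : Type*} [NormedAddCommGroup V] [NormedSpace ℝ V]
    (T : MultilinearMap ℝ (fun _ : Fin 2 => Fin 2 → ℝ) V) : Continuous T := by
  have : (T : (Fin 2 → Fin 2 → ℝ) → V) = _ := funext (map2_expand T)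
  rw [this]
  fun_prop

/-- The properties of polar and Cartesian coordinates that are used in the classification. -/
structure Standard (T : TMap 2) : Prop where
  isBase : IsBase T
  coprime : Coprime T
  omega_eq : ∃ q r : (Fin 2 → Fin 2 → ℝ) → ℝ, (∀ x, omega (embQ T) x 0 = icx (q x)) ∧
    (∀ x, omega (embQ T) x 1 = icx (I * r x)) ∧
    ∀ x, (∀ i j, x i j ≠ 0) → q x ≠ 0 ∧ r x ≠ 0
  eval : ∀ H : Herm, H.NonZero →
    ∃ x, (∀ i, omega (embQ T) x i ≠ 0) ∧ H.eval (T x) ≠ 0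

lemma standard_polarT : Standard polarT where
  isBase := isBase_iff.2 algDC_polarT
  coprime := coprime_polarT
  omega_eq := ⟨_, _, omega_polarT_zero, omega_polarT_one, fun x hx => by
    have := hx 0 0
    have := hx 0 1
    have h1 := hx 1 0
    exact ⟨by positivity, by simp [*]⟩⟩
  eval := fun _ => exists_eval_polarT_ne_zero

lemma standard_cartT : Standard cartT where
  isBase := isBase_iff.2 algDC_cartT
  coprime := coprime_cartT
  omega_eq := ⟨_, _, omega_cartT_zero, omega_cartT_one, fun x hx => by simp [hx]⟩
  eval := fun _ => exists_eval_cartT_ne_zero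

/-! ### Spherical systems are pencil forms -/

lemma quadric_emb (A C y1 y2 y3 v : ℝ) (p q : ℂ × ℂ) :
    quadric A (quat 0 y1 y2 y3) C (emb p + v • emb' q) =
      A * normSq p.1 + C * normSq p.2 +
      ((y1 - I * y2) * conj p.1 * p.2).re +
      v ^ 2 * (A * normSq q.2 + C * normSq q.1 -
        y1 * (q.2.re * q.1.re + q.2.im * q.1.im) + y2 * (q.2.re * q.1.im - q.2.im * q.1.re)) +
      v * y3 * (conj p.1 * q.1 + conj p.2 * q.2).im := by
  simp only [quadric, ← real_inner_self_eq_norm_sq, inner_def]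
  simp [emb_apply, emb'_apply, icx, cx, normSq_apply]
  ring

lemma exists_eval_of_quadrics {T B : TMap 2} (hT : Standard T) {g : (Fin 2 → Fin 2 → ℝ) → ℝ}
    (hg : ∀ x, conj (T x).1 * (B x).1 + conj (T x).2 * (B x).2 =
      I * g x)
    (hS : ∀ v : ℝ, v ≠ 0 → ∃ (A : ℝ) (Y : ℍ[ℝ]) (C : ℝ), Y.re = 0 ∧ (A ≠ 0 ∨ Y ≠ 0 ∨ C ≠ 0) ∧
      ∀ x, quadric A Y C (emb (T x) + v • emb' (B x)) = 0) :
    ∃ H : Herm, ∀ x, g x = H.eval (T x) := by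
  set F : ℝ → (Fin 5 → ℝ) → (Fin 2 → Fin 2 → ℝ) → ℝ := fun v θ x =>
    θ 0 * normSq (T x).1 + θ 1 * normSq (T x).2 +
      (θ 2 * (conj (T x).1 * (T x).2).re +
        θ 3 * (conj (T x).1 * (T x).2).im) +
      v ^ 2 * (θ 0 * normSq (B x).2 + θ 1 * normSq (B x).1 -
        θ 2 * ((B x).2.re * (B x).1.re + (B x).2.im * (B x).1.im) +
        θ 3 * ((B x).2.re * (B x).1.im - (B x).2.im * (B x).1.re)) +
      θ 4 * g x with hF
  have h1 : ∀ v : ℝ, v ≠ 0 → ∃ θ ∈ Metric.sphere (0 : Fin 5 → ℝ) 1, ∀ x, F v θ x = 0 := by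
    intro v hv
    obtain ⟨A, Y, C, hY, hne, h⟩ := hS v hv
    set θ : Fin 5 → ℝ := ![A, C, Y.imI, Y.imJ, v * Y.imK] with hθ
    have hθ0 : θ ≠ 0 := by
      intro h0
      have e0 := congrFun h0 0
      have e1 := congrFun h0 1
      have e2 := congrFun h0 2
      have e3 := congrFun h0 3
      have e4 := congrFun h0 4
      simp [hθ, hv] at e0 e1 e2 e3 e4
      rcases hne with h | h | h
      · exact h e0
      · exact h (by ext <;> simp [hY, e2, e3, e4])
      · exact h e1
    have hYq : Y = quat 0 Y.imI Y.imJ Y.imK := by ext <;> simp [hY]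
    have hFθ : ∀ x, F v θ x = 0 := by
      intro x
      have := h x
      rw [hYq, quadric_emb, hg] at this
      rw [← this]
      simp [hF, hθ]
      ring
    refine ⟨‖θ‖⁻¹ • θ, ?_, fun x => ?_⟩
    · rw [mem_sphere_zero_iff_norm, norm_smul, norm_inv, norm_norm, inv_mul_cancel₀]
      simpa using hθ0
    · have : F v (‖θ‖⁻¹ • θ) x = ‖θ‖⁻¹ * F v θ x := by
        simp only [hF, Pi.smul_apply, smul_eq_mul]; ring
      rw [this, hFθ, mul_zero]
  choose θ hθ hFθ using fun n : ℕ => h1 (1 / ((n : ℝ) + 1)) (by positivity)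
  obtain ⟨θ₀, hθ₀, φ, hφ, hlim⟩ := (isCompact_sphere (0 : Fin 5 → ℝ) 1).tendsto_subseq hθ
  have h2 : ∀ x, F 0 θ₀ x = 0 := by
    intro x
    have hc : Continuous fun z : ℝ × (Fin 5 → ℝ) => F z.1 z.2 x := by
      simp only [hF]; fun_prop
    have hv : Filter.Tendsto (fun n => 1 / (((φ n : ℕ) : ℝ) + 1)) Filter.atTop (nhds 0) :=
      tendsto_one_div_add_atTop_nhds_zero_nat.comp hφ.tendsto_atTop
    have h3 := (hc.tendsto (0, θ₀)).comp (hv.prodMk_nhds hlim)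
    have h4 : ((fun z : ℝ × (Fin 5 → ℝ) => F z.1 z.2 x) ∘
        fun n => (1 / (((φ n : ℕ) : ℝ) + 1), (θ ∘ φ) n)) = fun _ => 0 :=
      funext fun n => hFθ (φ n) x
    rw [h4] at h3
    exact (tendsto_nhds_unique h3 tendsto_const_nhds)
  set K : Herm := ⟨θ₀ 0, (θ₀ 2 - I * θ₀ 3) / 2, θ₀ 1⟩ with hK
  have h3 : ∀ x, K.eval (T x) + θ₀ 4 * g x = 0 := by
    intro x
    rw [← h2 x]
    simp [hK, hF, Herm.eval]
    ring
  have h4 : θ₀ 4 ≠ 0 := by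
    intro h4
    have hKn : K.NonZero := by
      by_contra hc
      simp only [Herm.NonZero, hK] at hc
      push Not at hc
      obtain ⟨c0, c1, c2⟩ := hc
      have c3 := congrArg Complex.re c1
      have c4 := congrArg Complex.im c1
      simp at c3 c4
      have : θ₀ = 0 := by
        funext i; fin_cases i <;> simp [c0, c2, c3, c4, h4]
      rw [this] at hθ₀
      simp at hθ₀
    obtain ⟨x, -, hx⟩ := hT.eval K hKn
    exact hx (by simpa [h4] using h3 x)
  refine ⟨K.scale (-(θ₀ 4)⁻¹), fun x => ?_⟩
  have e : ∀ c p, (K.scale c).eval p = c * K.eval p := fun c p => by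
    simp [Herm.scale, Herm.eval]; ring
  rw [e]
  have := h3 x
  field_simp
  linarith

lemma Coprime.conj {T : TMap 2} (hT : Coprime T) {B : TMap 2}
    (h : ∀ x, conj (T x).1 * (B x).1 + conj (T x).2 * (B x).2 = 0) :
    ∃ m : ℂ, ∀ x, B x = (m * conj (T x).2, -(m * conj (T x).1)) := by
  set L : ℂ × ℂ →ₗ[ℝ] ℂ × ℂ :=
    { toFun := fun p => (-conj p.2, conj p.1)
      map_add' := fun p q => by ext1 <;> simp; ring
      map_smul' := fun c p => by ext1 <;> simp }
  obtain ⟨m, hm⟩ := hT (L.compMultilinearMap B) fun x => by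
    have := congrArg conj (h x)
    simp at this
    change (T x).1 * conj (B x).1 - (T x).2 * (-conj (B x).2) = 0
    linear_combination this
  refine ⟨conj m, fun x => ?_⟩
  have h1 := congrArg Prod.fst (hm x)
  have h2 := congrArg Prod.snd (hm x)
  change -conj (B x).2 = m * (T x).1 at h1
  change conj (B x).1 = m * (T x).2 at h2
  have h1' := congrArg conj h1
  have h2' := congrArg conj h2
  simp at h1' h2'
  ext1
  · simpa using h2'
  · simp [← h1']

lemma omega_pencil_zero (A B : QMap 2) (x) : omega (pencil A B) x 0 =
    omega (fun y => x 2 0 • A y + x 2 1 • B y) ![x 0, x 1] 0 := by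
  rw [omega, pencil_apply, pencil_apply, update_triple_zero, update_triple_zero]
  rfl

lemma omega_pencil_one (A B : QMap 2) (x) : omega (pencil A B) x 1 =
    omega (fun y => x 2 0 • A y + x 2 1 • B y) ![x 0, x 1] 1 := by
  rw [omega, pencil_apply, pencil_apply, update_triple_one, update_triple_one]
  rfl

lemma omega_pencil_two (A B : QMap 2) (x) : omega (pencil A B) x 2 =
    form (A ![x 0, x 1]) (B ![x 0, x 1]) := by
  rw [omega, pencil_apply, pencil_apply]
  simp

lemma exists_rel_of_emb' {T B : TMap 2} (hT : Standard T) {D : QMap 3}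
    (hD : D = pencil (embQ T) (emb'.compMultilinearMap B)) (hA : AlgDC D)
    (hS : SphericalAt D 2) : ∃ H : Herm, H.NonZero ∧ D = pencilForm T H := by
  have hDx : ∀ x (u : Fin 2 → ℝ), D ![x 0, x 1, u] = u 0 • emb (T x) + u 1 • emb' (B x) :=
    fun x u => by
      rw [hD, pencil_apply]
      simp only [cons_val_zero, cons_val_one, cons_val, ← vec2_eta]
      rfl
  set S : (Fin 2 → Fin 2 → ℝ) → ℂ := fun x =>
    conj (T x).1 * (B x).1 + conj (T x).2 * (B x).2 with hSdef
  have hSre : ∀ x, S x = I * (S x).im := by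
    intro x
    have h1 := hA.isotropic ![x 0, x 1, ![1, 1]]
    rw [hDx] at h1
    simp only [cons_val_zero, cons_val_one, one_smul, form_add_left, form_add_right,
      isotropic_emb, form_emb'_emb'] at h1
    rw [← star_form (emb (T x)), form_emb_emb'] at h1
    have h2 := congrArg QuaternionAlgebra.re h1
    simp [cdet, mul_comm, icx, cx] at h2
    apply Complex.ext
    · simp [hSdef]; linarith
    · simp
  obtain ⟨H, hH⟩ := exists_eval_of_quadrics hT hSre (fun v hv => by
    obtain ⟨A, Y, C, h0, h1, h2⟩ := hS ![1, v] (by simp)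
    refine ⟨A, Y, C, h0, h1, fun x => ?_⟩
    have := h2 ![x 0, x 1, ![1, v]] rfl
    rw [hDx] at this
    simpa using this)
  have hom2 : ∀ x : Fin 3 → Fin 2 → ℝ, omega D x 2 = cx (I * H.eval (T ![x 0, x 1])) := by
    intro x
    rw [hD, omega_pencil_two, ← hH, ← hSre]
    exact form_emb_emb' _ _
  have hHn : H.NonZero := by
    by_contra hc
    simp only [Herm.NonZero] at hc
    push Not at hc
    obtain ⟨x, -, hx⟩ := hA.nondegenerate
    apply hx 2
    rw [hom2]; simp [Herm.eval, hc]
  refine ⟨H, hHn, ?_⟩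
  obtain ⟨m, hm⟩ := hT.coprime.conj (B := B - H.skew.compMultilinearMap T) (fun x => by
    have h1 := form_emb_skew H (T x)
    rw [form_emb_emb', ← hH] at h1
    have h2 : ∀ z w, cx z = cx w → z = w := fun z w h => by
      have h3 := congrArg QuaternionAlgebra.re h
      have h4 := congrArg QuaternionAlgebra.imK h
      exact Complex.ext (by simpa [cx] using h3) (by simpa [cx] using h4)
    have h3 := h2 _ _ h1
    have h4 := hSre x
    rw [← h3] at h4
    simp only [sub_apply, LinearMap.compMultilinearMap_apply, Prod.fst_sub,
      Prod.snd_sub]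
    linear_combination h4)
  have hB : ∀ x, B x = H.skew (T x) +
      (m * conj (T x).2, -(m * conj (T x).1)) := fun x => by
    rw [← hm]; simp
  have hm0 : m = 0 := by
    obtain ⟨x, hx1, hx2⟩ := hT.eval H hHn
    obtain ⟨q, r, hq, hr, -⟩ := hT.omega_eq
    have key : ∀ p p', (form (emb p + emb' (H.skew p + (m * conj p.2,
        -(m * conj p.1)))) (emb p' + emb' (H.skew p' + (m * conj p'.2,
        -(m * conj p'.1))))).imK = 2 * (m * conj (cdet p p')).im := by
      intro p p'
      have h1 := congrArg QuaternionAlgebra.imK (form_pencil H p p' 1 1)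
      have e1 : ∀ p q, (form (emb p) (emb q)).imK = 0 := fun p q => by
        rw [form_emb_emb]; simp [icx]
      have e2 : ∀ p q, (form (emb' p) (emb' q)).imK = 0 := fun p q => by
        rw [form_emb'_emb']; simp [icx]
      have e3 : ∀ p q, (form (emb p) (emb' q)).imK =
          (conj p.1 * q.1 + conj p.2 * q.2).im := fun p q => by
        rw [form_emb_emb']; simp [cx]
      have e4 : ∀ p q, (form (emb' q) (emb p)).imK =
          -(conj p.1 * q.1 + conj p.2 * q.2).im := fun p q => by
        rw [← star_form, ← e3]; simp
      have e5 : ∀ p q : ℍ[ℝ], (p + q).imK = p.imK + q.imK := fun p q => rfl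
      simp only [one_smul, form_add_left, form_add_right, map_add, e5, e1, e2, e3, e4] at h1 ⊢
      simp [cdet, icx] at h1 ⊢
      linarith
    have h0 := hA.orthogonal ![x 0, x 1, ![1, 1]] 0 2 (by simp)
    have h1 := hA.orthogonal ![x 0, x 1, ![1, 1]] 1 2 (by simp)
    rw [hom2] at h0 h1
    rw [hD, omega_pencil_zero] at h0
    rw [hD, omega_pencil_one] at h1
    simp only [cons_val_zero, cons_val_one, cons_val, ← vec2_eta, one_smul] at h0 h1
    have hin : ∀ (Q : ℍ[ℝ]) (z : ℝ), z ≠ 0 → inner ℝ Q (cx (I * z)) = 0 → Q.imK = 0 := by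
      intro Q z hz h
      simp [inner_def, cx] at h
      exact h.resolve_right hz
    have k0 := hin _ _ hx2 h0
    have k1 := hin _ _ hx2 h1
    simp only [omega, embQ_apply, LinearMap.compMultilinearMap_apply, hB] at k0 k1
    rw [key] at k0 k1
    have q0 := hq x
    have r0 := hr x
    have hq0 : q x ≠ 0 := fun h => hx1 0 (by rw [q0, h]; simp)
    have hr0 : r x ≠ 0 := fun h => hx1 1 (by rw [r0, h]; simp)
    have hi : ∀ z w, icx z = icx w → z = w := fun z w h => by
      have h3 := congrArg QuaternionAlgebra.imI h
      have h4 := congrArg QuaternionAlgebra.imJ h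
      exact Complex.ext (by simpa [icx] using h3) (by simpa [icx] using h4)
    rw [omega_embQ] at q0 r0
    have q1 := hi _ _ q0
    have r1 := hi _ _ r0
    rw [neg_eq_iff_eq_neg] at q1 r1
    rw [q1] at k0
    rw [r1] at k1
    simp at k0 k1
    exact Complex.ext (by simpa [hr0] using k1) (by simpa [hq0] using k0)
  rw [hD]
  refine MultilinearMap.ext fun x => ?_
  rw [pencil_apply, pencilForm_apply, LinearMap.compMultilinearMap_apply, hB, hm0]
  simp [embQ_apply]
  exact Or.inr (map_zero emb')

lemma exists_rel_of_emb {T : TMap 2} (hT : Standard T) {B : QMap 2} {D : QMap 3}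
    (hD : D = pencil (embQ T) B) (hA : AlgDC D) (hS : SphericalAt D 2) :
    ∃ H : Herm, H.NonZero ∧ Rel D (pencilForm T H) := by
  have hDx : ∀ x (u : Fin 2 → ℝ), D ![x 0, x 1, u] = u 0 • emb (T x) + u 1 • B x :=
    fun x u => by
      rw [hD, pencil_apply]
      simp only [cons_val_zero, cons_val_one, cons_val, ← vec2_eta]
      rfl
  obtain ⟨q, r, hq, hr, hqr⟩ := hT.omega_eq
  set B1 : TMap 2 := proj.compMultilinearMap B
  set B2 : TMap 2 := proj'.compMultilinearMap B
  have hB : ∀ x, B x = emb (B1 x) + emb' (B2 x) := fun x => (emb_proj_add (B x)).symm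
  have h1 : ∀ x, cdet (T x) (B1 x) = 0 := by
    refine eq_zero_of_coord_ne_zero ?_ fun x hx => ?_
    · have e : (fun x => cdet (T x) (B1 x)) =
        fun x => (T x).1 * (B1 x).2 - (T x).2 * (B1 x).1 := rfl
      have c1 := continuous_map2 T
      have c2 := continuous_map2 B1
      rw [e]; fun_prop
    · obtain ⟨hq0, hr0⟩ := hqr x hx
      have o0 := hA.orthogonal ![x 0, x 1, ![1, 0]] 0 2 (by simp)
      have o1 := hA.orthogonal ![x 0, x 1, ![1, 0]] 1 2 (by simp)
      rw [hD, omega_pencil_zero, omega_pencil_two] at o0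
      rw [hD, omega_pencil_one, omega_pencil_two] at o1
      simp only [cons_val_zero, cons_val_one, cons_val, ← vec2_eta, one_smul,
        zero_smul, add_zero] at o0 o1
      change inner ℝ (omega (embQ T) x 0) _ = 0 at o0
      change inner ℝ (omega (embQ T) x 1) _ = 0 at o1
      rw [hq, hB, embQ_apply, form_add_right, form_emb_emb, form_emb_emb', inner_add_right,
        inner_icx_cx, inner_icx] at o0
      rw [hr, hB, embQ_apply, form_add_right, form_emb_emb, form_emb_emb', inner_add_right,
        inner_icx_cx, inner_icx] at o1
      simp [hq0] at o0
      simp [hr0] at o1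
      exact Complex.ext o0 o1
  obtain ⟨m, hm⟩ := hT.coprime B1 h1
  set S : (Fin 2 → Fin 2 → ℝ) → ℂ := fun x =>
    conj (T x).1 * (B2 x).1 + conj (T x).2 * (B2 x).2 with hSdef
  have hform : ∀ x, form (emb (T x)) (B x) = cx (S x) := fun x => by
    rw [hB, form_add_right, form_emb_emb, form_emb_emb', h1]; simp [hSdef]
  have hBB : ∀ x, form (B x) (B x) = 0 := fun x => by
    have := hA.isotropic ![x 0, x 1, ![0, 1]]
    rw [hDx] at this
    simpa using this
  have hSre : ∀ x, (S x).re = 0 := by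
    intro x
    have h1 := hA.isotropic ![x 0, x 1, ![1, 1]]
    rw [hDx] at h1
    simp only [cons_val_zero, cons_val_one, one_smul, form_add_left, form_add_right,
      isotropic_emb, hBB] at h1
    rw [← star_form (emb (T x)), hform] at h1
    have h2 := congrArg QuaternionAlgebra.re h1
    simp [cx] at h2
    linarith
  have hmS : ∀ x, m.im * (S x).im = 0 := by
    intro x
    have h2 := hBB x
    rw [hB, hm] at h2
    simp only [form_add_left, form_add_right, isotropic_emb, form_emb'_emb'] at h2
    rw [← star_form (emb (m • T x)), form_emb_emb'] at h2
    have h3 : conj (m • T x).1 * (B2 x).1 + conj (m • T x).2 * (B2 x).2 =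
        conj m * S x := by
      simp [hSdef]; ring
    rw [h3] at h2
    have h4 := congrArg QuaternionAlgebra.re h2
    simp [cdet, mul_comm, icx, cx, hSre] at h4
    rcases h4 with h4 | h4 <;> simp [h4]
  have hmi : m.im = 0 := by
    obtain ⟨x, -, hx⟩ := hA.nondegenerate
    have h2 := hx 2
    rw [hD, omega_pencil_two, embQ_apply, hform, Ne, cx_eq_zero] at h2
    refine (mul_eq_zero.1 (hmS ![x 0, x 1])).resolve_right fun h => h2 ?_
    exact Complex.ext (hSre _) h
  have hmr : m = m.re := Complex.ext rfl (by simp [hmi])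
  set G := colGL ![1, 0] ![-m.re, 1] (by simp [wedge])
  set D' := act LinearMap.id 1 ![1, 1, G] 1 D with hD'
  have hrel : Rel D D' := rel_act isSim_id _ _ one_ne_zero D
  obtain ⟨H, hH, e⟩ := exists_rel_of_emb' (B := B2) hT (D := D') (by
    refine MultilinearMap.ext fun x => ?_
    rw [hD', act_apply, subst_one_two, rmul_one, LinearMap.id_apply, pencil_apply,
      show D ![x 0, x 1, G.1.mulVec (x 2)] = _ from hDx ![x 0, x 1] _, colGL_mulVec, hB, hm, hmr]
    simp only [embQ_apply, LinearMap.compMultilinearMap_apply]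
    have : ((m.re : ℂ) • T ![x 0, x 1]) = m.re • T ![x 0, x 1] := rfl
    rw [this, map_smul]
    simp
    module) (hrel.algDC hA) (hS.act hA.isotropic isSim_id _ _ _ rfl)
  exact ⟨H, hH, e ▸ hrel⟩

lemma exists_standard {T : TMap 2} (hT : IsBase T) : ∃ T₀, Standard T₀ ∧ (T₀ = polarT ∨ T₀ = cartT) ∧
    TEquiv T₀ T := by
  rcases hT with h | h
  · exact ⟨_, standard_polarT, Or.inl rfl, h⟩
  · exact ⟨_, standard_cartT, Or.inr rfl, h⟩

/-- The restriction of a three-dimensional system to a value of the third parameter. -/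
noncomputable def restrict (D : QMap 3) (u : Fin 2 → ℝ) : QMap 2 where
  toFun x := D ![x 0, x 1, u]
  map_update_add' := by
    intro inst m i x y
    obtain rfl : inst = instDecidableEqFin 2 := Subsingleton.elim _ _
    have h0 : ∀ v, ![update m 0 v 0, update m 0 v 1, u] = update ![m 0, m 1, u] 0 v := fun v => by
      funext i; fin_cases i <;> rfl
    have h1 : ∀ v, ![update m 1 v 0, update m 1 v 1, u] = update ![m 0, m 1, u] 1 v := fun v => by
      funext i; fin_cases i <;> rfl
    fin_cases i
    · change D ![update m 0 _ 0, update m 0 _ 1, u] = D ![update m 0 _ 0, update m 0 _ 1, u] +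
        D ![update m 0 _ 0, update m 0 _ 1, u]
      rw [h0, h0, h0, D.map_update_add]
    · change D ![update m 1 _ 0, update m 1 _ 1, u] = D ![update m 1 _ 0, update m 1 _ 1, u] +
        D ![update m 1 _ 0, update m 1 _ 1, u]
      rw [h1, h1, h1, D.map_update_add]
  map_update_smul' := by
    intro inst m i c x
    obtain rfl : inst = instDecidableEqFin 2 := Subsingleton.elim _ _
    have h0 : ∀ v, ![update m 0 v 0, update m 0 v 1, u] = update ![m 0, m 1, u] 0 v := fun v => by
      funext i; fin_cases i <;> rfl
    have h1 : ∀ v, ![update m 1 v 0, update m 1 v 1, u] = update ![m 0, m 1, u] 1 v := fun v => by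
      funext i; fin_cases i <;> rfl
    fin_cases i
    · change D ![update m 0 _ 0, update m 0 _ 1, u] = c • D ![update m 0 _ 0, update m 0 _ 1, u]
      rw [h0, h0, D.map_update_smul]
    · change D ![update m 1 _ 0, update m 1 _ 1, u] = c • D ![update m 1 _ 0, update m 1 _ 1, u]
      rw [h1, h1, D.map_update_smul]

lemma restrict_apply (D : QMap 3) (u) (x) : restrict D u x = D ![x 0, x 1, u] := rfl

lemma eq_pencil (D : QMap 3) : D = pencil (restrict D ![1, 0]) (restrict D ![0, 1]) := by
  refine MultilinearMap.ext fun x => ?_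
  rw [pencil_apply, restrict_apply, restrict_apply]
  have h := map_update_vec D ![x 0, x 1, x 2] 2 (x 2)
  have e : ∀ v, update ![x 0, x 1, x 2] 2 v = ![x 0, x 1, v] := fun v => by
    funext i; fin_cases i <;> rfl
  rw [e, e, e] at h
  refine Eq.trans (congrArg D ?_) h
  funext i; fin_cases i <;> rfl

lemma omega_restrict (D : QMap 3) (u) (x : Fin 2 → Fin 2 → ℝ) :
    omega (restrict D u) x 0 = omega D ![x 0, x 1, u] 0 ∧
      omega (restrict D u) x 1 = omega D ![x 0, x 1, u] 1 := by
  have h0 : ∀ v, ![update x 0 v 0, update x 0 v 1, u] = update ![x 0, x 1, u] 0 v := fun v => by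
    funext i; fin_cases i <;> rfl
  have h1 : ∀ v, ![update x 1 v 0, update x 1 v 1, u] = update ![x 0, x 1, u] 1 v := fun v => by
    funext i; fin_cases i <;> rfl
  constructor
  · simp only [omega, restrict_apply, h0]
  · simp only [omega, restrict_apply, h1]

lemma AlgDC.restrict {D : QMap 3} (hD : AlgDC D) {x : Fin 2 → Fin 2 → ℝ} {u} (hu : u ≠ 0)
    (h : ∀ i, omega D ![x 0, x 1, u] i ≠ 0) : AlgDC (restrict D u) := by
  have h01 : ∀ y, inner ℝ (omega (DupinCyclidic.restrict D u) y 0)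
      (omega (DupinCyclidic.restrict D u) y 1) = 0 := fun y => by
    rw [(omega_restrict D u y).1, (omega_restrict D u y).2]
    exact hD.orthogonal _ 0 1 (by simp)
  refine ⟨fun y => hD.isotropic _, fun y i j hij => ?_, x, ⟨fun i hi => ?_, fun h0 => ?_⟩,
    fun i => ?_⟩
  · fin_cases i <;> fin_cases j <;> first | exact absurd rfl hij | exact h01 y |
      (rw [real_inner_comm]; exact h01 y)
  · apply h 2
    fin_cases i
    · exact omega_eq_zero_of_coord (k := 0) (by simp) hi
    · exact omega_eq_zero_of_coord (k := 1) (by simp) hi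
  · exact h 2 (hD.isotropic.omega_eq_zero_of_eq_zero hu h0)
  · fin_cases i
    · exact (omega_restrict D u x).1 ▸ h 0
    · exact (omega_restrict D u x).2 ▸ h 1

lemma exists_rel_of_restrict {D : QMap 3} (hA : AlgDC D) (hS : SphericalAt D 2) {T : TMap 2}
    {k : ℍ[ℝ]} (hT : IsBase T) (hk : k ≠ 0) (h : ∀ x, restrict D ![1, 0] x = rmul (emb (T x)) k) :
    ∃ T₀ H, Standard T₀ ∧ (T₀ = polarT ∨ T₀ = cartT) ∧ H.NonZero ∧ Rel D (pencilForm T₀ H) := by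
  obtain ⟨T₀, hT₀, hT₀', σ, g, a, b, c, d, hd, hTx⟩ := exists_standard hT
  obtain ⟨M, l, hM, hl, -, he⟩ := TEquiv.eq_act hd hTx
  obtain ⟨N, hN, hNM, -⟩ := hM.exists_inverse
  obtain ⟨τ, g', hσ, -⟩ := exists_subst_inverse σ g
  obtain ⟨τ', k', hτ⟩ := exists_lift τ g'
  have hτ2 : τ' 2 = 2 := by
    have h1 : ∀ x : Fin 3 → Fin 2 → ℝ, (k' 2).1.mulVec (x (τ' 2)) = x 2 := fun x => (hτ x).2
    by_contra hne
    have h2 := h1 (update (fun _ => 0) 2 ![1, 0])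
    rw [update_of_ne hne] at h2
    simp at h2
    simpa using congrFun h2 0
  set D' := act N τ' k' (k⁻¹ * l⁻¹) D with hD'
  have hrel : Rel D D' := rel_act hN _ _ (mul_ne_zero (inv_ne_zero hk) (inv_ne_zero hl)) D
  have hres : restrict D' ![1, 0] = embQ T₀ := by
    refine MultilinearMap.ext fun x => ?_
    rw [restrict_apply, hD', act_apply]
    have h1 : subst τ' k' ![x 0, x 1, ![1, 0]] =
        ![subst τ g' x 0, subst τ g' x 1, ![1, 0]] := by
      obtain ⟨h2, h3⟩ := hτ ![x 0, x 1, ![1, 0]]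
      have h4 : ![(![x 0, x 1, ![1, 0]] : Fin 3 → Fin 2 → ℝ) 0,
        (![x 0, x 1, ![1, 0]] : Fin 3 → Fin 2 → ℝ) 1] = x := (vec2_eta x).symm
      rw [h4] at h2
      have h5 := congrFun h2 0
      have h6 := congrFun h2 1
      simp only [cons_val_zero, cons_val_one] at h5 h6
      funext i; fin_cases i
      · exact h5
      · exact h6
      · exact h3
    rw [h1, ← restrict_apply, h, show emb (T (subst τ g' x)) = embQ T (subst τ g' x) from rfl, he,
      act_apply, hσ, rmul_rmul, hN.map_rmul, hNM, rmul_rmul]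
    rw [show l * k * (k⁻¹ * l⁻¹) = 1 by
      rw [mul_assoc, ← mul_assoc k, mul_inv_cancel₀ hk, one_mul, mul_inv_cancel₀ hl], rmul_one]
  have e := eq_pencil D'
  rw [hres] at e
  obtain ⟨H, hH, h2⟩ := exists_rel_of_emb hT₀ e (hrel.algDC hA) (hS.act hA.isotropic hN _ _ _ hτ2)
  exact ⟨T₀, H, hT₀, hT₀', hH, hrel.trans h2⟩

lemma exists_perp {v : Fin 2 → ℝ} (hv : v ≠ 0) : wedge v ![-v 1, v 0] ≠ 0 := by
  have := sq_add_sq_pos hv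
  simp [wedge]; nlinarith

/-- Spherical systems are equivalent to pencil forms. -/
lemma IsSpherical.exists_rel {D : QMap 3} (hA : AlgDC D) (hS : IsSpherical D) :
    ∃ T₀ H, Standard T₀ ∧ (T₀ = polarT ∨ T₀ = cartT) ∧ H.NonZero ∧ Rel D (pencilForm T₀ H) := by
  obtain ⟨i, hS⟩ := hS
  have hSA := IsSpherical.sphericalAt hA.isotropic hS
  obtain ⟨y, hy, hom⟩ := hA.nondegenerate
  obtain ⟨S, hSS, hsub⟩ := hS (Projectivization.mk ℝ (y i) (hy.1 i))
  obtain ⟨M, hM⟩ := hSS.exists_chart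
  obtain ⟨N, hN, hNM, hMN⟩ := hM.1.exists_inverse
  set g : Fin 3 → GL (Fin 2) ℝ := fun j => colGL (y j) ![-y j 1, y j 0] (exists_perp (hy.1 j))
    with hg
  set σ := Equiv.swap i 2 with hσ
  set D' := act N σ g 1 D with hD'
  have hrel : Rel D D' := rel_act hN _ _ one_ne_zero D
  have hA' := hrel.algDC hA
  have hσi : σ i = 2 := Equiv.swap_apply_left _ _
  have hsub0 : subst σ g (fun _ => ![1, 0]) = y := by
    funext j
    change (g j).1.mulVec _ = _
    rw [hg, colGL_mulVec]
    simp
  have hom' : ∀ j, omega D' (fun _ => ![1, 0]) j ≠ 0 := fun j => by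
    rw [hD', Ne, omega_act_eq_zero_iff hN σ g one_ne_zero hA.isotropic, hsub0]
    exact hom _
  have hres : AlgDC (restrict D' ![1, 0]) := by
    refine hA'.restrict (x := fun _ => ![1, 0]) (by simp) fun j => ?_
    convert hom' j using 2
    funext l; fin_cases l <;> rfl
  obtain ⟨T, k, hk, hT⟩ := hres.exists_complex (fun x hx => by
    have h1 : (subst σ g ![x 0, x 1, ![1, 0]]) i = y i := by
      change (g i).1.mulVec (![x 0, x 1, ![1, 0]] (σ i)) = y i
      rw [hσi, hg, colGL_mulVec]
      simp
    have h2 := hx.2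
    rw [restrict_apply, hD', act_apply, rmul_one, Ne, hN.map_eq_zero] at h2
    rw [val_eq_toPoint, restrict_apply, hD', act_apply, rmul_one,
      ← hM.2 _ (hN.map_eq_zero.not.2 h2) ((hN.isotropic_iff _).2 (hA.isotropic _)), hMN]
    refine hsub ⟨_, ⟨⟨fun j hj => h2 (D.map_coord_zero j hj), h2⟩, by rw [h1]; exact hy.1 i, ?_⟩, rfl⟩
    simp only [h1])
  refine (exists_rel_of_restrict hA' (hSA.act hA.isotropic hN σ g 1 hσi) (T := T) (k := k) ?_ hk hT).imp
    fun T₀ h => h.imp fun H h => ⟨h.1, h.2.1, h.2.2.1, hrel.trans h.2.2.2⟩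
  rw [isBase_iff]
  refine Rel.algDC ⟨LinearMap.id, isSim_id, 1, 1, k⁻¹, inv_ne_zero hk,
    MultilinearMap.ext fun x => ?_⟩ hres
  rw [act_apply, subst_one, LinearMap.id_apply, hT, rmul_rmul, mul_inv_cancel₀ hk, rmul_one]
  rfl

/-! ### Reduction of pencil forms to the four classes -/

/-- Sylvester's law of inertia for Hermitian forms in two variables. -/
lemma Herm.NonZero.sylvester {H : Herm} (hH : H.NonZero) : ∃ H₀ : Herm,
    (H₀ = hSphere ∨ H₀ = hPlane ∨ H₀ = hAxial) ∧ ∃ c : ℝ, c ≠ 0 ∧ ∃ v w : ℂ × ℂ,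
      v.1 * w.2 - w.1 * v.2 ≠ 0 ∧ H.scale c = H₀.pull v.1 w.1 v.2 w.2 := by
  have h1 : ∀ {H : Herm}, H.α ≠ 0 → ∃ H₀ : Herm,
    (H₀ = hSphere ∨ H₀ = hPlane ∨ H₀ = hAxial) ∧ ∃ c : ℝ, c ≠ 0 ∧ ∃ v w : ℂ × ℂ,
      v.1 * w.2 - w.1 * v.2 ≠ 0 ∧ H.scale c = H₀.pull v.1 w.1 v.2 w.2 := by
    intro H hα
    have hα' : (H.α : ℂ) ≠ 0 := by exact_mod_cast hα
    rcases lt_trichotomy H.det 0 with hd | hd | hd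
    · set e := sqrt (-H.det) / H.α
      have he0 : e ≠ 0 := div_ne_zero (sqrt_pos.2 (by linarith)).ne' hα
      have he : e * e = -H.det / H.α ^ 2 := by
        rw [div_mul_div_comm, Real.mul_self_sqrt (by linarith), pow_two]
      rw [Herm.det, normSq_apply] at he
      field_simp at he
      refine ⟨hAxial, by simp, 2 / H.α, div_ne_zero two_ne_zero hα, (1, I),
        (H.β / H.α + e, I * (H.β / H.α - e)), ?_, ?_⟩
      · simp only
        rw [show (1 : ℂ) * (I * (H.β / H.α - e)) - (H.β / H.α + e) * I =
          -(2 * I) * e by ring]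
        simpa using he0
      · refine Herm.ext' ?_ (Complex.ext ?_ ?_) ?_
        · simp [Herm.scale, Herm.pull, hAxial, Herm.eval, hα]
        · simp [Herm.scale, Herm.pull, hAxial]; field_simp; ring
        · simp [Herm.scale, Herm.pull, hAxial]; field_simp; ring
        · simp [Herm.scale, Herm.pull, hAxial, Herm.eval]; field_simp; linarith
    · refine ⟨hPlane, by simp, (H.α)⁻¹, inv_ne_zero hα, (0, 1), (1, H.β / H.α), by simp, ?_⟩
      rw [Herm.det] at hd
      refine Herm.ext' ?_ ?_ ?_
      · simp [Herm.scale, Herm.pull, hPlane, Herm.eval, hα]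
      · simp [Herm.scale, Herm.pull, hPlane]; field_simp
      · simp [Herm.scale, Herm.pull, hPlane, Herm.eval]; field_simp; linarith
    · set e := sqrt (H.det) / H.α
      have he0 : e ≠ 0 := div_ne_zero (sqrt_pos.2 hd).ne' hα
      have he : e * e = H.det / H.α ^ 2 := by
        rw [div_mul_div_comm, Real.mul_self_sqrt hd.le, pow_two]
      rw [Herm.det] at he
      field_simp at he
      refine ⟨hSphere, by simp, (H.α)⁻¹, inv_ne_zero hα, (1, 0), (H.β / H.α, e),
        by simpa using he0, ?_⟩
      refine Herm.ext' ?_ ?_ ?_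
      · simp [Herm.scale, Herm.pull, hSphere, Herm.eval, hα]
      · simp [Herm.scale, Herm.pull, hSphere]; field_simp
      · simp [Herm.scale, Herm.pull, hSphere, Herm.eval]; field_simp; linarith
  by_cases hα : H.α = 0
  · by_cases hγ : H.γ = 0
    · have hβ : H.β ≠ 0 := by rcases hH with h | h | h <;> tauto
      refine ⟨hAxial, by simp, 1, one_ne_zero, (1, 0), (0, I * H.β), by simpa using hβ, ?_⟩
      refine Herm.ext' ?_ (Complex.ext ?_ ?_) ?_ <;>
        simp [Herm.scale, Herm.pull, hAxial, Herm.eval, hα, hγ]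
    · obtain ⟨H₀, h0, c, hc, v, w, hd, h⟩ := h1 (H := H.pull 0 1 1 0) (by simpa [Herm.pull, Herm.eval])
      refine ⟨H₀, h0, c, hc, w, v, fun h => hd (by linear_combination -h), ?_⟩
      have := congrArg (fun K => Herm.pull K 0 1 1 0) h
      simp only [Herm.pull_pull] at this
      simp only [mul_zero, mul_one, zero_add, add_zero] at this
      rw [← this]
      refine Herm.ext' ?_ ?_ ?_ <;> simp [Herm.scale, Herm.pull, Herm.eval]
  · exact h1 hα

lemma IsDC.exists_class {D : QMap 3} (hD : IsDC D) (hS : IsSpherical D) :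
    ∃ G, MobiusEquiv D G ∧ (ClassS1 G ∨ ClassS2 G ∨ ClassS3 G ∨ ClassS4 G) := by
  have hA := isDC_iff.1 hD
  obtain ⟨T₀, H, hT₀, hT, hH, hrel⟩ := hS.exists_rel hA
  obtain ⟨H₀, h0, c, hc, v, w, hd, h⟩ := hH.sylvester
  obtain ⟨T, hcol⟩ := exists_tColumns T₀ hd
  have h1 := (hrel.trans (rel_pencilForm_scale T₀ H hc)).trans (h ▸ hcol.rel_pencilForm H₀)
  have hTE := hcol.tEquiv
  have hB : IsBase T := by rcases hT with rfl | rfl <;> [exact Or.inl hTE; exact Or.inr hTE]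
  rcases h0 with rfl | rfl | rfl
  · obtain ⟨P, G, g, h2, h3⟩ := exists_sphereOffset hB
    exact ⟨G, (h1.trans h3.rel).mobiusEquiv hA.isotropic, Or.inl ⟨P, _, _, h2⟩⟩
  · obtain ⟨P, G, g, h2, h3⟩ := exists_planeOffset hB
    exact ⟨G, (h1.trans h3.rel).mobiusEquiv hA.isotropic, Or.inr (Or.inl ⟨P, h2⟩)⟩
  · obtain ⟨P, G, g, h2, h3⟩ := exists_axial hB
    refine ⟨G, (h1.trans h3.rel).mobiusEquiv hA.isotropic, Or.inr (Or.inr ?_)⟩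
    rcases hT with rfl | rfl
    · exact Or.inl ⟨P, _, h3.twoPolar_iff.2 hTE, h2⟩
    · exact Or.inr ⟨P, _, h3.onePolar_iff.2 hTE, h2⟩

/-! ### Coordinate surfaces -/

lemma surface_mk (D : QMap n) (i) {v : Fin 2 → ℝ} (hv : v ≠ 0) :
    surface D i (Projectivization.mk ℝ v hv) = val D '' {x | Defined D x ∧ x i = v} := by
  ext Q
  constructor
  · rintro ⟨x, ⟨hx, hi, h⟩, rfl⟩
    obtain ⟨a, ha⟩ := (mk_eq_mk_iff' ..).1 h
    have ha0 : a ≠ 0 := by rintro rfl; simp at ha; exact hi ha.symm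
    have h1 : D x = a • D (update x i v) := by
      rw [← D.map_update_smul, ha, update_eq_self]
    have h2 : D (update x i v) ≠ 0 := fun h => hx.2 (by rw [h1, h, smul_zero])
    refine ⟨update x i v, ⟨⟨fun j hj => h2 (D.map_coord_zero j hj), h2⟩, by simp⟩, ?_⟩
    rw [val_eq_toPoint, val_eq_toPoint, h1, toPoint_smul _ ha0]
  · rintro ⟨x, ⟨hx, rfl⟩, rfl⟩
    exact ⟨x, ⟨hx, hv, rfl⟩, rfl⟩

namespace Herm

/-- The point with base point `p` and parameter `v` in a pencil form. -/
noncomputable def lift (H : Herm) (v : Fin 2 → ℝ) : ℂ × ℂ →ₗ[ℝ] ℍ² :=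
  v 0 • emb + v 1 • (emb' ∘ₗ H.skew)

lemma lift_apply (H : Herm) (v p) : H.lift v p = v 0 • emb p + v 1 • emb' (H.skew p) := rfl

lemma lift_smul (H : Herm) (v) (z : ℂ) (p) : H.lift v (z • p) = rmul (H.lift v p) (cx z) := by
  rw [lift_apply, lift_apply, skew, cmat_smul, emb_smul, emb'_smul, rmul_add_left, rmul_smul_left,
    rmul_smul_left]

lemma form_lift (H : Herm) (v p) : form (H.lift v p) (H.lift v p) = 0 := by
  rw [lift_apply, form_pencil]
  simp [cdet, mul_comm]

end Herm

lemma Presents.eq_lift {H M T k g P G} (h : Presents H M T k g P G) (x) :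
    G x = rmul (M (H.lift (g.1.mulVec (x 2)) (T ![x 0, x 1]))) k := h.apply x

lemma Presents.val_eq {H M T k g P G} (h : Presents H M T k g P G) (x) :
    val G x = toPoint (M (H.lift (g.1.mulVec (x 2)) (T ![x 0, x 1]))) := by
  rw [val_eq_toPoint, h.eq_lift, toPoint_rmul _ h.ne_zero]

lemma Presents.defined_iff {H M T k g P G} (h : Presents H M T k g P G) (x) :
    Defined G x ↔ (∀ i, x i ≠ 0) ∧ H.lift (g.1.mulVec (x 2)) (T ![x 0, x 1]) ≠ 0 := by
  rw [Defined, h.eq_lift, Ne, rmul_eq_zero h.ne_zero, h.isSim.map_eq_zero]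

/-- A bilinear map that represents polar or Cartesian coordinates takes all values. -/
lemma exists_polarT_eq {p : ℂ × ℂ} (hp : p ≠ 0) :
    ∃ x, (∀ i, x i ≠ 0) ∧ ∃ z : ℂ, z ≠ 0 ∧ polarT x = z • p := by
  by_cases h1 : p.1 = 0
  · have h2 : p.2 ≠ 0 := fun h => hp (Prod.ext h1 h)
    refine ⟨![![1, 0], ![1, 0]], fun i => by fin_cases i <;> simp, p.2⁻¹, inv_ne_zero h2, ?_⟩
    rw [polarT_apply]; ext1 <;> simp [h1, h2]
  by_cases h2 : p.2 = 0
  · refine ⟨![![0, 1], ![1, 0]], fun i => by fin_cases i <;> simp, p.1⁻¹, inv_ne_zero h1, ?_⟩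
    rw [polarT_apply]; ext1 <;> simp [h1, h2]
  obtain ⟨t, ht⟩ := IsAlgClosed.exists_pow_nat_eq (p.2 / p.1) (n := 2) (by norm_num)
  have ht0 : t ≠ 0 := by
    rintro rfl
    simp only [ne_eq, OfNat.ofNat_ne_zero, not_false_eq_true, zero_pow] at ht
    exact div_ne_zero h2 h1 ht.symm
  have hc : conj t ≠ 0 := by simpa using ht0
  have e1 : (t.re - I * t.im : ℂ) = conj t := by
    apply Complex.ext <;> simp
  have e2 : (t.re + I * t.im : ℂ) = t := by apply Complex.ext <;> simp
  refine ⟨![![normSq t, 1], ![t.re, t.im]], fun i => ?_, conj t / p.1,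
    div_ne_zero hc h1, ?_⟩
  · fin_cases i
    · simp
    · intro h
      have h3 := congrFun h 0
      have h4 := congrFun h 1
      exact ht0 (Complex.ext (by simpa using h3) (by simpa using h4))
  · rw [polarT_apply]
    simp only [cons_val_zero, cons_val_one, e1, e2, ofReal_one, one_mul]
    ext1
    · simp; field_simp
    · have h5 : p.2 = t ^ 2 * p.1 := by rw [ht]; field_simp
      simp only [Prod.smul_snd, smul_eq_mul, h5, normSq_eq_conj_mul_self]
      field_simp

lemma exists_cartT_eq {p : ℂ × ℂ} (hp : p ≠ 0) :
    ∃ x, (∀ i, x i ≠ 0) ∧ ∃ z : ℂ, z ≠ 0 ∧ cartT x = z • p := by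
  by_cases h2 : p.2 = 0
  · have h1 : p.1 ≠ 0 := fun h => hp (Prod.ext h h2)
    refine ⟨![![0, 1], ![1, 0]], fun i => by fin_cases i <;> simp, p.1⁻¹, inv_ne_zero h1, ?_⟩
    rw [cartT_apply]; ext1 <;> simp [h1, h2]
  · refine ⟨![![1, (p.1 / p.2).re], ![1, -(p.1 / p.2).im]], fun i => by fin_cases i <;> simp,
      p.2⁻¹, inv_ne_zero h2, ?_⟩
    rw [cartT_apply]
    have : ((p.1 / p.2).re + I * (p.1 / p.2).im : ℂ) = p.1 / p.2 := by
      apply Complex.ext <;> simp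
    ext1
    · simp [this]; field_simp
    · simp [h2]

lemma TEquiv.exists_eq {T₀ T : TMap 2} (h : TEquiv T₀ T)
    (hT₀ : ∀ p : ℂ × ℂ, p ≠ 0 → ∃ x, (∀ i, x i ≠ 0) ∧ ∃ z : ℂ, z ≠ 0 ∧ T₀ x = z • p) {p : ℂ × ℂ}
    (hp : p ≠ 0) : ∃ x, (∀ i, x i ≠ 0) ∧ ∃ z : ℂ, z ≠ 0 ∧ T x = z • p := by
  obtain ⟨σ, g, a, b, c, d, hd, h⟩ := h
  obtain ⟨τ, k, h1, h2⟩ := exists_subst_inverse σ g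
  have e : ∀ q, cmat a b c d (cmat d (-b) (-c) a q) = (a * d - b * c) • q := fun q => by
    ext1 <;> simp [cmat_apply] <;> ring
  obtain ⟨x, hx, z, hz, hxz⟩ := hT₀ (cmat d (-b) (-c) a p) fun h0 => by
    have := e p
    rw [h0, map_zero] at this
    exact (smul_ne_zero hd hp) this.symm
  refine ⟨subst τ k x, (subst_ne_zero_iff τ k x).2 hx, z * (a * d - b * c), mul_ne_zero hz hd, ?_⟩
  rw [h, h1, hxz, cmat_smul, e, smul_smul]

lemma IsBase.exists_eq {T : TMap 2} (h : IsBase T) {p : ℂ × ℂ} (hp : p ≠ 0) :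
    ∃ x, (∀ i, x i ≠ 0) ∧ ∃ z : ℂ, z ≠ 0 ∧ T x = z • p := by
  rcases h with h | h
  · exact h.exists_eq (fun _ => exists_polarT_eq) hp
  · exact h.exists_eq (fun _ => exists_cartT_eq) hp

lemma Presents.surface_two {H M T k g P G} (h : Presents H M T k g P G) {u : Fin 2 → ℝ}
    (hu : u ≠ 0) : surface G 2 (Projectivization.mk ℝ u hu) =
      {Q | ∃ p, H.lift (g.1.mulVec u) p ≠ 0 ∧ toPoint (M (H.lift (g.1.mulVec u) p)) = Q} := by
  rw [surface_mk]
  ext Q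
  constructor
  · rintro ⟨x, ⟨hx, rfl⟩, rfl⟩
    exact ⟨_, ((h.defined_iff x).1 hx).2, (h.val_eq x).symm⟩
  · rintro ⟨p, hp, rfl⟩
    obtain ⟨x, hx, z, hz, hxz⟩ := h.isBase.exists_eq (p := p) fun h0 => hp (by rw [h0, map_zero])
    have hz' : cx z ≠ 0 := by rwa [Ne, cx_eq_zero]
    have hT : T ![(![x 0, x 1, u] : Fin 3 → Fin 2 → ℝ) 0,
        (![x 0, x 1, u] : Fin 3 → Fin 2 → ℝ) 1] = z • p := by
      rw [← hxz]; exact congrArg T (vec2_eta x).symm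
    refine ⟨![x 0, x 1, u], ⟨(h.defined_iff _).2 ⟨fun i => ?_, ?_⟩, rfl⟩, ?_⟩
    · fin_cases i
      exacts [hx 0, hx 1, hu]
    · rw [hT, H.lift_smul, Ne, rmul_eq_zero hz']; exact hp
    · rw [h.val_eq, hT, H.lift_smul, h.isSim.map_rmul, toPoint_rmul _ hz']; rfl

lemma Presents.isSpherical {H M T k g P G} (h : Presents H M T k g P G)
    (hS : ∀ v : Fin 2 → ℝ, v ≠ 0 → ∃ S, IsMSphere S ∧
      ∀ p, H.lift v p ≠ 0 → toPoint (M (H.lift v p)) ∈ S) : IsSpherical G := by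
  refine ⟨2, fun c => ?_⟩
  induction c using ind with
  | h u hu =>
    obtain ⟨S, h1, h2⟩ := hS (g.1.mulVec u) ((mulVec_ne_zero_iff g u).2 hu)
    refine ⟨S, h1, ?_⟩
    rw [h.surface_two]
    rintro _ ⟨p, hp, rfl⟩
    exact h2 p hp



lemma SphereOffset.isSpherical {P c r G} (h : SphereOffset P c r G) : IsSpherical G := by
  obtain ⟨T, k, g, hp⟩ := h.presents
  have hc := h.2.1
  refine hp.isSpherical fun v hv => ?_
  by_cases h0 : v 0 + v 1 = 0 ∨ v 0 - v 1 = 0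
  · refine ⟨plane qk (inner ℝ qk c), Or.inr ⟨_, _, rfl, qk_ne_zero, rfl⟩, fun p hne => ?_⟩
    rw [toPoint_mem_plane ((hp.isSim.isotropic_iff _).2 (hSphere.form_lift _ _)), Herm.lift_apply,
      sphereMat_pencil]
    rcases h0 with h0 | h0
    · simp [h0]
    · simp only [h0, mul_zero, zero_smul, zero_add, mul_smul_comm, inner_smul_left,
        inner_smul_right, norm_smul, mul_pow]
      rw [inner_mul_right_mul, real_inner_comm]
      simp; ring
  · push Not at h0
    have hr : 0 < |r * (v 0 - v 1) / (v 0 + v 1)| :=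
      abs_pos.2 (div_ne_zero (mul_ne_zero h.2.2.1.ne' h0.2) h0.1)
    refine ⟨sphere c |r * (v 0 - v 1) / (v 0 + v 1)|, Or.inl ⟨_, _, hc, hr, rfl⟩, fun p hne => ?_⟩
    have hp0 : p ≠ 0 := fun h => hne (by rw [h, map_zero])
    have h1 := ((isChart_sphereMat hc one_pos).2 (emb p) (by rwa [Ne, emb_eq_zero])
      (isotropic_emb p)).2 (toPoint_emb_mem p)
    rw [toPoint_mem_sphere (((isSim_sphereMat hc one_ne_zero).isotropic_iff _).2 (isotropic_emb p)),
      sphereMat_apply] at h1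
    simp only [one_smul, add_sub_cancel_right, one_mul] at h1
    rw [toPoint_mem_sphere ((hp.isSim.isotropic_iff _).2 (hSphere.form_lift _ _)), Herm.lift_apply,
      sphereMat_pencil]
    refine ⟨smul_ne_zero h0.1 h1.1, ?_⟩
    simp only [mul_smul_comm, add_sub_cancel_right, norm_smul, h1.2, abs_div, abs_mul,
      Real.norm_eq_abs]
    have := abs_pos.2 h0.1
    field_simp

lemma planeMat_lift_hPlane (q : ℍ[ℝ]) (d : ℝ) {v : Fin 2 → ℝ}
    (hv : v 0 ≠ 0) (p) : planeMat q d (hPlane.lift v p) =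
      v 0 • planeMat q (d + v 1 / v 0) (emb p) := by
  rw [Herm.lift_apply, emb'_skew_hPlane, planeMat_apply, planeMat_apply]
  ext1
  · simp only [Prod.fst_add, Prod.smul_fst, Prod.snd_add, Prod.smul_snd, smul_zero, add_zero,
      mul_add, mul_smul_comm, smul_mul_assoc, add_smul, add_mul, smul_add, smul_smul, mul_assoc]
    match_scalars <;> field_simp
    ring
  · simp

lemma PlaneOffset.isSpherical {P G} (h : PlaneOffset P G) : IsSpherical G := by
  obtain ⟨ν, q, d, T, k, g, h0, h1, hq, hν, hp⟩ := h.presents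
  have hν0 : ν ≠ 0 := by rintro rfl; simp at h1
  refine hp.isSpherical fun v hv => ?_
  by_cases hv0 : v 0 = 0
  · refine ⟨plane ν 0, Or.inr ⟨_, _, h0, hν0, rfl⟩, fun p _ => ?_⟩
    rw [Herm.lift_apply, emb'_skew_hPlane, planeMat_apply, toPoint_of_eq_zero (by simp [hv0])]
    exact infty_mem_plane
  · refine ⟨plane ν (d + v 1 / v 0), Or.inr ⟨_, _, h0, hν0, rfl⟩, fun p hne => ?_⟩
    have hp0 : p ≠ 0 := fun h => hne (by rw [h, map_zero])
    rw [planeMat_lift_hPlane q d hv0, toPoint_smul _ hv0,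
      (isChart_planeMat hq _ hν h1).2 _ (by rwa [Ne, emb_eq_zero]) (isotropic_emb p)]
    exact toPoint_emb_mem p

/-- Half of the rotation about the axis `i` that belongs to a parameter. -/
noncomputable def halfTurn (v : Fin 2 → ℝ) : ℍ[ℝ] := quat (v 0) (v 1) 0 0

lemma halfTurn_ne_zero {v : Fin 2 → ℝ} (hv : v ≠ 0) : halfTurn v ≠ 0 := by
  intro h
  apply hv
  have h0 := congrArg QuaternionAlgebra.re h
  have h1 := congrArg QuaternionAlgebra.imI h
  ext i; fin_cases i
  · simpa [halfTurn] using h0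
  · simpa [halfTurn] using h1

lemma planeMat_lift_hAxial (q : ℍ[ℝ]) (v p) :
    planeMat q 0 (hAxial.lift v p) = planeMat (q * halfTurn v) 0 (emb p) := by
  have h : ∀ X : ℍ[ℝ], v 0 • X + v 1 • (qi * X) = halfTurn v * X := fun X => by
    ext <;> simp [halfTurn, qi] <;> ring
  rw [Herm.lift_apply, emb'_skew_hAxial, planeMat_apply, planeMat_apply]
  ext1 <;> simp [h, mul_assoc]

/-- The normal of a plane of the rotating family. -/
noncomputable def turnedNormal (q : ℍ[ℝ]) (v : Fin 2 → ℝ) : ℍ[ℝ] :=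
  q * halfTurn v * qk * (q * halfTurn v)⁻¹

lemma isChart_turned {q : ℍ[ℝ]} (hq : q ≠ 0) {v : Fin 2 → ℝ} (hv : v ≠ 0) :
    IsChart (planeMat (q * halfTurn v) 0) (plane (turnedNormal q v) 0) := by
  have h := mul_ne_zero hq (halfTurn_ne_zero hv)
  refine isChart_planeMat h 0 ?_ ?_
  · rw [turnedNormal, mul_assoc _ _⁻¹, inv_mul_cancel₀ h, mul_one]
  · rw [turnedNormal, norm_mul, norm_mul, norm_qk, mul_one, norm_inv, mul_inv_cancel₀]
    simpa using h

lemma turnedNormal_re (q v) : (turnedNormal q v).re = 0 := conj_re rfl _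

lemma turnedNormal_ne_zero {q : ℍ[ℝ]} (hq : q ≠ 0) {v : Fin 2 → ℝ} (hv : v ≠ 0) :
    turnedNormal q v ≠ 0 := by
  have h := mul_ne_zero hq (halfTurn_ne_zero hv)
  exact mul_ne_zero (mul_ne_zero h qk_ne_zero) (inv_ne_zero h)

lemma Axial.isSpherical {P a G} (h : Axial P a G) : IsSpherical G := by
  obtain ⟨ν, q, T, k, h0, h1, hq, hν, ha, hp⟩ := h.presents
  refine hp.isSpherical fun v hv => ?_
  refine ⟨plane (turnedNormal q v) 0, Or.inr ⟨_, _, turnedNormal_re q v,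
    turnedNormal_ne_zero hq hv, rfl⟩, fun p hne => ?_⟩
  have hp0 : p ≠ 0 := fun h => hne (by rw [h, map_zero])
  rw [planeMat_lift_hAxial, (isChart_turned hq hv).2 _ (by rwa [Ne, emb_eq_zero]) (isotropic_emb p)]
  exact toPoint_emb_mem p

lemma isDC_and_isSpherical {G : QMap 3} (h : ClassS1 G ∨ ClassS2 G ∨ ClassS3 G ∨ ClassS4 G) :
    IsDC G ∧ IsSpherical G := by
  have hax : ∀ {P a}, Axial P a G → IsDC G ∧ IsSpherical G := fun h => by
    obtain ⟨ν, q, T, k, -, -, -, -, -, hp⟩ := h.presents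
    exact ⟨isDC_iff.2 (hp.algDC nonZero_hAxial), h.isSpherical⟩
  rcases h with ⟨P, c, r, h⟩ | ⟨P, h⟩ | ⟨P, a, -, h⟩ | ⟨P, a, -, h⟩
  · obtain ⟨T, k, g, hp⟩ := h.presents
    exact ⟨isDC_iff.2 (hp.algDC nonZero_hSphere), h.isSpherical⟩
  · obtain ⟨ν, q, d, T, k, g, -, -, -, -, hp⟩ := h.presents
    exact ⟨isDC_iff.2 (hp.algDC nonZero_hPlane), h.isSpherical⟩
  · exact hax h
  · exact hax h

/-! ### Coordinate surfaces of equivalent systems -/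

/-- A projective transformation of the real projective line. -/
noncomputable def moveRP1 (g : GL (Fin 2) ℝ) : RP1 ≃ RP1 where
  toFun := Projectivization.map (Matrix.mulVecLin g.1)
    (LeftInverse.injective (g := (g⁻¹).1.mulVec) (mulVec_inv_mulVec g))
  invFun := Projectivization.map (Matrix.mulVecLin (g⁻¹).1)
    (LeftInverse.injective (g := g.1.mulVec) (mulVec_mulVec_inv g))
  left_inv c := by
    induction c using ind with
    | h v hv => simp only [Projectivization.map_mk, Matrix.mulVecLin_apply, mulVec_inv_mulVec]
  right_inv c := by
    induction c using ind with
    | h v hv => simp only [Projectivization.map_mk, Matrix.mulVecLin_apply, mulVec_mulVec_inv]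

lemma moveRP1_mk (g : GL (Fin 2) ℝ) {v : Fin 2 → ℝ} (hv : v ≠ 0) :
    moveRP1 g (Projectivization.mk ℝ v hv) =
      Projectivization.mk ℝ (g.1.mulVec v) ((mulVec_ne_zero_iff g v).2 hv) := rfl

/-- The map of parameters of coordinate surfaces that is defined by a substitution. -/
noncomputable def moveIndex (σ : Equiv.Perm (Fin n)) (g : Fin n → GL (Fin 2) ℝ) :
    Fin n × RP1 ≃ Fin n × RP1 where
  toFun k := (σ.symm k.1, moveRP1 (g (σ.symm k.1)) k.2)
  invFun k := (σ k.1, (moveRP1 (g k.1)).symm k.2)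
  left_inv k := by simp
  right_inv k := by simp

lemma surface_act {M μ} (hM : IsSim M) (hμ : Realizes μ M) (σ : Equiv.Perm (Fin n)) (g) {h}
    (hh : h ≠ 0) {D : QMap n} (hD : Isotropic D) (k : Fin n × RP1) :
    surface (act M σ g h D) k.1 k.2 =
      μ '' surface D (moveIndex σ g k).1 (moveIndex σ g k).2 := by
  obtain ⟨i, c⟩ := k
  induction c using ind with
  | h v hv =>
    obtain ⟨τ, l, h3, h4⟩ := exists_subst_inverse σ g
    have hi : ∀ x, subst σ g x (σ.symm i) = (g (σ.symm i)).1.mulVec (x i) := fun x => by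
      simp [subst]
    change surface _ i _ = μ '' surface D (σ.symm i) (moveRP1 _ _)
    rw [moveRP1_mk, surface_mk, surface_mk]
    ext Q
    constructor
    · rintro ⟨x, ⟨hx, rfl⟩, rfl⟩
      exact ⟨_, ⟨_, ⟨(defined_act hM σ g hh D x).1 hx, hi x⟩, rfl⟩, (val_act hM hμ σ g hh hD hx).symm⟩
    · rintro ⟨_, ⟨x, ⟨hx, hx'⟩, rfl⟩, rfl⟩
      have hd : Defined (act M σ g h D) (subst τ l x) := by
        rw [defined_act hM σ g hh, h3]; exact hx
      refine ⟨subst τ l x, ⟨hd, ?_⟩, ?_⟩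
      · have := hi (subst τ l x)
        rw [h3, hx'] at this
        simpa only [mulVec_inv_mulVec] using (congrArg ((g (σ.symm i))⁻¹).1.mulVec this).symm
      · rw [val_act hM hμ σ g hh hD hd, h3]

/-! ### Degenerate coordinate curves -/

lemma exists_smul_of_cdet {p q : ℂ × ℂ} (hp : p ≠ 0) (hq : q ≠ 0) (h : cdet p q = 0) :
    ∃ z : ℂ, z ≠ 0 ∧ q = z • p := by
  have h' : p.1 * q.2 = p.2 * q.1 := by simpa [cdet, sub_eq_zero] using h
  have key : ∃ z : ℂ, q = z • p := by
    by_cases h1 : p.1 = 0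
    · have h2 : p.2 ≠ 0 := fun h => hp (Prod.ext h1 h)
      refine ⟨q.2 / p.2, ?_⟩
      have : q.1 = 0 := by simpa [h1, h2] using h'.symm
      ext1 <;> simp [h1, h2, this]
    · refine ⟨q.1 / p.1, ?_⟩
      ext1
      · simp [h1]
      · simp; field_simp; linear_combination h'
  obtain ⟨z, rfl⟩ := key
  exact ⟨z, fun h => hq (by simp [h]), rfl⟩

lemma exists_smul_of_toPoint_eq {p q : ℂ × ℂ} (hp : p ≠ 0) (hq : q ≠ 0)
    (h : toPoint (emb p) = toPoint (emb q)) : ∃ z : ℂ, z ≠ 0 ∧ q = z • p :=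
  exists_smul_of_cdet hp hq (toPoint_sim_injective isSim_id hp hq h)

/-- The poles of a bilinear map, counted with multiplicity, together with the parameters of the
coordinate curves that degenerate to them. -/
structure HasPoles (T : TMap 2) (v w : ℂ × ℂ) : Prop where
  fst_ne_zero : v ≠ 0
  snd_ne_zero : w ≠ 0
  sing_eq : sing (embQ T) = {toPoint (emb v), toPoint (emb w)}
  curves : ∃ k l : Fin 2 × RP1, k ≠ l ∧ surface (embQ T) k.1 k.2 = {toPoint (emb v)} ∧
    surface (embQ T) l.1 l.2 = {toPoint (emb w)} ∧
    ∀ m, m ≠ k → m ≠ l → (surface (embQ T) m.1 m.2).Infinite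

lemma surface_eq_singleton {T : TMap 2} {i} {u : Fin 2 → ℝ} (hu : u ≠ 0) {p : ℂ × ℂ}
    (h : ∀ x, x i = u → ∃ z : ℂ, T x = z • p)
    (h' : ∃ x, (∀ j, x j ≠ 0) ∧ T x ≠ 0 ∧ x i = u) :
    surface (embQ T) i (Projectivization.mk ℝ u hu) = {toPoint (emb p)} := by
  rw [surface_mk]
  have key : ∀ x, T x ≠ 0 → x i = u → val (embQ T) x = toPoint (emb p) := fun x hx hi => by
    obtain ⟨z, hz⟩ := h x hi
    rw [val_eq_toPoint, embQ_apply, hz, toPoint_emb_smul]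
    rintro rfl
    exact hx (by simp [hz])
  ext Q
  constructor
  · rintro ⟨x, ⟨hx, hi⟩, rfl⟩
    exact key x (fun h => hx.2 (by rw [embQ_apply, h, map_zero])) hi
  · rintro rfl
    obtain ⟨x, h1, h2, h3⟩ := h'
    exact ⟨x, ⟨⟨h1, by rwa [embQ_apply, Ne, emb_eq_zero]⟩, h3⟩, key x h2 h3⟩

lemma surface_infinite {T : TMap 2} {i} {u : Fin 2 → ℝ} (hu : u ≠ 0)
    (x : ℝ → Fin 2 → Fin 2 → ℝ) (hx : ∀ t j, x t j ≠ 0) (hi : ∀ t, x t i = u)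
    (h : ∀ s t, s ≠ t → cdet (T (x s)) (T (x t)) ≠ 0) :
    (surface (embQ T) i (Projectivization.mk ℝ u hu)).Infinite := by
  have h0 : ∀ t, T (x t) ≠ 0 := fun t h0 => h t (t + 1) (by simp) (by simp [h0, cdet])
  rw [surface_mk]
  refine Set.infinite_of_injective_forall_mem (f := fun t : ℝ => val (embQ T) (x t)) ?_
    fun t => ⟨x t, ⟨⟨hx t, by rw [embQ_apply, Ne, emb_eq_zero]; exact h0 t⟩, hi t⟩, rfl⟩
  intro s t hst
  by_contra hne
  exact h s t hne (toPoint_sim_injective isSim_id (h0 s) (h0 t) hst)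

lemma mk_eq_of_wedge {v w : Fin 2 → ℝ} (hv : v ≠ 0) (hw : w ≠ 0) (h : wedge v w = 0) :
    Projectivization.mk ℝ v hv = Projectivization.mk ℝ w hw := by
  rw [mk_eq_mk_iff']
  have h' : v 0 * w 1 = v 1 * w 0 := by
    simp only [wedge] at h; linarith
  by_cases h0 : w 0 = 0
  · have h1 : w 1 ≠ 0 := fun h => hw (by ext i; fin_cases i <;> simpa)
    refine ⟨v 1 / w 1, ?_⟩
    have : v 0 = 0 := by simpa [h0, h1] using h'
    ext i; fin_cases i <;> simp [h0, h1, this]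
  · refine ⟨v 0 / w 0, ?_⟩
    ext i; fin_cases i
    · simp [h0]
    · simp; field_simp; linarith

lemma wedge_ne_zero_of_mk {v w : Fin 2 → ℝ} {hv : v ≠ 0} {hw : w ≠ 0}
    (h : Projectivization.mk ℝ v hv ≠ Projectivization.mk ℝ w hw) : wedge v w ≠ 0 :=
  fun h' => h (mk_eq_of_wedge hv hw h')

lemma zero_one_ne_zero : (![0, 1] : Fin 2 → ℝ) ≠ 0 := by simp

lemma one_zero_ne_zero : (![1, 0] : Fin 2 → ℝ) ≠ 0 := by simp

lemma hasPoles_polarT : HasPoles polarT (1, 0) (0, 1) where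
  fst_ne_zero := by simp
  snd_ne_zero := by simp
  sing_eq := sing_polarT
  curves := by
    refine ⟨(0, Projectivization.mk ℝ ![0, 1] zero_one_ne_zero),
      (0, Projectivization.mk ℝ ![1, 0] one_zero_ne_zero), ?_, ?_, ?_, ?_⟩
    · intro h
      obtain ⟨a, ha⟩ := (mk_eq_mk_iff' ..).1 (congrArg Prod.snd h)
      simpa using congrFun ha 1
    · refine surface_eq_singleton _ (fun x hx => ⟨x 1 0 - I * x 1 1, ?_⟩)
        ⟨![![0, 1], ![1, 0]], fun j => by fin_cases j <;> simp, by rw [polarT_apply]; simp, rfl⟩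
      rw [polarT_apply, hx]; simp
    · refine surface_eq_singleton _ (fun x hx => ⟨x 1 0 + I * x 1 1, ?_⟩)
        ⟨![![1, 0], ![1, 0]], fun j => by fin_cases j <;> simp, by rw [polarT_apply]; simp, rfl⟩
      rw [polarT_apply, hx]; simp
    · rintro ⟨i, c⟩ h1 h2
      induction c using ind with
      | h u hu =>
        fin_cases i
        · have e1 := wedge_ne_zero_of_mk fun h => h1 (congrArg (Prod.mk 0) h)
          have e2 := wedge_ne_zero_of_mk fun h => h2 (congrArg (Prod.mk 0) h)
          simp [wedge] at e1 e2
          refine surface_infinite hu (fun t => ![u, ![1, t]]) (fun t j => ?_) (fun t => rfl)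
            fun s t hst h => ?_
          · fin_cases j
            · exact hu
            · simp
          · have := congrArg Complex.im h
            simp [polarT_apply, cdet] at this
            refine (mul_ne_zero (mul_ne_zero e1 e2) (sub_ne_zero.2 hst)) ?_
            linear_combination (-1 / 2 : ℝ) * this
        · refine surface_infinite hu (fun t => ![![1, t], u]) (fun t j => ?_) (fun t => rfl)
            fun s t hst h => ?_
          · fin_cases j
            · simp
            · exact hu
          · have := congrArg Complex.re h
            simp [polarT_apply, cdet] at this
            refine (mul_ne_zero (sq_add_sq_pos hu).ne' (sub_ne_zero.2 hst)) ?_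
            linear_combination this

lemma hasPoles_cartT : HasPoles cartT (1, 0) (1, 0) where
  fst_ne_zero := by simp
  snd_ne_zero := by simp
  sing_eq := by rw [sing_cartT]; simp
  curves := by
    refine ⟨(0, Projectivization.mk ℝ ![0, 1] zero_one_ne_zero),
      (1, Projectivization.mk ℝ ![0, 1] zero_one_ne_zero), by simp, ?_, ?_, ?_⟩
    · refine surface_eq_singleton _ (fun x hx => ⟨x 1 0, ?_⟩)
        ⟨![![0, 1], ![1, 0]], fun j => by fin_cases j <;> simp, by rw [cartT_apply]; simp, rfl⟩
      rw [cartT_apply, hx]; simp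
    · refine surface_eq_singleton _ (fun x hx => ⟨-I * x 0 0, ?_⟩)
        ⟨![![1, 0], ![0, 1]], fun j => by fin_cases j <;> simp, by rw [cartT_apply]; simp, rfl⟩
      rw [cartT_apply, hx]; simp
    · rintro ⟨i, c⟩ h1 h2
      induction c using ind with
      | h u hu =>
        fin_cases i
        · have e1 := wedge_ne_zero_of_mk fun h => h1 (congrArg (Prod.mk 0) h)
          simp [wedge] at e1
          refine surface_infinite hu (fun t => ![u, ![1, t]]) (fun t j => ?_) (fun t => rfl)
            fun s t hst h => ?_
          · fin_cases j
            · exact hu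
            · simp
          · have := congrArg Complex.im h
            simp [cartT_apply, cdet] at this
            refine (mul_ne_zero (mul_ne_zero e1 e1) (sub_ne_zero.2 hst)) ?_
            linear_combination (-1 : ℝ) * this
        · have e1 := wedge_ne_zero_of_mk fun h => h2 (congrArg (Prod.mk 1) h)
          simp [wedge] at e1
          refine surface_infinite hu (fun t => ![![1, t], u]) (fun t j => ?_) (fun t => rfl)
            fun s t hst h => ?_
          · fin_cases j
            · simp
            · exact hu
          · have := congrArg Complex.re h
            simp [cartT_apply, cdet] at this
            refine (mul_ne_zero (mul_ne_zero e1 e1) (sub_ne_zero.2 hst)) ?_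
            linear_combination this

lemma surface_subset_range {T : TMap 2} {i c} {Q} (h : Q ∈ surface (embQ T) i c) :
    ∃ p, p ≠ 0 ∧ Q = toPoint (emb p) := by
  obtain ⟨x, ⟨hx, -⟩, rfl⟩ := h
  exact ⟨T x, fun h => hx.2 (by rw [embQ_apply, h, map_zero]), rfl⟩

lemma HasPoles.transport {T₀ T : TMap 2} {v w v₀ w₀ : ℂ × ℂ} (hT₀ : AlgDC (embQ T₀))
    (h₀ : HasPoles T₀ v₀ w₀) (h : TColumns T₀ T v w) :
    HasPoles T (cmat v.1 w.1 v.2 w.2 v₀) (cmat v.1 w.1 v.2 w.2 w₀) := by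
  obtain ⟨hd, σ, g, hT⟩ := h
  obtain ⟨N, l, hN, hl, h1, h2⟩ := TEquiv.eq_act hd hT
  obtain ⟨μ, -, hμ⟩ := hN.realizable
  have hμ' : ∀ p, p ≠ 0 → μ (toPoint (emb p)) = toPoint (emb (cmat v.1 w.1 v.2 w.2 p)) :=
    fun p hp => by
      rw [hμ _ (by rwa [Ne, emb_eq_zero]) (isotropic_emb p), ← h1, toPoint_rmul _ hl]
  have hne : ∀ p, p ≠ 0 → cmat v.1 w.1 v.2 w.2 p ≠ 0 := fun p hp h => by
    have := h1 p
    rw [h, map_zero, rmul_eq_zero hl, hN.map_eq_zero, emb_eq_zero] at this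
    exact hp this
  have hs : ∀ k : Fin 2 × RP1, surface (embQ T) k.1 k.2 =
      μ '' surface (embQ T₀) (moveIndex σ g k).1 (moveIndex σ g k).2 := fun k => by
    rw [h2]; exact surface_act hN hμ σ g hl (isotropic_embQ T₀) k
  obtain ⟨k, m, hkm, hk, hm, hinf⟩ := h₀.curves
  refine ⟨hne _ h₀.fst_ne_zero, hne _ h₀.snd_ne_zero, ?_,
    (moveIndex σ g).symm k, (moveIndex σ g).symm m, fun h => hkm ((moveIndex σ g).symm.injective h),
    ?_, ?_, fun a ha hb => ?_⟩
  · rw [h2, sing_act hN hμ σ g hl hT₀, h₀.sing_eq, Set.image_pair, hμ' _ h₀.fst_ne_zero,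
      hμ' _ h₀.snd_ne_zero]
  · rw [hs, Equiv.apply_symm_apply, hk, Set.image_singleton, hμ' _ h₀.fst_ne_zero]
  · rw [hs, Equiv.apply_symm_apply, hm, Set.image_singleton, hμ' _ h₀.snd_ne_zero]
  · rw [hs]
    refine (hinf _ (fun h => ha (by rw [← h, Equiv.symm_apply_apply]))
      (fun h => hb (by rw [← h, Equiv.symm_apply_apply]))).image ?_
    intro Q hQ Q' hQ' he
    obtain ⟨p, hp, rfl⟩ := surface_subset_range hQ
    obtain ⟨q, hq, rfl⟩ := surface_subset_range hQ'
    rw [hμ _ (by rwa [Ne, emb_eq_zero]) (isotropic_emb p),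
      hμ _ (by rwa [Ne, emb_eq_zero]) (isotropic_emb q)] at he
    obtain ⟨z, hz, rfl⟩ := exists_smul_of_cdet hp hq (toPoint_sim_injective hN hp hq he)
    rw [toPoint_emb_smul hz]

lemma TColumns.hasPoles_polar {T : TMap 2} {v w} (h : TColumns polarT T v w) : HasPoles T v w := by
  have := HasPoles.transport algDC_polarT hasPoles_polarT h
  simpa [cmat_apply] using this

lemma TColumns.hasPoles_cart {T : TMap 2} {v w} (h : TColumns cartT T v w) : HasPoles T v v := by
  have := HasPoles.transport algDC_cartT hasPoles_cartT h
  simpa [cmat_apply] using this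

/-! ### Singular loci of offset and axial constructions -/

/-- The orthogonal trajectory of the spherical family through a point of the base. -/
def fiber (H : Herm) (M : ℍ² →ₗ[ℝ] ℍ²) (p : ℂ × ℂ) :
    Set (OnePoint ℍ[ℝ]) :=
  {Q | ∃ v, H.lift v p ≠ 0 ∧ toPoint (M (H.lift v p)) = Q}

lemma fiber_smul {H : Herm} {M} (hM : IsSim M) {z : ℂ} (hz : z ≠ 0) (p) :
    fiber H M (z • p) = fiber H M p := by
  have hz' : cx z ≠ 0 := by rwa [Ne, cx_eq_zero]
  unfold fiber
  simp only [H.lift_smul, hM.map_rmul, toPoint_rmul _ hz', Ne, rmul_eq_zero hz']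

lemma Presents.omega_eq_zero_iff {H M T k g P G} (h : Presents H M T k g P G) (x i) :
    omega G x i = 0 ↔ omega (pencilForm T H) ![x 0, x 1, g.1.mulVec (x 2)] i = 0 := by
  rw [h.eq_act, omega_act_eq_zero_iff h.isSim 1 _ h.ne_zero (isotropic_pencilForm T H), subst_one_two]
  rfl

lemma mem_sing_embQ_iff {T : TMap 2} (hT : IsBase T) {p : ℂ × ℂ} (hp : p ≠ 0) :
    toPoint (emb p) ∈ sing (embQ T) ↔
      ∃ x, (∀ i, x i ≠ 0) ∧ (∃ z : ℂ, z ≠ 0 ∧ T x = z • p) ∧ ∃ i, omega (embQ T) x i = 0 := by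
  rw [hT.algDC.sing_eq]
  constructor
  · rintro ⟨x, ⟨hx, hi⟩, he⟩
    have h0 : T x ≠ 0 := fun h => hx.2 (by rw [embQ_apply, h, map_zero])
    exact ⟨x, hx.1, exists_smul_of_toPoint_eq hp h0 he.symm, hi⟩
  · rintro ⟨x, hx, ⟨z, hz, hxz⟩, hi⟩
    refine ⟨x, ⟨⟨hx, ?_⟩, hi⟩, ?_⟩
    · rw [embQ_apply, hxz, Ne, emb_eq_zero]; exact smul_ne_zero hz hp
    · rw [val_eq_toPoint, embQ_apply, hxz, toPoint_emb_smul hz]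

lemma Presents.mem_sing_iff {H M T k g P G} (h : Presents H M T k g P G) (hH : H.NonZero) {Q} :
    Q ∈ sing G ↔ ∃ v p, H.lift v p ≠ 0 ∧ toPoint (M (H.lift v p)) = Q ∧
      (v 0 ^ 2 = H.det * v 1 ^ 2 ∨ H.eval p = 0 ∨ toPoint (emb p) ∈ sing (embQ T)) := by
  rw [(h.algDC hH).sing_eq]
  constructor
  · rintro ⟨x, ⟨hx, i, hi⟩, rfl⟩
    obtain ⟨hx1, hx2⟩ := (h.defined_iff x).1 hx
    have hT0 : T ![x 0, x 1] ≠ 0 := fun h0 => hx2 (by rw [h0, map_zero])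
    refine ⟨_, _, hx2, (h.val_eq x).symm, ?_⟩
    have hmem : ∀ j, omega (embQ T) ![x 0, x 1] j = 0 →
        toPoint (emb (T ![x 0, x 1])) ∈ sing (embQ T) := fun j hj =>
      (mem_sing_embQ_iff h.isBase hT0).2 ⟨_, fun i => by fin_cases i <;> exact hx1 _,
        ⟨1, one_ne_zero, by simp⟩, j, hj⟩
    rw [h.omega_eq_zero_iff] at hi
    fin_cases i
    · change omega _ _ 0 = 0 at hi
      rw [omega_pencilForm_zero, smul_eq_zero, sub_eq_zero] at hi
      exact hi.imp id fun h => Or.inr (hmem _ h)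
    · change omega _ _ 1 = 0 at hi
      rw [omega_pencilForm_one, smul_eq_zero, sub_eq_zero] at hi
      exact hi.imp id fun h => Or.inr (hmem _ h)
    · change omega _ _ 2 = 0 at hi
      rw [omega_pencilForm_two, cx_eq_zero] at hi
      exact Or.inr (Or.inl (by simpa using hi))
  · rintro ⟨v, p, hne, rfl, hc⟩
    have hp : p ≠ 0 := fun h0 => hne (by rw [h0, map_zero])
    have hv : v ≠ 0 := fun h0 => hne (by rw [h0, Herm.lift_apply]; simp)
    have key : ∀ (x : Fin 2 → Fin 2 → ℝ) (z : ℂ), (∀ i, x i ≠ 0) → z ≠ 0 → T x = z • p →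
        (∃ i, omega (pencilForm T H) ![x 0, x 1, v] i = 0) →
        toPoint (M (H.lift v p)) ∈ val G '' {x | Defined G x ∧ ∃ i, omega G x i = 0} := by
      rintro x z hx hz hxz ⟨i, hi⟩
      have hz' : cx z ≠ 0 := by rwa [Ne, cx_eq_zero]
      set y : Fin 3 → Fin 2 → ℝ := ![x 0, x 1, (g⁻¹).1.mulVec v] with hy
      have e1 : g.1.mulVec (y 2) = v := mulVec_mulVec_inv g v
      have e2 : ![y 0, y 1] = x := (vec2_eta x).symm
      refine ⟨y, ⟨(h.defined_iff y).2 ⟨fun j => ?_, ?_⟩, i, ?_⟩, ?_⟩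
      · fin_cases j
        exacts [hx 0, hx 1, (mulVec_ne_zero_iff _ _).2 hv]
      · rw [e1, e2, hxz, H.lift_smul, Ne, rmul_eq_zero hz']; exact hne
      · rw [h.omega_eq_zero_iff, e1]; exact hi
      · rw [h.val_eq, e1, e2, hxz, H.lift_smul, h.isSim.map_rmul, toPoint_rmul _ hz']
    have e3 : ∀ x : Fin 2 → Fin 2 → ℝ, ![(![x 0, x 1, v] : Fin 3 → Fin 2 → ℝ) 0,
        (![x 0, x 1, v] : Fin 3 → Fin 2 → ℝ) 1] = x := fun x => (vec2_eta x).symm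
    rcases hc with hc | hc | hc
    · obtain ⟨x, hx, z, hz, hxz⟩ := h.isBase.exists_eq hp
      refine key x z hx hz hxz ⟨0, ?_⟩
      rw [omega_pencilForm_zero]
      simp [hc]
    · obtain ⟨x, hx, z, hz, hxz⟩ := h.isBase.exists_eq hp
      refine key x z hx hz hxz ⟨2, ?_⟩
      rw [omega_pencilForm_two, e3, hxz, H.eval_smul, hc]
      simp
    · obtain ⟨x, hx, ⟨z, hz, hxz⟩, i, hi⟩ := (mem_sing_embQ_iff h.isBase hp).1 hc
      refine key x z hx hz hxz ⟨i.castSucc, ?_⟩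
      fin_cases i
      · change omega _ _ 0 = 0
        change omega _ _ 0 = 0 at hi
        rw [omega_pencilForm_zero, e3, hi, smul_zero]
      · change omega _ _ 1 = 0
        change omega _ _ 1 = 0 at hi
        rw [omega_pencilForm_one, e3, hi, smul_zero]

/-- The singular points over the poles form the two fibers, the other singular points are those
over the zeros of the Hermitian form and at the exceptional parameters. -/
lemma Presents.sing_eq {H M T k g P G} (h : Presents H M T k g P G) (hH : H.NonZero) {v w}
    (hp : HasPoles T v w) : sing G = {Q | ∃ u p, H.lift u p ≠ 0 ∧ toPoint (M (H.lift u p)) = Q ∧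
      (u 0 ^ 2 = H.det * u 1 ^ 2 ∨ H.eval p = 0)} ∪ (fiber H M v ∪ fiber H M w) := by
  ext Q
  rw [h.mem_sing_iff hH, hp.sing_eq]
  have key : ∀ q p, q ≠ 0 → p ≠ 0 → toPoint (emb p) = toPoint (emb q) → fiber H M p = fiber H M q :=
    fun q p hq hp he => by
      obtain ⟨z, hz, rfl⟩ := exists_smul_of_toPoint_eq hp hq he
      rw [fiber_smul h.isSim hz]
  constructor
  · rintro ⟨u, p, h1, h2, h3⟩
    have hp0 : p ≠ 0 := fun h0 => h1 (by rw [h0, map_zero])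
    rcases h3 with h3 | h3 | h3 | h3
    · exact Or.inl ⟨u, p, h1, h2, Or.inl h3⟩
    · exact Or.inl ⟨u, p, h1, h2, Or.inr h3⟩
    · exact Or.inr (Or.inl (key _ _ hp.fst_ne_zero hp0 h3 ▸ ⟨u, h1, h2⟩))
    · exact Or.inr (Or.inr (key _ _ hp.snd_ne_zero hp0 h3 ▸ ⟨u, h1, h2⟩))
  · rintro (⟨u, p, h1, h2, h3⟩ | ⟨u, h1, h2⟩ | ⟨u, h1, h2⟩)
    · exact ⟨u, p, h1, h2, by tauto⟩
    · exact ⟨u, v, h1, h2, by simp⟩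
    · exact ⟨u, w, h1, h2, by simp⟩

/-! ### Multiplicities of singular curves -/

lemma Presents.surface_castSucc {H M T k g P G} (h : Presents H M T k g P G) (i : Fin 2) (c) :
    surface G i.castSucc c = {Q | ∃ p, p ≠ 0 ∧ toPoint (emb p) ∈ surface (embQ T) i c ∧
      Q ∈ fiber H M p} := by
  induction c using ind with
  | h u hu =>
    rw [surface_mk, surface_mk]
    ext Q
    constructor
    · rintro ⟨x, ⟨hx, hi⟩, rfl⟩
      obtain ⟨hx1, hx2⟩ := (h.defined_iff x).1 hx
      have hT0 : T ![x 0, x 1] ≠ 0 := fun h0 => hx2 (by rw [h0, map_zero])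
      refine ⟨T ![x 0, x 1], hT0, ⟨![x 0, x 1], ⟨⟨fun j => by fin_cases j <;> exact hx1 _, ?_⟩, ?_⟩,
        rfl⟩, _, hx2, (h.val_eq x).symm⟩
      · rwa [embQ_apply, Ne, emb_eq_zero]
      · rw [← hi]; fin_cases i <;> rfl
    · rintro ⟨p, hp, ⟨y, ⟨hy, hi⟩, he⟩, v, hv, rfl⟩
      have hT0 : T y ≠ 0 := fun h => hy.2 (by rw [embQ_apply, h, map_zero])
      obtain ⟨z, hz, hyz⟩ := exists_smul_of_toPoint_eq hp hT0 he.symm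
      have hz' : cx z ≠ 0 := by rwa [Ne, cx_eq_zero]
      have hv0 : v ≠ 0 := fun h0 => hv (by rw [h0, Herm.lift_apply]; simp)
      set x : Fin 3 → Fin 2 → ℝ := ![y 0, y 1, (g⁻¹).1.mulVec v] with hx
      have e1 : g.1.mulVec (x 2) = v := mulVec_mulVec_inv g v
      have e2 : ![x 0, x 1] = y := (vec2_eta y).symm
      refine ⟨x, ⟨(h.defined_iff x).2 ⟨fun j => ?_, ?_⟩, ?_⟩, ?_⟩
      · fin_cases j
        exacts [hy.1 0, hy.1 1, (mulVec_ne_zero_iff _ _).2 hv0]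
      · rw [e1, e2, hyz, H.lift_smul, Ne, rmul_eq_zero hz']; exact hv
      · rw [← hi]; fin_cases i <;> rfl
      · rw [h.val_eq, e1, e2, hyz, H.lift_smul, h.isSim.map_rmul, toPoint_rmul _ hz']

lemma Presents.surface_of_singleton {H M T k g P G} (h : Presents H M T k g P G) {i c} {q : ℂ × ℂ}
    (hq : q ≠ 0) (hs : surface (embQ T) i c = {toPoint (emb q)}) :
    surface G i.castSucc c = fiber H M q := by
  rw [h.surface_castSucc, hs]
  ext Q
  constructor
  · rintro ⟨p, hp, he, hQ⟩
    obtain ⟨z, hz, rfl⟩ := exists_smul_of_toPoint_eq hp hq he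
    rwa [fiber_smul h.isSim hz]
  · exact fun hQ => ⟨q, hq, rfl, hQ⟩

lemma Herm.form_emb_lift (H : Herm) (p q : ℂ × ℂ) (v : Fin 2 → ℝ) :
    form (emb p) (H.lift v q) = icx (-(v 0 * cdet p q)) +
      cx (v 1 * (conj p.1 * (H.skew q).1 + conj p.2 * (H.skew q).2)) := by
  rw [H.lift_apply, form_add_right, form_smul_right, form_smul_right, form_emb_emb, form_emb_emb']
  ext <;> simp [icx, cx]

/-- A fiber meets the base surface in at most two points. -/
lemma finite_fiber (H : Herm) {M} (hM : IsSim M) {q : ℂ × ℂ} (hq : q ≠ 0) :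
    {Q | ∃ p, p ≠ 0 ∧ Q = toPoint (emb p) ∧ toPoint (M (emb p)) ∈ fiber H M q}.Finite := by
  refine Set.Finite.subset (s := {toPoint (emb q),
    toPoint (emb (-conj (H.skew q).2, conj (H.skew q).1))}) (by simp) ?_
  rintro Q ⟨p, hp, rfl, v, hv, he⟩
  have hp' : emb p ≠ 0 := by rwa [Ne, emb_eq_zero]
  obtain ⟨l, hl, e⟩ := (toPoint_eq_iff (by rwa [Ne, hM.map_eq_zero])
    (by rwa [Ne, hM.map_eq_zero])).1 he.symm
  rw [← hM.map_rmul] at e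
  have h1 : form (emb p) (H.lift v q) = 0 := by
    rw [hM.injective e, ← rmul_one (emb p), rmul_rmul, form_rmul, isotropic_emb]; simp
  rw [H.form_emb_lift] at h1
  have h2 : ∀ z w : ℂ, icx z + cx w = 0 → z = 0 ∧ w = 0 := fun z w h => by
    have a1 := congrArg QuaternionAlgebra.imI h
    have a2 := congrArg QuaternionAlgebra.imJ h
    have a3 := congrArg QuaternionAlgebra.re h
    have a4 := congrArg QuaternionAlgebra.imK h
    simp [icx, cx] at a1 a2 a3 a4
    exact ⟨Complex.ext a1 a2, Complex.ext a3 a4⟩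
  obtain ⟨h3, h4⟩ := h2 _ _ h1
  by_cases h0 : cdet p q = 0
  · left
    obtain ⟨z, hz, rfl⟩ := exists_smul_of_cdet hp hq h0
    rw [toPoint_emb_smul hz]
  · right
    have hv0 : v 0 = 0 := by simpa [h0] using h3
    have hv1 : v 1 ≠ 0 := fun h => hv (by rw [H.lift_apply]; simp [hv0, h])
    have hs : H.skew q ≠ 0 := fun h => hv (by rw [H.lift_apply]; simp [hv0, h])
    have h5 : conj p.1 * (H.skew q).1 + conj p.2 * (H.skew q).2 = 0 := by
      simpa [hv1] using h4
    have h6 : ((-conj (H.skew q).2, conj (H.skew q).1) : ℂ × ℂ) ≠ 0 := by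
      intro h
      have a1 := congrArg Prod.fst h
      have a2 := congrArg Prod.snd h
      simp at a1 a2
      exact hs (Prod.ext a2 a1)
    obtain ⟨z, hz, hzp⟩ := exists_smul_of_cdet hp h6 (by
      have := congrArg conj h5
      simp at this
      simp [cdet]; linear_combination this)
    rw [hzp, toPoint_emb_smul hz]
    rfl

lemma Presents.surface_ne_fiber {H M T k g P G} (h : Presents H M T k g P G) {i c} {q : ℂ × ℂ}
    (hq : q ≠ 0) (hs : (surface (embQ T) i c).Infinite) :
    surface G i.castSucc c ≠ fiber H M q := by
  intro he
  refine hs ((finite_fiber H h.isSim hq).subset fun Q hQ => ?_)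
  obtain ⟨p, hp, rfl⟩ := surface_subset_range hQ
  refine ⟨p, hp, rfl, ?_⟩
  rw [← he, h.surface_castSucc]
  have e : H.lift ![1, 0] p = emb p := by rw [H.lift_apply]; simp
  refine ⟨p, hp, hQ, ![1, 0], ?_, by rw [e]⟩
  rwa [e, Ne, emb_eq_zero]

lemma Presents.multiplicity_aux {H M T k g P G} (h : Presents H M T k g P G) {v w}
    (hp : HasPoles T v w) {Γ} {q : ℂ × ℂ} (hq : q ≠ 0) (hΓ : Γ = fiber H M q)
    (h2 : ∀ c, surface G 2 c ≠ Γ) : ∃ m l : Fin 3 × RP1, m ≠ l ∧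
      surface G m.1 m.2 = fiber H M v ∧ surface G l.1 l.2 = fiber H M w ∧
      ∀ n, n ≠ m → n ≠ l → surface G n.1 n.2 ≠ Γ := by
  obtain ⟨⟨i, a⟩, ⟨j, b⟩, hne, h3, h4, h5⟩ := hp.curves
  refine ⟨(i.castSucc, a), (j.castSucc, b), fun e => hne ?_,
    h.surface_of_singleton hp.fst_ne_zero h3, h.surface_of_singleton hp.snd_ne_zero h4, ?_⟩
  · simpa using e
  · rintro ⟨n, c⟩ hm hl
    induction n using Fin.lastCases with
    | last => exact h2 c
    | cast n =>
      rw [hΓ]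
      refine h.surface_ne_fiber hq (h5 (n, c) ?_ ?_)
      · rintro e; apply hm; simpa using e
      · rintro e; apply hl; simpa using e

lemma Presents.multiplicity_eq_two {H M T k g P G} (h : Presents H M T k g P G) {v w}
    (hp : HasPoles T v w) {Γ} (hv : fiber H M v = Γ) (hw : fiber H M w = Γ)
    (h2 : ∀ c, surface G 2 c ≠ Γ) : multiplicity G Γ = 2 := by
  obtain ⟨m, l, hne, h3, h4, h5⟩ := h.multiplicity_aux hp hp.fst_ne_zero hv.symm h2
  have : {k : Fin 3 × RP1 | surface G k.1 k.2 = Γ} = {m, l} := by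
    ext n
    constructor
    · intro hn
      by_contra hc
      simp only [Set.mem_insert_iff, mem_singleton_iff, not_or] at hc
      exact h5 n hc.1 hc.2 hn
    · rintro (rfl | rfl)
      · exact h3.trans hv
      · exact h4.trans hw
  rw [multiplicity, this, Set.ncard_pair hne]

lemma Presents.multiplicity_eq_one {H M T k g P G} (h : Presents H M T k g P G) {v w}
    (hp : HasPoles T v w) {Γ} (hv : fiber H M v = Γ) (hw : fiber H M w ≠ Γ)
    (h2 : ∀ c, surface G 2 c ≠ Γ) : multiplicity G Γ = 1 := by
  obtain ⟨m, l, hne, h3, h4, h5⟩ := h.multiplicity_aux hp hp.fst_ne_zero hv.symm h2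
  have : {k : Fin 3 × RP1 | surface G k.1 k.2 = Γ} = {m} := by
    ext n
    constructor
    · intro hn
      by_contra hc
      by_cases hl : n = l
      · subst hl; exact hw (h4.symm.trans hn)
      · exact h5 n hc hl hn
    · rintro rfl
      exact h3.trans hv
  rw [multiplicity, this, Set.ncard_singleton]

lemma HasPoles.symm {T : TMap 2} {v w} (h : HasPoles T v w) : HasPoles T w v := by
  obtain ⟨h1, h2, h3, k, l, h4, h5, h6, h7⟩ := h
  exact ⟨h2, h1, h3.trans (Set.pair_comm _ _), l, k, h4.symm, h6, h5, fun m h h' => h7 m h' h⟩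

/-! ### Offsets based on a sphere -/

/-- The unit normal of the unit sphere at the point with homogeneous complex coordinates `p`. -/
noncomputable def sphereNormal (p : ℂ × ℂ) : ℍ[ℝ] :=
  ((emb p).1 - qk * (emb p).2) * ((emb p).2 - qk * (emb p).1)⁻¹

lemma cayley_ne_zero {p : ℂ × ℂ} (hp : p ≠ 0) : (emb p).2 - qk * (emb p).1 ≠ 0 := by
  intro h
  have h0 := congrArg QuaternionAlgebra.re h
  have h1 := congrArg QuaternionAlgebra.imI h
  have h2 := congrArg QuaternionAlgebra.imJ h
  have h3 := congrArg QuaternionAlgebra.imK h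
  simp [emb_apply, icx, cx, qk] at h0 h1 h2 h3
  exact hp (Prod.ext (Complex.ext h2 h1) (Complex.ext h0 h3))

lemma eval_hSphere (p : ℂ × ℂ) : hSphere.eval p = normSq p.1 + normSq p.2 := by
  simp [hSphere, Herm.eval]

lemma eval_hSphere_pos {p : ℂ × ℂ} (hp : p ≠ 0) : 0 < hSphere.eval p := by
  rw [eval_hSphere]
  by_cases h : p.1 = 0
  · have h2 : p.2 ≠ 0 := fun h' => hp (Prod.ext h h')
    have := normSq_pos.2 h2
    have := normSq_nonneg p.1
    linarith
  · have := normSq_pos.2 h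
    have := normSq_nonneg p.2
    linarith

lemma sphereNormal_eq {p : ℂ × ℂ} (hp : p ≠ 0) : sphereNormal p = (hSphere.eval p)⁻¹ •
    quat 0 (2 * (p.1 * conj p.2).re) (-2 * (p.1 * conj p.2).im)
      (normSq p.1 - normSq p.2) := by
  rw [sphereNormal, mul_inv_eq_iff_eq_mul₀ (cayley_ne_zero hp), smul_mul_assoc,
    eq_inv_smul_iff₀ (eval_hSphere_pos hp).ne', eval_hSphere]
  ext <;> simp [emb_apply, icx, cx, qk, normSq_apply] <;> ring

lemma inner_sphereNormal {p q : ℂ × ℂ} (hp : p ≠ 0) (hq : q ≠ 0) :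
    inner ℝ (sphereNormal p) (sphereNormal q) = 2 * normSq
      (conj p.1 * q.1 + conj p.2 * q.2) /
        (hSphere.eval p * hSphere.eval q) - 1 := by
  have h1 := (eval_hSphere_pos hp).ne'
  have h2 := (eval_hSphere_pos hq).ne'
  have key : inner ℝ (quat 0 (2 * (p.1 * conj p.2).re)
      (-2 * (p.1 * conj p.2).im) (normSq p.1 - normSq p.2))
      (quat 0 (2 * (q.1 * conj q.2).re) (-2 * (q.1 * conj q.2).im)
        (normSq q.1 - normSq q.2)) = 2 * normSq
      (conj p.1 * q.1 + conj p.2 * q.2) -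
        hSphere.eval p * hSphere.eval q := by
    rw [eval_hSphere, eval_hSphere, inner_def]
    simp [normSq_apply]
    ring
  rw [sphereNormal_eq hp, sphereNormal_eq hq, inner_smul_left, inner_smul_right, key, conj_trivial]
  field_simp

lemma norm_sphereNormal {p : ℂ × ℂ} (hp : p ≠ 0) : ‖sphereNormal p‖ = 1 := by
  have h := inner_sphereNormal hp hp
  have h1 := (eval_hSphere_pos hp).ne'
  rw [← normSq_eq_conj_mul_self, ← normSq_eq_conj_mul_self, ← Complex.ofReal_add,
    ← eval_hSphere, normSq_ofReal, mul_div_assoc, div_self (mul_ne_zero h1 h1),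
    real_inner_self_eq_norm_sq] at h
  have h2 : ‖sphereNormal p‖ ^ 2 = 1 := by linarith
  rwa [pow_eq_one_iff_of_nonneg (norm_nonneg _) (by norm_num)] at h2

lemma sphereNormal_ne_zero {p : ℂ × ℂ} (hp : p ≠ 0) : sphereNormal p ≠ 0 := by
  intro h
  simpa [h] using norm_sphereNormal hp

lemma sphereNormal_re {p : ℂ × ℂ} (hp : p ≠ 0) : (sphereNormal p).re = 0 := by
  rw [sphereNormal_eq hp]; simp

lemma sphereMat_lift_eq (c : ℍ[ℝ]) (r : ℝ) (v) {p : ℂ × ℂ} (hp : p ≠ 0) :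
    sphereMat c r (hSphere.lift v p) = rmul
      ((r * (v 0 - v 1)) • sphereNormal p + (v 0 + v 1) • c, ((v 0 + v 1 : ℝ) : ℍ[ℝ]))
      ((emb p).2 - qk * (emb p).1) := by
  have h : sphereNormal p * ((emb p).2 - qk * (emb p).1) = (emb p).1 - qk * (emb p).2 := by
    rw [sphereNormal, mul_assoc, inv_mul_cancel₀ (cayley_ne_zero hp), mul_one]
  rw [Herm.lift_apply, sphereMat_pencil]
  ext1
  · simp only [rmul, add_mul, smul_mul_assoc, h]
  · simp only [rmul, coe_mul_eq_smul]

lemma toPoint_sphereMat_lift (c : ℍ[ℝ]) (r : ℝ) (v) {p : ℂ × ℂ} (hp : p ≠ 0) :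
    toPoint (sphereMat c r (hSphere.lift v p)) = if v 0 + v 1 = 0 then ∞ else
      ((c + (r * (v 0 - v 1) / (v 0 + v 1)) • sphereNormal p : ℍ[ℝ]) : OnePoint ℍ[ℝ]) := by
  rw [sphereMat_lift_eq c r v hp, toPoint_rmul _ (cayley_ne_zero hp)]
  split_ifs with h
  · rw [toPoint_of_eq_zero (by simp [h])]
  · have h' : ((v 0 + v 1 : ℝ) : ℍ[ℝ]) ≠ 0 := fun h1 => h (coe_injective h1)
    rw [toPoint_of_ne_zero h']
    congr 1
    rw [mul_inv_eq_iff_eq_mul₀ h', mul_coe_eq_smul]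
    match_scalars <;> field_simp

lemma hSphere_lift_ne_zero {v : Fin 2 → ℝ} (hv : v ≠ 0) {p : ℂ × ℂ} (hp : p ≠ 0) :
    hSphere.lift v p ≠ 0 := by
  intro h
  have h1 := sphereMat_lift_eq 0 1 v hp
  rw [h, map_zero, eq_comm, rmul_eq_zero (cayley_ne_zero hp)] at h1
  have h2 := congrArg Prod.fst h1
  have h3 : v 0 + v 1 = 0 := coe_injective (congrArg Prod.snd h1)
  simp [sphereNormal_ne_zero hp] at h2
  apply hv
  ext i; fin_cases i <;> simp <;> linarith

lemma toPoint_sphereMat (c : ℍ[ℝ]) (r : ℝ) {p : ℂ × ℂ} (hp : p ≠ 0) :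
    toPoint (sphereMat c r (emb p)) = ((c + r • sphereNormal p : ℍ[ℝ]) : OnePoint ℍ[ℝ]) := by
  have := toPoint_sphereMat_lift c r ![1, 0] hp
  simpa [Herm.lift_apply] using this

lemma fiber_sphereMat (c : ℍ[ℝ]) {r : ℝ} (hr : r ≠ 0) {p : ℂ × ℂ} (hp : p ≠ 0) :
    fiber hSphere (sphereMat c r) p = line c (sphereNormal p) := by
  ext Q
  constructor
  · rintro ⟨v, hv, rfl⟩
    rw [toPoint_sphereMat_lift c r v hp]
    split_ifs with h
    · exact Or.inl rfl
    · exact Or.inr ⟨_, rfl⟩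
  · rintro (rfl | ⟨l, rfl⟩)
    · refine ⟨![1, -1], hSphere_lift_ne_zero (by simp) hp, ?_⟩
      rw [toPoint_sphereMat_lift c r _ hp]; simp
    · have h2 : (1 + l / r) + (1 - l / r) ≠ 0 := by ring_nf; norm_num
      refine ⟨![1 + l / r, 1 - l / r], hSphere_lift_ne_zero (fun h => h2 ?_) hp, ?_⟩
      · have e0 := congrFun h 0
        have e1 := congrFun h 1
        simp at e0 e1
        rw [e0, e1, add_zero]
      · rw [toPoint_sphereMat_lift c r _ hp]
        simp only [cons_val_zero, cons_val_one, h2, if_false]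
        congr 3
        rw [show (1 + l / r) + (1 - l / r) = 2 by ring]
        field_simp; ring

section

variable {c : ℍ[ℝ]} {r : ℝ} {T : TMap 2} {k : ℍ[ℝ]} {g : GL (Fin 2) ℝ} {P : QMap 2} {G : QMap 3}
  {v w : ℂ × ℂ}

lemma sing_sphereOffset (hr : r ≠ 0) (h : Presents hSphere (sphereMat c r) T k g P G)
    (hp : HasPoles T v w) : sing G = line c (sphereNormal v) ∪ line c (sphereNormal w) := by
  rw [h.sing_eq nonZero_hSphere hp, fiber_sphereMat c hr hp.fst_ne_zero,
    fiber_sphereMat c hr hp.snd_ne_zero]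
  refine Set.union_eq_self_of_subset_left ?_
  rintro Q ⟨u, p, h1, rfl, h2⟩
  have hp0 : p ≠ 0 := fun h0 => h1 (by rw [h0, map_zero])
  left
  rw [toPoint_sphereMat_lift c r u hp0]
  split_ifs with h3
  · exact Or.inl rfl
  · rcases h2 with h2 | h2
    · have h4 : u 0 - u 1 = 0 := by
        have : (u 0 + u 1) * (u 0 - u 1) = 0 := by
          simp [Herm.det, hSphere] at h2; linear_combination h2
        exact (mul_eq_zero.1 this).resolve_left h3
      exact Or.inr ⟨0, by simp [h4]⟩
    · exact absurd h2 (eval_hSphere_pos hp0).ne'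

lemma surface_sphereOffset_ne_line (h : Presents hSphere (sphereMat c r) T k g P G)
    (m : RP1) (n : ℍ[ℝ]) : surface G 2 m ≠ line c n := by
  induction m using ind with
  | h u hu =>
    intro he
    rw [h.surface_two] at he
    set y := g.1.mulVec u
    have h1 : ∞ ∈ line c n := Or.inl rfl
    have h2 : (c : OnePoint ℍ[ℝ]) ∈ line c n := Or.inr ⟨0, by simp⟩
    rw [← he] at h1 h2
    obtain ⟨p, hp, e1⟩ := h1
    obtain ⟨q, hq, e2⟩ := h2
    have hp0 : p ≠ 0 := fun h0 => hp (by rw [h0, map_zero])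
    have hq0 : q ≠ 0 := fun h0 => hq (by rw [h0, map_zero])
    rw [toPoint_sphereMat_lift c r y hp0] at e1
    rw [toPoint_sphereMat_lift c r y hq0] at e2
    split_ifs at e1 with h3
    · simp [h3] at e2
    · simp at e1

lemma multiplicity_sphereOffset_two (hr : r ≠ 0) (h : Presents hSphere (sphereMat c r) T k g P G)
    (hp : HasPoles T v w) (hvw : line c (sphereNormal w) = line c (sphereNormal v)) :
    multiplicity G (line c (sphereNormal v)) = 2 :=
  h.multiplicity_eq_two hp (fiber_sphereMat c hr hp.fst_ne_zero)
    ((fiber_sphereMat c hr hp.snd_ne_zero).trans hvw) fun m => surface_sphereOffset_ne_line h m _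

lemma multiplicity_sphereOffset_one (hr : r ≠ 0) (h : Presents hSphere (sphereMat c r) T k g P G)
    (hp : HasPoles T v w) (hvw : line c (sphereNormal w) ≠ line c (sphereNormal v)) :
    multiplicity G (line c (sphereNormal v)) = 1 :=
  h.multiplicity_eq_one hp (fiber_sphereMat c hr hp.fst_ne_zero)
    (by rwa [fiber_sphereMat c hr hp.snd_ne_zero]) fun m => surface_sphereOffset_ne_line h m _

lemma oneLine_sphereOffset (hc : c.re = 0) (hr : r ≠ 0)
    (h : Presents hSphere (sphereMat c r) T k g P G) (hp : HasPoles T v w)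
    (hvw : line c (sphereNormal w) = line c (sphereNormal v)) : OneLine 2 G :=
  ⟨c, _, hc, sphereNormal_re hp.fst_ne_zero, sphereNormal_ne_zero hp.fst_ne_zero,
    by rw [sing_sphereOffset hr h hp, hvw, Set.union_self], multiplicity_sphereOffset_two hr h hp hvw⟩

lemma line_neg (c n : ℍ[ℝ]) : line c (-n) = line c n := by
  unfold line
  congr 1
  ext Q
  constructor <;> (rintro ⟨l, rfl⟩; exact ⟨-l, by simp⟩)

lemma line_ne_of_linearIndependent {c n m : ℍ[ℝ]} (h : LinearIndependent ℝ ![n, m]) :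
    line c m ≠ line c n := by
  intro he
  have h1 : ((c + (1 : ℝ) • m : ℍ[ℝ]) : OnePoint ℍ[ℝ]) ∈ line c m := Or.inr ⟨1, rfl⟩
  rw [he] at h1
  rcases h1 with h1 | ⟨l, hl⟩
  · simp at h1
  · have h2 : l • n = m := by simpa using hl
    have h3 : n ≠ 0 := h.ne_zero 0
    exact (LinearIndependent.pair_iff' h3).1 h l h2

lemma twoIntersectingLines_sphereOffset (hc : c.re = 0) (hr : r ≠ 0)
    (h : Presents hSphere (sphereMat c r) T k g P G) (hp : HasPoles T v w)
    (hli : LinearIndependent ℝ ![sphereNormal v, sphereNormal w]) : TwoIntersectingLines G := by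
  have hli' : LinearIndependent ℝ ![sphereNormal w, sphereNormal v] :=
    LinearIndependent.pair_symm_iff.1 hli
  exact ⟨c, _, _, hc, sphereNormal_re hp.fst_ne_zero, sphereNormal_re hp.snd_ne_zero, hli,
    sing_sphereOffset hr h hp,
    multiplicity_sphereOffset_one hr h hp (line_ne_of_linearIndependent hli),
    multiplicity_sphereOffset_one hr h hp.symm (line_ne_of_linearIndependent hli')⟩

/-! ### Offsets based on a plane -/

variable {q ν : ℍ[ℝ]} {d : ℝ}

/-- The finite point `q (i z) q⁻¹ + d ν`. -/
lemma toPoint_planeMat (hq : q ≠ 0) (d : ℝ) (hν : ν * q = q * qk) {p : ℂ × ℂ} (hp : p.2 ≠ 0) :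
    toPoint (planeMat q d (emb p)) =
      ((q * icx (p.1 / p.2) * q⁻¹ + d • ν : ℍ[ℝ]) : OnePoint ℍ[ℝ]) := by
  have h1 : cx p.2 ≠ 0 := by rwa [Ne, cx_eq_zero]
  have h2 : emb p = rmul (icx (p.1 / p.2), 1) (cx p.2) := by
    have e1 : p = p.2 • (p.1 / p.2, 1) := by ext1 <;> simp; field_simp
    conv_lhs => rw [e1, emb_smul, emb_apply]
    congr 2
  rw [h2, (isSim_planeMat hq d).map_rmul, toPoint_rmul _ h1, planeMat_apply,
    toPoint_of_ne_zero (by simpa using hq)]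
  congr 1
  simp only [mul_one, add_mul, smul_mul_assoc]
  rw [← hν, mul_assoc ν, mul_inv_cancel₀ hq, mul_one]

lemma toPoint_planeMat_infty (q : ℍ[ℝ]) (d : ℝ) {p : ℂ × ℂ} (hp : p.2 = 0) :
    toPoint (planeMat q d (emb p)) = ∞ :=
  toPoint_of_eq_zero (by rw [planeMat_apply, emb_apply]; simp [hp])

lemma toPoint_planeMat_eq_infty_iff (hq : q ≠ 0) (hν : ν * q = q * qk) {p : ℂ × ℂ} :
    toPoint (planeMat q d (emb p)) = ∞ ↔ p.2 = 0 := by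
  refine ⟨fun h => ?_, toPoint_planeMat_infty q d⟩
  by_contra h2
  rw [toPoint_planeMat hq d hν h2] at h
  simp at h

lemma fiber_planeMat (hq : q ≠ 0) (d : ℝ) (hν : ν * q = q * qk) {p : ℂ × ℂ} (hp : p.2 ≠ 0) :
    fiber hPlane (planeMat q d) p = line (q * icx (p.1 / p.2) * q⁻¹ + d • ν) ν := by
  have hp0 : p ≠ 0 := fun h => hp (by simp [h])
  ext Q
  constructor
  · rintro ⟨u, hu, rfl⟩
    by_cases h0 : u 0 = 0
    · rw [Herm.lift_apply, emb'_skew_hPlane, planeMat_apply, toPoint_of_eq_zero (by simp [h0])]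
      exact Or.inl rfl
    · rw [planeMat_lift_hPlane q d h0, toPoint_smul _ h0, toPoint_planeMat hq _ hν hp]
      exact Or.inr ⟨u 1 / u 0, by simp only [add_smul, add_assoc]⟩
  · rintro (rfl | ⟨l, rfl⟩)
    · refine ⟨![0, 1], fun h => ?_, ?_⟩
      · rw [Herm.lift_apply, emb'_skew_hPlane] at h
        have h1 := congrArg Prod.fst h
        simp [qk_ne_zero, emb_apply, cx_eq_zero, hp] at h1
      · rw [Herm.lift_apply, emb'_skew_hPlane, planeMat_apply, toPoint_of_eq_zero (by simp)]
    · refine ⟨![1, l], fun h => ?_, ?_⟩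
      · rw [Herm.lift_apply, emb'_skew_hPlane] at h
        have h1 := congrArg Prod.snd h
        simp [emb_apply, cx_eq_zero, hp] at h1
      · rw [planeMat_lift_hPlane q d (by simp), toPoint_smul _ (by simp),
          toPoint_planeMat hq _ hν hp]
        simp [add_smul, add_assoc]

lemma fiber_planeMat_infty {p : ℂ × ℂ} (hp0 : p ≠ 0) (hp : p.2 = 0) :
    fiber hPlane (planeMat q d) p = {∞} := by
  have h1 : ∀ u, toPoint (planeMat q d (hPlane.lift u p)) = ∞ := fun u => by
    rw [Herm.lift_apply, emb'_skew_hPlane, planeMat_apply,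
      toPoint_of_eq_zero (by simp [emb_apply, hp])]
  ext Q
  constructor
  · rintro ⟨u, hu, rfl⟩
    exact h1 u
  · rintro rfl
    refine ⟨![1, 0], ?_, h1 _⟩
    rw [Herm.lift_apply]
    simpa [emb_eq_zero] using hp0

lemma eval_hPlane (p : ℂ × ℂ) : hPlane.eval p = normSq p.2 := by simp [hPlane, Herm.eval]

lemma sing_planeOffset (h : Presents hPlane (planeMat q d) T k g P G)
    (hp : HasPoles T v w) :
    sing G = {∞} ∪ (fiber hPlane (planeMat q d) v ∪ fiber hPlane (planeMat q d) w) := by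
  rw [h.sing_eq nonZero_hPlane hp]
  congr 1
  ext Q
  constructor
  · rintro ⟨u, p, h1, rfl, h2⟩
    rw [Herm.lift_apply, emb'_skew_hPlane, planeMat_apply]
    refine toPoint_of_eq_zero ?_
    rcases h2 with h2 | h2
    · have : u 0 = 0 := by simpa [Herm.det, hPlane] using h2
      simp [this]
    · rw [eval_hPlane] at h2
      have : p.2 = 0 := by simpa using h2
      simp [emb_apply, this]
  · rintro rfl
    refine ⟨![1, 0], (1, 0), ?_, ?_, Or.inr (by simp [eval_hPlane])⟩
    · rw [Herm.lift_apply]; simp [emb_eq_zero]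
    · rw [Herm.lift_apply]
      simp only [cons_val_zero, cons_val_one, one_smul, zero_smul, add_zero]
      exact toPoint_planeMat_infty q d rfl

lemma surface_planeOffset_ne_line (h : Presents hPlane (planeMat q d) T k g P G) (h1 : ‖ν‖ = 1)
    (hq : q ≠ 0) (hν : ν * q = q * qk) (m : RP1) (n : ℍ[ℝ]) : surface G 2 m ≠ line n ν := by
  have hν0 : ν ≠ 0 := by rintro rfl; simp at h1
  induction m using ind with
  | h u hu =>
    intro he
    rw [h.surface_two] at he
    set y := g.1.mulVec u
    have key : ∀ l : ℝ, y 0 ≠ 0 ∧ inner ℝ ν (n + l • ν) = d + y 1 / y 0 := by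
      intro l
      have h2 : ((n + l • ν : ℍ[ℝ]) : OnePoint ℍ[ℝ]) ∈ line n ν := Or.inr ⟨l, rfl⟩
      rw [← he] at h2
      obtain ⟨p, hp, e⟩ := h2
      have hp0 : p ≠ 0 := fun h0 => hp (by rw [h0, map_zero])
      by_cases h0 : y 0 = 0
      · rw [Herm.lift_apply, emb'_skew_hPlane, planeMat_apply, toPoint_of_eq_zero (by simp [h0])] at e
        simp at e
      · refine ⟨h0, ?_⟩
        have h3 := ((isChart_planeMat hq (d + y 1 / y 0) hν h1).2 (emb p)
          (by rwa [Ne, emb_eq_zero]) (isotropic_emb p)).2 (toPoint_emb_mem p)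
        rw [planeMat_lift_hPlane q d h0, toPoint_smul _ h0] at e
        rw [e, coe_mem_plane] at h3
        exact h3.2
    have k0 := (key 0).2
    have k1 := (key 1).2
    simp only [zero_smul, add_zero, one_smul, inner_add_right] at k0 k1
    rw [k0] at k1
    simp [hν0] at k1

lemma oneLine_planeOffset_two (h : Presents hPlane (planeMat q d) T k g P G) (h0 : ν.re = 0)
    (h1 : ‖ν‖ = 1) (hq : q ≠ 0) (hν : ν * q = q * qk) (hp : HasPoles T v v) (hv : v.2 ≠ 0) :
    OneLine 2 G := by
  refine ⟨_, ν, ?_, h0, by rintro rfl; simp at h1, ?_,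
    h.multiplicity_eq_two hp (fiber_planeMat hq d hν hv) (fiber_planeMat hq d hν hv)
      fun m => surface_planeOffset_ne_line h h1 hq hν m _⟩
  · simp [h0, conj_re (show (icx (v.1 / v.2)).re = 0 from rfl)]
  · rw [sing_planeOffset h hp, fiber_planeMat hq d hν hv, Set.union_self]
    exact Set.union_eq_self_of_subset_left (by rintro Q rfl; exact Or.inl rfl)

lemma infty_ne_line (c n : ℍ[ℝ]) : {∞} ≠ line c n := by
  intro h
  have h1 : ((c + (0 : ℝ) • n : ℍ[ℝ]) : OnePoint ℍ[ℝ]) ∈ line c n := Or.inr ⟨0, rfl⟩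
  rw [← h] at h1
  simp at h1

lemma oneLine_planeOffset_one (h : Presents hPlane (planeMat q d) T k g P G) (h0 : ν.re = 0)
    (h1 : ‖ν‖ = 1) (hq : q ≠ 0) (hν : ν * q = q * qk) (hp : HasPoles T v w) (hv : v.2 ≠ 0)
    (hw : w.2 = 0) : OneLine 1 G := by
  refine ⟨_, ν, ?_, h0, by rintro rfl; simp at h1, ?_,
    h.multiplicity_eq_one hp (fiber_planeMat hq d hν hv) ?_
      fun m => surface_planeOffset_ne_line h h1 hq hν m _⟩
  · simp [h0, conj_re (show (icx (v.1 / v.2)).re = 0 from rfl)]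
  · rw [sing_planeOffset h hp, fiber_planeMat hq d hν hv, fiber_planeMat_infty hp.snd_ne_zero hw]
    ext Q
    simp [line]
  · rw [fiber_planeMat_infty hp.snd_ne_zero hw]
    exact infty_ne_line _ _

lemma sing_planeOffset_infty (h : Presents hPlane (planeMat q d) T k g P G)
    (hp : HasPoles T v w) (hv : v.2 = 0) (hw : w.2 = 0) : sing G = {∞} := by
  rw [sing_planeOffset h hp, fiber_planeMat_infty hp.fst_ne_zero hv,
    fiber_planeMat_infty hp.snd_ne_zero hw]
  simp

lemma twoParallelLines_planeOffset (h : Presents hPlane (planeMat q d) T k g P G) (h0 : ν.re = 0)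
    (h1 : ‖ν‖ = 1) (hq : q ≠ 0) (hν : ν * q = q * qk) (hp : HasPoles T v w) (hv : v.2 ≠ 0)
    (hw : w.2 ≠ 0) (hvw : v.1 * w.2 - w.1 * v.2 ≠ 0) : TwoParallelLines G := by
  have hν0 : ν ≠ 0 := by rintro rfl; simp at h1
  have hmem : ∀ p : ℂ × ℂ, p.2 ≠ 0 → inner ℝ ν (q * icx (p.1 / p.2) * q⁻¹ + d • ν) = d := by
    intro p hp
    have h3 := ((isChart_planeMat hq d hν h1).2 (emb p)
      (by rw [Ne, emb_eq_zero]; exact fun h => hp (by simp [h])) (isotropic_emb p)).2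
      (toPoint_emb_mem p)
    rw [toPoint_planeMat hq d hν hp, coe_mem_plane] at h3
    exact h3.2
  have hne : line (q * icx (v.1 / v.2) * q⁻¹ + d • ν) ν ≠
      line (q * icx (w.1 / w.2) * q⁻¹ + d • ν) ν := by
    intro he
    have h2 : ((q * icx (v.1 / v.2) * q⁻¹ + d • ν + (0 : ℝ) • ν : ℍ[ℝ]) : OnePoint ℍ[ℝ]) ∈
        line (q * icx (v.1 / v.2) * q⁻¹ + d • ν) ν := Or.inr ⟨0, rfl⟩
    rw [he] at h2
    rcases h2 with h2 | ⟨l, hl⟩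
    · simp at h2
    · have h3 : q * icx (w.1 / w.2) * q⁻¹ + d • ν + l • ν = q * icx (v.1 / v.2) * q⁻¹ + d • ν := by
        simpa using hl
      have h4 := congrArg (inner ℝ ν) h3
      rw [inner_add_right, hmem w hw, hmem v hv, inner_smul_right, real_inner_self_eq_norm_sq, h1] at h4
      have hl0 : l = 0 := by linarith
      rw [hl0, zero_smul, add_zero, add_left_inj, mul_left_inj' (inv_ne_zero hq),
        mul_right_inj' hq] at h3
      have h5 : w.1 / w.2 = v.1 / v.2 := by
        have e1 := congrArg QuaternionAlgebra.imI h3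
        have e2 := congrArg QuaternionAlgebra.imJ h3
        simp only [icx, quat_imI, quat_imJ, neg_inj] at e1 e2
        exact Complex.ext e1 e2
      field_simp at h5
      exact hvw (by linear_combination -h5)
  have hre : ∀ z, (q * icx z * q⁻¹ + d • ν).re = 0 := fun z => by
    simp [h0, conj_re (show (icx z).re = 0 from rfl)]
  refine ⟨_, _, ν, hre _, hre _, h0, hν0, hne, ?_,
    h.multiplicity_eq_one hp (fiber_planeMat hq d hν hv) (by
      rw [fiber_planeMat hq d hν hw]; exact hne.symm)
      fun m => surface_planeOffset_ne_line h h1 hq hν m _,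
    h.multiplicity_eq_one hp.symm (fiber_planeMat hq d hν hw) (by
      rw [fiber_planeMat hq d hν hv]; exact hne)
      fun m => surface_planeOffset_ne_line h h1 hq hν m _⟩
  rw [sing_planeOffset h hp, fiber_planeMat hq d hν hv, fiber_planeMat hq d hν hw]
  exact Set.union_eq_self_of_subset_left (by rintro Q rfl; exact Or.inl (Or.inl rfl))

end

/-! ### Axial constructions -/

lemma inner_conj_conj {q : ℍ[ℝ]} (hq : q ≠ 0) (x y : ℍ[ℝ]) :
    inner ℝ (q * x * q⁻¹) (q * y * q⁻¹) = inner ℝ x y := by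
  have h : ‖q‖ ≠ 0 := by simpa using hq
  rw [inner_mul_right_mul, inner_mul_left_mul, norm_inv]
  field_simp

lemma norm_conj_conj {q : ℍ[ℝ]} (hq : q ≠ 0) (x : ℍ[ℝ]) : ‖q * x * q⁻¹‖ = ‖x‖ := by
  have h : ‖q‖ ≠ 0 := by simpa using hq
  rw [norm_mul, norm_mul, norm_inv]
  field_simp

lemma exists_conj_eq {q : ℍ[ℝ]} (hq : q ≠ 0) (x : ℍ[ℝ]) : ∃ y, x = q * y * q⁻¹ :=
  ⟨q⁻¹ * x * q, by simp [← mul_assoc, hq]⟩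

lemma conj_injective {q : ℍ[ℝ]} (hq : q ≠ 0) {x y : ℍ[ℝ]} (h : q * x * q⁻¹ = q * y * q⁻¹) :
    x = y := by
  rwa [mul_left_inj' (inv_ne_zero hq), mul_right_inj' hq] at h

lemma conj_re_iff {q : ℍ[ℝ]} (hq : q ≠ 0) (x : ℍ[ℝ]) : (q * x * q⁻¹).re = 0 ↔ x.re = 0 := by
  refine ⟨fun h => ?_, fun h => conj_re h q⟩
  have := conj_re h q⁻¹
  rwa [inv_inv, ← mul_assoc, ← mul_assoc, inv_mul_cancel₀ hq, one_mul, mul_assoc,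
    inv_mul_cancel₀ hq, mul_one] at this

section

variable {q a : ℍ[ℝ]} (hq : q ≠ 0) (ha : a = q * qi * q⁻¹)
include hq ha

lemma coe_conj_mem_circle {l r : ℝ} (hr : 0 < r) {y : ℍ[ℝ]} :
    ((q * y * q⁻¹ : ℍ[ℝ]) : OnePoint ℍ[ℝ]) ∈ circle (l • a) a r ↔
      y.re = 0 ∧ y.imI = l ∧ y.imJ ^ 2 + y.imK ^ 2 = r ^ 2 := by
  have e : q * y * q⁻¹ - l • a = q * (y - l • qi) * q⁻¹ := by
    rw [ha, mul_sub, sub_mul]; simp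
  simp only [circle, Set.mem_image, mem_ofPred_eq, OnePoint.coe_eq_coe, exists_eq_right]
  rw [e, conj_re_iff hq, norm_conj_conj hq]
  nth_rewrite 1 [ha]
  rw [inner_conj_conj hq, ← sq_eq_sq₀ (norm_nonneg _) hr.le, ← real_inner_self_eq_norm_sq,
    inner_def, inner_def]
  simp only [qi, Quaternion.re_mul, Quaternion.re_star, Quaternion.imI_star, Quaternion.imJ_star,
    Quaternion.imK_star, Quaternion.re_sub, Quaternion.imI_sub, Quaternion.imJ_sub,
    Quaternion.imK_sub, Quaternion.re_smul, Quaternion.imI_smul, Quaternion.imJ_smul,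
    Quaternion.imK_smul, quat_re, quat_imI, quat_imJ, quat_imK, smul_eq_mul]
  constructor
  · rintro ⟨h0, h1, h2⟩
    have h3 : y.imI = l := by linarith
    refine ⟨h0, h3, ?_⟩
    rw [h0, h3] at h2
    linarith
  · rintro ⟨h0, rfl, h2⟩
    refine ⟨h0, by ring, ?_⟩
    rw [h0]; linarith

lemma coe_conj_mem_axis {y : ℍ[ℝ]} :
    ((q * y * q⁻¹ : ℍ[ℝ]) : OnePoint ℍ[ℝ]) ∈ line 0 a ↔ y.re = 0 ∧ y.imJ = 0 ∧ y.imK = 0 := by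
  have h1 : ∀ l : ℝ, l • a = q * (l • qi) * q⁻¹ := fun l => by rw [ha]; simp
  constructor
  · rintro (h | ⟨l, hl⟩)
    · simp at h
    · have h2 : l • a = q * y * q⁻¹ := by simpa using hl
      rw [h1] at h2
      rw [← conj_injective hq h2]
      simp [qi]
  · rintro ⟨h2, h3, h4⟩
    refine Or.inr ⟨y.imI, ?_⟩
    simp only [zero_add, OnePoint.coe_eq_coe]
    rw [h1]
    congr 2
    ext <;> simp [qi, h2, h3, h4]

lemma circle_injective {l l' r r' : ℝ} (hr : 0 < r) (hr' : 0 < r')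
    (h : circle (l • a) a r = circle (l' • a) a r') : l = l' ∧ r = r' := by
  have h1 : ((q * quat 0 l r 0 * q⁻¹ : ℍ[ℝ]) : OnePoint ℍ[ℝ]) ∈ circle (l • a) a r :=
    (coe_conj_mem_circle hq ha hr).2 ⟨rfl, rfl, by simp⟩
  rw [h, coe_conj_mem_circle hq ha hr'] at h1
  refine ⟨h1.2.1, ?_⟩
  have h2 : r ^ 2 = r' ^ 2 := by simpa using h1.2.2
  rwa [sq_eq_sq₀ hr.le hr'.le] at h2

lemma circle_not_subset_axis {l r : ℝ} (hr : 0 < r) : ¬ circle (l • a) a r ⊆ line 0 a := by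
  intro h
  have h1 : ((q * quat 0 l r 0 * q⁻¹ : ℍ[ℝ]) : OnePoint ℍ[ℝ]) ∈ circle (l • a) a r :=
    (coe_conj_mem_circle hq ha hr).2 ⟨rfl, rfl, by simp⟩
  have h2 := (coe_conj_mem_axis hq ha).1 (h h1)
  exact hr.ne' h2.2.1

end

lemma infty_notMem_circle {c v : ℍ[ℝ]} {r : ℝ} : ∞ ∉ circle c v r := by simp [circle]

lemma halfTurn_conj {v : Fin 2 → ℝ} (hv : v ≠ 0) (b x y : ℝ) :
    halfTurn v * quat 0 b x y * (halfTurn v)⁻¹ = quat 0 b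
      (((v 0 ^ 2 - v 1 ^ 2) * x - 2 * v 0 * v 1 * y) / (v 0 ^ 2 + v 1 ^ 2))
      (((v 0 ^ 2 - v 1 ^ 2) * y + 2 * v 0 * v 1 * x) / (v 0 ^ 2 + v 1 ^ 2)) := by
  have h := (sq_add_sq_pos hv).ne'
  rw [mul_inv_eq_iff_eq_mul₀ (halfTurn_ne_zero hv)]
  ext <;> simp [halfTurn] <;> field_simp <;> ring

lemma conj_mul_conj (q h x : ℍ[ℝ]) : q * h * x * (q * h)⁻¹ = q * (h * x * h⁻¹) * q⁻¹ := by
  rw [mul_inv_rev]; simp only [mul_assoc]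

/-- The points of an axial construction over a finite point of the base. -/
lemma toPoint_axial {q : ℍ[ℝ]} (hq : q ≠ 0) {v : Fin 2 → ℝ} (hv : v ≠ 0) {p : ℂ × ℂ}
    (hp : p.2 ≠ 0) : toPoint (planeMat q 0 (hAxial.lift v p)) =
      ((q * (halfTurn v * icx (p.1 / p.2) * (halfTurn v)⁻¹) * q⁻¹ : ℍ[ℝ]) : OnePoint ℍ[ℝ]) := by
  have h := mul_ne_zero hq (halfTurn_ne_zero hv)
  have hν : (q * halfTurn v) * qk * (q * halfTurn v)⁻¹ * (q * halfTurn v) = q * halfTurn v * qk := by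
    rw [mul_assoc _ _⁻¹, inv_mul_cancel₀ h, mul_one]
  rw [planeMat_lift_hAxial, toPoint_planeMat h 0 hν hp, zero_smul, add_zero, conj_mul_conj]

lemma hAxial_lift_ne_zero {v : Fin 2 → ℝ} (hv : v ≠ 0) {p : ℂ × ℂ} (hp : p ≠ 0) :
    hAxial.lift v p ≠ 0 := by
  intro h
  have h1 := planeMat_lift_hAxial 1 v p
  rw [h, map_zero, eq_comm, (isSim_planeMat (mul_ne_zero one_ne_zero
    (halfTurn_ne_zero hv)) 0).map_eq_zero, emb_eq_zero] at h1
  exact hp h1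

lemma eval_hAxial (p : ℂ × ℂ) (hp : p.2 ≠ 0) :
    hAxial.eval p = -2 * normSq p.2 * (p.1 / p.2).im := by
  have h : normSq p.2 ≠ 0 := by simpa using hp
  rw [Complex.div_im]
  field_simp
  simp [hAxial, Herm.eval, normSq_apply]
  ring

lemma eval_hAxial_infty (p : ℂ × ℂ) (hp : p.2 = 0) : hAxial.eval p = 0 := by
  simp [hAxial, Herm.eval, hp]

lemma eval_hAxial_eq_zero_iff (p : ℂ × ℂ) (hp : p.2 ≠ 0) :
    hAxial.eval p = 0 ↔ (p.1 / p.2).im = 0 := by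
  have h : normSq p.2 ≠ 0 := by simpa using hp
  rw [eval_hAxial p hp]; simp [hp]

section

variable {q a ν : ℍ[ℝ]} {T : TMap 2} {k : ℍ[ℝ]} {g : GL (Fin 2) ℝ} {P : QMap 2} {G : QMap 3}
  {v w : ℂ × ℂ}

lemma toPoint_axial_mem_axis (hq : q ≠ 0) (ha : a = q * qi * q⁻¹) {u : Fin 2 → ℝ} (hu : u ≠ 0)
    {p : ℂ × ℂ} (h : hAxial.eval p = 0) :
    toPoint (planeMat q 0 (hAxial.lift u p)) ∈ line 0 a := by
  by_cases hp : p.2 = 0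
  · rw [planeMat_lift_hAxial, toPoint_planeMat_infty _ _ hp]; exact Or.inl rfl
  · rw [toPoint_axial hq hu hp, coe_conj_mem_axis hq ha]
    rw [eval_hAxial_eq_zero_iff p hp] at h
    rw [icx, halfTurn_conj hu]
    simp [h]

lemma exists_axis_point (hq : q ≠ 0) (ha : a = q * qi * q⁻¹) {Q} (hQ : Q ∈ line 0 a) :
    ∃ p, p ≠ 0 ∧ hAxial.eval p = 0 ∧
      ∀ u : Fin 2 → ℝ, u ≠ 0 → toPoint (planeMat q 0 (hAxial.lift u p)) = Q := by
  rcases hQ with rfl | ⟨l, rfl⟩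
  · refine ⟨(1, 0), by simp, eval_hAxial_infty _ rfl, fun u hu => ?_⟩
    rw [planeMat_lift_hAxial]
    exact toPoint_planeMat_infty _ _ rfl
  · refine ⟨(l, 1), by simp, by rw [eval_hAxial_eq_zero_iff _ (by simp)]; simp, fun u hu => ?_⟩
    rw [toPoint_axial hq hu (by simp), icx, halfTurn_conj hu]
    congr 1
    rw [ha, zero_add, ← smul_mul_assoc, ← mul_smul_comm]
    congr 2
    ext <;> simp [qi]

lemma fiber_axial_subset (hq : q ≠ 0) (ha : a = q * qi * q⁻¹) {p : ℂ × ℂ}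
    (h : hAxial.eval p = 0) : fiber hAxial (planeMat q 0) p ⊆ line 0 a := by
  rintro Q ⟨u, hu, rfl⟩
  exact toPoint_axial_mem_axis hq ha (fun h0 => hu (by rw [h0, Herm.lift_apply]; simp)) h

lemma fiber_axial (hq : q ≠ 0) (ha : a = q * qi * q⁻¹) {p : ℂ × ℂ} (hp : p.2 ≠ 0)
    (h : (p.1 / p.2).im ≠ 0) : fiber hAxial (planeMat q 0) p =
      circle ((p.1 / p.2).re • a) a |(p.1 / p.2).im| := by
  have hp0 : p ≠ 0 := fun h => hp (by simp [h])
  have hr := abs_pos.2 h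
  set z := p.1 / p.2 with hz
  ext Q
  constructor
  · rintro ⟨u, hu, rfl⟩
    have hu0 : u ≠ 0 := fun h0 => hu (by rw [h0, Herm.lift_apply]; simp)
    have hn := (sq_add_sq_pos hu0).ne'
    rw [toPoint_axial hq hu0 hp, coe_conj_mem_circle hq ha hr, ← hz, icx, halfTurn_conj hu0]
    refine ⟨rfl, rfl, ?_⟩
    simp
    field_simp
    ring
  · intro hQ
    induction Q using OnePoint.rec with
    | infty => exact absurd hQ infty_notMem_circle
    | coe x =>
      obtain ⟨y, rfl⟩ := exists_conj_eq hq x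
      rw [coe_conj_mem_circle hq ha hr] at hQ
      obtain ⟨h0, h1, h2⟩ := hQ
      rw [sq_abs] at h2
      obtain ⟨t, ht⟩ := IsAlgClosed.exists_pow_nat_eq (⟨y.imJ / (-z.im), y.imK / (-z.im)⟩ : ℂ)
        (n := 2) (by norm_num)
      have e1 : t.re ^ 2 - t.im ^ 2 = y.imJ / (-z.im) := by
        have := congrArg Complex.re ht
        rw [pow_two] at this; simp at this; rw [← this]; ring
      have e2 : 2 * t.re * t.im = y.imK / (-z.im) := by
        have := congrArg Complex.im ht
        rw [pow_two] at this; simp at this; rw [← this]; ring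
      have e3 : t.re ^ 2 + t.im ^ 2 = 1 := by
        have : (t.re ^ 2 + t.im ^ 2) ^ 2 = 1 := by
          have : (t.re ^ 2 + t.im ^ 2) ^ 2 = (t.re ^ 2 - t.im ^ 2) ^ 2 + (2 * t.re * t.im) ^ 2 := by
            ring
          rw [this, e1, e2]
          field_simp
          linarith
        rwa [pow_eq_one_iff_of_nonneg (by positivity) (by norm_num)] at this
      have hu : (![t.re, t.im] : Fin 2 → ℝ) ≠ 0 := by
        intro h
        have a0 := congrFun h 0
        have a1 := congrFun h 1
        simp at a0 a1
        simp [a0, a1] at e3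
      refine ⟨![t.re, t.im], hAxial_lift_ne_zero hu hp0, ?_⟩
      rw [toPoint_axial hq hu hp, ← hz, icx, halfTurn_conj hu]
      simp only [cons_val_zero, cons_val_one, e3, e1, e2]
      congr 3
      ext
      · simp [h0]
      · simp [h1]
      · simp; field_simp
      · simp; field_simp

lemma sing_axial (hq : q ≠ 0) (ha : a = q * qi * q⁻¹) (h : Presents hAxial (planeMat q 0) T k g P G)
    (hp : HasPoles T v w) : sing G = line 0 a ∪
      (fiber hAxial (planeMat q 0) v ∪ fiber hAxial (planeMat q 0) w) := by
  rw [h.sing_eq nonZero_hAxial hp]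
  congr 1
  ext Q
  constructor
  · rintro ⟨u, p, h1, rfl, h2⟩
    have hu0 : u ≠ 0 := fun h0 => h1 (by rw [h0, Herm.lift_apply]; simp)
    refine toPoint_axial_mem_axis hq ha hu0 (h2.resolve_left fun h2 => ?_)
    have := sq_add_sq_pos hu0
    simp [Herm.det, hAxial] at h2
    linarith
  · intro hQ
    obtain ⟨p, hp, he, h1⟩ := exists_axis_point hq ha hQ
    have : (![1, 0] : Fin 2 → ℝ) ≠ 0 := by simp
    exact ⟨![1, 0], p, hAxial_lift_ne_zero this hp, h1 _ this, Or.inr he⟩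

lemma surface_axial (hq : q ≠ 0) (h : Presents hAxial (planeMat q 0) T k g P G)
    {u : Fin 2 → ℝ} (hu : u ≠ 0) : surface G 2 (Projectivization.mk ℝ u hu) =
      plane (turnedNormal q (g.1.mulVec u)) 0 := by
  have hv := (mulVec_ne_zero_iff g u).2 hu
  rw [h.surface_two]
  set y := g.1.mulVec u
  have hch := isChart_turned hq hv
  obtain ⟨N, hN, hNM, hMN⟩ := hch.1.exists_inverse
  have key : ∀ X : ℍ², X ≠ 0 → form X X = 0 → toPoint X ∈ plane (turnedNormal q y) 0 →
      ∃ p, hAxial.lift y p ≠ 0 ∧ toPoint (planeMat q 0 (hAxial.lift y p)) = toPoint X := by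
    intro X hX hX0 hm
    rw [← hMN X, hch.2 _ (by rwa [Ne, hN.map_eq_zero]) ((hN.isotropic_iff X).2 hX0)] at hm
    obtain ⟨p, l, hl, e⟩ := exists_emb_of_mem_basePlane (by rwa [Ne, hN.map_eq_zero]) hm
    have hp : p ≠ 0 := by
      rintro rfl
      rw [map_zero, (rmul_eq_zero hl).2 rfl, hN.map_eq_zero] at e
      exact hX e
    refine ⟨p, hAxial_lift_ne_zero hv hp, ?_⟩
    rw [planeMat_lift_hAxial, ← hMN X, e, hch.1.map_rmul, toPoint_rmul _ hl]
  ext Q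
  constructor
  · rintro ⟨p, hp, rfl⟩
    have hp0 : p ≠ 0 := fun h => hp (by rw [h, map_zero])
    rw [planeMat_lift_hAxial, hch.2 _ (by rwa [Ne, emb_eq_zero]) (isotropic_emb p)]
    exact toPoint_emb_mem p
  · intro hQ
    induction Q using OnePoint.rec with
    | infty =>
      obtain ⟨p, hp, e⟩ := key (1, 0) (by simp) (by simp [form])
        (by rw [toPoint_of_eq_zero rfl]; exact hQ)
      exact ⟨p, hp, by rw [e, toPoint_of_eq_zero rfl]⟩
    | coe x =>
      have e0 : toPoint (x, 1) = (x : OnePoint ℍ[ℝ]) := by rw [toPoint_of_ne_zero (by simp)]; simp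
      obtain ⟨p, hp, e⟩ := key (x, 1) (by simp) (by
        rw [form_self_eq_zero_iff _ (by simp)]
        simpa using (coe_mem_plane.1 hQ).1) (by rw [e0]; exact hQ)
      exact ⟨p, hp, by rw [e, e0]⟩

lemma turnedNormal_eq {u : Fin 2 → ℝ} (hu : u ≠ 0) : turnedNormal q u = q * quat 0 0
    (-(2 * u 0 * u 1) / (u 0 ^ 2 + u 1 ^ 2)) ((u 0 ^ 2 - u 1 ^ 2) / (u 0 ^ 2 + u 1 ^ 2)) * q⁻¹ := by
  have := halfTurn_conj hu 0 0 1
  rw [turnedNormal, conj_mul_conj, qk, this]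
  simp

lemma plane_neg (n : ℍ[ℝ]) : plane (-n) 0 = plane n 0 := by
  unfold plane
  simp

lemma plane_turned_eq_iff (hq : q ≠ 0) {u y : Fin 2 → ℝ} (hu : u ≠ 0) (hy : y ≠ 0) :
    plane (turnedNormal q y) 0 = plane (turnedNormal q u) 0 ↔
      wedge u y = 0 ∨ wedge ![-u 1, u 0] y = 0 := by
  have hu' := (sq_add_sq_pos hu).ne'
  have hy' := (sq_add_sq_pos hy).ne'
  constructor
  · intro h
    set Q := q * quat 0 0 (-(2 * u 0 * u 1) / (u 0 ^ 2 + u 1 ^ 2) - 0)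
      ((u 0 ^ 2 - u 1 ^ 2) / (u 0 ^ 2 + u 1 ^ 2)) * q⁻¹
    set R := q * quat 0 0 ((u 0 ^ 2 - u 1 ^ 2) / (u 0 ^ 2 + u 1 ^ 2))
      ((2 * u 0 * u 1) / (u 0 ^ 2 + u 1 ^ 2)) * q⁻¹ with hR
    have h1 : (R : OnePoint ℍ[ℝ]) ∈ plane (turnedNormal q u) 0 := by
      rw [coe_mem_plane, turnedNormal_eq hu, hR, inner_conj_conj hq, conj_re_iff hq,
        inner_def]
      simp
      field_simp
      ring
    rw [← h, coe_mem_plane, turnedNormal_eq hy, hR, inner_conj_conj hq, inner_def] at h1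
    have h2 := h1.2
    simp at h2
    field_simp at h2
    have h3 : wedge u y * wedge ![-u 1, u 0] y = 0 := by
      simp only [wedge, cons_val_zero, cons_val_one]
      linear_combination (1 / 2 : ℝ) * h2
    exact mul_eq_zero.1 h3
  · have hsmul : ∀ (t : ℝ) (z : Fin 2 → ℝ), z ≠ 0 → t ≠ 0 →
        turnedNormal q (t • z) = turnedNormal q z := fun t z hz ht => by
      have hz' := (sq_add_sq_pos hz).ne'
      rw [turnedNormal_eq hz, turnedNormal_eq (smul_ne_zero ht hz)]
      congr 2
      simp only [Pi.smul_apply, smul_eq_mul]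
      ext <;> simp only [quat_re, quat_imI, quat_imJ, quat_imK]
      · field_simp
      · field_simp
    have hJ : (![-u 1, u 0] : Fin 2 → ℝ) ≠ 0 := by
      intro h
      have a0 := congrFun h 0
      have a1 := congrFun h 1
      simp at a0 a1
      apply hu; ext i; fin_cases i <;> simp [a0, a1]
    have hex : ∀ z : Fin 2 → ℝ, z ≠ 0 → wedge z y = 0 → turnedNormal q y = turnedNormal q z := by
      intro z hz hw
      obtain ⟨t, ht⟩ := (mk_eq_mk_iff' ℝ _ _ hz hy).1 (mk_eq_of_wedge hz hy hw)
      rw [← ht, hsmul _ _ hy (by rintro rfl; simp at ht; exact hz ht.symm)]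
    rintro (h | h)
    · rw [hex u hu h]
    · rw [hex _ hJ h, ← plane_neg, turnedNormal_eq hu, turnedNormal_eq hJ, ← neg_mul, ← mul_neg]
      congr 4
      ext <;> simp
      · rw [add_comm (u 1 ^ 2)]; ring
      · rw [add_comm (u 1 ^ 2)]; ring

lemma isDoubleAxis (hq : q ≠ 0) (ha : a = q * qi * q⁻¹)
    (h : Presents hAxial (planeMat q 0) T k g P G) : IsDoubleAxis a G := by
  intro c
  induction c using ind with
  | h u hu =>
    have hv := (mulVec_ne_zero_iff g u).2 hu
    refine ⟨fun Q hQ => ?_, ?_⟩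
    · obtain ⟨p, hp, -, h1⟩ := exists_axis_point hq ha hQ
      rw [h.surface_two]
      exact ⟨p, hAxial_lift_ne_zero hv hp, h1 _ hv⟩
    · set y := g.1.mulVec u
      have hJ : (![-y 1, y 0] : Fin 2 → ℝ) ≠ 0 := by
        intro h
        have a0 := congrFun h 0
        have a1 := congrFun h 1
        simp at a0 a1
        apply hv; ext i; fin_cases i <;> simp [a0, a1]
      have key : {c' | surface G 2 c' = surface G 2 (Projectivization.mk ℝ u hu)} =
          (moveRP1 g).symm '' {Projectivization.mk ℝ y hv, Projectivization.mk ℝ ![-y 1, y 0] hJ} := by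
        ext c'
        rw [Equiv.image_eq_preimage_symm, Equiv.symm_symm, Set.mem_preimage]
        induction c' using ind with
        | h u' hu' =>
          have hy' := (mulVec_ne_zero_iff g u').2 hu'
          rw [mem_ofPred_eq, surface_axial hq h, surface_axial hq h,
            plane_turned_eq_iff hq hv hy', moveRP1_mk]
          simp only [Set.mem_insert_iff, mem_singleton_iff]
          have e : ∀ {z : Fin 2 → ℝ} (hz : z ≠ 0), wedge z (g.1.mulVec u') = 0 ↔
              Projectivization.mk ℝ (g.1.mulVec u') hy' = Projectivization.mk ℝ z hz := by
            intro z hz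
            constructor
            · intro h; exact (mk_eq_of_wedge hz hy' h).symm
            · intro h
              obtain ⟨t, ht⟩ := (mk_eq_mk_iff' ..).1 h
              rw [← ht]; simp [wedge]; ring
          rw [e hv, e hJ]
      rw [key, Set.ncard_image_of_injective _ (moveRP1 g).symm.injective, Set.ncard_pair]
      intro h
      obtain ⟨t, ht⟩ := (mk_eq_mk_iff' ..).1 h
      have b0 := congrFun ht 0
      have b1 := congrFun ht 1
      simp at b0 b1
      have := sq_add_sq_pos hv
      have h2 : (1 + t ^ 2) * (y 0 ^ 2 + y 1 ^ 2) = 0 := by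
        have e0 : y 0 = -(t * y 1) := by linarith
        have e1 : y 1 = t * y 0 := by linarith
        have : y 0 * (1 + t ^ 2) = 0 := by rw [e1] at e0; linear_combination e0
        have h4 : (1 + t ^ 2 : ℝ) ≠ 0 := by positivity
        have h5 : y 0 = 0 := (mul_eq_zero.1 this).resolve_right h4
        rw [e1, h5]; ring
      have h3 : (0 : ℝ) < 1 + t ^ 2 := by positivity
      rcases mul_eq_zero.1 h2 with h4 | h4 <;> linarith

lemma surface_axial_ne_circle (h : Presents hAxial (planeMat q 0) T k g P G) (m : RP1) (c n r) :
    surface G 2 m ≠ circle c n r := by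
  induction m using ind with
  | h u hu =>
    intro he
    rw [h.surface_two] at he
    have : ∞ ∈ circle c n r := by
      rw [← he]
      refine ⟨(1, 0), hAxial_lift_ne_zero ((mulVec_ne_zero_iff g u).2 hu) (by simp), ?_⟩
      rw [planeMat_lift_hAxial]
      exact toPoint_planeMat_infty _ _ rfl
    exact infty_notMem_circle this

/-- The pole does not lie on the axis. -/
def OffAxis (p : ℂ × ℂ) : Prop := p.2 ≠ 0 ∧ (p.1 / p.2).im ≠ 0

lemma axisAndTwoCircles_axial (hq : q ≠ 0) (ha : a = q * qi * q⁻¹)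
    (h : Presents hAxial (planeMat q 0) T k g P G) (hp : HasPoles T v w) (hv : OffAxis v)
    (hw : OffAxis w) (h1 : v.1 / v.2 ≠ w.1 / w.2)
    (h2 : v.1 / v.2 ≠ conj (w.1 / w.2)) : AxisAndTwoCircles a G := by
  have hne : ((v.1 / v.2).re, |(v.1 / v.2).im|) ≠ ((w.1 / w.2).re, |(w.1 / w.2).im|) := by
    intro he
    have e1 := congrArg Prod.fst he
    have e2 := congrArg Prod.snd he
    simp only at e1 e2
    rcases abs_eq_abs.1 e2 with e2 | e2
    · exact h1 (Complex.ext e1 e2)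
    · exact h2 (Complex.ext (by rw [Complex.conj_re]; exact e1) (by rw [Complex.conj_im]; exact e2))
  have hr := abs_pos.2 hv.2
  have hr' := abs_pos.2 hw.2
  have hne' : circle ((v.1 / v.2).re • a) a |(v.1 / v.2).im| ≠
      circle ((w.1 / w.2).re • a) a |(w.1 / w.2).im| := fun he => by
    obtain ⟨e1, e2⟩ := circle_injective hq ha hr hr' he
    exact hne (Prod.ext e1 e2)
  refine ⟨isDoubleAxis hq ha h, _, _, _, _, hr, hr', hne, ?_,
    h.multiplicity_eq_one hp (fiber_axial hq ha hv.1 hv.2) ?_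
      fun m => surface_axial_ne_circle h m _ _ _,
    h.multiplicity_eq_one hp.symm (fiber_axial hq ha hw.1 hw.2) ?_
      fun m => surface_axial_ne_circle h m _ _ _⟩
  · rw [sing_axial hq ha h hp, fiber_axial hq ha hv.1 hv.2, fiber_axial hq ha hw.1 hw.2,
      Set.union_assoc]
  · rw [fiber_axial hq ha hw.1 hw.2]; exact hne'.symm
  · rw [fiber_axial hq ha hv.1 hv.2]; exact hne'

lemma axisAndCircle_two_axial (hq : q ≠ 0) (ha : a = q * qi * q⁻¹)
    (h : Presents hAxial (planeMat q 0) T k g P G) (hp : HasPoles T v w) (hv : OffAxis v)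
    (hw : OffAxis w) (h1 : v.1 / v.2 = w.1 / w.2 ∨ v.1 / v.2 = conj (w.1 / w.2)) :
    AxisAndCircle 2 a G := by
  have he : fiber hAxial (planeMat q 0) w = circle ((v.1 / v.2).re • a) a |(v.1 / v.2).im| := by
    rw [fiber_axial hq ha hw.1 hw.2]
    rcases h1 with h1 | h1 <;> rw [h1]
    rw [Complex.conj_re, Complex.conj_im, abs_neg]
  refine ⟨isDoubleAxis hq ha h, _, _, abs_pos.2 hv.2, ?_, h.multiplicity_eq_two hp
    (fiber_axial hq ha hv.1 hv.2) he fun m => surface_axial_ne_circle h m _ _ _⟩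
  rw [sing_axial hq ha h hp, fiber_axial hq ha hv.1 hv.2, he, Set.union_self]

lemma axisAndCircle_one_axial (hq : q ≠ 0) (ha : a = q * qi * q⁻¹)
    (h : Presents hAxial (planeMat q 0) T k g P G) (hp : HasPoles T v w) (hv : OffAxis v)
    (hw : hAxial.eval w = 0) : AxisAndCircle 1 a G := by
  have hsub := fiber_axial_subset hq ha hw
  refine ⟨isDoubleAxis hq ha h, _, _, abs_pos.2 hv.2, ?_, h.multiplicity_eq_one hp
    (fiber_axial hq ha hv.1 hv.2) (fun he => ?_) fun m => surface_axial_ne_circle h m _ _ _⟩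
  · rw [sing_axial hq ha h hp, fiber_axial hq ha hv.1 hv.2, ← Set.union_assoc]
    exact Set.union_eq_self_of_subset_right (hsub.trans Set.subset_union_left)
  · rw [he] at hsub
    exact circle_not_subset_axis hq ha (abs_pos.2 hv.2) hsub

lemma axisOnly_axial (hq : q ≠ 0) (ha : a = q * qi * q⁻¹)
    (h : Presents hAxial (planeMat q 0) T k g P G) (hp : HasPoles T v w)
    (hv : hAxial.eval v = 0) (hw : hAxial.eval w = 0) : AxisOnly a G := by
  refine ⟨isDoubleAxis hq ha h, ?_⟩
  rw [sing_axial hq ha h hp]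
  exact Set.union_eq_self_of_subset_right
    (Set.union_subset (fiber_axial_subset hq ha hv) (fiber_axial_subset hq ha hw))

end

/-! ### Invariants of equivalence -/

/-- The `i`-th tangent vector vanishes on the coordinate surface `x j = c`. -/
def Vanishes {n : ℕ} (D : QMap n) (i j : Fin n) (c : Fin 2 → ℝ) : Prop :=
  ∀ x, x j = c → omega D x i = 0

/-- The `i`-th tangent vector vanishes on a coordinate surface of the `j`-th family. -/
def VanishesSomewhere {n : ℕ} (D : QMap n) (i j : Fin n) : Prop := ∃ c, c ≠ 0 ∧ Vanishes D i j c

/-- The `i`-th and the `j`-th tangent vector vanish on a common coordinate surface. -/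
def VanishTogether {n : ℕ} (D : QMap n) (i j : Fin n) : Prop :=
  ∃ k c, c ≠ 0 ∧ Vanishes D i k c ∧ Vanishes D j k c

section

variable {n : ℕ} {D D' : QMap n} {M : ℍ² →ₗ[ℝ] ℍ²} {h : ℍ[ℝ]}

lemma vanishes_act (hM : IsSim M) (σ : Equiv.Perm (Fin n)) (g : Fin n → GL (Fin 2) ℝ) (hh : h ≠ 0)
    (hD : Isotropic D) (i j c) : Vanishes (act M σ g h D) i j c ↔
      Vanishes D (σ.symm i) (σ.symm j) ((g (σ.symm j)).1.mulVec c) := by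
  constructor
  · intro h1 y hy
    obtain ⟨τ, k, h3, -⟩ := exists_subst_inverse σ g
    have h4 := h1 (subst τ k y) (by
      have := congrFun (h3 y) (σ.symm j)
      rw [hy, subst, Equiv.apply_symm_apply] at this
      rw [← mulVec_inv_mulVec (g (σ.symm j)) (subst τ k y j), this, mulVec_inv_mulVec])
    rwa [omega_act_eq_zero_iff hM σ g hh hD, h3] at h4
  · intro h1 x hx
    rw [omega_act_eq_zero_iff hM σ g hh hD]
    exact h1 _ (by rw [subst, Equiv.apply_symm_apply, hx])

lemma vanishesSomewhere_act (hM : IsSim M) (σ : Equiv.Perm (Fin n)) (g : Fin n → GL (Fin 2) ℝ)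
    (hh : h ≠ 0) (hD : Isotropic D) (i j) : VanishesSomewhere (act M σ g h D) i j ↔
      VanishesSomewhere D (σ.symm i) (σ.symm j) := by
  constructor
  · rintro ⟨c, hc, h1⟩
    exact ⟨_, (mulVec_ne_zero_iff _ _).2 hc, (vanishes_act hM σ g hh hD i j c).1 h1⟩
  · rintro ⟨c, hc, h1⟩
    refine ⟨(g (σ.symm j))⁻¹.1.mulVec c, (mulVec_ne_zero_iff _ _).2 hc,
      (vanishes_act hM σ g hh hD i j _).2 ?_⟩
    rwa [mulVec_mulVec_inv]

lemma Rel.exists_perm (hD : Isotropic D) (hR : Rel D D') : ∃ σ : Equiv.Perm (Fin n),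
    (∀ i j, VanishesSomewhere D' i j → VanishesSomewhere D (σ i) (σ j)) ∧
    ∀ i j, VanishTogether D' i j → VanishTogether D (σ i) (σ j) := by
  obtain ⟨M, hM, σ, g, h, hh, rfl⟩ := hR
  refine ⟨σ.symm, fun i j => (vanishesSomewhere_act hM σ g hh hD i j).1, ?_⟩
  rintro i j ⟨k, c, hc, h1, h2⟩
  exact ⟨_, _, (mulVec_ne_zero_iff _ _).2 hc, (vanishes_act hM σ g hh hD i k c).1 h1,
    (vanishes_act hM σ g hh hD j k c).1 h2⟩

end

section

variable {K K' : Herm}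

lemma omega_pencilForm_two_eq_zero_iff (T : TMap 2) (K : Herm) (x) :
    omega (pencilForm T K) x 2 = 0 ↔ K.eval (T ![x 0, x 1]) = 0 := by
  rw [omega_pencilForm_two, cx_eq_zero]; simp

lemma omega_polar_zero_eq_zero_iff (x) : omega (pencilForm polarT K) x 0 = 0 ↔
    (x 2 0 ^ 2 - K.det * x 2 1 ^ 2) * (x 1 0 ^ 2 + x 1 1 ^ 2) = 0 := by
  rw [omega_pencilForm_zero, omega_polarT_zero, smul_eq_zero, icx_eq_zero, mul_eq_zero,
    Complex.ofReal_eq_zero]; rfl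

lemma omega_polar_one_eq_zero_iff (x) : omega (pencilForm polarT K) x 1 = 0 ↔
    (x 2 0 ^ 2 - K.det * x 2 1 ^ 2) * (x 0 0 * x 0 1) = 0 := by
  rw [omega_pencilForm_one, omega_polarT_one, smul_eq_zero, icx_eq_zero, mul_eq_zero]; simp

lemma omega_cart_zero_eq_zero_iff (x) : omega (pencilForm cartT K) x 0 = 0 ↔
    (x 2 0 ^ 2 - K.det * x 2 1 ^ 2) * x 1 0 = 0 := by
  rw [omega_pencilForm_zero, omega_cartT_zero, smul_eq_zero, icx_eq_zero, mul_eq_zero]; simp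

lemma omega_cart_one_eq_zero_iff (x) : omega (pencilForm cartT K) x 1 = 0 ↔
    (x 2 0 ^ 2 - K.det * x 2 1 ^ 2) * x 0 0 = 0 := by
  rw [omega_pencilForm_one, omega_cartT_one, smul_eq_zero, icx_eq_zero, mul_eq_zero]; simp

lemma vanishes_polar_zero_iff {j c} (hc : c ≠ 0) : Vanishes (pencilForm polarT K) 0 j c ↔
    j = 2 ∧ c 0 ^ 2 = K.det * c 1 ^ 2 := by
  have hc' := (sq_add_sq_pos hc).ne'
  simp only [Vanishes, omega_polar_zero_eq_zero_iff]
  constructor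
  · intro h
    fin_cases j
    · simpa using h ![c, ![1, 0], ![1, 0]] rfl
    · exact absurd (by simpa using h ![![1, 0], c, ![1, 0]] rfl) hc'
    · have := h ![![1, 0], ![1, 0], c] rfl
      exact ⟨rfl, by simp at this; linarith⟩
  · rintro ⟨rfl, h⟩ x rfl
    rw [h]; ring

lemma vanishes_polar_one_iff {j c} (hc : c ≠ 0) : Vanishes (pencilForm polarT K) 1 j c ↔
    (j = 2 ∧ c 0 ^ 2 = K.det * c 1 ^ 2) ∨ (j = 0 ∧ c 0 * c 1 = 0) := by
  have hc' := (sq_add_sq_pos hc).ne'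
  simp only [Vanishes, omega_polar_one_eq_zero_iff]
  constructor
  · intro h
    fin_cases j
    · exact Or.inr ⟨rfl, by simpa using h ![c, ![1, 0], ![1, 0]] rfl⟩
    · simpa using h ![![1, 1], c, ![1, 0]] rfl
    · have := h ![![1, 1], ![1, 0], c] rfl
      exact Or.inl ⟨rfl, by simp at this; linarith⟩
  · rintro (⟨rfl, h⟩ | ⟨rfl, h⟩) x rfl
    · rw [h]; ring
    · rw [h]; ring

lemma vanishes_polar_two_iff (hK : K.NonZero) {j c} : Vanishes (pencilForm polarT K) 2 j c ↔
    (j = 0 ∧ K.α * c 1 ^ 2 + K.γ * c 0 ^ 2 = 0 ∧ (c 0 * c 1 = 0 ∨ K.β = 0)) ∨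
    (j = 1 ∧ (c 0 ^ 2 + c 1 ^ 2 = 0 ∨ K.α = 0 ∧ K.γ = 0) ∧
      (K.β * (c 0 + I * c 1) ^ 2).re = 0) := by
  simp only [Vanishes, omega_pencilForm_two_eq_zero_iff, eval_polarT, cons_val_zero,
    cons_val_one]
  constructor
  · intro h
    fin_cases j
    · have h1 := h ![c, ![1, 0], 0] rfl
      have h2 := h ![c, ![0, 1], 0] rfl
      have h3 := h ![c, ![1, 1], 0] rfl
      simp [pow_two] at h1 h2 h3
      refine Or.inl ⟨rfl, by linarith, ?_⟩
      by_contra! hc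
      obtain ⟨h0, hβ⟩ := hc
      have e1 : (c 0 * c 1) * K.β.re = 0 := by linarith
      have e2 : (c 0 * c 1) * K.β.im = 0 := by linarith
      exact hβ (Complex.ext ((mul_eq_zero.1 e1).resolve_left h0)
        ((mul_eq_zero.1 e2).resolve_left h0))
    · have h1 := h ![![1, 0], c, 0] rfl
      have h2 := h ![![0, 1], c, 0] rfl
      have h3 := h ![![1, 1], c, 0] rfl
      simp only [cons_val_zero, cons_val_one, mul_zero, zero_mul,
        mul_one, one_pow, ne_eq, OfNat.ofNat_ne_zero, not_false_eq_true, zero_pow, zero_add,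
        add_zero, mul_eq_zero] at h1 h2 h3
      refine Or.inr ⟨rfl, by tauto, ?_⟩
      rw [mul_add, mul_eq_zero.2 h1, mul_eq_zero.2 h2] at h3
      linarith
    · obtain ⟨y, -, hy⟩ := exists_eval_polarT_ne_zero hK
      refine absurd ?_ hy
      rw [eval_polarT]
      exact h ![y 0, y 1, c] rfl
  · rintro (⟨rfl, h, h'⟩ | ⟨rfl, h, h'⟩) x rfl
    · rw [h]
      rcases h' with h' | h' <;> simp [h']
    · rw [h']
      rcases h with h | ⟨h, h''⟩
      · rw [h]; ring
      · rw [h, h'']; ring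

lemma not_vanishesSomewhere_polar_two (hα : K.α ≠ 0) (hγ : K.γ ≠ 0)
    (h : 0 < K.α * K.γ ∨ K.β ≠ 0) (j) : ¬ VanishesSomewhere (pencilForm polarT K) 2 j := by
  rintro ⟨c, hc, h1⟩
  have hc' := sq_add_sq_pos hc
  rcases (vanishes_polar_two_iff (Or.inl hα)).1 h1 with ⟨-, h2, h3⟩ | ⟨-, h2, h3⟩
  · have h4 : c 0 * c 1 ≠ 0 := fun h4 => by
      rcases mul_eq_zero.1 h4 with h4 | h4 <;> simp [h4, hα, hγ] at h2 hc' <;> simp [h2] at hc'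
    have hβ := h3.resolve_left h4
    have h0 := h.resolve_right (by simpa using hβ)
    have h6 : 0 < c 0 ^ 2 := by have := left_ne_zero_of_mul h4; positivity
    have h7 : K.α ^ 2 * c 1 ^ 2 + K.α * K.γ * c 0 ^ 2 = 0 := by linear_combination K.α * h2
    have := mul_pos h0 h6
    nlinarith [sq_nonneg (K.α * c 1)]
  · exact hc'.ne' (h2.resolve_right fun h => hα h.1)

lemma vanishesSomewhere_polar_two_zero (hK : K.OneZero) :
    VanishesSomewhere (pencilForm polarT K) 2 0 := by
  rcases hK with ⟨h1, h2⟩ | ⟨h1, h2⟩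
  · exact ⟨![1, 0], by simp, (vanishes_polar_two_iff (Or.inl h1)).2 (Or.inl (by simp [h2]))⟩
  · exact ⟨![0, 1], by simp,
      (vanishes_polar_two_iff (Or.inr (Or.inr h2))).2 (Or.inl (by simp [h1]))⟩

end

/-! ### Equivalences that preserve the parameter lines -/

section

variable {K K' : Herm} {M : ℍ² →ₗ[ℝ] ℍ²} {g : Fin 3 → GL (Fin 2) ℝ} {h : ℍ[ℝ]}

lemma exists_norm_sq_of_act (hM : IsSim M)
    (he : pencilForm polarT K' = act M 1 g h (pencilForm polarT K)) : ∃ ρ : ℝ, ∀ t : Fin 2 → ℝ,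
      (g 1).1.mulVec t 0 ^ 2 + (g 1).1.mulVec t 1 ^ 2 = ρ * (t 0 ^ 2 + t 1 ^ 2) := by
  obtain ⟨r, hr, h1⟩ := omega_act hM 1 g h (isotropic_pencilForm polarT K)
  rw [← he] at h1
  change ∀ x i, _ = (r * (g i).1.det) • (star h * omega _ (subst 1 g x) i * h) at h1
  obtain ⟨C, hC⟩ : ∃ C : ℝ, ∀ t : Fin 2 → ℝ,
      t 0 ^ 2 + t 1 ^ 2 = C * ((g 1).1.mulVec t 0 ^ 2 + (g 1).1.mulVec t 1 ^ 2) := by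
    refine ⟨|r * (g 0).1.det| * (‖h‖ * |(g 2).1.mulVec ![1, 0] 0 ^ 2 -
      K.det * (g 2).1.mulVec ![1, 0] 1 ^ 2| * ‖h‖), fun t => ?_⟩
    have h2 := congrArg norm (h1 ![![1, 0], t, ![1, 0]] 0)
    have hnn : ∀ x y : ℝ, 0 ≤ x ^ 2 + y ^ 2 := fun x y => by positivity
    have hn : ∀ x : ℝ, ‖icx (x : ℂ)‖ = |x| := fun x => by
      rw [← Real.sqrt_sq_eq_abs, ← Real.sqrt_sq (norm_nonneg (icx _)), ← real_inner_self_eq_norm_sq,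
        inner_icx]
      simp [pow_two]
    simp only [norm_smul, norm_mul, Quaternion.norm_star, omega_pencilForm_zero, omega_polarT_zero,
      hn, Real.norm_eq_abs, subst, Equiv.Perm.one_apply, cons_val_zero,
      cons_val_one, cons_val, abs_of_nonneg (hnn _ _)] at h2
    simp only [one_pow, ne_eq, OfNat.ofNat_ne_zero, not_false_eq_true, zero_pow, mul_zero, sub_zero,
      abs_one, one_mul] at h2
    rw [h2, abs_mul]; ring
  have hC0 : C ≠ 0 := fun h0 => by simpa [h0] using hC ![1, 0]
  exact ⟨C⁻¹, fun t => by rw [hC t]; field_simp⟩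

lemma exists_eval_of_act (hM : IsSim M) (hK' : K'.NonZero)
    (he : pencilForm polarT K' = act M 1 g h (pencilForm polarT K)) : ∃ κ : ℝ, ∀ s t : Fin 2 → ℝ,
      K'.eval (polarT ![s, t]) =
        κ * K.eval (polarT ![(g 0).1.mulVec s, (g 1).1.mulVec t]) := by
  obtain ⟨r, hr, h1⟩ := omega_act hM 1 g h (isotropic_pencilForm polarT K)
  rw [← he] at h1
  change ∀ x i, _ = (r * (g i).1.det) • (star h * omega _ (subst 1 g x) i * h) at h1
  have h2 : ∀ s t : Fin 2 → ℝ, K'.eval (polarT ![s, t]) • qk =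
      (r * (g 2).1.det * K.eval (polarT ![(g 0).1.mulVec s, (g 1).1.mulVec t])) •
        (star h * qk * h) := fun s t => by
    have h3 : ∀ x : ℝ, cx (I * x) = x • qk := fun x => by ext <;> simp [cx, qk]
    have := h1 ![s, t, 0] 2
    rw [omega_pencilForm_two, omega_pencilForm_two, h3, h3, mul_smul_comm, smul_mul_assoc,
      smul_smul] at this
    exact this
  obtain ⟨y, -, hy⟩ := exists_eval_polarT_ne_zero hK'
  obtain ⟨x, hx⟩ : ∃ x : ℝ, star h * qk * h = x • qk := by
    have h3 := h2 (y 0) (y 1)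
    have hy' : K'.eval (polarT ![y 0, y 1]) ≠ 0 := by rw [eval_polarT] at hy ⊢; exact hy
    set a := r * (g 2).1.det * K.eval (polarT ![(g 0).1.mulVec (y 0), (g 1).1.mulVec (y 1)])
    have ha : a ≠ 0 := fun h0 => by
      rw [h0, zero_smul, smul_eq_zero] at h3
      exact h3.elim hy' qk_ne_zero
    exact ⟨a⁻¹ * K'.eval (polarT ![y 0, y 1]), by rw [mul_smul, h3, inv_smul_smul₀ ha]⟩
  refine ⟨r * (g 2).1.det * x, fun s t => ?_⟩
  have h3 := h2 s t
  rw [hx, smul_smul] at h3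
  rw [smul_left_injective ℝ qk_ne_zero h3]
  ring

lemma normSq_beta_le_of_act (hM : IsSim M) (hh : h ≠ 0) (hK' : K'.NonZero)
    (he : pencilForm polarT K' = act M 1 g h (pencilForm polarT K)) :
    ∃ R : ℝ, K'.α * K'.γ = R * (K.α * K.γ) ∧
      normSq K'.β ≤ R * normSq K.β := by
  obtain ⟨ρ, hρ⟩ := exists_norm_sq_of_act hM he
  obtain ⟨κ, hκ⟩ := exists_eval_of_act hM hK' he
  simp only [eval_polarT, cons_val_zero, cons_val_one, hρ] at hκ
  have hv : ∀ c, c ≠ 0 → c 0 * c 1 = 0 →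
      (g 0).1.mulVec c 0 * (g 0).1.mulVec c 1 = 0 := fun c hc h0 => by
    have h1 := (vanishes_polar_one_iff (K := K') hc).2 (Or.inr ⟨rfl, h0⟩)
    rw [he, vanishes_act hM 1 g hh (isotropic_pencilForm _ _)] at h1
    rcases (vanishes_polar_one_iff ((mulVec_ne_zero_iff (g 0) c).2 hc)).1 h1 with h2 | h2
    · exact absurd h2.1 (by decide)
    · exact h2.2
  have hm : ∀ c, (g 0).1.mulVec c = ![(g 0).1 0 0 * c 0 + (g 0).1 0 1 * c 1,
      (g 0).1 1 0 * c 0 + (g 0).1 1 1 * c 1] := fun c => by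
    ext i; fin_cases i <;> simp [Matrix.mulVec]
  have hd := GL_det_ne_zero (g 0)
  rw [Matrix.det_fin_two] at hd
  have v1 := hv ![1, 0] (by simp) (by simp)
  have v2 := hv ![0, 1] (by simp) (by simp)
  simp only [hm] at v1 v2 hκ
  set a := (g 0).1 0 0
  set b := (g 0).1 0 1
  set c := (g 0).1 1 0
  set d := (g 0).1 1 1
  simp at v1 v2
  have hα := hκ ![0, 1] ![1, 0]
  have hγ := hκ ![1, 0] ![1, 0]
  simp at hα hγ
  have hβ : ∀ t, (K'.β * (t 0 + I * t 1) ^ 2).re = κ * (a * d + b * c) *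
      (K.β * ((g 1).1.mulVec t 0 + I * (g 1).1.mulVec t 1) ^ 2).re := fun t => by
    have e1 := hκ ![1, 1] t
    have e2 := hκ ![1, -1] t
    simp only [cons_val_zero, cons_val_one] at e1 e2
    rcases v1 with h0 | h0 <;> rcases v2 with h1 | h1 <;> simp only [h0, h1] at hd e1 e2 ⊢
    · simp at hd
    · linear_combination (e1 - e2) / 4
    · linear_combination (e1 - e2) / 4
    · simp at hd
  refine ⟨(κ * ρ * (a * d + b * c)) ^ 2, ?_, ?_⟩
  · rcases v1 with h0 | h0 <;> rcases v2 with h1 | h1 <;>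
      simp only [h0, h1, zero_mul, mul_zero, sub_self, ne_eq, not_true_eq_false] at hd <;>
      rw [hα, hγ, h0, h1] <;> ring
  · obtain ⟨w, hw⟩ := IsAlgClosed.exists_pow_nat_eq (conj K'.β) (n := 2) (by norm_num)
    have e1 := hβ ![w.re, w.im]
    have e2 := hρ ![w.re, w.im]
    have hw' : ((w.re : ℂ) + I * w.im) = w := by
      rw [mul_comm, Complex.re_add_im]
    simp only [cons_val_zero, cons_val_one] at e1 e2
    rw [hw', hw, Complex.mul_conj, Complex.ofReal_re] at e1
    set z : ℂ := (g 1).1.mulVec ![w.re, w.im] 0 + I * (g 1).1.mulVec ![w.re, w.im] 1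
    have e3 : normSq z = ρ * normSq w := by
      rw [normSq_apply, normSq_apply]
      rw [← pow_two, ← pow_two, ← pow_two, ← pow_two, ← e2]
      simp only [z, Complex.add_re, Complex.add_im, Complex.ofReal_re, Complex.ofReal_im,
        Complex.mul_re, Complex.mul_im, Complex.I_re, Complex.I_im]
      ring
    have e4 : normSq w ^ 2 = normSq K'.β := by
      rw [← map_pow, hw, Complex.normSq_conj]
    have e5 : (K.β * z ^ 2).re ^ 2 ≤ normSq K.β * (ρ ^ 2 * normSq K'.β) := by
      rw [← e4, ← mul_pow, ← e3, ← map_pow, ← map_mul, pow_two, normSq_apply]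
      exact le_add_of_nonneg_right (mul_self_nonneg _)
    by_cases h0 : normSq K'.β = 0
    · rw [h0]; exact mul_nonneg (sq_nonneg _) (normSq_nonneg _)
    · have h1 : 0 < normSq K'.β := lt_of_le_of_ne (normSq_nonneg _) (Ne.symm h0)
      refine le_of_mul_le_mul_right ?_ h1
      calc normSq K'.β * normSq K'.β
          = (κ * (a * d + b * c)) ^ 2 * (K.β * z ^ 2).re ^ 2 := by
            rw [← mul_pow, ← e1, pow_two]
        _ ≤ (κ * (a * d + b * c)) ^ 2 * (normSq K.β * (ρ ^ 2 * normSq K'.β)) := by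
            gcongr
        _ = _ := by ring

lemma normSq_beta_mul_eq (hα : K.α ≠ 0) (hγ : K.γ ≠ 0) (hK' : K'.NonZero)
    (hR : Rel (pencilForm polarT K) (pencilForm polarT K'))
    (hσ : ∀ σ : Equiv.Perm (Fin 3), (∀ i j, VanishesSomewhere (pencilForm polarT K') i j ↔
      VanishesSomewhere (pencilForm polarT K) (σ i) (σ j)) → σ = 1) :
    normSq K.β * (K'.α * K'.γ) = normSq K'.β * (K.α * K.γ) := by
  have key : ∀ {K K' : Herm}, K'.NonZero → Rel (pencilForm polarT K) (pencilForm polarT K') →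
      (∀ σ : Equiv.Perm (Fin 3), (∀ i j, VanishesSomewhere (pencilForm polarT K') i j ↔
        VanishesSomewhere (pencilForm polarT K) (σ i) (σ j)) → σ = 1) →
      ∃ R : ℝ, K'.α * K'.γ = R * (K.α * K.γ) ∧
        normSq K'.β ≤ R * normSq K.β := fun hK' hR hσ => by
    obtain ⟨M, hM, σ, g, h, hh, he⟩ := hR
    have h1 := hσ σ.symm fun i j => by
      rw [he]; exact vanishesSomewhere_act hM σ g hh (isotropic_pencilForm _ _) i j
    have h2 : σ = 1 := by rw [← σ.symm_symm, h1]; rfl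
    rw [h2] at he
    exact normSq_beta_le_of_act hM hh hK' he
  obtain ⟨R, h1, h2⟩ := key hK' hR hσ
  obtain ⟨R', h3, h4⟩ := key (Or.inl hα) hR.symm fun σ h => by
    have := hσ σ.symm fun i j => by rw [h, Equiv.apply_symm_apply, Equiv.apply_symm_apply]
    rw [← σ.symm_symm, this]; rfl
  have h5 : R' * R = 1 := by
    rw [h1, ← mul_assoc] at h3
    exact (mul_eq_right₀ (mul_ne_zero hα hγ)).1 h3.symm
  rw [h1]
  by_cases hR : 0 ≤ R
  · have h6 := mul_le_mul_of_nonneg_left h4 hR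
    rw [← mul_assoc, mul_comm R R', h5, one_mul] at h6
    rw [le_antisymm h2 h6]; ring
  · have h6 := normSq_nonneg K'.β
    have h7 := normSq_nonneg K.β
    have h8 : normSq K.β = 0 := by nlinarith
    rw [h8] at h2 ⊢
    have h9 : normSq K'.β = 0 := by linarith
    rw [h9]; ring

lemma perm_eq_one {σ : Equiv.Perm (Fin 3)} (h0 : σ 0 = 0) (h1 : σ 1 = 1) : σ = 1 := by
  revert σ; decide

lemma vanishesSomewhere_polar_one_zero (K : Herm) : VanishesSomewhere (pencilForm polarT K) 1 0 :=
  ⟨![1, 0], by simp, (vanishes_polar_one_iff (by simp)).2 (Or.inr ⟨rfl, by simp⟩)⟩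

lemma vanishesSomewhere_polar_zero_iff (K : Herm) (j) :
    VanishesSomewhere (pencilForm polarT K) 0 j ↔ j = 2 ∧ 0 ≤ K.det := by
  constructor
  · rintro ⟨c, hc, h⟩
    obtain ⟨h1, h2⟩ := (vanishes_polar_zero_iff hc).1 h
    refine ⟨h1, ?_⟩
    by_contra! h3
    have := sq_add_sq_pos hc
    have h4 := mul_nonneg (neg_pos.2 h3).le (sq_nonneg (c 1))
    have h5 : c 0 ^ 2 = 0 := le_antisymm (by linarith) (sq_nonneg _)
    rw [h5, eq_comm, mul_eq_zero, or_iff_right h3.ne] at h2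
    linarith
  · rintro ⟨rfl, h⟩
    exact ⟨![√K.det, 1], by simp, (vanishes_polar_zero_iff (by simp)).2 ⟨rfl, by simp [h]⟩⟩

lemma vanishesSomewhere_polar_one_iff (K : Herm) (j) :
    VanishesSomewhere (pencilForm polarT K) 1 j ↔ j = 0 ∨ (j = 2 ∧ 0 ≤ K.det) := by
  constructor
  · rintro ⟨c, hc, h⟩
    rcases (vanishes_polar_one_iff hc).1 h with h1 | h1
    · exact Or.inr ((vanishesSomewhere_polar_zero_iff K j).1
        ⟨c, hc, (vanishes_polar_zero_iff hc).2 h1⟩)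
    · exact Or.inl h1.1
  · rintro (rfl | h)
    · exact vanishesSomewhere_polar_one_zero K
    · obtain ⟨c, hc, h1⟩ := (vanishesSomewhere_polar_zero_iff K j).2 h
      exact ⟨c, hc, (vanishes_polar_one_iff hc).2 (Or.inl ((vanishes_polar_zero_iff hc).1 h1))⟩

lemma normSq_beta_mul_eq_of_rel (hα : K.α ≠ 0) (hγ : K.γ ≠ 0) (h : 0 < K.α * K.γ ∨ K.β ≠ 0)
    (hα' : K'.α ≠ 0) (hγ' : K'.γ ≠ 0) (h' : 0 < K'.α * K'.γ ∨ K'.β ≠ 0)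
    (hd : 0 ≤ K'.det ∨ K.det < 0)
    (hR : Rel (pencilForm polarT K) (pencilForm polarT K')) :
    normSq K.β * (K'.α * K'.γ) = normSq K'.β * (K.α * K.γ) := by
  refine normSq_beta_mul_eq hα hγ (Or.inl hα') hR fun σ hσ => ?_
  have h2 := not_vanishesSomewhere_polar_two hα hγ h
  have h2' := not_vanishesSomewhere_polar_two hα' hγ' h'
  have h0 := vanishesSomewhere_polar_zero_iff K
  have h1 := vanishesSomewhere_polar_one_iff K
  have h0' := vanishesSomewhere_polar_zero_iff K'
  have h1' := vanishesSomewhere_polar_one_iff K'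
  have a10 := (hσ 1 0).1 ((h1' 0).2 (Or.inl rfl))
  rcases hd with hd | hd
  · have a02 := (hσ 0 2).1 ((h0' 2).2 ⟨rfl, hd⟩)
    generalize e0 : σ 0 = i at *
    generalize e1 : σ 1 = j at *
    generalize e2 : σ 2 = k at *
    have := σ.injective.ne (show (0 : Fin 3) ≠ 1 by decide)
    have := σ.injective.ne (show (0 : Fin 3) ≠ 2 by decide)
    have := σ.injective.ne (show (1 : Fin 3) ≠ 2 by decide)
    refine perm_eq_one ?_ ?_ <;> fin_cases i <;> fin_cases j <;> simp_all
  · generalize e0 : σ 0 = i at *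
    generalize e1 : σ 1 = j at *
    refine perm_eq_one ?_ ?_ <;> fin_cases j <;> simp_all [not_le.2 hd]

end

/-! ### Inequivalent systems -/

section

variable {K K' : Herm}

lemma not_rel_polar_cart_of_det (hK : K.α ≠ 0 ∨ K.γ ≠ 0) (hK' : 0 ≤ K'.det) :
    ¬ Rel (pencilForm polarT K) (pencilForm cartT K') := by
  intro hR
  obtain ⟨σ, h1, -⟩ := hR.exists_perm (isotropic_pencilForm _ _)
  have hs : (![√K'.det, 1] : Fin 2 → ℝ) 0 ^ 2 - K'.det * (![√K'.det, 1] : Fin 2 → ℝ) 1 ^ 2 = 0 := by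
    simp [hK']
  have c01 := h1 0 1 ⟨![0, 1], by simp, fun x hx => by
    rw [omega_cart_zero_eq_zero_iff, hx]; simp⟩
  have c02 := h1 0 2 ⟨![√K'.det, 1], by simp, fun x hx => by
    rw [omega_cart_zero_eq_zero_iff, hx, hs, zero_mul]⟩
  have c10 := h1 1 0 ⟨![0, 1], by simp, fun x hx => by
    rw [omega_cart_one_eq_zero_iff, hx]; simp⟩
  have c12 := h1 1 2 ⟨![√K'.det, 1], by simp, fun x hx => by
    rw [omega_cart_one_eq_zero_iff, hx, hs, zero_mul]⟩
  have hrow : ∀ i j j', j ≠ j' → VanishesSomewhere (pencilForm polarT K) i j →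
      VanishesSomewhere (pencilForm polarT K) i j' → i = 1 := fun i j j' hj h2 h3 => by
    have hz : K.NonZero := hK.elim Or.inl fun h => Or.inr (Or.inr h)
    have h20 : ∀ j, VanishesSomewhere (pencilForm polarT K) 2 j → j = 0 := fun j ⟨c, hc, h⟩ => by
      rcases (vanishes_polar_two_iff hz).1 h with h | ⟨-, h, -⟩
      · exact h.1
      · exact (hK.elim (fun hK => hK (h.resolve_left (sq_add_sq_pos hc).ne').1)
          fun hK => hK (h.resolve_left (sq_add_sq_pos hc).ne').2).elim
    fin_cases i
    · exact absurd (((vanishesSomewhere_polar_zero_iff K j).1 h2).1.trans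
        ((vanishesSomewhere_polar_zero_iff K j').1 h3).1.symm) hj
    · rfl
    · exact absurd ((h20 j h2).trans (h20 j' h3).symm) hj
  have e0 := hrow _ _ _ (σ.injective.ne (by decide)) c01 c02
  have e1 := hrow _ _ _ (σ.injective.ne (by decide)) c10 c12
  exact absurd (σ.injective (e0.trans e1.symm)) (by decide)

/-- Every tangent vector vanishes on some coordinate surface. -/
def AllVanish (D : QMap 3) : Prop := ∀ i, ∃ j, VanishesSomewhere D i j

lemma AllVanish.of_rel {D D' : QMap 3} (hD : Isotropic D) (h : AllVanish D') (hR : Rel D D') :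
    AllVanish D := by
  obtain ⟨σ, h1, -⟩ := hR.exists_perm hD
  intro i
  obtain ⟨j, hj⟩ := h (σ.symm i)
  exact ⟨_, by simpa using h1 _ _ hj⟩

lemma allVanish_polar (h : K.OneZero) (hd : 0 ≤ K.det) : AllVanish (pencilForm polarT K) := by
  intro i
  fin_cases i
  · exact ⟨2, (vanishesSomewhere_polar_zero_iff K 2).2 ⟨rfl, hd⟩⟩
  · exact ⟨0, vanishesSomewhere_polar_one_zero K⟩
  · exact ⟨0, vanishesSomewhere_polar_two_zero h⟩

lemma not_allVanish_polar (hα : K.α ≠ 0) (hγ : K.γ ≠ 0) (h : 0 < K.α * K.γ ∨ K.β ≠ 0) :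
    ¬ AllVanish (pencilForm polarT K) := fun h1 =>
  have ⟨j, hj⟩ := h1 2
  not_vanishesSomewhere_polar_two hα hγ h j hj

lemma allVanish_cart (hα : K.α = 0) : AllVanish (pencilForm cartT K) := by
  intro i
  fin_cases i
  · exact ⟨1, ![0, 1], by simp, fun x hx => by
      change omega _ x 0 = 0; rw [omega_cart_zero_eq_zero_iff, hx]; simp⟩
  · exact ⟨0, ![0, 1], by simp, fun x hx => by
      change omega _ x 1 = 0; rw [omega_cart_one_eq_zero_iff, hx]; simp⟩
  · exact ⟨0, ![0, 1], by simp, fun x hx => by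
      change omega _ x 2 = 0
      rw [omega_pencilForm_two_eq_zero_iff, eval_cartT]; simp [hα, hx]⟩

lemma not_allVanish_cart (hα : K.α ≠ 0) : ¬ AllVanish (pencilForm cartT K) := by
  intro h1
  obtain ⟨j, c, hc, h⟩ := h1 2
  have hc' := (sq_add_sq_pos hc).ne'
  have h2 : ∀ x : Fin 3 → Fin 2 → ℝ, x j = c → K.eval (cartT ![x 0, x 1]) = 0 := fun x hx =>
    (omega_pencilForm_two_eq_zero_iff _ _ x).1 (h x hx)
  simp only [eval_cartT, cons_val_zero, cons_val_one] at h2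
  fin_cases j
  · have e1 := h2 ![c, ![0, 1], 0] rfl
    simp [hα] at e1
    have e2 := h2 ![c, ![1, 0], 0] rfl
    simp [hα, e1] at e2
    exact hc' (by rw [e1, e2]; ring)
  · have e1 := h2 ![![0, 1], c, 0] rfl
    simp [hα] at e1
    have e2 := h2 ![![1, 0], c, 0] rfl
    simp [hα, e1] at e2
    exact hc' (by rw [e1, e2]; ring)
  · obtain ⟨y, -, hy⟩ := exists_eval_cartT_ne_zero (Or.inl hα : K.NonZero)
    rw [eval_cartT] at hy
    exact hy (h2 ![y 0, y 1, c] rfl)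

/-- Two of the tangent vectors vanish on coordinate surfaces. -/
def TwoVanish (D : QMap 3) : Prop :=
  ∃ i i', i ≠ i' ∧ (∃ j, VanishesSomewhere D i j) ∧ ∃ j, VanishesSomewhere D i' j

lemma TwoVanish.of_rel {D D' : QMap 3} (hD : Isotropic D) (h : TwoVanish D') (hR : Rel D D') :
    TwoVanish D := by
  obtain ⟨σ, h1, -⟩ := hR.exists_perm hD
  obtain ⟨i, i', hi, ⟨j, hj⟩, j', hj'⟩ := h
  exact ⟨_, _, σ.injective.ne hi, ⟨_, h1 _ _ hj⟩, _, h1 _ _ hj'⟩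

lemma not_twoVanish_polar (hα : K.α ≠ 0) (hγ : K.γ ≠ 0) (hβ : K.β ≠ 0) (hd : K.det < 0) :
    ¬ TwoVanish (pencilForm polarT K) := by
  have key : ∀ i, (∃ j, VanishesSomewhere (pencilForm polarT K) i j) → i = 1 := fun i ⟨j, hj⟩ => by
    fin_cases i
    · exact absurd ((vanishesSomewhere_polar_zero_iff K j).1 hj).2 hd.not_ge
    · rfl
    · exact absurd hj (not_vanishesSomewhere_polar_two hα hγ (Or.inr hβ) j)
  rintro ⟨i, i', hi, h1, h2⟩
  exact hi ((key i h1).trans (key i' h2).symm)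

lemma twoVanish_polar_of_beta_eq_zero (hβ : K.β = 0) (h : K.α * K.γ < 0) :
    TwoVanish (pencilForm polarT K) := by
  refine ⟨1, 2, by decide, ⟨0, vanishesSomewhere_polar_one_zero K⟩, 0, ?_⟩
  have hα : K.α ≠ 0 := by rintro h0; simp [h0] at h
  have hs := sq_sqrt (neg_nonneg.2 h.le)
  refine ⟨![K.α, √(-(K.α * K.γ))], by simp [hα],
    (vanishes_polar_two_iff (Or.inl hα)).2 (Or.inl ⟨rfl, ?_, Or.inr hβ⟩)⟩
  simp only [cons_val_zero, cons_val_one]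
  rw [hs]; ring

lemma vanishTogether_polar_of_gamma_eq_zero (hK : K.NonZero) (h : K.γ = 0) :
    VanishTogether (pencilForm polarT K) 1 2 :=
  ⟨0, ![1, 0], by simp, (vanishes_polar_one_iff (by simp)).2 (Or.inr ⟨rfl, by simp⟩),
    (vanishes_polar_two_iff hK).2 (Or.inl ⟨rfl, by simp [h], by simp⟩)⟩

lemma vanishTogether_polar_of_alpha_eq_zero (hK : K.NonZero) (h : K.α = 0) :
    VanishTogether (pencilForm polarT K) 1 2 :=
  ⟨0, ![0, 1], by simp, (vanishes_polar_one_iff (by simp)).2 (Or.inr ⟨rfl, by simp⟩),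
    (vanishes_polar_two_iff hK).2 (Or.inl ⟨rfl, by simp [h], by simp⟩)⟩

lemma not_vanishTogether_polar (hα : K.α ≠ 0) (hγ : K.γ ≠ 0) (hd : K.det < 0) {i i'}
    (hi : i ≠ i') : ¬ VanishTogether (pencilForm polarT K) i i' := by
  have h0 : ∀ j c, c ≠ 0 → ¬ Vanishes (pencilForm polarT K) 0 j c := fun j c hc h =>
    absurd ((vanishesSomewhere_polar_zero_iff K j).1 ⟨c, hc, h⟩).2 hd.not_ge
  have h12 : ∀ j c, c ≠ 0 → Vanishes (pencilForm polarT K) 1 j c →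
      ¬ Vanishes (pencilForm polarT K) 2 j c := fun j c hc h1 h2 => by
    have hc' := sq_add_sq_pos hc
    rcases (vanishes_polar_one_iff hc).1 h1 with h3 | ⟨rfl, h3⟩
    · exact h0 j c hc ((vanishes_polar_zero_iff hc).2 h3)
    · rcases (vanishes_polar_two_iff (Or.inl hα)).1 h2 with ⟨-, h4, -⟩ | h4
      · rcases mul_eq_zero.1 h3 with h5 | h5 <;> simp [h5, hα, hγ] at h4 <;> simp [h4, h5] at hc'
      · simp at h4
  rintro ⟨j, c, hc, h1, h2⟩
  fin_cases i <;> fin_cases i'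
  · exact hi rfl
  · exact h0 j c hc h1
  · exact h0 j c hc h1
  · exact h0 j c hc h2
  · exact hi rfl
  · exact h12 j c hc h1 h2
  · exact h0 j c hc h2
  · exact h12 j c hc h2 h1
  · exact hi rfl

lemma Rel.not_vanishTogether {D D' : QMap 3} (hD : Isotropic D)
    (h : ∀ i i', i ≠ i' → ¬ VanishTogether D i i') (hR : Rel D D') (i i') (hi : i ≠ i') :
    ¬ VanishTogether D' i i' := by
  obtain ⟨σ, -, h1⟩ := hR.exists_perm hD
  exact fun h2 => h _ _ (σ.injective.ne hi) (h1 _ _ h2)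

lemma not_rel_polar_oneZero_bothZero (hK : K.OneZero) (hd : K.det < 0) (hα : K'.α = 0)
    (hγ : K'.γ = 0) (hβ : K'.β ≠ 0) : ¬ Rel (pencilForm polarT K) (pencilForm polarT K') := by
  intro hR
  obtain ⟨σ, h1, -⟩ := hR.exists_perm (isotropic_pencilForm _ _)
  have hz : K.NonZero := hK.elim (fun h => Or.inl h.1) fun h => Or.inr (Or.inr h.2)
  have hrow : ∀ i j, VanishesSomewhere (pencilForm polarT K) i j → j = 0 := fun i j h => by
    fin_cases i
    · exact absurd ((vanishesSomewhere_polar_zero_iff K j).1 h).2 hd.not_ge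
    · exact ((vanishesSomewhere_polar_one_iff K j).1 h).resolve_right fun h => hd.not_ge h.2
    · obtain ⟨c, hc, h⟩ := h
      rcases (vanishes_polar_two_iff hz).1 h with h | ⟨-, h, -⟩
      · exact h.1
      · have h' := h.resolve_left (sq_add_sq_pos hc).ne'
        exact (hK.elim (fun hK => hK.1 h'.1) fun hK => hK.2 h'.2).elim
  obtain ⟨w, hw⟩ := IsAlgClosed.exists_pow_nat_eq (I * conj K'.β) (n := 2)
    (by norm_num)
  have hw0 : w ≠ 0 := fun h0 => by simp [h0, hβ] at hw
  have h20 := h1 2 0 ⟨![1, 0], by simp,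
    (vanishes_polar_two_iff (Or.inr (Or.inl hβ))).2 (Or.inl ⟨rfl, by simp [hγ], by simp⟩)⟩
  have h21 := h1 2 1 ⟨![w.re, w.im], fun h => hw0 (Complex.ext (by simpa using congrFun h 0)
      (by simpa using congrFun h 1)),
    (vanishes_polar_two_iff (Or.inr (Or.inl hβ))).2 (Or.inr ⟨rfl, Or.inr ⟨hα, hγ⟩, by
      simp only [cons_val_zero, cons_val_one]
      rw [mul_comm I, Complex.re_add_im, hw, mul_left_comm, Complex.mul_conj]
      simp⟩)⟩
  exact absurd (σ.injective ((hrow _ _ h20).trans (hrow _ _ h21).symm)) (by decide)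

end

/-! ### Kinds of offset constructions -/

lemma TColumns.symm {T : TMap 2} {v w} (h : TColumns polarT T v w) : TColumns polarT T w v := by
  obtain ⟨hd, σ, g, hT⟩ := h
  obtain ⟨g', hg⟩ : ∃ g' : Fin 2 → GL (Fin 2) ℝ, ∀ y,
      polarT (subst 1 g' y) = ((polarT y).2, (polarT y).1) :=
    ⟨![colGL ![0, 1] ![1, 0] (by simp [wedge]), diagGL 1 (-1) (by simp)], fun y => by
      rw [subst2, colGL_mulVec, diagGL_mulVec, polarT_apply, polarT_apply]
      simp [sub_eq_add_neg]⟩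
  refine ⟨fun h0 => hd (by linear_combination -h0), Equiv.trans (1 : Equiv.Perm (Fin 2)) σ,
    fun i => g' i * g ((1 : Equiv.Perm (Fin 2)) i), fun x => ?_⟩
  rw [hT, ← subst_subst, hg]
  ext1 <;> simp [cmat_apply, add_comm]

lemma Presents.exists_columns {H M T k g P G} (h : Presents H M T k g P G) (hP : TwoPolar P)
    {p q : OnePoint ℍ[ℝ]} (hs : sing P = {p, q}) : ∃ v w, TColumns polarT T v w ∧
      toPoint (M (emb v)) = p ∧ toPoint (M (emb w)) = q := by
  obtain ⟨v, w, hc⟩ := (h.twoPolar_iff.1 hP).exists_columns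
  rw [h.sing_polar hc, Set.pair_eq_pair_iff] at hs
  rcases hs with ⟨h1, h2⟩ | ⟨h1, h2⟩
  · exact ⟨v, w, hc, h1, h2⟩
  · exact ⟨w, v, hc.symm, h2, h1⟩

lemma Presents.rel_pencilForm {H M T k g P G} (h : Presents H M T k g P G) {T₀ v w}
    (hc : TColumns T₀ T v w) : Rel (pencilForm T₀ (H.pull v.1 w.1 v.2 w.2)) G :=
  (hc.rel_pencilForm H).trans h.rel

lemma mobiusEquiv_iff_of_rel {D D' G G' : QMap 3} (hG : AlgDC G) (h : Rel D G) (h' : Rel D' G') :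
    MobiusEquiv G G' ↔ Rel D D' := by
  rw [mobiusEquiv_iff_rel hG]
  exact ⟨fun hR => (h.trans hR).trans h'.symm, fun hR => (h.symm.trans hR).trans h'⟩

/-- The system can be brought to the polar form. -/
def PolarType (G : QMap 3) : Prop :=
  ∃ K : Herm, (K.α ≠ 0 ∨ K.γ ≠ 0) ∧ Rel (pencilForm polarT K) G

/-- The system can be brought to the Cartesian form with a form of non-negative determinant. -/
def CartType (G : QMap 3) : Prop := ∃ K : Herm, 0 ≤ K.det ∧ Rel (pencilForm cartT K) G

lemma PolarType.not_rel {G G'} (h : PolarType G) (h' : CartType G') : ¬ Rel G G' := by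
  obtain ⟨K, h1, h2⟩ := h
  obtain ⟨K', h1', h2'⟩ := h'
  exact fun hR => not_rel_polar_cart_of_det h1 h1' ((h2.trans hR).trans h2'.symm)

/-! #### Offsets based on spheres -/

lemma TColumns.normSq_pos {T₀ T : TMap 2} {v w} (h : TColumns T₀ T v w) :
    0 < normSq (v.1 * w.2 - w.1 * v.2) := Complex.normSq_pos.2 h.1

lemma det_pull_hSphere_pos {T₀ T : TMap 2} {v w} (h : TColumns T₀ T v w) :
    0 < (hSphere.pull v.1 w.1 v.2 w.2).det := by
  rw [Herm.det_pull]
  exact mul_pos h.normSq_pos (by simp [hSphere, Herm.det])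

lemma normSq_beta_hSphere {v w : ℂ × ℂ} (hv : v ≠ 0) (hw : w ≠ 0) :
    2 * normSq (hSphere.pull v.1 w.1 v.2 w.2).β =
      (1 + Real.cos (InnerProductGeometry.angle (sphereNormal v) (sphereNormal w))) *
        (hSphere.eval v * hSphere.eval w) := by
  have h1 := eval_hSphere_pos hv
  have h2 := eval_hSphere_pos hw
  rw [InnerProductGeometry.cos_angle, norm_sphereNormal hv, norm_sphereNormal hw,
    inner_sphereNormal hv hw]
  simp only [Herm.pull, hSphere] at h1 h2 ⊢
  field_simp
  simp

/-- Normal data of a sphere offset with a 2-polar base. -/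
lemma SphereOffset.exists_polar {P c r G} (h : SphereOffset P c r G) (hP : TwoPolar P)
    {p q : OnePoint ℍ[ℝ]} (hs : sing P = {p, q}) : ∃ T k g v w,
      Presents hSphere (sphereMat c r) T k g P G ∧ TColumns polarT T v w ∧
      ((c + r • sphereNormal v : ℍ[ℝ]) : OnePoint ℍ[ℝ]) = p ∧
      ((c + r • sphereNormal w : ℍ[ℝ]) : OnePoint ℍ[ℝ]) = q := by
  obtain ⟨T, k, g, hp⟩ := h.presents
  obtain ⟨v, w, hc, h1, h2⟩ := hp.exists_columns hP hs
  rw [toPoint_sphereMat c r hc.ne_zero.1] at h1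
  rw [toPoint_sphereMat c r hc.ne_zero.2] at h2
  exact ⟨T, k, g, v, w, hp, hc, h1, h2⟩

lemma HasKindS1.exists_polar {θ G} (h : HasKindS1 (.twoPolar θ) G) : ∃ P c r T k g v w,
    c.re = 0 ∧ 0 < r ∧ Presents hSphere (sphereMat c r) T k g P G ∧ TColumns polarT T v w ∧
      InnerProductGeometry.angle (sphereNormal v) (sphereNormal w) = θ := by
  obtain ⟨P, c, r, p, q, h, hP, -, hs, rfl⟩ := h
  obtain ⟨T, k, g, v, w, hp, hc, h1, h2⟩ := h.exists_polar hP hs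
  refine ⟨P, c, r, T, k, g, v, w, h.2.1, h.2.2.1, hp, hc, ?_⟩
  rw [← OnePoint.coe_injective h1, ← OnePoint.coe_injective h2, add_sub_cancel_left,
    add_sub_cancel_left, InnerProductGeometry.angle_smul_smul h.2.2.1.ne']

lemma HasKindS1.exists_cart {G} (h : HasKindS1 .onePolar G) : ∃ P c r T k g v w,
    c.re = 0 ∧ 0 < r ∧ Presents hSphere (sphereMat c r) T k g P G ∧ TColumns cartT T v w := by
  obtain ⟨P, c, r, h, hP⟩ := h
  obtain ⟨T, k, g, hp⟩ := h.presents
  obtain ⟨v, w, hc⟩ := (hp.onePolar_iff.1 hP).exists_columns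
  exact ⟨P, c, r, T, k, g, v, w, h.2.1, h.2.2.1, hp, hc⟩

lemma SphereOffset.hasKindS1 {P c r G T k g v w} (h : SphereOffset P c r G)
    (hp : Presents hSphere (sphereMat c r) T k g P G) (hc : TColumns polarT T v w) :
    HasKindS1 (.twoPolar (InnerProductGeometry.angle (sphereNormal v) (sphereNormal w))) G := by
  have hs := hp.sing_polar hc
  refine ⟨P, c, r, c + r • sphereNormal v, c + r • sphereNormal w, h,
    hp.twoPolar_iff.2 hc.tEquiv, fun he => hc.1 ?_, ?_, ?_⟩
  · have := toPoint_sim_injective hp.isSim hc.ne_zero.1 hc.ne_zero.2 (by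
      rw [toPoint_sphereMat c r hc.ne_zero.1, toPoint_sphereMat c r hc.ne_zero.2, he])
    rw [cdet] at this
    linear_combination this
  · rw [hs, toPoint_sphereMat c r hc.ne_zero.1, toPoint_sphereMat c r hc.ne_zero.2]
  · rw [add_sub_cancel_left, add_sub_cancel_left,
      InnerProductGeometry.angle_smul_smul h.2.2.1.ne']

lemma angle_sphereNormal_pos {T : TMap 2} {v w} (hc : TColumns polarT T v w) :
    0 < InnerProductGeometry.angle (sphereNormal v) (sphereNormal w) := by
  refine (InnerProductGeometry.angle_nonneg _ _).lt_of_ne fun h0 => ?_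
  have h1 := normSq_beta_hSphere hc.ne_zero.1 hc.ne_zero.2
  have h2 := det_pull_hSphere_pos hc
  rw [← h0, Real.cos_zero] at h1
  simp only [Herm.det] at h2
  change 0 < hSphere.eval v * hSphere.eval w - _ at h2
  linarith

lemma ClassS1.exists_kind {G} (h : ClassS1 G) :
    (∃ θ ∈ Ioc 0 Real.pi, HasKindS1 (.twoPolar θ) G) ∨ HasKindS1 .onePolar G := by
  obtain ⟨P, c, r, h⟩ := h
  obtain ⟨T, k, g, hp⟩ := h.presents
  rcases hp.isBase with hT | hT
  · obtain ⟨v, w, hc⟩ := hT.exists_columns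
    exact Or.inl ⟨_, ⟨angle_sphereNormal_pos hc, InnerProductGeometry.angle_le_pi _ _⟩,
      h.hasKindS1 hp hc⟩
  · exact Or.inr ⟨P, c, r, h, hp.onePolar_iff.2 hT⟩

lemma exists_hasKindS1_twoPolar {θ : ℝ} (hθ : θ ∈ Ioc 0 Real.pi) :
    ∃ G, HasKindS1 (.twoPolar θ) G := by
  have hsin : Real.sin (θ / 2) ≠ 0 :=
    (Real.sin_pos_of_pos_of_lt_pi (by linarith [hθ.1]) (by linarith [hθ.1, hθ.2])).ne'
  obtain ⟨T, hc⟩ := exists_tColumns polarT (v := (1, 0))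
    (w := ((Real.cos (θ / 2) : ℝ), (Real.sin (θ / 2) : ℝ)))
    (by simpa only [one_mul, mul_zero, sub_zero, ne_eq, Complex.ofReal_eq_zero] using hsin)
  obtain ⟨P, G, g, h, hp⟩ := exists_sphereOffset (Or.inl hc.tEquiv)
  have h1 := h.hasKindS1 hp hc
  have h2 := inner_sphereNormal hc.ne_zero.1 hc.ne_zero.2
  refine ⟨G, ?_⟩
  convert h1
  rw [InnerProductGeometry.angle, norm_sphereNormal hc.ne_zero.1, norm_sphereNormal hc.ne_zero.2,
    h2, eval_hSphere, eval_hSphere]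
  simp only [map_one, map_zero, one_mul, zero_mul, add_zero, normSq_ofReal,
    ← pow_two, Real.cos_sq_add_sin_sq, one_pow, div_one]
  rw [← Real.cos_two_mul, mul_div_cancel₀ _ two_ne_zero, Real.arccos_cos hθ.1.le hθ.2]

lemma exists_hasKindS1_onePolar : ∃ G, HasKindS1 .onePolar G := by
  obtain ⟨T, hT⟩ := exists_tColumns cartT (v := (1, 0)) (w := (0, 1)) (by simp)
  obtain ⟨P, G, g, h, hp⟩ := exists_sphereOffset (Or.inr hT.tEquiv)
  exact ⟨G, P, _, _, h, hp.onePolar_iff.2 hT.tEquiv⟩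

lemma HasKindS1.polar_data {θ G} (h : HasKindS1 (.twoPolar θ) G) : 0 ≤ θ ∧ θ ≤ Real.pi ∧ AlgDC G ∧
    ∃ K : Herm, 0 < K.α ∧ 0 < K.γ ∧ 0 < K.det ∧
      2 * normSq K.β = (1 + Real.cos θ) * (K.α * K.γ) ∧ Rel (pencilForm polarT K) G := by
  obtain ⟨P, c, r, T, k, g, v, w, hc, hr, hp, hT, rfl⟩ := h.exists_polar
  exact ⟨InnerProductGeometry.angle_nonneg _ _, InnerProductGeometry.angle_le_pi _ _,
    hp.algDC nonZero_hSphere, _, eval_hSphere_pos hT.ne_zero.1, eval_hSphere_pos hT.ne_zero.2,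
    det_pull_hSphere_pos hT, normSq_beta_hSphere hT.ne_zero.1 hT.ne_zero.2, hp.rel_pencilForm hT⟩

lemma HasKindS1.cart_data {G} (h : HasKindS1 .onePolar G) : AlgDC G ∧
    ∃ K : Herm, 0 < K.α ∧ 0 < K.det ∧ Rel (pencilForm cartT K) G := by
  obtain ⟨P, c, r, T, k, g, v, w, hc, hr, hp, hT⟩ := h.exists_cart
  exact ⟨hp.algDC nonZero_hSphere, _, eval_hSphere_pos hT.ne_zero.1, det_pull_hSphere_pos hT,
    hp.rel_pencilForm hT⟩

lemma HasKindS1.mobiusEquiv_iff {k k' G G'} (h : HasKindS1 k G) (h' : HasKindS1 k' G') :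
    MobiusEquiv G G' ↔ k = k' := by
  cases k with
  | twoPolar θ =>
    obtain ⟨h0, h1, hG, K, hα, hγ, hd, hβ, hR⟩ := h.polar_data
    have hK : PolarType G := ⟨K, Or.inl hα.ne', hR⟩
    cases k' with
    | twoPolar θ' =>
      obtain ⟨h0', h1', -, K', hα', hγ', hd', hβ', hR'⟩ := h'.polar_data
      have hp := mul_pos hα hγ
      have hp' := mul_pos hα' hγ'
      rw [mobiusEquiv_iff_of_rel hG hR hR', KindS1.twoPolar.injEq]
      constructor
      · intro h2
        have h3 := normSq_beta_mul_eq_of_rel hα.ne' hγ.ne' (Or.inl hp) hα'.ne' hγ'.ne' (Or.inl hp')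
          (Or.inl hd'.le) h2
        refine Real.injOn_cos ⟨h0, h1⟩ ⟨h0', h1'⟩ ?_
        have h4 : (K.α * K.γ * (K'.α * K'.γ)) * (Real.cos θ - Real.cos θ') = 0 := by
          linear_combination 2 * h3 - (K'.α * K'.γ) * hβ + (K.α * K.γ) * hβ'
        exact sub_eq_zero.1 ((mul_eq_zero.1 h4).resolve_left (mul_pos hp hp').ne')
      · rintro rfl
        refine rel_polarT_of_mul_pos (mul_pos hp hp') ?_
        linear_combination (K'.α * K'.γ) / 2 * hβ - (K.α * K.γ) / 2 * hβ'
    | onePolar =>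
      obtain ⟨-, K', -, hd', hR'⟩ := h'.cart_data
      rw [mobiusEquiv_iff_rel hG]
      exact iff_of_false (hK.not_rel ⟨K', hd'.le, hR'⟩) (by simp)
  | onePolar =>
    obtain ⟨hG, K, hα, hd, hR⟩ := h.cart_data
    cases k' with
    | twoPolar θ' =>
      obtain ⟨-, -, -, K', hα', -, -, -, hR'⟩ := h'.polar_data
      rw [mobiusEquiv_iff_rel hG]
      exact iff_of_false (fun h2 => PolarType.not_rel ⟨K', Or.inl hα'.ne', hR'⟩ ⟨K, hd.le, hR⟩
        h2.symm) (by simp)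
    | onePolar =>
      obtain ⟨-, K', hα', hd', hR'⟩ := h'.cart_data
      rw [mobiusEquiv_iff_of_rel hG hR hR']
      exact iff_of_true (rel_cartT hα.ne' hα'.ne' (by rw [sign_pos hd, sign_pos hd'])) rfl

lemma HasKindS1.twoIntersectingLines {θ G} (hθ : θ ∈ Set.Ioo 0 Real.pi)
    (h : HasKindS1 (.twoPolar θ) G) : TwoIntersectingLines G := by
  obtain ⟨P, c, r, T, k, g, v, w, hc, hr, hp, hT, rfl⟩ := h.exists_polar
  have hv := norm_sphereNormal hT.ne_zero.1
  have hw := norm_sphereNormal hT.ne_zero.2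
  have hw0 := sphereNormal_ne_zero hT.ne_zero.2
  refine twoIntersectingLines_sphereOffset hc hr.ne' hp hT.hasPoles_polar
    (linearIndependent_fin2.2 ⟨hw0, fun a ha => ?_⟩)
  change a • sphereNormal w = sphereNormal v at ha
  have h1 : |a| = 1 := by simpa [norm_smul, hw, hv] using congrArg norm ha
  rw [← ha] at hθ
  rcases abs_eq_abs.1 (h1.trans abs_one.symm) with rfl | rfl
  · simp [InnerProductGeometry.angle_self hw0] at hθ
  · simp [InnerProductGeometry.angle_self_neg_of_nonzero, InnerProductGeometry.angle_comm, hw0]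
      at hθ

lemma HasKindS1.oneLine_of_pi {G} (h : HasKindS1 (.twoPolar Real.pi) G) : OneLine 2 G := by
  obtain ⟨P, c, r, T, k, g, v, w, hc, hr, hp, hT, hθ⟩ := h.exists_polar
  obtain ⟨-, t, ht, e⟩ := InnerProductGeometry.angle_eq_pi_iff.1 hθ
  have h1 : |t| = 1 := by
    simpa [norm_smul, norm_sphereNormal hT.ne_zero.1, norm_sphereNormal hT.ne_zero.2] using
      (congrArg norm e).symm
  rw [abs_of_neg ht] at h1
  obtain rfl : t = -1 := by linarith
  refine oneLine_sphereOffset hc hr.ne' hp hT.hasPoles_polar ?_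
  rw [e, neg_one_smul, line_neg]

lemma HasKindS1.oneLine_of_onePolar {G} (h : HasKindS1 .onePolar G) : OneLine 2 G := by
  obtain ⟨P, c, r, T, k, g, v, w, hc, hr, hp, hT⟩ := h.exists_cart
  exact oneLine_sphereOffset hc hr.ne' hp hT.hasPoles_cart rfl

/-! #### Offsets based on planes -/

/-- The condition on the Hermitian form that characterizes a kind of plane offsets. -/
def KindS2.Condition : KindS2 → Herm → Prop
  | .twoFinitePoles, K => K.α ≠ 0 ∧ K.γ ≠ 0
  | .twoPolesOneInfinite, K => K.OneZero
  | .oneFinitePole, K => K.α ≠ 0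
  | .oneInfinitePole, K => K.α = 0

/-- The bilinear map that belongs to a kind of plane offsets. -/
noncomputable def KindS2.base : KindS2 → TMap 2
  | .twoFinitePoles => polarT
  | .twoPolesOneInfinite => polarT
  | .oneFinitePole => cartT
  | .oneInfinitePole => cartT

lemma pull_hPlane_α (v w : ℂ × ℂ) :
    (hPlane.pull v.1 w.1 v.2 w.2).α = normSq v.2 := by
  simp [Herm.pull, hPlane, Herm.eval]

lemma pull_hPlane_γ (v w : ℂ × ℂ) :
    (hPlane.pull v.1 w.1 v.2 w.2).γ = normSq w.2 := by
  simp [Herm.pull, hPlane, Herm.eval]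

lemma det_pull_hPlane (v w : ℂ × ℂ) : (hPlane.pull v.1 w.1 v.2 w.2).det = 0 := by
  rw [Herm.det_pull]; simp [hPlane, Herm.det]

section

variable {P : QMap 2} {G : QMap 3} {ν q κ : ℍ[ℝ]} {d : ℝ} {T : TMap 2} {g : GL (Fin 2) ℝ}
  {v w : ℂ × ℂ}

lemma Presents.infty_mem_sing_polar (hp : Presents hPlane (planeMat q d) T κ g P G) (hq : q ≠ 0)
    (hν : ν * q = q * qk) (hT : TColumns polarT T v w) : ∞ ∈ sing P ↔ v.2 = 0 ∨ w.2 = 0 := by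
  rw [hp.sing_polar hT, ← toPoint_planeMat_eq_infty_iff (d := d) hq hν (p := v),
    ← toPoint_planeMat_eq_infty_iff (d := d) hq hν (p := w)]
  simp [eq_comm]

lemma Presents.infty_mem_sing_cart (hp : Presents hPlane (planeMat q d) T κ g P G) (hq : q ≠ 0)
    (hν : ν * q = q * qk) (hT : TColumns cartT T v w) : ∞ ∈ sing P ↔ v.2 = 0 := by
  rw [hp.sing_cart hT, ← toPoint_planeMat_eq_infty_iff (d := d) hq hν (p := v)]
  simp [eq_comm]

end

lemma HasKindS2.exists_presents {k G} (h : HasKindS2 k G) : ∃ P ν q d T κ g v w,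
    ν.re = 0 ∧ ‖ν‖ = 1 ∧ q ≠ 0 ∧ ν * q = q * qk ∧ Presents hPlane (planeMat q d) T κ g P G ∧
      TColumns k.base T v w ∧ k.Condition (hPlane.pull v.1 w.1 v.2 w.2) := by
  cases k
  all_goals
    obtain ⟨P, h, hP, hs⟩ := h
    obtain ⟨ν, q, d, T, κ, g, h0, h1, hq, hν, hp⟩ := h.presents
  case oneFinitePole | oneInfinitePole =>
    obtain ⟨v, w, hT⟩ := (hp.onePolar_iff.1 hP).exists_columns
    rw [hp.infty_mem_sing_cart hq hν hT] at hs
    refine ⟨P, ν, q, d, T, κ, g, v, w, h0, h1, hq, hν, hp, hT, ?_⟩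
    simpa only [KindS2.Condition, pull_hPlane_α, ne_eq, normSq_eq_zero] using hs
  all_goals
    obtain ⟨v, w, hT⟩ := (hp.twoPolar_iff.1 hP).exists_columns
    rw [hp.infty_mem_sing_polar hq hν hT] at hs
    refine ⟨P, ν, q, d, T, κ, g, v, w, h0, h1, hq, hν, hp, hT, ?_⟩
    simp only [KindS2.Condition, Herm.OneZero, pull_hPlane_α, pull_hPlane_γ, ne_eq,
      normSq_eq_zero]
  · tauto
  · rcases hs with hs | hs
    · exact Or.inr ⟨hs, fun h => hT.1 (by rw [h, hs]; ring)⟩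
    · exact Or.inl ⟨fun h => hT.1 (by rw [h, hs]; ring), hs⟩

lemma ClassS2.exists_kind {G} (h : ClassS2 G) : ∃ k, HasKindS2 k G := by
  obtain ⟨P, h⟩ := h
  obtain ⟨ν, q, d, T, κ, g, h0, h1, hq, hν, hp⟩ := h.presents
  by_cases hs : ∞ ∈ sing P <;> rcases hp.isBase with hT | hT
  · exact ⟨.twoPolesOneInfinite, P, h, hp.twoPolar_iff.2 hT, hs⟩
  · exact ⟨.oneInfinitePole, P, h, hp.onePolar_iff.2 hT, hs⟩
  · exact ⟨.twoFinitePoles, P, h, hp.twoPolar_iff.2 hT, hs⟩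
  · exact ⟨.oneFinitePole, P, h, hp.onePolar_iff.2 hT, hs⟩

lemma exists_hasKindS2 (k : KindS2) : ∃ G, HasKindS2 k G := by
  have hν : qk * 1 = 1 * qk := by simp
  have key : ∀ {T₀ : TMap 2}, (∀ T, TEquiv T₀ T → IsBase T) → ∀ {v w : ℂ × ℂ},
      v.1 * w.2 - w.1 * v.2 ≠ 0 → ∃ T P G g, TColumns T₀ T v w ∧ PlaneOffset P G ∧
        Presents hPlane (planeMat 1 0) T 1 g P G := fun hB v w hd => by
    obtain ⟨T, hT⟩ := exists_tColumns _ hd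
    obtain ⟨P, G, g, h, hp⟩ := exists_planeOffset (hB T hT.tEquiv)
    exact ⟨T, P, G, g, hT, h, hp⟩
  cases k with
  | twoFinitePoles =>
    obtain ⟨T, P, G, g, hT, h, hp⟩ := key (fun T => Or.inl) (v := (0, 1)) (w := (1, 1)) (by simp)
    refine ⟨G, P, h, hp.twoPolar_iff.2 hT.tEquiv, ?_⟩
    rw [hp.infty_mem_sing_polar one_ne_zero hν hT]; simp
  | twoPolesOneInfinite =>
    obtain ⟨T, P, G, g, hT, h, hp⟩ := key (fun T => Or.inl) (v := (0, 1)) (w := (1, 0)) (by simp)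
    refine ⟨G, P, h, hp.twoPolar_iff.2 hT.tEquiv, ?_⟩
    rw [hp.infty_mem_sing_polar one_ne_zero hν hT]; simp
  | oneFinitePole =>
    obtain ⟨T, P, G, g, hT, h, hp⟩ := key (fun T => Or.inr) (v := (0, 1)) (w := (1, 0)) (by simp)
    refine ⟨G, P, h, hp.onePolar_iff.2 hT.tEquiv, ?_⟩
    rw [hp.infty_mem_sing_cart one_ne_zero hν hT]; simp
  | oneInfinitePole =>
    obtain ⟨T, P, G, g, hT, h, hp⟩ := key (fun T => Or.inr) (v := (1, 0)) (w := (0, 1)) (by simp)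
    refine ⟨G, P, h, hp.onePolar_iff.2 hT.tEquiv, ?_⟩
    rw [hp.infty_mem_sing_cart one_ne_zero hν hT]

lemma HasKindS2.data {k G} (h : HasKindS2 k G) : AlgDC G ∧ ∃ K : Herm, 0 ≤ K.α ∧ 0 ≤ K.γ ∧
    (K.α ≠ 0 ∨ K.γ ≠ 0) ∧ K.det = 0 ∧ k.Condition K ∧ Rel (pencilForm k.base K) G := by
  obtain ⟨P, ν, q, d, T, κ, g, v, w, h0, h1, hq, hν, hp, hT, hk⟩ := h.exists_presents
  refine ⟨hp.algDC nonZero_hPlane, _, ?_, ?_, ?_, det_pull_hPlane v w, hk, hp.rel_pencilForm hT⟩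
  · rw [pull_hPlane_α]; exact normSq_nonneg _
  · rw [pull_hPlane_γ]; exact normSq_nonneg _
  · rw [pull_hPlane_α, pull_hPlane_γ]
    by_contra! hc
    rw [normSq_eq_zero, normSq_eq_zero] at hc
    exact hT.1 (by rw [hc.1, hc.2]; ring)

lemma KindS2.Condition.allVanish_iff {k : KindS2} {K : Herm} (h : k.Condition K) (hα : 0 ≤ K.α)
    (hγ : 0 ≤ K.γ) (hd : K.det = 0) : AllVanish (pencilForm k.base K) ↔
      k = .twoPolesOneInfinite ∨ k = .oneInfinitePole := by
  cases k with
  | twoFinitePoles =>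
    exact iff_of_false (not_allVanish_polar h.1 h.2
      (Or.inl (mul_pos (hα.lt_of_ne h.1.symm) (hγ.lt_of_ne h.2.symm)))) (by simp)
  | twoPolesOneInfinite => exact iff_of_true (allVanish_polar h hd.ge) (by simp)
  | oneFinitePole => exact iff_of_false (not_allVanish_cart h) (by simp)
  | oneInfinitePole => exact iff_of_true (allVanish_cart h) (by simp)

lemma HasKindS2.mobiusEquiv_iff {k k' G G'} (h : HasKindS2 k G) (h' : HasKindS2 k' G') :
    MobiusEquiv G G' ↔ k = k' := by
  obtain ⟨hG, K, hα, hγ, hn, hd, hk, hR⟩ := h.data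
  obtain ⟨-, K', hα', hγ', hn', hd', hk', hR'⟩ := h'.data
  have hβ : normSq K.β = K.α * K.γ := by rw [Herm.det] at hd; linarith
  have hβ' : normSq K'.β = K'.α * K'.γ := by rw [Herm.det] at hd'; linarith
  rw [mobiusEquiv_iff_of_rel hG hR hR']
  constructor
  · intro hE
    have hA : AllVanish (pencilForm k.base K) ↔ AllVanish (pencilForm k'.base K') :=
      ⟨fun h => h.of_rel (isotropic_pencilForm _ _) hE.symm,
        fun h => h.of_rel (isotropic_pencilForm _ _) hE⟩
    rw [hk.allVanish_iff hα hγ hd, hk'.allVanish_iff hα' hγ' hd'] at hA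
    have h1 : k.base = polarT → k'.base = cartT → False := fun e e' => by
      rw [e, e'] at hE
      exact not_rel_polar_cart_of_det hn hd'.ge hE
    have h2 : k'.base = polarT → k.base = cartT → False := fun e e' => by
      rw [e, e'] at hE
      exact not_rel_polar_cart_of_det hn' hd.ge hE.symm
    cases k <;> cases k' <;> first
      | rfl
      | exact (h1 rfl rfl).elim
      | exact (h2 rfl rfl).elim
      | simp at hA
  · rintro rfl
    have hz : ∀ {z : ℂ} {x y : ℝ}, normSq z = x * y → (x = 0 ∨ y = 0) → z = 0 :=
      fun h1 h2 => by rwa [mul_eq_zero.2 h2, normSq_eq_zero] at h1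
    cases k with
    | twoFinitePoles =>
      refine rel_polarT_of_mul_pos (mul_pos (mul_pos (hα.lt_of_ne hk.1.symm)
        (hγ.lt_of_ne hk.2.symm)) (mul_pos (hα'.lt_of_ne hk'.1.symm) (hγ'.lt_of_ne hk'.2.symm))) ?_
      rw [hβ, hβ']; ring
    | twoPolesOneInfinite =>
      exact rel_polarT_of_oneZero hk hk' (iff_of_true
        (hz hβ (hk.elim (fun h => Or.inr h.2) fun h => Or.inl h.1))
        (hz hβ' (hk'.elim (fun h => Or.inr h.2) fun h => Or.inl h.1)))
    | oneFinitePole => exact rel_cartT hk hk' (by rw [hd, hd'])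
    | oneInfinitePole =>
      exact rel_cartT_of_alpha_beta_eq_zero hk hk' (hz hβ (Or.inl hk)) (hz hβ' (Or.inl hk'))
        (hn.resolve_left (not_not_intro hk)) (hn'.resolve_left (not_not_intro hk'))

lemma HasKindS2.twoParallelLines {G} (h : HasKindS2 .twoFinitePoles G) : TwoParallelLines G := by
  obtain ⟨P, ν, q, d, T, κ, g, v, w, h0, h1, hq, hν, hp, hT, hk⟩ := h.exists_presents
  simp only [KindS2.Condition, pull_hPlane_α, pull_hPlane_γ, ne_eq, normSq_eq_zero] at hk
  exact twoParallelLines_planeOffset hp h0 h1 hq hν (TColumns.hasPoles_polar hT) hk.1 hk.2 hT.1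

lemma HasKindS2.oneLine_two {G} (h : HasKindS2 .oneFinitePole G) : OneLine 2 G := by
  obtain ⟨P, ν, q, d, T, κ, g, v, w, h0, h1, hq, hν, hp, hT, hk⟩ := h.exists_presents
  simp only [KindS2.Condition, pull_hPlane_α, ne_eq, normSq_eq_zero] at hk
  exact oneLine_planeOffset_two hp h0 h1 hq hν (TColumns.hasPoles_cart hT) hk

lemma HasKindS2.oneLine_one {G} (h : HasKindS2 .twoPolesOneInfinite G) : OneLine 1 G := by
  obtain ⟨P, ν, q, d, T, κ, g, v, w, h0, h1, hq, hν, hp, hT, hk⟩ := h.exists_presents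
  simp only [KindS2.Condition, Herm.OneZero, pull_hPlane_α, pull_hPlane_γ, ne_eq,
    normSq_eq_zero] at hk
  have hpoles := TColumns.hasPoles_polar hT
  rcases hk with hk | hk
  · exact oneLine_planeOffset_one hp h0 h1 hq hν hpoles hk.1 hk.2
  · exact oneLine_planeOffset_one hp h0 h1 hq hν hpoles.symm hk.2 hk.1

lemma HasKindS2.sing_eq {G} (h : HasKindS2 .oneInfinitePole G) : sing G = {∞} := by
  obtain ⟨P, ν, q, d, T, κ, g, v, w, h0, h1, hq, hν, hp, hT, hk⟩ := h.exists_presents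
  simp only [KindS2.Condition, pull_hPlane_α, normSq_eq_zero] at hk
  exact sing_planeOffset_infty hp (TColumns.hasPoles_cart hT) hk hk

/-! ### Kinds of axial constructions -/

/-- The condition on the Hermitian form that characterizes a kind of axial constructions from
2-polar systems. -/
def KindS3.Condition : KindS3 → Herm → Prop
  | .generic κ, K => K.α ≠ 0 ∧ K.γ ≠ 0 ∧ K.β ≠ 0 ∧ 0 < κ ∧
      K.α * K.γ = (1 - κ ^ 2) * normSq K.β
  | .symmetricPoles, K => K.α ≠ 0 ∧ K.γ ≠ 0 ∧ K.β = 0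
  | .onePoleOnAxis, K => K.OneZero
  | .bothPolesOnAxis, K => K.α = 0 ∧ K.γ = 0

lemma normSq_beta_pos {K : Herm} (hd : K.det < 0) (h : K.α * K.γ = 0) : 0 < normSq K.β := by
  rw [Herm.det, h] at hd; linarith

lemma KindS3.exists_condition {K : Herm} (hd : K.det < 0) :
    (∃ κ, 0 < κ ∧ κ ≠ 1 ∧ (KindS3.generic κ).Condition K) ∨ KindS3.symmetricPoles.Condition K ∨
      KindS3.onePoleOnAxis.Condition K ∨ KindS3.bothPolesOnAxis.Condition K := by
  by_cases hα : K.α = 0 <;> by_cases hγ : K.γ = 0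
  · exact Or.inr (Or.inr (Or.inr ⟨hα, hγ⟩))
  · exact Or.inr (Or.inr (Or.inl (Or.inr ⟨hα, hγ⟩)))
  · exact Or.inr (Or.inr (Or.inl (Or.inl ⟨hα, hγ⟩)))
  · by_cases hβ : K.β = 0
    · exact Or.inr (Or.inl ⟨hα, hγ, hβ⟩)
    · have h0 := normSq_pos.2 hβ
      have h1 : 0 < 1 - K.α * K.γ / normSq K.β := by
        rw [sub_pos, div_lt_one h0]; rw [Herm.det] at hd; linarith
      have h2 := sq_sqrt h1.le
      refine Or.inl ⟨√(1 - K.α * K.γ / normSq K.β), sqrt_pos.2 h1, fun h => ?_,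
        hα, hγ, hβ, sqrt_pos.2 h1, by rw [h2]; field_simp; ring⟩
      rw [h, eq_comm, one_pow, sub_eq_self, div_eq_zero_iff] at h2
      exact h2.elim (mul_ne_zero hα hγ) h0.ne'

lemma Herm.OneZero.mul_eq_zero {K : Herm} (h : K.OneZero) : K.α * K.γ = 0 :=
  h.elim (fun h => by rw [h.2, mul_zero]) fun h => by rw [h.1, zero_mul]

lemma beta_ne_zero {K : Herm} (hd : K.det < 0) (h : K.α * K.γ = 0) : K.β ≠ 0 :=
  normSq_pos.1 (normSq_beta_pos hd h)

lemma twoVanish_of_vanishTogether {D : QMap 3} {i i'} (hi : i ≠ i') (h : VanishTogether D i i') :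
    TwoVanish D := by
  obtain ⟨j, c, hc, h1, h2⟩ := h
  exact ⟨i, i', hi, ⟨j, c, hc, h1⟩, j, c, hc, h2⟩

lemma KindS3.Condition.vanishTogether_iff {k : KindS3} {K : Herm} (h : k.Condition K)
    (hd : K.det < 0) : (∃ i i', i ≠ i' ∧ VanishTogether (pencilForm polarT K) i i') ↔
      k = .onePoleOnAxis ∨ k = .bothPolesOnAxis := by
  have hz : K.α = 0 ∨ K.γ = 0 →
      ∃ i i', i ≠ i' ∧ VanishTogether (pencilForm polarT K) i i' := fun h0 => by
    have hK : K.NonZero := Or.inr (Or.inl (beta_ne_zero hd (mul_eq_zero.2 h0)))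
    exact ⟨1, 2, by decide, h0.elim (vanishTogether_polar_of_alpha_eq_zero hK)
      (vanishTogether_polar_of_gamma_eq_zero hK)⟩
  cases k with
  | generic κ =>
    exact iff_of_false (fun ⟨i, i', hi, h2⟩ => not_vanishTogether_polar h.1 h.2.1 hd hi h2) (by simp)
  | symmetricPoles =>
    exact iff_of_false (fun ⟨i, i', hi, h2⟩ => not_vanishTogether_polar h.1 h.2.1 hd hi h2) (by simp)
  | onePoleOnAxis => exact iff_of_true (hz (mul_eq_zero.1 h.mul_eq_zero)) (by simp)
  | bothPolesOnAxis => exact iff_of_true (hz (Or.inl h.1)) (by simp)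

lemma KindS3.Condition.twoVanish_iff {k : KindS3} {K : Herm} (h : k.Condition K)
    (hd : K.det < 0) : TwoVanish (pencilForm polarT K) ↔ ∀ κ, k ≠ .generic κ := by
  have h1 := h.vanishTogether_iff hd
  cases k with
  | generic κ => exact iff_of_false (not_twoVanish_polar h.1 h.2.1 h.2.2.1 hd) (by simp)
  | symmetricPoles =>
    refine iff_of_true (twoVanish_polar_of_beta_eq_zero h.2.2 ?_) (by simp)
    simpa [Herm.det, h.2.2] using hd
  | _ =>
    obtain ⟨i, i', hi, h2⟩ := h1.2 (by simp)
    exact iff_of_true (twoVanish_of_vanishTogether hi h2) (by simp)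

lemma KindS3.Condition.rel_iff {k k' : KindS3} {K K' : Herm} (h : k.Condition K)
    (h' : k'.Condition K') (hd : K.det < 0) (hd' : K'.det < 0) :
    Rel (pencilForm polarT K) (pencilForm polarT K') ↔ k = k' := by
  constructor
  · intro hR
    have h2 : TwoVanish (pencilForm polarT K) ↔ TwoVanish (pencilForm polarT K') :=
      ⟨fun h => h.of_rel (isotropic_pencilForm _ _) hR.symm,
        fun h => h.of_rel (isotropic_pencilForm _ _) hR⟩
    have h3 : (∃ i i', i ≠ i' ∧ VanishTogether (pencilForm polarT K) i i') ↔
        ∃ i i', i ≠ i' ∧ VanishTogether (pencilForm polarT K') i i' := by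
      constructor <;> contrapose! <;> intro h4
      · exact hR.symm.not_vanishTogether (isotropic_pencilForm _ _) h4
      · exact hR.not_vanishTogether (isotropic_pencilForm _ _) h4
    rw [h.twoVanish_iff hd, h'.twoVanish_iff hd'] at h2
    rw [h.vanishTogether_iff hd, h'.vanishTogether_iff hd'] at h3
    cases k <;> cases k'
    case generic.generic κ κ' =>
      obtain ⟨hα, hγ, hβ, hκ, e⟩ := h
      obtain ⟨hα', hγ', hβ', hκ', e'⟩ := h'
      have h4 := normSq_beta_mul_eq_of_rel hα hγ (Or.inr hβ) hα' hγ' (Or.inr hβ') (Or.inr hd) hR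
      rw [e, e'] at h4
      have h5 : (normSq K.β * normSq K'.β) * (κ ^ 2 - κ' ^ 2) = 0 := by
        linear_combination h4
      have h6 := (mul_eq_zero.1 h5).resolve_left
        (mul_pos (normSq_pos.2 hβ) (normSq_pos.2 hβ')).ne'
      rw [(pow_left_inj₀ hκ.le hκ'.le two_ne_zero).1 (sub_eq_zero.1 h6)]
    case onePoleOnAxis.bothPolesOnAxis =>
      exact (not_rel_polar_oneZero_bothZero h hd h'.1 h'.2
        (beta_ne_zero hd' (by rw [h'.1, zero_mul])) hR).elim
    case bothPolesOnAxis.onePoleOnAxis =>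
      exact (not_rel_polar_oneZero_bothZero h' hd' h.1 h.2
        (beta_ne_zero hd (by rw [h.1, zero_mul])) hR.symm).elim
    all_goals first | rfl | (refine absurd h2 ?_; simp; done) |
      (refine absurd h3 ?_; simp)
  · rintro rfl
    cases k with
    | generic κ =>
      obtain ⟨hα, hγ, hβ, hκ, e⟩ := h
      obtain ⟨hα', hγ', hβ', -, e'⟩ := h'
      have h1 : 1 - κ ^ 2 ≠ 0 := fun h0 => mul_ne_zero hα hγ (by rw [e, h0, zero_mul])
      have h2 := normSq_pos.2 hβ
      have h3 := normSq_pos.2 hβ'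
      refine rel_polarT_of_mul_pos ?_ (by rw [e, e']; ring)
      rw [e, e', show (1 - κ ^ 2) * normSq K.β * ((1 - κ ^ 2) * normSq K'.β) =
        (1 - κ ^ 2) ^ 2 * (normSq K.β * normSq K'.β) by ring]
      positivity
    | symmetricPoles =>
      obtain ⟨-, -, hβ⟩ := h
      obtain ⟨-, -, hβ'⟩ := h'
      refine rel_polarT_of_mul_pos (mul_pos_of_neg_of_neg ?_ ?_) (by rw [hβ, hβ']; simp)
      · simpa [Herm.det, hβ] using hd
      · simpa [Herm.det, hβ'] using hd'
    | onePoleOnAxis =>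
      exact rel_polarT_of_oneZero h h' (iff_of_false (beta_ne_zero hd h.mul_eq_zero)
        (beta_ne_zero hd' h'.mul_eq_zero))
    | bothPolesOnAxis =>
      exact rel_polarT_of_alpha_gamma_eq_zero h.1 h'.1 h.2 h'.2
        (beta_ne_zero hd (by rw [h.1, zero_mul])) (beta_ne_zero hd' (by rw [h'.1, zero_mul]))

lemma det_pull_hAxial (v w : ℂ × ℂ) : (hAxial.pull v.1 w.1 v.2 w.2).det =
    -normSq (v.1 * w.2 - w.1 * v.2) := by
  rw [Herm.det_pull]; simp [hAxial, Herm.det]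

lemma det_pull_hAxial_neg {T₀ T : TMap 2} {v w} (h : TColumns T₀ T v w) :
    (hAxial.pull v.1 w.1 v.2 w.2).det < 0 := by
  rw [det_pull_hAxial, neg_lt_zero]; exact h.normSq_pos

lemma pull_hAxial_β {v w : ℂ × ℂ} (hv : v.2 ≠ 0) (hw : w.2 ≠ 0) :
    (hAxial.pull v.1 w.1 v.2 w.2).β = I * (conj v.2 * w.2) *
      (conj (v.1 / v.2) - w.1 / w.2) * (-1) := by
  have hv' : conj v.2 ≠ 0 := by simpa using hv
  simp [Herm.pull, hAxial]
  field_simp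
  ring

lemma offAxis_iff {p : ℂ × ℂ} : OffAxis p ↔ hAxial.eval p ≠ 0 := by
  by_cases hp : p.2 = 0
  · exact iff_of_false (fun h => h.1 hp) (not_not_intro (eval_hAxial_infty p hp))
  · exact (and_iff_right hp).trans (eval_hAxial_eq_zero_iff p hp).symm.not

lemma mem_axis_iff {q a ν : ℍ[ℝ]} (hq : q ≠ 0) (ha : a = q * qi * q⁻¹) (hν : ν * q = q * qk)
    (p : ℂ × ℂ) : toPoint (planeMat q 0 (emb p)) ∈ line 0 a ↔ hAxial.eval p = 0 := by
  by_cases hp : p.2 = 0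
  · exact iff_of_true (by rw [toPoint_planeMat_infty q 0 hp]; exact Or.inl rfl)
      (eval_hAxial_infty p hp)
  · rw [toPoint_planeMat hq 0 hν hp, zero_smul, add_zero, coe_conj_mem_axis hq ha,
      eval_hAxial_eq_zero_iff p hp]
    simp [icx]

lemma norm_icx (z : ℂ) : ‖icx z‖ = ‖z‖ := by
  rw [← pow_left_inj₀ (norm_nonneg _) (norm_nonneg _) two_ne_zero, ← real_inner_self_eq_norm_sq,
    inner_icx, Complex.sq_norm, normSq_apply]
  simp

lemma norm_conj_icx_sub {q : ℍ[ℝ]} (hq : q ≠ 0) (z w : ℂ) :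
    ‖q * icx z * q⁻¹ - q * icx w * q⁻¹‖ = ‖z - w‖ := by
  rw [← sub_mul, ← mul_sub, norm_conj_conj hq, ← norm_icx]
  congr 1
  ext <;> simp [icx]
  ring

lemma conj_icx_inj {q : ℍ[ℝ]} (hq : q ≠ 0) {z w : ℂ} :
    q * icx z * q⁻¹ = q * icx w * q⁻¹ ↔ z = w := by
  rw [← sub_eq_zero, ← norm_eq_zero, norm_conj_icx_sub hq, norm_eq_zero, sub_eq_zero]

lemma axis_conj {q a : ℍ[ℝ]} (hq : q ≠ 0) (ha : a = q * qi * q⁻¹) (z : ℂ) :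
    a * (q * icx z * q⁻¹) * a⁻¹ = q * icx (conj z) * q⁻¹ := by
  have hqi : qi⁻¹ = -qi := by
    refine inv_eq_of_mul_eq_one_right ?_
    ext <;> simp [qi]
  have h1 : qi * icx z * qi⁻¹ = icx (conj z) := by
    rw [hqi]; ext <;> simp [qi, icx]
  rw [ha, mul_inv_rev, mul_inv_rev, inv_inv, ← h1]
  simp only [mul_assoc, inv_mul_cancel_left₀ hq]

/-- The relations between the coefficients of the form and the distances of the poles. -/
lemma exists_pull_hAxial_eq {v w : ℂ × ℂ} (hv : v.2 ≠ 0) (hw : w.2 ≠ 0) : ∃ n : ℝ, 0 < n ∧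
    normSq (hAxial.pull v.1 w.1 v.2 w.2).β =
      n * ‖v.1 / v.2 - conj (w.1 / w.2)‖ ^ 2 ∧
    (hAxial.pull v.1 w.1 v.2 w.2).α * (hAxial.pull v.1 w.1 v.2 w.2).γ =
      n * (‖v.1 / v.2 - conj (w.1 / w.2)‖ ^ 2 - ‖v.1 / v.2 - w.1 / w.2‖ ^ 2) := by
  have hβ : normSq (hAxial.pull v.1 w.1 v.2 w.2).β = normSq (v.2 * w.2) *
      ‖v.1 / v.2 - conj (w.1 / w.2)‖ ^ 2 := by
    have h1 : conj (v.1 / v.2) - w.1 / w.2 =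
        conj (v.1 / v.2 - conj (w.1 / w.2)) := by
      rw [map_sub, conj_conj]
    rw [pull_hAxial_β hv hw, h1, Complex.sq_norm]
    simp only [map_mul, Complex.normSq_conj, Complex.normSq_I, Complex.normSq_neg, map_one, one_mul,
      mul_one]
  have hd := det_pull_hAxial v w
  have hc : v.1 * w.2 - w.1 * v.2 = (v.2 * w.2) * (v.1 / v.2 - w.1 / w.2) := by field_simp
  rw [hc, map_mul, ← Complex.sq_norm (_ - _)] at hd
  refine ⟨normSq (v.2 * w.2), normSq_pos.2 (mul_ne_zero hv hw), hβ, ?_⟩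
  rw [Herm.det, hβ] at hd
  linear_combination hd

lemma pull_hAxial_β_eq_zero_iff {v w : ℂ × ℂ} (hv : v.2 ≠ 0) (hw : w.2 ≠ 0) :
    (hAxial.pull v.1 w.1 v.2 w.2).β = 0 ↔ v.1 / v.2 = conj (w.1 / w.2) := by
  obtain ⟨n, hn, hβ, -⟩ := exists_pull_hAxial_eq hv hw
  rw [← normSq_eq_zero, hβ, mul_eq_zero, or_iff_right hn.ne', sq_eq_zero_iff, norm_eq_zero,
    sub_eq_zero]

section

variable {P : QMap 2} {G : QMap 3} {a ν q κ : ℍ[ℝ]} {T : TMap 2} {g : GL (Fin 2) ℝ}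
  {v w : ℂ × ℂ}

lemma toPoint_axial_base (hq : q ≠ 0) (hν : ν * q = q * qk) {p : ℂ × ℂ} (hp : p.2 ≠ 0) :
    toPoint (planeMat q 0 (emb p)) = ((q * icx (p.1 / p.2) * q⁻¹ : ℍ[ℝ]) : OnePoint ℍ[ℝ]) := by
  rw [toPoint_planeMat hq 0 hν hp, zero_smul, add_zero]

lemma exists_of_toPoint_eq_coe (hq : q ≠ 0) (hν : ν * q = q * qk) {p : ℂ × ℂ} {x : ℍ[ℝ]}
    (h : toPoint (planeMat q 0 (emb p)) = x) : p.2 ≠ 0 ∧ x = q * icx (p.1 / p.2) * q⁻¹ := by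
  have hp : p.2 ≠ 0 := fun h0 => by simp [toPoint_planeMat_infty q 0 h0] at h
  rw [toPoint_axial_base hq hν hp] at h
  exact ⟨hp, (OnePoint.coe_injective h).symm⟩

lemma Axial.exists_presents (h : Axial P a G) : ∃ ν q T κ g, q ≠ 0 ∧ a = q * qi * q⁻¹ ∧
    ν * q = q * qk ∧ Presents hAxial (planeMat q 0) T κ g P G := by
  obtain ⟨ν, q, T, κ, -, -, hq, hν, ha, hp⟩ := h.presents
  exact ⟨ν, q, T, κ, _, hq, by rw [← ha, mul_assoc, mul_inv_cancel₀ hq, mul_one], hν, hp⟩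

lemma Axial.hasKindS3 (h : Axial P a G) (hq : q ≠ 0) (ha : a = q * qi * q⁻¹)
    (hν : ν * q = q * qk) (hp : Presents hAxial (planeMat q 0) T κ g P G)
    (hT : TColumns polarT T v w) {k : KindS3} (hk : k.Condition (hAxial.pull v.1 w.1 v.2 w.2)) :
    HasKindS3 a k G := by
  have hs := hp.sing_polar hT
  have hP := hp.twoPolar_iff.2 hT.tEquiv
  have hv := mem_axis_iff hq ha hν v
  have hw := mem_axis_iff hq ha hν w
  have hinf : ∀ p : ℂ × ℂ, hAxial.eval p ≠ 0 → p.2 ≠ 0 := fun p h => (offAxis_iff.2 h).1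
  cases k with
  | generic c =>
    obtain ⟨hα, hγ, hβ, hc, e⟩ := hk
    have hv2 := hinf v hα
    have hw2 := hinf w hγ
    obtain ⟨n, hn, e1, e2⟩ := exists_pull_hAxial_eq hv2 hw2
    rw [Ne, pull_hAxial_β_eq_zero_iff hv2 hw2] at hβ
    rw [toPoint_axial_base hq hν hv2] at hs hv
    rw [toPoint_axial_base hq hν hw2] at hs hw
    refine ⟨P, _, _, hP, h, fun h0 => hT.1 ?_, hs, hv.not.2 hα, hw.not.2 hγ, ?_, ?_⟩
    · rw [conj_icx_inj hq, div_eq_div_iff hv2 hw2] at h0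
      rw [h0, sub_self]
    · rw [axis_conj hq ha, Ne, conj_icx_inj hq]
      exact fun h0 => hβ (by rw [h0, conj_conj])
    · rw [axis_conj hq ha, norm_conj_icx_sub hq, norm_conj_icx_sub hq]
      have h0 : 0 < ‖v.1 / v.2 - conj (w.1 / w.2)‖ := norm_pos_iff.2 (sub_ne_zero.2 hβ)
      rw [div_eq_iff h0.ne', ← pow_left_inj₀ (norm_nonneg _) (by positivity) two_ne_zero, mul_pow]
      rw [e1, e2] at e
      have := mul_left_cancel₀ hn.ne' (e.trans (mul_left_comm _ _ _))
      linear_combination -this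
  | symmetricPoles =>
    obtain ⟨hα, hγ, hβ⟩ := hk
    have hv2 := hinf v hα
    have hw2 := hinf w hγ
    rw [pull_hAxial_β_eq_zero_iff hv2 hw2] at hβ
    rw [toPoint_axial_base hq hν hv2] at hs hv
    rw [toPoint_axial_base hq hν hw2] at hs
    refine ⟨P, _, hP, h, ?_, hv.not.2 hα⟩
    rw [hs, axis_conj hq ha, hβ, conj_conj]
  | onePoleOnAxis =>
    rcases hk with ⟨h1, h2⟩ | ⟨h1, h2⟩
    · exact ⟨P, _, _, hP, h, hs, hv.not.2 h1, hw.2 h2⟩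
    · exact ⟨P, _, _, hP, h, by rw [hs, Set.pair_comm], hw.not.2 h2, hv.2 h1⟩
  | bothPolesOnAxis =>
    refine ⟨P, hP, h, ?_⟩
    rw [hs, Set.insert_subset_iff, singleton_subset_iff]
    exact ⟨hv.2 hk.1, hw.2 hk.2⟩

lemma HasKindS3.exists_presents {k : KindS3} (h : HasKindS3 a k G) : ∃ P ν q T κ g v w, q ≠ 0 ∧
    a = q * qi * q⁻¹ ∧ ν * q = q * qk ∧ Presents hAxial (planeMat q 0) T κ g P G ∧
    TColumns polarT T v w ∧ k.Condition (hAxial.pull v.1 w.1 v.2 w.2) := by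
  cases k with
  | generic c =>
    obtain ⟨P, x, y, hP, h, hxy, hs, hx, hy, hne, rfl⟩ := h
    obtain ⟨ν, q, T, κ, g, hq, ha, hν, hp⟩ := h.exists_presents
    obtain ⟨v, w, hT, h1, h2⟩ := hp.exists_columns hP hs
    refine ⟨P, ν, q, T, κ, g, v, w, hq, ha, hν, hp, hT, ?_⟩
    rw [← h1, mem_axis_iff hq ha hν] at hx
    rw [← h2, mem_axis_iff hq ha hν] at hy
    obtain ⟨hv2, rfl⟩ := exists_of_toPoint_eq_coe hq hν h1
    obtain ⟨hw2, rfl⟩ := exists_of_toPoint_eq_coe hq hν h2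
    obtain ⟨n, hn, e1, e2⟩ := exists_pull_hAxial_eq hv2 hw2
    rw [axis_conj hq ha, Ne, conj_icx_inj hq] at hne
    rw [Ne, conj_icx_inj hq] at hxy
    have hne' : v.1 / v.2 ≠ conj (w.1 / w.2) := fun h0 =>
      hne (by rw [h0, conj_conj])
    rw [axis_conj hq ha, norm_conj_icx_sub hq, norm_conj_icx_sub hq]
    have h3 := norm_pos_iff.2 (sub_ne_zero.2 hxy)
    have h4 := norm_pos_iff.2 (sub_ne_zero.2 hne')
    refine ⟨hx, hy, (pull_hAxial_β_eq_zero_iff hv2 hw2).not.2 hne', div_pos h3 h4, ?_⟩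
    rw [e1, e2, div_pow, sub_mul, one_mul, mul_left_comm, div_mul_cancel₀ _ (pow_pos h4 2).ne']
    ring
  | symmetricPoles =>
    obtain ⟨P, x, hP, h, hs, hx⟩ := h
    obtain ⟨ν, q, T, κ, g, hq, ha, hν, hp⟩ := h.exists_presents
    obtain ⟨v, w, hT, h1, h2⟩ := hp.exists_columns hP hs
    refine ⟨P, ν, q, T, κ, g, v, w, hq, ha, hν, hp, hT, ?_⟩
    rw [← h1, mem_axis_iff hq ha hν] at hx
    obtain ⟨hv2, rfl⟩ := exists_of_toPoint_eq_coe hq hν h1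
    obtain ⟨hw2, e⟩ := exists_of_toPoint_eq_coe hq hν h2
    rw [axis_conj hq ha, conj_icx_inj hq] at e
    refine ⟨hx, fun hy => hx ?_, (pull_hAxial_β_eq_zero_iff hv2 hw2).2 (by
      rw [← e, conj_conj])⟩
    change hAxial.eval w = 0 at hy
    rw [eval_hAxial_eq_zero_iff w hw2, ← e, Complex.conj_im, neg_eq_zero] at hy
    exact (eval_hAxial_eq_zero_iff v hv2).2 hy
  | onePoleOnAxis =>
    obtain ⟨P, x, y, hP, h, hs, hx, hy⟩ := h
    obtain ⟨ν, q, T, κ, g, hq, ha, hν, hp⟩ := h.exists_presents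
    obtain ⟨v, w, hT, rfl, rfl⟩ := hp.exists_columns hP hs
    rw [mem_axis_iff hq ha hν] at hx hy
    exact ⟨P, ν, q, T, κ, g, v, w, hq, ha, hν, hp, hT, Or.inl ⟨hx, hy⟩⟩
  | bothPolesOnAxis =>
    obtain ⟨P, hP, h, hs⟩ := h
    obtain ⟨ν, q, T, κ, g, hq, ha, hν, hp⟩ := h.exists_presents
    obtain ⟨v, w, hT⟩ := (hp.twoPolar_iff.1 hP).exists_columns
    rw [hp.sing_polar hT, Set.insert_subset_iff, singleton_subset_iff, mem_axis_iff hq ha hν,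
      mem_axis_iff hq ha hν] at hs
    exact ⟨P, ν, q, T, κ, g, v, w, hq, ha, hν, hp, hT, hs⟩

lemma Axial.exists_kindS3 (h : Axial P a G) (hP : TwoPolar P) :
    (∃ κ, 0 < κ ∧ κ ≠ 1 ∧ HasKindS3 a (.generic κ) G) ∨ HasKindS3 a .symmetricPoles G ∨
      HasKindS3 a .onePoleOnAxis G ∨ HasKindS3 a .bothPolesOnAxis G := by
  obtain ⟨ν, q, T, κ, g, hq, ha, hν, hp⟩ := h.exists_presents
  obtain ⟨v, w, hT⟩ := (hp.twoPolar_iff.1 hP).exists_columns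
  have key : ∀ {k : KindS3}, k.Condition (hAxial.pull v.1 w.1 v.2 w.2) → HasKindS3 a k G :=
    fun hk => h.hasKindS3 hq ha hν hp hT hk
  rcases KindS3.exists_condition (det_pull_hAxial_neg hT) with ⟨c, h1, h2, h3⟩ | h | h | h
  · exact Or.inl ⟨c, h1, h2, key h3⟩
  · exact Or.inr (Or.inl (key h))
  · exact Or.inr (Or.inr (Or.inl (key h)))
  · exact Or.inr (Or.inr (Or.inr (key h)))

lemma exists_hasKindS3 (k : KindS3) {v w : ℂ × ℂ} (hd : v.1 * w.2 - w.1 * v.2 ≠ 0)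
    (hk : k.Condition (hAxial.pull v.1 w.1 v.2 w.2)) : ∃ a G, HasKindS3 a k G := by
  obtain ⟨T, hT⟩ := exists_tColumns polarT hd
  obtain ⟨P, G, g, h, hp⟩ := exists_axial (Or.inl hT.tEquiv)
  exact ⟨qi, G, h.hasKindS3 one_ne_zero (by simp) (ν := qk) (by simp) hp hT hk⟩

lemma exists_hasKindS3_generic {c : ℝ} (hc : 0 < c) (hc1 : c ≠ 1) :
    ∃ a G, HasKindS3 a (.generic c) G := by
  have h0 : 1 + c ≠ 0 := by positivity
  have h1 : 1 - c ≠ 0 := sub_ne_zero.2 hc1.symm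
  obtain ⟨y, hy⟩ : ∃ y, y = (1 - c) / (1 + c) := ⟨_, rfl⟩
  have hy0 : y ≠ 0 := by rw [hy]; exact div_ne_zero h1 h0
  have hy1 : 1 - y = c * (1 + y) := by rw [hy]; field_simp; ring
  have hy2 : 1 + y ≠ 0 := fun h => by rw [h, mul_zero] at hy1; linarith
  have hβ : (hAxial.pull I (y * I) 1 1).β = ((-(1 + y) : ℝ) : ℂ) := by
    simp [Herm.pull, hAxial, mul_left_comm _ (y : ℂ)]; ring
  refine exists_hasKindS3 _ (v := (I, 1)) (w := (y * I, 1)) ?_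
    ⟨?_, ?_, ?_, hc, ?_⟩
  · rw [show (I * 1 - y * I * 1 : ℂ) = ((1 - y : ℝ) : ℂ) * I by
      push_cast; ring, hy1]
    exact mul_ne_zero (by exact_mod_cast mul_ne_zero hc.ne' hy2) I_ne_zero
  · simp [Herm.pull, hAxial, Herm.eval]
  · simpa [Herm.pull, hAxial, Herm.eval] using hy0
  · rw [hβ]; exact_mod_cast neg_ne_zero.2 hy2
  · rw [hβ, normSq_ofReal]
    simp only [Herm.pull, hAxial, Herm.eval]
    simp
    linear_combination -(1 - y + c * (1 + y)) * hy1

lemma exists_hasKindS3_symmetricPoles : ∃ a G, HasKindS3 a .symmetricPoles G :=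
  exists_hasKindS3 _ (v := (I, 1)) (w := (-I, 1))
    (by norm_num [Complex.ext_iff]) (by simp [KindS3.Condition, Herm.pull, hAxial, Herm.eval])

lemma exists_hasKindS3_onePoleOnAxis : ∃ a G, HasKindS3 a .onePoleOnAxis G :=
  exists_hasKindS3 _ (v := (I, 1)) (w := (0, 1))
    (by simp) (by simp [KindS3.Condition, Herm.OneZero, Herm.pull, hAxial, Herm.eval])

lemma exists_hasKindS3_bothPolesOnAxis : ∃ a G, HasKindS3 a .bothPolesOnAxis G :=
  exists_hasKindS3 _ (v := (0, 1)) (w := (1, 0))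
    (by simp) (by simp [KindS3.Condition, Herm.pull, hAxial, Herm.eval])

lemma HasKindS3.mobiusEquiv_iff {a a' : ℍ[ℝ]} {k k' : KindS3} {G G' : QMap 3}
    (h : HasKindS3 a k G) (h' : HasKindS3 a' k' G') : MobiusEquiv G G' ↔ k = k' := by
  obtain ⟨P, ν, q, T, κ, g, v, w, hq, ha, hν, hp, hT, hk⟩ := h.exists_presents
  obtain ⟨P', ν', q', T', κ', g', v', w', hq', ha', hν', hp', hT', hk'⟩ := h'.exists_presents
  rw [mobiusEquiv_iff_of_rel (hp.algDC nonZero_hAxial) (hp.rel_pencilForm hT)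
    (hp'.rel_pencilForm hT'), hk.rel_iff hk' (det_pull_hAxial_neg hT) (det_pull_hAxial_neg hT')]

lemma HasKindS3.axisAndTwoCircles {c : ℝ} (h : HasKindS3 a (.generic c) G) :
    AxisAndTwoCircles a G := by
  obtain ⟨P, ν, q, T, κ, g, v, w, hq, ha, hν, hp, hT, hα, hγ, hβ, -⟩ := h.exists_presents
  have hv := offAxis_iff.2 hα
  have hw := offAxis_iff.2 hγ
  refine axisAndTwoCircles_axial hq ha hp hT.hasPoles_polar hv hw (fun h0 => hT.1 ?_)
    ((pull_hAxial_β_eq_zero_iff hv.1 hw.1).not.1 hβ)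
  rw [div_eq_div_iff hv.1 hw.1] at h0
  rw [h0, sub_self]

lemma HasKindS3.axisAndCircle_two (h : HasKindS3 a .symmetricPoles G) : AxisAndCircle 2 a G := by
  obtain ⟨P, ν, q, T, κ, g, v, w, hq, ha, hν, hp, hT, hα, hγ, hβ⟩ := h.exists_presents
  have hv := offAxis_iff.2 hα
  have hw := offAxis_iff.2 hγ
  exact axisAndCircle_two_axial hq ha hp hT.hasPoles_polar hv hw
    (Or.inr ((pull_hAxial_β_eq_zero_iff hv.1 hw.1).1 hβ))

lemma HasKindS3.axisAndCircle_one (h : HasKindS3 a .onePoleOnAxis G) : AxisAndCircle 1 a G := by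
  obtain ⟨P, ν, q, T, κ, g, v, w, hq, ha, hν, hp, hT, ⟨h1, h2⟩ | ⟨h1, h2⟩⟩ := h.exists_presents
  · exact axisAndCircle_one_axial hq ha hp hT.hasPoles_polar (offAxis_iff.2 h1) h2
  · exact axisAndCircle_one_axial hq ha hp hT.hasPoles_polar.symm (offAxis_iff.2 h2) h1

lemma HasKindS3.axisOnly (h : HasKindS3 a .bothPolesOnAxis G) : AxisOnly a G := by
  obtain ⟨P, ν, q, T, κ, g, v, w, hq, ha, hν, hp, hT, h1, h2⟩ := h.exists_presents
  exact axisOnly_axial hq ha hp hT.hasPoles_polar h1 h2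

/-! #### Axial constructions from 1-polar systems -/

lemma Axial.exists_cart (h : Axial P a G) (hP : OnePolar P) : ∃ q T κ g v w, q ≠ 0 ∧
    a = q * qi * q⁻¹ ∧ Presents hAxial (planeMat q 0) T κ g P G ∧ TColumns cartT T v w ∧
    (sing P ⊆ line 0 a ↔ hAxial.eval v = 0) := by
  obtain ⟨ν, q, T, κ, g, hq, ha, hν, hp⟩ := h.exists_presents
  obtain ⟨v, w, hT⟩ := (hp.onePolar_iff.1 hP).exists_columns
  refine ⟨q, T, κ, g, v, w, hq, ha, hp, hT, ?_⟩
  rw [hp.sing_cart hT, singleton_subset_iff, mem_axis_iff hq ha hν]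

lemma Axial.exists_kindS4 (h : Axial P a G) (hP : OnePolar P) : ∃ k, HasKindS4 a k G := by
  by_cases hs : sing P ⊆ line 0 a
  · exact ⟨.poleOnAxis, P, hP, h, hs⟩
  · exact ⟨.poleOffAxis, P, hP, h, hs⟩

lemma exists_hasKindS4 (k : KindS4) : ∃ a G, HasKindS4 a k G := by
  have key : ∀ {v w : ℂ × ℂ}, v.1 * w.2 - w.1 * v.2 ≠ 0 → ∃ P G, OnePolar P ∧ Axial P qi G ∧
      (sing P ⊆ line 0 qi ↔ hAxial.eval v = 0) := fun {v w} hd => by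
    obtain ⟨T, hT⟩ := exists_tColumns cartT hd
    obtain ⟨P, G, g, h, hp⟩ := exists_axial (Or.inr hT.tEquiv)
    refine ⟨P, G, hp.onePolar_iff.2 hT.tEquiv, h, ?_⟩
    rw [hp.sing_cart hT, singleton_subset_iff,
      mem_axis_iff one_ne_zero (by simp) (ν := qk) (by simp)]
  cases k with
  | poleOffAxis =>
    obtain ⟨P, G, hP, h, hs⟩ := key (v := (I, 1)) (w := (1, 0)) (by simp)
    exact ⟨qi, G, P, hP, h, by rw [hs]; simp [hAxial, Herm.eval]⟩
  | poleOnAxis =>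
    obtain ⟨P, G, hP, h, hs⟩ := key (v := (0, 1)) (w := (1, 0)) (by simp)
    exact ⟨qi, G, P, hP, h, by rw [hs]; simp [hAxial, Herm.eval]⟩

lemma HasKindS4.mobiusEquiv {a a' : ℍ[ℝ]} {G G' : QMap 3} (h : HasKindS4 a .poleOffAxis G)
    (h' : HasKindS4 a' .poleOffAxis G') : MobiusEquiv G G' := by
  obtain ⟨P, hP, h, hs⟩ := h
  obtain ⟨P', hP', h', hs'⟩ := h'
  obtain ⟨q, T, κ, g, v, w, hq, ha, hp, hT, e⟩ := h.exists_cart hP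
  obtain ⟨q', T', κ', g', v', w', hq', ha', hp', hT', e'⟩ := h'.exists_cart hP'
  rw [e] at hs
  rw [e'] at hs'
  refine (mobiusEquiv_iff_of_rel (hp.algDC nonZero_hAxial) (hp.rel_pencilForm hT)
    (hp'.rel_pencilForm hT')).2 (rel_cartT hs hs' ?_)
  rw [sign_neg (det_pull_hAxial_neg hT), sign_neg (det_pull_hAxial_neg hT')]

lemma HasKindS4.axisAndCircle (h : HasKindS4 a .poleOffAxis G) : AxisAndCircle 2 a G := by
  obtain ⟨P, hP, h, hs⟩ := h
  obtain ⟨q, T, κ, g, v, w, hq, ha, hp, hT, e⟩ := h.exists_cart hP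
  have hv := offAxis_iff.2 (e.not.1 hs)
  exact axisAndCircle_two_axial hq ha hp hT.hasPoles_cart hv hv (Or.inl rfl)

lemma HasKindS4.axisOnly (h : HasKindS4 a .poleOnAxis G) : AxisOnly a G := by
  obtain ⟨P, hP, h, hs⟩ := h
  obtain ⟨q, T, κ, g, v, w, hq, ha, hp, hT, e⟩ := h.exists_cart hP
  exact axisOnly_axial hq ha hp hT.hasPoles_cart (e.1 hs) (e.1 hs)

end

end DupinCyclidic

theorem mainTheorem4 :
    -- every spherical system is equivalent to an offset or axial construction, and conversely
    -- these constructions are spherical systems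
    (∀ D : QMap 3, IsDC D → IsSpherical D →
      ∃ G, MobiusEquiv D G ∧ (ClassS1 G ∨ ClassS2 G ∨ ClassS3 G ∨ ClassS4 G)) ∧
    (∀ G : QMap 3, ClassS1 G ∨ ClassS2 G ∨ ClassS3 G ∨ ClassS4 G → IsDC G ∧ IsSpherical G) ∧
    -- (S1)
    ((∀ G, ClassS1 G → (∃ θ ∈ Set.Ioc 0 Real.pi, HasKindS1 (.twoPolar θ) G) ∨
        HasKindS1 .onePolar G) ∧
      (∀ θ ∈ Set.Ioc 0 Real.pi, ∃ G, HasKindS1 (.twoPolar θ) G) ∧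
      (∃ G, HasKindS1 .onePolar G) ∧
      (∀ k k' G G', HasKindS1 k G → HasKindS1 k' G' → (MobiusEquiv G G' ↔ k = k')) ∧
      (∀ θ ∈ Set.Ioo 0 Real.pi, ∀ G, HasKindS1 (.twoPolar θ) G → TwoIntersectingLines G) ∧
      (∀ G, HasKindS1 (.twoPolar Real.pi) G → OneLine 2 G) ∧
      (∀ G, HasKindS1 .onePolar G → OneLine 2 G)) ∧
    -- (S2)
    ((∀ G, ClassS2 G → ∃ k, HasKindS2 k G) ∧
      (∀ k, ∃ G, HasKindS2 k G) ∧
      (∀ k k' G G', HasKindS2 k G → HasKindS2 k' G' → (MobiusEquiv G G' ↔ k = k')) ∧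
      (∀ G, HasKindS2 .twoFinitePoles G → TwoParallelLines G) ∧
      (∀ G, HasKindS2 .oneFinitePole G → OneLine 2 G) ∧
      (∀ G, HasKindS2 .twoPolesOneInfinite G → OneLine 1 G) ∧
      (∀ G, HasKindS2 .oneInfinitePole G → sing G = {OnePoint.infty})) ∧
    -- (S3)
    ((∀ P a G, TwoPolar P → Axial P a G →
        (∃ κ, 0 < κ ∧ κ ≠ 1 ∧ HasKindS3 a (.generic κ) G) ∨ HasKindS3 a .symmetricPoles G ∨
          HasKindS3 a .onePoleOnAxis G ∨ HasKindS3 a .bothPolesOnAxis G) ∧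
      (∀ κ : ℝ, 0 < κ → κ ≠ 1 → ∃ a G, HasKindS3 a (.generic κ) G) ∧
      (∃ a G, HasKindS3 a .symmetricPoles G) ∧
      (∃ a G, HasKindS3 a .onePoleOnAxis G) ∧
      (∃ a G, HasKindS3 a .bothPolesOnAxis G) ∧
      (∀ a a' k k' G G', HasKindS3 a k G → HasKindS3 a' k' G' → (MobiusEquiv G G' ↔ k = k')) ∧
      (∀ a κ G, HasKindS3 a (.generic κ) G → AxisAndTwoCircles a G) ∧
      (∀ a G, HasKindS3 a .symmetricPoles G → AxisAndCircle 2 a G) ∧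
      (∀ a G, HasKindS3 a .onePoleOnAxis G → AxisAndCircle 1 a G) ∧
      (∀ a G, HasKindS3 a .bothPolesOnAxis G → AxisOnly a G)) ∧
    -- (S4)
    ((∀ P a G, OnePolar P → Axial P a G → ∃ k, HasKindS4 a k G) ∧
      (∀ k, ∃ a G, HasKindS4 a k G) ∧
      (∀ a a' G G', HasKindS4 a .poleOffAxis G → HasKindS4 a' .poleOffAxis G' →
        MobiusEquiv G G') ∧
      (∀ a G, HasKindS4 a .poleOffAxis G → AxisAndCircle 2 a G) ∧
      (∀ a G, HasKindS4 a .poleOnAxis G → AxisOnly a G)) := by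
  refine ⟨fun D hD hS => hD.exists_class hS, fun G h => isDC_and_isSpherical h,
    ⟨fun G h => h.exists_kind, fun θ hθ => exists_hasKindS1_twoPolar hθ, exists_hasKindS1_onePolar,
      fun k k' G G' h h' => h.mobiusEquiv_iff h', fun θ hθ G h => h.twoIntersectingLines hθ,
      fun G h => h.oneLine_of_pi, fun G h => h.oneLine_of_onePolar⟩,
    ⟨fun G h => h.exists_kind, exists_hasKindS2, fun k k' G G' h h' => h.mobiusEquiv_iff h',
      fun G h => h.twoParallelLines, fun G h => h.oneLine_two, fun G h => h.oneLine_one,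
      fun G h => h.sing_eq⟩,
    ⟨fun P a G hP h => h.exists_kindS3 hP, fun κ h0 h1 => exists_hasKindS3_generic h0 h1,
      exists_hasKindS3_symmetricPoles, exists_hasKindS3_onePoleOnAxis,
      exists_hasKindS3_bothPolesOnAxis, fun a a' k k' G G' h h' => h.mobiusEquiv_iff h',
      fun a κ G h => h.axisAndTwoCircles, fun a G h => h.axisAndCircle_two,
      fun a G h => h.axisAndCircle_one, fun a G h => h.axisOnly⟩,
    fun P a G hP h => h.exists_kindS4 hP, exists_hasKindS4, fun a a' G G' h h' => h.mobiusEquiv h',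
    fun a G h => h.axisAndCircle, fun a G h => h.axisOnly⟩
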